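/- **Setting.** Let $\mu>0$, let $v:\mathbb R^2\to\mathbb R$ be measurable and even with $|v(x)|\le C(1+|x|)^{-p}$ for some $C$ and some $p>2$, and let $\tau\in\mathbb C$, $\operatorname{Im}\tau>0$. For $\delta>0$ let $\mathcal L=\delta^{-1}(\mathbb Z+\tau\mathbb Z)\subset\mathbb C=\mathbb R^2$, with fundamental cell $\Omega$. Let $b>0$, $a_b(x)=\frac b2(-x_2,x_1)$, $s\wedge x=s_1x_2-s_2x_1$, and $\chi_s(x)=\frac b2\,s\wedge x+c_s$ $(s\in\mathcal L)$, where the real numbers $c_s$ are such that $\chi_{s+t}(x)-\chi_s(x+t)-\chi_t(x)\in2\pi\mathbb Z$ for all $s,t\in\mathcal L$ (so $b|\Omega|\in2\pi\mathbb Z$). Let $\mathfrak h$ be the Hilbert space of $f\in L^2_{loc}(\mathbb R^2)$ with $f(x+s)=e^{i\chi_s(x)}f(x)$ for $s\in\mathcal L$, with the norm of $L^2(\Omega)$; let $\mathfrak h^*=\{\bar f:f\in\mathfrak h\}$, let $\bar A=\mathcal CA\mathcal C$ with $\mathcal C$ complex conjugation, and let $\Delta_a=(\nabla-ia)^2$.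 Traces are taken over $\mathfrak h$ or $\mathfrak h\times\mathfrak h^*$. *Normal states.* Let $T>0$. A magnetically translation invariant normal state $(\Gamma_{T,b},a_b)$, without exchange term, is given by an operator $\gamma=\gamma_{Tb}$ on $\mathfrak h$ acting as $(\gamma f)(x)=\int_{\mathbb R^2}\gamma(x,y)f(y)\,dy$ with a continuous hermitian kernel on $\mathbb R^2\times\mathbb R^2$ with $\gamma(0,\cdot)\in L^1$ and $\gamma(x+s,y+s)=e^{i\frac b2 s\wedge x}\gamma(x,y)e^{-i\frac b2s\wedge y}$ for all $s\in\mathbb R^2$, solving $$\gamma=\big(1+e^{2h_{Tb}/T}\big)^{-1},\qquad h_{Tb}=-\Delta_{a_b}-\mu+v*d_\gamma,\quad d_\gamma(x)=\gamma(x,x),$$ and $\Gamma_{T,b}=\begin{pmatrix}\gamma&0\\0&1-\bar\gamma\end{pmatrix}$. *The operator $L_{Tb}$.* On Hilbert–Schmidt operators $\alpha:\mathfrak h^*\to\mathfrak h$ (with kernels $\alpha(x,y)$ in $\mathfrak h\otimes\mathfrak h$ and inner product $\mathrm{Tr}(\alpha^*\alpha')$) let $h^L\alpha=h_{Tb}\alpha$,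 $h^R\alpha=\alpha\bar h_{Tb}$, $(v^\sharp\alpha)(x,y)=\sum_{s\in\mathcal L}v(x-y+s)\,\alpha(x,y)$, and $$L_{Tb}=\frac{h^L+h^R}{\tanh(h^L/T)+\tanh(h^R/T)}+v^\sharp ,$$ the quotient being extended by continuity to $h^L+h^R=0$. *Free energy.* For $\Gamma=\begin{pmatrix}\gamma&\alpha\\\alpha^*&1-\bar\gamma\end{pmatrix}$ with $0\le\Gamma\le1$, $\alpha^*=\bar\alpha$, let $$F_T(\Gamma,a)=\mathrm{Tr}(-\Delta_a\gamma)+\tfrac12\mathrm{Tr}\big((v*d_\gamma)\gamma\big)+\tfrac12\mathrm{Tr}(\alpha^*v^\sharp\alpha)+\int_\Omega|\operatorname{curl}a|^2+T\,\mathrm{Tr}(\Gamma\ln\Gamma)-\mu\,\mathrm{Tr}\,\gamma .$$ The normal state is *energetically unstable under $\alpha$-perturbations* if there is a Hilbert–Schmidt $\alpha:\mathfrak h^*\to\mathfrak h$ with $\alpha(-\overline{\Delta_{a_b}})$ Hilbert–Schmidt, $\alpha^*=\bar\alpha$, such that $\Gamma'=\begin{pmatrix}0&\alpha\\\alpha^*&0\end{pmatrix}$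 satisfies $(\Gamma')^2\le C'[\Gamma_{T,b}(1-\Gamma_{T,b})]^2$ for some $C'$, and for all sufficiently small real $\varepsilon\ne0$ one has $0\le\Gamma_{T,b}+\varepsilon\Gamma'\le1$, both free energies below are well defined, and $F_T(\Gamma_{T,b}+\varepsilon\Gamma',a_b)<F_T(\Gamma_{T,b},a_b)$. **Theorem.** Suppose that $v\le0$ and $v$ is not almost everywhere $0$. Then there is $\varepsilon_0>0$, depending only on $\mu$, $v$ and $\tau$, such that for all $T,b\in(0,\varepsilon_0)$, all $\delta$ and $(c_s)$ as above, and every magnetically translation invariant normal state $(\Gamma_{T,b},a_b)$, the operator $L_{Tb}$ has a negative eigenvalue, and $(\Gamma_{T,b},a_b)$ is energetically unstable under $\alpha$-perturbations. -/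

import Mathlib

open MeasureTheory Complex
open scoped ContDiff ComplexConjugate InnerProductSpace

noncomputable section

namespace BdG

/-! ## The plane, vector potentials, covariant Laplacian

The plane `ℝ²` is identified with `ℂ`; a vector field is a map `ℂ → ℂ`. -/

/-- `x ∧ y = x₁ y₂ - x₂ y₁`. -/
def wedge (x y : ℂ) : ℝ := x.re * y.im - x.im * y.re

/-- The vector potential `a_b(x) = (b/2) J x`, `J x = (-x₂, x₁)`, of the constant magnetic
field `b`. -/
def aB (b : ℝ) (x : ℂ) : ℂ := ((b / 2 : ℝ) : ℂ) * (I * x)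

/-- `curl a = ∂₁ a₂ - ∂₂ a₁`. -/
def curl (a : ℂ → ℂ) (x : ℂ) : ℝ := (fderiv ℝ a x 1).im - (fderiv ℝ a x I).re

/-- First component of the covariant gradient `∇_a = ∇ - i a`. -/
def cov₁ (a : ℂ → ℂ) (φ : ℂ → ℂ) (x : ℂ) : ℂ := fderiv ℝ φ x 1 - I * ((a x).re : ℂ) * φ x

/-- Second component of the covariant gradient `∇_a = ∇ - i a`. -/
def cov₂ (a : ℂ → ℂ) (φ : ℂ → ℂ) (x : ℂ) : ℂ := fderiv ℝ φ x I - I * ((a x).im : ℂ) * φ x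

/-- `-Δ_a φ`, where `Δ_a = ∇_a · ∇_a`. -/
def negLap (a : ℂ → ℂ) (φ : ℂ → ℂ) (x : ℂ) : ℂ :=
  -(cov₁ a (cov₁ a φ) x + cov₂ a (cov₂ a φ) x)

/-! ## Magnetic lattices and the one-particle space -/

/-- The point `δ⁻¹ (m₁ + m₂ τ)` of the lattice `δ⁻¹ (ℤ + τ ℤ)`. -/
def latPt (τ : ℂ) (δ : ℝ) (m : ℤ × ℤ) : ℂ := ((δ⁻¹ : ℝ) : ℂ) * ((m.1 : ℂ) + (m.2 : ℂ) * τ)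

/-- A lattice `δ⁻¹ (ℤ + τ ℤ)` of shape `τ` with a constant magnetic field `b > 0` and summands of
automorphy `χ_s(x) = (b/2) s ∧ x + c_s` satisfying the co-cycle condition
(which forces the flux of `b` through a cell to lie in `2π ℤ`). -/
structure MagLattice (τ : ℂ) where
  δ : ℝ
  δ_pos : 0 < δ
  b : ℝ
  b_pos : 0 < b
  c : ℤ × ℤ → ℝ
  cocycle : ∀ (m m' : ℤ × ℤ) (x : ℂ), ∃ k : ℤ,
    (b / 2 * wedge (latPt τ δ (m + m')) x + c (m + m'))
      - (b / 2 * wedge (latPt τ δ m) (x + latPt τ δ m') + c m)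
      - (b / 2 * wedge (latPt τ δ m') x + c m') = 2 * Real.pi * k

variable {τ : ℂ}

/-- The summand of automorphy `χ_s`, `s` being the lattice point with index `m`. -/
def MagLattice.chi (M : MagLattice τ) (m : ℤ × ℤ) (x : ℂ) : ℝ :=
  M.b / 2 * wedge (latPt τ M.δ m) x + M.c m

/-- The fundamental cell `Ω_δ`. -/
def MagLattice.cell (M : MagLattice τ) : Set ℂ :=
  {x | ∃ s ∈ Set.Ico (0 : ℝ) 1, ∃ t ∈ Set.Ico (0 : ℝ) 1,
    x = ((M.δ⁻¹ : ℝ) : ℂ) * ((s : ℂ) + (t : ℂ) * τ)}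

/-- Lebesgue measure on the fundamental cell. -/
def MagLattice.vol (M : MagLattice τ) : Measure ℂ := volume.restrict M.cell

/-- The one-particle space `𝔥` of the locally square integrable `f` on the plane with
`f(x + s) = e^{i χ_s(x)} f(x)` for `s` in the lattice, normed over a cell.  Since `f` is determined
by its restriction to the cell, `𝔥` is `L²` of the cell; the equivariance enters through the
functions `M.IsSection`.  The dual space `𝔥^*` (the complex conjugates of the elements of `𝔥`)
is `L²` of the cell as well. -/
abbrev MagLattice.H (M : MagLattice τ) : Type := Lp ℂ 2 M.vol

/-- The Hilbert space `𝔥 ⊗ 𝔥` of kernels `κ(x, y)` on cell × cell. -/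
abbrev MagLattice.HH (M : MagLattice τ) : Type := Lp ℂ 2 (M.vol.prod M.vol)

/-- Smooth elements of `𝔥`: smooth functions on the plane with `U_s φ = φ`, that is,
`φ(x + s) = e^{i χ_s(x)} φ(x)`. -/
def MagLattice.IsSection (M : MagLattice τ) (φ : ℂ → ℂ) : Prop :=
  ContDiff ℝ ∞ φ ∧ ∀ m x, φ (x + latPt τ M.δ m) = exp (I * (M.chi m x : ℂ)) * φ x

/-- `u` is in the domain of the operator `-Δ_a + W` on `𝔥`, and `(-Δ_a + W) u = f`.  The operator
is the adjoint of its restriction to the smooth elements of `𝔥`, on which it is essentially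
self-adjoint for the potentials used below. -/
def MagLattice.Schr (M : MagLattice τ) (a : ℂ → ℂ) (W : ℂ → ℝ) (u f : M.H) : Prop :=
  ∀ φ, M.IsSection φ →
    ∫ x, conj (negLap a φ x + (W x : ℂ) * φ x) * u x ∂M.vol = ∫ x, conj (φ x) * f x ∂M.vol

/-! ## Operators -/

/-- Complex conjugation on `𝔥`, as a bounded conjugate-linear map. -/
def MagLattice.conjH (M : MagLattice τ) : M.H →L⋆[ℂ] M.H :=
  LinearMap.mkContinuous
    { toFun := fun u => star u
      map_add' := fun u w => by
        apply Lp.ext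
        filter_upwards [Lp.coeFn_star (u + w), Lp.coeFn_add u w, Lp.coeFn_add (star u) (star w),
          Lp.coeFn_star u, Lp.coeFn_star w] with x h1 h2 h3 h4 h5
        exact h1.trans ((congrArg star h2).trans ((star_add (u x) (w x)).trans
          ((congrArg₂ (· + ·) h4.symm h5.symm).trans h3.symm)))
      map_smul' := fun z u => by
        apply Lp.ext
        filter_upwards [Lp.coeFn_star (z • u), Lp.coeFn_smul z u, Lp.coeFn_smul (conj z) (star u),
          Lp.coeFn_star u] with x h1 h2 h3 h4
        exact h1.trans ((congrArg star h2).trans ((star_smul z (u x)).trans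
          ((congrArg (conj z • ·) h4.symm).trans h3.symm))) }
    1 (fun u => by
      rw [one_mul]
      apply Lp.norm_le_norm_of_ae_le
      filter_upwards [Lp.coeFn_star u] with x h1
      simp [h1])

/-- `Ā = 𝒞 A 𝒞`. -/
def MagLattice.conjOp (M : MagLattice τ) (A : M.H →L[ℂ] M.H) : M.H →L[ℂ] M.H :=
  M.conjH.comp (A.comp M.conjH)

/-- The space `𝔥 × 𝔥^*`. -/
abbrev MagLattice.HxH (M : MagLattice τ) : Type := WithLp 2 (M.H × M.H)

/-- The operator matrix `(A B; C D)` on `𝔥 × 𝔥^*`. -/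
def MagLattice.block (M : MagLattice τ) (A B C D : M.H →L[ℂ] M.H) : M.HxH →L[ℂ] M.HxH :=
  let e := WithLp.prodContinuousLinearEquiv 2 ℂ M.H M.H
  (e.symm : M.H × M.H →L[ℂ] M.HxH).comp
    (((A.coprod B).prod (C.coprod D)).comp (e : M.HxH →L[ℂ] M.H × M.H))

/-- `A` is trace class with trace `t`: in every orthonormal basis the series of diagonal matrix
elements converges (unconditionally) to `t`. -/
def HasTrace {E : Type} [NormedAddCommGroup E] [InnerProductSpace ℂ E] (A : E →L[ℂ] E) (t : ℂ) :
    Prop :=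
  ∀ (ι : Type) (e : HilbertBasis ι ℂ E), HasSum (fun i => ⟪e i, A (e i)⟫_ℂ) t

/-- `-A ln A`, for a self-adjoint `A ≥ 0`. -/
def negLog {E : Type} [NormedAddCommGroup E] [InnerProductSpace ℂ E] [CompleteSpace E]
    (A : E →L[ℂ] E) : E →L[ℂ] E :=
  cfc Real.negMulLog A

/-- `A : 𝔥^* → 𝔥` is the Hilbert-Schmidt operator with integral kernel `κ`. -/
def MagLattice.HasL2Kernel (M : MagLattice τ) (A : M.H →L[ℂ] M.H) (κ : M.HH) : Prop :=
  ∀ u : M.H, (A u : ℂ → ℂ) =ᵐ[M.vol] fun x => ∫ y, κ (x, y) * u y ∂M.vol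

/-- The periodization `∑_s v(x + s)` over the lattice of the pair potential. -/
def MagLattice.per (M : MagLattice τ) (v : ℂ → ℝ) (x : ℂ) : ℝ :=
  ∑' m : ℤ × ℤ, v (x + latPt τ M.δ m)

/-- `η = v^♯ κ`: the kernel `κ(x, y)` is multiplied by the (periodized) pair potential. -/
def MagLattice.VSharp (M : MagLattice τ) (v : ℂ → ℝ) (κ η : M.HH) : Prop :=
  (η : ℂ × ℂ → ℂ) =ᵐ[M.vol.prod M.vol] fun p => (M.per v (p.1 - p.2) : ℂ) * κ p

/-! ## Normal states -/

/-- The density `d_γ(x) = γ(x, x)` of an operator with integral kernel `k`. -/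
def density (k : ℂ → ℂ → ℂ) (x : ℂ) : ℝ := (k x x).re

/-- The direct self-interaction potential `(v * d)(x) = ∫ v(x - y) d(y) dy`. -/
def direct (v d : ℂ → ℝ) (x : ℂ) : ℝ := ∫ y, v (x - y) * d y

/-- `(1 + e^{2h})⁻¹`. -/
def fermi (h : ℝ) : ℝ := (1 + Real.exp (2 * h))⁻¹

/-- `h_{γ, a_b} u = f`, where `h_{γ, a_b} = -Δ_{a_b} - μ + v * d_γ` (no exchange term) and
`k` is the integral kernel of `γ`. -/
def MagLattice.OneBody (M : MagLattice τ) (v : ℂ → ℝ) (μ : ℝ) (k : ℂ → ℂ → ℂ) (u f : M.H) :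
    Prop :=
  M.Schr (aB M.b) (fun x => direct v (density k) x - μ) u f

/-- `γ`, with integral kernel `k` on the plane, is the diagonal part of a magnetically
translation invariant normal state `(Γ_{T,b}, a_b)`. -/
structure MagLattice.IsNormal (M : MagLattice τ) (v : ℂ → ℝ) (μ T : ℝ)
    (γ : M.H →L[ℂ] M.H) (k : ℂ → ℂ → ℂ) : Prop where
  continuous : Continuous (fun p : ℂ × ℂ => k p.1 p.2)
  integrable : Integrable (k 0)
  hermitian : ∀ x y, k y x = conj (k x y)
  /-- invariance under the magnetic translations by all `s` in the plane -/
  mt_invariant : ∀ s x y, k (x + s) (y + s) =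
    exp (I * ((M.b / 2 * wedge s x : ℝ) : ℂ)) * k x y * exp (-(I * ((M.b / 2 * wedge s y : ℝ) : ℂ)))
  /-- `γ` acts on the equivariant functions through the kernel `k` -/
  kernel : ∀ (φ : ℂ → ℂ) (u : M.H), M.IsSection φ → (u : ℂ → ℂ) =ᵐ[M.vol] φ →
    (γ u : ℂ → ℂ) =ᵐ[M.vol] fun x => ∫ y, k x y * φ y
  /-- `γ = (1 + e^{2 h/T})⁻¹` with `h = h_{γ, a_b}`, an operator with compact resolvent, so that a
  function of it is given by its action on eigenvectors -/
  self_consistent : ∀ (E : ℝ) (u : M.H), M.OneBody v μ k u ((E : ℂ) • u) →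
    γ u = ((fermi (E / T) : ℝ) : ℂ) • u

/-! ## The operator `L_{Tb}` -/

/-- The function `(x + y) / (tanh (x/T) + tanh (y/T))`, extended by continuity to `x + y = 0`. -/
def kT (T x y : ℝ) : ℝ :=
  if x + y = 0 then T * Real.cosh (x / T) ^ 2
  else (x + y) / (Real.tanh (x / T) + Real.tanh (y / T))

/-- `⟨u ⊗ w, κ⟩`, the matrix element `⟨u, κ w̄⟩` of the operator with kernel `κ`. -/
def MagLattice.pair (M : MagLattice τ) (u w : ℂ → ℂ) (κ : M.HH) : ℂ :=
  ∫ p, conj (u p.1) * conj (w p.2) * κ p ∂(M.vol.prod M.vol)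

/-- `κ` is in the domain of `K_{Tb} = (h^L + h^R) / (tanh (h^L/T) + tanh (h^R/T))` and
`K_{Tb} κ = β`.  Here `h = h_{γ, a_b}`, and `h^L`, `h^R` are multiplication of operators
`𝔥^* → 𝔥` by `h` from the left and by `h̄` from the right, that is, `h` acting on the variables
`x` and `y` of the kernel; their joint eigenvectors are the products `u ⊗ w` of eigenvectors of
`h`, and these span `𝔥 ⊗ 𝔥`. -/
def MagLattice.KOp (M : MagLattice τ) (v : ℂ → ℝ) (μ T : ℝ) (k : ℂ → ℂ → ℂ) (κ β : M.HH) : Prop :=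
  ∀ (E E' : ℝ) (u w : M.H), M.OneBody v μ k u ((E : ℂ) • u) → M.OneBody v μ k w ((E' : ℂ) • w) →
    M.pair u w β = (kT T E E' : ℂ) * M.pair u w κ

/-- `κ` is in the domain of `L_{Tb} = K_{Tb} + v^♯` and `L_{Tb} κ = η`. -/
def MagLattice.LOp (M : MagLattice τ) (v : ℂ → ℝ) (μ T : ℝ) (k : ℂ → ℂ → ℂ) (κ η : M.HH) : Prop :=
  ∃ β ζ : M.HH, M.KOp v μ T k κ β ∧ M.VSharp v κ ζ ∧ η = β + ζ

/-! ## Free energy and stability -/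

/-- The operator matrix `Γ = (γ α; α^* 1 - γ̄)`. -/
def MagLattice.Gam (M : MagLattice τ) (γ α : M.H →L[ℂ] M.H) : M.HxH →L[ℂ] M.HxH :=
  M.block γ α (ContinuousLinearMap.adjoint α) (1 - M.conjOp γ)

/-- The off-diagonal operator matrix `φ(α) = (0 α; α^* 0)`. -/
def MagLattice.offDiag (M : MagLattice τ) (α : M.H →L[ℂ] M.H) : M.HxH →L[ℂ] M.HxH :=
  M.block 0 α (ContinuousLinearMap.adjoint α) 0

/-- `Γ = (γ α; α^* 1 - γ̄)` is a state: `0 ≤ Γ = Γ^* ≤ 1` and `α^* = ᾱ`. -/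
def MagLattice.IsState (M : MagLattice τ) (γ α : M.H →L[ℂ] M.H) : Prop :=
  0 ≤ M.Gam γ α ∧ M.Gam γ α ≤ 1 ∧ ContinuousLinearMap.adjoint α = M.conjOp α

/-- The free energy `F_T(Γ, a) = E(Γ, a) - T S(Γ) - μ N(Γ)` is defined and equals `F`, where
`E(Γ, a) = Tr((-Δ_a) γ) + ½ Tr((v * d_γ) γ) + ½ Tr(α^* (v^♯ α)) + ∫ |curl a|²` (no exchange term),
`S(Γ) = -Tr(Γ ln Γ)`, `N(Γ) = Tr γ`; `k` is the integral kernel of `γ` and `κ` that of `α`. -/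
def MagLattice.HasFreeEnergy (M : MagLattice τ) (v : ℂ → ℝ) (μ T : ℝ) (a : ℂ → ℂ)
    (γ : M.H →L[ℂ] M.H) (k : ℂ → ℂ → ℂ) (α : M.H →L[ℂ] M.H) (κ : M.HH) (F : ℝ) : Prop :=
  ∃ tKin tDir tPair S N : ℝ,
    (∃ B : M.H →L[ℂ] M.H, (∀ u, M.Schr a (fun _ => 0) (γ u) (B u)) ∧ HasTrace B tKin) ∧
    (∃ B : M.H →L[ℂ] M.H,
      (∀ u : M.H, (B u : ℂ → ℂ) =ᵐ[M.vol] fun x => (direct v (density k) x : ℂ) * γ u x) ∧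
      HasTrace B tDir) ∧
    (∃ (B : M.H →L[ℂ] M.H) (ζ : M.HH), M.VSharp v κ ζ ∧ M.HasL2Kernel B ζ ∧
      HasTrace (ContinuousLinearMap.adjoint α ∘L B) tPair) ∧
    HasTrace (negLog (M.Gam γ α)) S ∧
    HasTrace γ N ∧
    F = tKin + tDir / 2 + tPair / 2 + ∫ x, curl a x ^ 2 ∂M.vol - T * S - μ * N

/-- `κ` is the kernel of an operator `α` with `α M_b²` Hilbert-Schmidt, `M_b² = -Δ_{a_b}`. -/
def MagLattice.IsSmooth (M : MagLattice τ) (κ : M.HH) : Prop :=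
  ∃ κ' : M.HH, ∀ (u : M.H) (φ : ℂ → ℂ), M.IsSection φ →
    M.pair u (negLap (aB M.b) φ) κ = M.pair u φ κ'

/-- The perturbation `Γ' = φ(α)` of the normal state is admissible: `α` is Hilbert-Schmidt with
kernel `κ` and smooth, `J^* Γ' J = -Γ̄'` (that is, `α^* = ᾱ`) and
`(Γ')² ≤ C [Γ_{Tb} (1 - Γ_{Tb})]²` for some constant `C`. -/
def MagLattice.IsAdmissible (M : MagLattice τ) (γ α : M.H →L[ℂ] M.H) (κ : M.HH) : Prop :=
  M.HasL2Kernel α κ ∧ M.IsSmooth κ ∧ ContinuousLinearMap.adjoint α = M.conjOp α ∧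
  ∃ C : ℝ, M.offDiag α ^ 2 ≤ (C : ℂ) • (M.Gam γ 0 * (1 - M.Gam γ 0)) ^ 2

/-- The normal state is energetically unstable under `α`-perturbations: along some admissible
`Γ' = φ(α)` the operators `Γ_{Tb} + ε Γ'` are states of free energy strictly below that of the
normal state for all small `ε ≠ 0`. -/
def MagLattice.Unstable (M : MagLattice τ) (v : ℂ → ℝ) (μ T : ℝ)
    (γ : M.H →L[ℂ] M.H) (k : ℂ → ℂ → ℂ) : Prop :=
  ∃ (α : M.H →L[ℂ] M.H) (κ : M.HH), M.IsAdmissible γ α κ ∧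
    ∃ ε₀ > 0, ∀ ε : ℝ, ε ≠ 0 → |ε| < ε₀ →
      M.IsState γ ((ε : ℂ) • α) ∧
      ∃ F F₀ : ℝ,
        M.HasFreeEnergy v μ T (aB M.b) γ k ((ε : ℂ) • α) ((ε : ℂ) • κ) F ∧
        M.HasFreeEnergy v μ T (aB M.b) γ k 0 0 F₀ ∧ F < F₀

end BdG

end

open MeasureTheory Complex Filter
open scoped ContDiff ComplexConjugate InnerProductSpace Topology Real
open Finset (sum_congr range mul_sum sum_add_distrib sum_eq_zero sum_le_sum sum_comm sum_nonneg
  sum_product sum_coe_sort sum_sub_distrib sum_range_succ sum_ite_eq sum_ite_eq' sum_div sum_disjSum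
  smul_sum sum_smul sum_neg_distrib sum_mul)
open ContinuousLinearMap (adjoint adjoint_inner_right adjoint_inner_left toSpanSingleton
  nonneg_iff_isPositive isSelfAdjoint_iff_isSymmetric reApplyInnerSelf_apply isPositive_def'
  opNorm_comp_le)
open Real (pi_pos negMulLog norm_eq_abs norm_of_nonneg exp_pos sq_sqrt mul_self_sqrt sqrt_pos
  sqrt_nonneg smoothTransition exp_le_one_iff sinh_pos_iff)
open Set (univ indicator_of_mem indicator_of_notMem Icc mem_ofPred_eq)

noncomputable section

namespace BdG

variable {τ : ℂ}

lemma integral_ext {X E : Type*} [MeasurableSpace X] [NormedAddCommGroup E] [NormedSpace ℝ E]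
    {μ : Measure X} {f g : X → E} (h : ∀ x, f x = g x) : ∫ x, f x ∂μ = ∫ x, g x ∂μ :=
  congrArg (integral μ) (funext h)

/-! ## Lattice geometry -/

lemma wedge_add_left (x y z : ℂ) : wedge (x + y) z = wedge x z + wedge y z := by
  simp [wedge]; ring

lemma wedge_add_right (x y z : ℂ) : wedge x (y + z) = wedge x y + wedge x z := by
  simp [wedge]; ring

lemma wedge_sub_right (x y z : ℂ) : wedge x (y - z) = wedge x y - wedge x z := by
  simp [wedge]; ring

lemma wedge_self (x : ℂ) : wedge x x = 0 := by simp [wedge]; ring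

lemma wedge_swap (x y : ℂ) : wedge x y = -wedge y x := by simp [wedge]; ring

@[simp] lemma wedge_zero_right (x : ℂ) : wedge x 0 = 0 := by simp [wedge]

@[simp] lemma wedge_zero_left (x : ℂ) : wedge 0 x = 0 := by simp [wedge]

lemma contDiff_wedge {f g : ℂ → ℂ} (hf : ContDiff ℝ ∞ f) (hg : ContDiff ℝ ∞ g) :
    ContDiff ℝ ∞ fun x => wedge (f x) (g x) := by
  unfold wedge
  have h1 := reCLM.contDiff.comp hf
  have h2 := imCLM.contDiff.comp hf
  have h3 := reCLM.contDiff.comp hg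
  have h4 := imCLM.contDiff.comp hg
  exact (h1.mul h4).sub (h2.mul h3)

@[fun_prop]
lemma continuous_wedge {X : Type*} [TopologicalSpace X] {f g : X → ℂ} (hf : Continuous f)
    (hg : Continuous g) : Continuous fun x => wedge (f x) (g x) := by
  unfold wedge; fun_prop

namespace MagLattice

/-- The lattice point with index `m`. -/
def w (M : MagLattice τ) (m : ℤ × ℤ) : ℂ := latPt τ M.δ m

lemma w_add (M : MagLattice τ) (m n : ℤ × ℤ) : M.w (m + n) = M.w m + M.w n := by
  simp [w, latPt]; ring

@[simp] lemma w_zero (M : MagLattice τ) : M.w 0 = 0 := by simp [w, latPt]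

lemma w_neg (M : MagLattice τ) (m : ℤ × ℤ) : M.w (-m) = -M.w m := by
  simp [w, latPt]; ring

/-- Second lattice coordinate. -/
def tc (M : MagLattice τ) (x : ℂ) : ℝ := M.δ * x.im / τ.im

/-- First lattice coordinate. -/
def sc (M : MagLattice τ) (x : ℂ) : ℝ := M.δ * x.re - M.tc x * τ.re

lemma tc_add (M : MagLattice τ) (x y : ℂ) : M.tc (x + y) = M.tc x + M.tc y := by
  simp [tc]; ring

lemma sc_add (M : MagLattice τ) (x y : ℂ) : M.sc (x + y) = M.sc x + M.sc y := by
  simp [sc, tc_add]; ring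

lemma coord_comb (M : MagLattice τ) (hτ : 0 < τ.im) (s t : ℝ) :
    M.sc (((M.δ⁻¹ : ℝ) : ℂ) * ((s : ℂ) + (t : ℂ) * τ)) = s ∧
    M.tc (((M.δ⁻¹ : ℝ) : ℂ) * ((s : ℂ) + (t : ℂ) * τ)) = t := by
  have hδ := M.δ_pos.ne'
  have h2 : M.tc (((M.δ⁻¹ : ℝ) : ℂ) * ((s : ℂ) + (t : ℂ) * τ)) = t := by
    simp only [tc, im_ofReal_mul, add_im, ofReal_im]
    field_simp
    ring
  refine ⟨?_, h2⟩
  rw [sc, h2]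
  simp only [re_ofReal_mul, add_re, ofReal_re]
  field_simp
  ring

lemma eq_coord (M : MagLattice τ) (hτ : 0 < τ.im) (x : ℂ) :
    x = ((M.δ⁻¹ : ℝ) : ℂ) * ((M.sc x : ℂ) + (M.tc x : ℂ) * τ) := by
  have hδ := M.δ_pos.ne'
  apply Complex.ext
  · simp only [re_ofReal_mul, add_re, ofReal_re, sc]
    field_simp
    ring
  · simp only [im_ofReal_mul, add_im, ofReal_im, tc]
    field_simp
    ring

lemma coord_w (M : MagLattice τ) (hτ : 0 < τ.im) (m : ℤ × ℤ) :
    M.sc (M.w m) = m.1 ∧ M.tc (M.w m) = m.2 := by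
  have := M.coord_comb hτ m.1 m.2
  simpa [w, latPt] using this

lemma mem_cell_iff (M : MagLattice τ) (hτ : 0 < τ.im) (x : ℂ) :
    x ∈ M.cell ↔ M.sc x ∈ Set.Ico (0 : ℝ) 1 ∧ M.tc x ∈ Set.Ico (0 : ℝ) 1 := by
  constructor
  · rintro ⟨s, hs, t, ht, rfl⟩
    rw [(M.coord_comb hτ s t).1, (M.coord_comb hτ s t).2]
    exact ⟨hs, ht⟩
  · rintro ⟨hs, ht⟩
    exact ⟨_, hs, _, ht, M.eq_coord hτ x⟩

/-- Index of the cell containing `x`. -/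
def idx (M : MagLattice τ) (x : ℂ) : ℤ × ℤ := (⌊M.sc x⌋, ⌊M.tc x⌋)

/-- Representative of `x` in the fundamental cell. -/
def red (M : MagLattice τ) (x : ℂ) : ℂ := x - M.w (M.idx x)

lemma red_add_w (M : MagLattice τ) (x : ℂ) : M.red x + M.w (M.idx x) = x := by
  simp [red]

lemma idx_add_w (M : MagLattice τ) (hτ : 0 < τ.im) (x : ℂ) (m : ℤ × ℤ) :
    M.idx (x + M.w m) = M.idx x + m := by
  simp [idx, sc_add, tc_add, (M.coord_w hτ m).1, (M.coord_w hτ m).2, Prod.ext_iff]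

lemma red_periodic (M : MagLattice τ) (hτ : 0 < τ.im) (x : ℂ) (m : ℤ × ℤ) :
    M.red (x + M.w m) = M.red x := by
  rw [red, idx_add_w M hτ, w_add, red]; ring

lemma idx_eq_zero_iff (M : MagLattice τ) (hτ : 0 < τ.im) (x : ℂ) : M.idx x = 0 ↔ x ∈ M.cell := by
  rw [M.mem_cell_iff hτ]
  simp [idx, Prod.ext_iff, Int.floor_eq_zero_iff]

lemma red_mem (M : MagLattice τ) (hτ : 0 < τ.im) (x : ℂ) : M.red x ∈ M.cell := by
  rw [← M.idx_eq_zero_iff hτ, red, sub_eq_add_neg, ← w_neg, idx_add_w M hτ]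
  simp

lemma red_of_mem (M : MagLattice τ) (hτ : 0 < τ.im) {x : ℂ} (hx : x ∈ M.cell) : M.red x = x := by
  rw [red, (M.idx_eq_zero_iff hτ x).2 hx]; simp

@[fun_prop]
lemma continuous_tc (M : MagLattice τ) : Continuous M.tc := by
  unfold tc; fun_prop

@[fun_prop]
lemma continuous_sc (M : MagLattice τ) : Continuous M.sc := by
  unfold sc; fun_prop

lemma measurable_idx (M : MagLattice τ) : Measurable M.idx :=
  (Int.measurable_floor.comp M.continuous_sc.measurable).prodMk
    (Int.measurable_floor.comp M.continuous_tc.measurable)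

lemma measurable_red (M : MagLattice τ) : Measurable M.red :=
  measurable_id.sub ((measurable_of_countable M.w).comp M.measurable_idx)

lemma measurableSet_cell (M : MagLattice τ) (hτ : 0 < τ.im) : MeasurableSet M.cell := by
  have : M.cell = M.idx ⁻¹' {0} := by
    ext x; simp [M.idx_eq_zero_iff hτ]
  rw [this]
  exact M.measurable_idx (measurableSet_singleton _)

lemma norm_le_of_mem_cell (M : MagLattice τ) {x : ℂ} (hx : x ∈ M.cell) :
    ‖x‖ ≤ M.δ⁻¹ * (1 + ‖τ‖) := by
  obtain ⟨s, hs, t, ht, rfl⟩ := hx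
  have hδ := inv_pos.2 M.δ_pos
  rw [norm_mul, norm_real, norm_of_nonneg hδ.le]
  refine mul_le_mul_of_nonneg_left ((norm_add_le _ _).trans ?_) hδ.le
  rw [norm_mul, norm_real, norm_real, norm_of_nonneg hs.1, norm_of_nonneg ht.1]
  nlinarith [hs.2, ht.2, norm_nonneg τ, ht.1]

lemma volume_cell_lt_top (M : MagLattice τ) : volume M.cell < ⊤ :=
  (measure_mono (fun _ hx => mem_closedBall_zero_iff.2 (M.norm_le_of_mem_cell hx))).trans_lt
    (measure_closedBall_lt_top)

instance (M : MagLattice τ) : IsFiniteMeasure M.vol :=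
  ⟨by rw [vol, Measure.restrict_apply_univ]; exact M.volume_cell_lt_top⟩

/-- The lattice translates of the cell tile the plane. -/
lemma lintegral_unfold (M : MagLattice τ) (hτ : 0 < τ.im) (F : ℂ → ENNReal) :
    ∫⁻ x, F x = ∑' m, ∫⁻ x, F (x + M.w m) ∂M.vol := by
  have hU : (⋃ m, M.idx ⁻¹' {m}) = univ := by ext x; simp
  rw [← setLIntegral_univ, ← hU, lintegral_iUnion
    (fun m => M.measurable_idx (measurableSet_singleton m))]
  · refine tsum_congr fun m => ?_
    rw [vol, ← lintegral_indicator (M.measurableSet_cell hτ),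
      ← lintegral_indicator (M.measurable_idx (measurableSet_singleton m)),
      ← lintegral_add_right_eq_self _ (M.w m)]
    refine lintegral_congr fun x => ?_
    by_cases hx : x ∈ M.cell
    · rw [indicator_of_mem hx, indicator_of_mem]
      simp [idx_add_w M hτ, (M.idx_eq_zero_iff hτ x).2 hx]
    · rw [indicator_of_notMem hx, indicator_of_notMem]
      simpa [idx_add_w M hτ] using fun h => hx ((M.idx_eq_zero_iff hτ x).1 h)
  · intro i j hij
    exact Set.disjoint_left.2 fun x hi hj => hij (by simp_all)

lemma hasSum_integral_unfold (M : MagLattice τ) (hτ : 0 < τ.im) {F : ℂ → ℂ} (hF : Integrable F) :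
    HasSum (fun m => ∫ x, F (x + M.w m) ∂M.vol) (∫ x, F x) := by
  have hU : (⋃ m, M.idx ⁻¹' {m}) = univ := by ext x; simp
  have := hasSum_integral_iUnion (μ := volume) (f := F)
    (fun m => M.measurable_idx (measurableSet_singleton m)) (by
      intro i j hij
      exact Set.disjoint_left.2 fun x hi hj => hij (by simp_all)) (by rw [hU]; exact hF.integrableOn)
  rw [hU, setIntegral_univ] at this
  convert! this using 2 with m
  rw [vol, ← integral_indicator (M.measurableSet_cell hτ),
    ← integral_indicator (M.measurable_idx (measurableSet_singleton m)),
    ← integral_add_right_eq_self ((M.idx ⁻¹' {m}).indicator F) (M.w m)]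
  refine integral_ext fun x => ?_
  by_cases hx : x ∈ M.cell
  · rw [indicator_of_mem hx, indicator_of_mem]
    simp [idx_add_w M hτ, (M.idx_eq_zero_iff hτ x).2 hx]
  · rw [indicator_of_notMem hx, indicator_of_notMem]
    simpa [idx_add_w M hτ] using fun h => hx ((M.idx_eq_zero_iff hτ x).1 h)

lemma volume_cell_ne_zero (M : MagLattice τ) (hτ : 0 < τ.im) : volume M.cell ≠ 0 := fun h => by
  have h1 := M.lintegral_unfold hτ (fun _ => 1)
  have h2 : M.vol = 0 := by rw [vol, Measure.restrict_eq_zero]; exact h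
  simp [h2] at h1

/-- Translation modulo the lattice preserves the measure on the cell. -/
lemma measurePreserving_red_add (M : MagLattice τ) (hτ : 0 < τ.im) (a : ℂ) :
    MeasurePreserving (fun x => M.red (x + a)) M.vol M.vol := by
  have hm : Measurable fun x => M.red (x + a) := M.measurable_red.comp (measurable_add_const a)
  refine ⟨hm, Measure.ext_of_lintegral _ fun F hF => ?_⟩
  rw [lintegral_map hF hm]
  have hFr : Measurable fun x => F (M.red x) := hF.comp M.measurable_red
  have e1 : ∫⁻ x, F (M.red (x + a)) ∂M.vol
      = ∫⁻ x, M.cell.indicator 1 (x - a) * F (M.red x) := by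
    rw [vol, ← lintegral_indicator (M.measurableSet_cell hτ),
      ← lintegral_add_right_eq_self (fun x => M.cell.indicator 1 (x - a) * F (M.red x)) a]
    refine lintegral_congr fun x => ?_
    by_cases hx : x ∈ M.cell <;> simp [hx]
  have hmi : Measurable (M.cell.indicator (1 : ℂ → ENNReal)) :=
    measurable_one.indicator (M.measurableSet_cell hτ)
  rw [e1, M.lintegral_unfold hτ, ← lintegral_tsum]
  · rw [vol]
    refine setLIntegral_congr_fun (M.measurableSet_cell hτ) fun x hx => ?_
    simp only [M.red_periodic hτ, M.red_of_mem hτ hx]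
    rw [ENNReal.tsum_mul_right]
    have : ∑' m, M.cell.indicator (1 : ℂ → ENNReal) (x + M.w m - a) = 1 := by
      rw [tsum_eq_single (-M.idx (x - a))]
      · rw [indicator_of_mem]; · rfl
        rw [w_neg, ← sub_eq_add_neg, sub_right_comm]
        exact M.red_mem hτ (x - a)
      · intro m hm
        rw [indicator_of_notMem]
        intro h
        rw [← M.idx_eq_zero_iff hτ, add_sub_right_comm, M.idx_add_w hτ] at h
        exact hm (by rw [← eq_neg_iff_add_eq_zero.2 (by rwa [add_comm] at h)])
    rw [this, one_mul]
  · intro m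
    exact ((hmi.comp (by fun_prop)).mul (hFr.comp (by fun_prop))).aemeasurable

lemma integral_cell_add (M : MagLattice τ) (hτ : 0 < τ.im) {F : ℂ → ℂ}
    (hF : AEStronglyMeasurable F M.vol) (hper : ∀ m x, F (x + M.w m) = F x) (a : ℂ) :
    ∫ x, F (x + a) ∂M.vol = ∫ x, F x ∂M.vol := by
  have h := M.measurePreserving_red_add hτ a
  rw [← h.map_eq] at hF
  have e := integral_map h.measurable.aemeasurable hF
  rw [h.map_eq] at e
  rw [e]
  refine integral_ext fun x => ?_
  conv_lhs => rw [← M.red_add_w (x + a), hper]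

/-- Sums of a decaying function over lattice translates are bounded. -/
lemma exists_sum_decay_bound (M : MagLattice τ) (hτ : 0 < τ.im) {p : ℝ} (hp : 2 < p) :
    ∃ B : ℝ, 0 ≤ B ∧ ∀ x, Summable (fun m => (1 + ‖x + M.w m‖) ^ (-p)) ∧
      ∑' m, (1 + ‖x + M.w m‖) ^ (-p) ≤ B := by
  set D := M.δ⁻¹ * (1 + ‖τ‖)
  have hD : 0 ≤ D := by have := M.δ_pos; positivity
  have hfin : ∫⁻ z : ℂ, ENNReal.ofReal ((1 + ‖z‖) ^ (-p)) < ⊤ :=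
    finite_integral_one_add_norm (by simpa [finrank_real_complex] using hp)
  set L := ∫⁻ z : ℂ, ENNReal.ofReal ((1 + ‖z‖) ^ (-p))
  have hc0 := M.volume_cell_ne_zero hτ
  have hc1 := M.volume_cell_lt_top.ne
  set c := volume M.cell
  have key : ∀ x, ∑' m, ENNReal.ofReal ((1 + ‖x + M.w m‖) ^ (-p)) ≤
      ENNReal.ofReal ((1 + D) ^ p) * L / c := fun x => by
    rw [ENNReal.le_div_iff_mul_le (Or.inl hc0) (Or.inl hc1)]
    calc (∑' m, ENNReal.ofReal ((1 + ‖x + M.w m‖) ^ (-p))) * c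
        = ∑' m, ∫⁻ _y, ENNReal.ofReal ((1 + ‖x + M.w m‖) ^ (-p)) ∂M.vol := by
          simp [vol, ENNReal.tsum_mul_right, c]
      _ ≤ ∑' m, ∫⁻ y, ENNReal.ofReal ((1 + D) ^ p) *
            ENNReal.ofReal ((1 + ‖x + (y + M.w m)‖) ^ (-p)) ∂M.vol := by
          refine ENNReal.tsum_le_tsum fun m => ?_
          rw [vol]
          refine setLIntegral_mono' (M.measurableSet_cell hτ) fun y hy => ?_
          rw [← ENNReal.ofReal_mul (by positivity)]
          apply ENNReal.ofReal_le_ofReal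
          have h1 : 1 + ‖x + (y + M.w m)‖ ≤ (1 + D) * (1 + ‖x + M.w m‖) := by
            have := norm_add_le (x + M.w m) y
            have hy' := M.norm_le_of_mem_cell hy
            rw [show x + (y + M.w m) = x + M.w m + y by ring]
            nlinarith [norm_nonneg (x + M.w m)]
          have h2 : ((1 + D) * (1 + ‖x + M.w m‖)) ^ (-p) ≤ (1 + ‖x + (y + M.w m)‖) ^ (-p) :=
            Real.rpow_le_rpow_of_nonpos (by positivity) h1 (by linarith)
          rw [Real.mul_rpow (by positivity) (by positivity)] at h2
          calc (1 + ‖x + M.w m‖) ^ (-p)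
              = (1 + D) ^ p * ((1 + D) ^ (-p) * (1 + ‖x + M.w m‖) ^ (-p)) := by
                rw [← mul_assoc, ← Real.rpow_add (by positivity)]; simp
            _ ≤ _ := by gcongr
      _ = ENNReal.ofReal ((1 + D) ^ p) * ∫⁻ y, ENNReal.ofReal ((1 + ‖x + y‖) ^ (-p)) := by
          rw [M.lintegral_unfold hτ, ← ENNReal.tsum_mul_left]
          refine tsum_congr fun m => ?_
          rw [lintegral_const_mul]
          fun_prop
      _ = _ := by
          congr 1
          exact lintegral_add_left_eq_self (fun z : ℂ => ENNReal.ofReal ((1 + ‖z‖) ^ (-p))) x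
  have hKtop : ENNReal.ofReal ((1 + D) ^ p) * L / c ≠ ⊤ :=
    ENNReal.div_ne_top (ENNReal.mul_ne_top ENNReal.ofReal_ne_top hfin.ne) hc0
  refine ⟨(ENNReal.ofReal ((1 + D) ^ p) * L / c).toReal, ENNReal.toReal_nonneg, fun x => ?_⟩
  have hs : Summable (fun m => (1 + ‖x + M.w m‖) ^ (-p)) := by
    have := ENNReal.summable_toReal ((key x).trans_lt hKtop.lt_top).ne
    refine this.congr fun m => ENNReal.toReal_ofReal (by positivity)
  refine ⟨hs, ?_⟩
  rw [← ENNReal.ofReal_le_iff_le_toReal hKtop, ENNReal.ofReal_tsum_of_nonneg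
    (fun m => by positivity) hs]
  exact key x

lemma chi_eq (M : MagLattice τ) (m : ℤ × ℤ) (x : ℂ) :
    M.chi m x = M.b / 2 * wedge (M.w m) x + M.c m := rfl

/-- The factor of automorphy. -/
def e (M : MagLattice τ) (m : ℤ × ℤ) (x : ℂ) : ℂ := exp (I * (M.chi m x : ℂ))

lemma e_cocycle (M : MagLattice τ) (m n : ℤ × ℤ) (x : ℂ) :
    M.e (m + n) x = M.e m (x + M.w n) * M.e n x := by
  obtain ⟨k, hk⟩ := M.cocycle m n x
  rw [e, e, e, ← exp_add]
  have : M.chi (m + n) x = M.chi m (x + M.w n) + M.chi n x + 2 * π * k := by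
    simp only [chi, w]; linarith
  rw [this]
  push_cast
  rw [show I * ((M.chi m (x + M.w n) : ℂ) + (M.chi n x : ℂ) + 2 * π * k) =
    (I * (M.chi m (x + M.w n) : ℂ) + I * (M.chi n x : ℂ)) + k * (2 * π * I) by ring]
  exact exp_periodic.int_mul k _

@[simp] lemma norm_e (M : MagLattice τ) (m : ℤ × ℤ) (x : ℂ) : ‖M.e m x‖ = 1 := by
  rw [e, mul_comm]; exact norm_exp_ofReal_mul_I _

lemma e_ne_zero (M : MagLattice τ) (m : ℤ × ℤ) (x : ℂ) : M.e m x ≠ 0 := exp_ne_zero _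

lemma e_zero (M : MagLattice τ) (x : ℂ) : M.e 0 x = 1 := by
  have := M.e_cocycle 0 0 x
  simp only [add_zero, w_zero] at this
  exact (mul_right_eq_self₀.1 this.symm).resolve_right (M.e_ne_zero 0 x)

lemma conj_e_mul (M : MagLattice τ) (m : ℤ × ℤ) (x : ℂ) : conj (M.e m x) * M.e m x = 1 := by
  rw [mul_comm, mul_conj, normSq_eq_norm_sq, norm_e]; simp

/-- Equivariant functions. -/
def Equi (M : MagLattice τ) (f : ℂ → ℂ) : Prop := ∀ m x, f (x + M.w m) = M.e m x * f x

lemma IsSection.equi {M : MagLattice τ} {f : ℂ → ℂ} (h : M.IsSection f) : M.Equi f := h.2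

lemma Equi.norm {M : MagLattice τ} {f : ℂ → ℂ} (h : M.Equi f) (m : ℤ × ℤ) (x : ℂ) :
    ‖f (x + M.w m)‖ = ‖f x‖ := by rw [h, norm_mul, norm_e, one_mul]

lemma Equi.conj_mul {M : MagLattice τ} {f g : ℂ → ℂ} (hf : M.Equi f) (hg : M.Equi g)
    (m : ℤ × ℤ) (x : ℂ) : conj (f (x + M.w m)) * g (x + M.w m) = conj (f x) * g x := by
  rw [hf, hg, map_mul]
  linear_combination (conj (f x) * g x) * M.conj_e_mul m x

/-- Equivariant extension of a function on the cell. -/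
def ext (M : MagLattice τ) (u : ℂ → ℂ) (x : ℂ) : ℂ := M.e (M.idx x) (M.red x) * u (M.red x)

lemma ext_equi (M : MagLattice τ) (hτ : 0 < τ.im) (u : ℂ → ℂ) : M.Equi (M.ext u) := fun m x => by
  rw [ext, ext, M.red_periodic hτ, M.idx_add_w hτ, add_comm, M.e_cocycle, M.red_add_w]
  ring

lemma ext_of_mem (M : MagLattice τ) (hτ : 0 < τ.im) (u : ℂ → ℂ) {x : ℂ} (hx : x ∈ M.cell) :
    M.ext u x = u x := by
  rw [ext, M.red_of_mem hτ hx, (M.idx_eq_zero_iff hτ x).2 hx, e_zero, one_mul]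

/-- Flux quantization. -/
lemma flux (M : MagLattice τ) (m n : ℤ × ℤ) :
    ∃ k : ℤ, M.b * wedge (M.w m) (M.w n) = 2 * π * k := by
  obtain ⟨k, hk⟩ := M.cocycle m n 0
  obtain ⟨l, hl⟩ := M.cocycle n m 0
  refine ⟨l - k, ?_⟩
  rw [add_comm n m] at hl
  change (M.b / 2 * wedge (M.w (m + n)) 0 + _) - (M.b / 2 * wedge (M.w m) (0 + M.w n) + _)
    - (M.b / 2 * wedge (M.w n) 0 + _) = _ at hk
  change (M.b / 2 * wedge (M.w (m + n)) 0 + _) - (M.b / 2 * wedge (M.w n) (0 + M.w m) + _)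
    - (M.b / 2 * wedge (M.w m) 0 + _) = _ at hl
  simp only [wedge_zero_right, zero_add] at hk hl
  rw [wedge_swap (M.w n)] at hl
  push_cast
  linarith

/-- The cell is large when the field is weak. -/
lemma two_pi_le (M : MagLattice τ) (hτ : 0 < τ.im) : 2 * π * M.δ ^ 2 ≤ M.b * τ.im := by
  obtain ⟨k, hk⟩ := M.flux (1, 0) (0, 1)
  have hδ := M.δ_pos
  have hw : wedge (M.w (1, 0)) (M.w (0, 1)) = τ.im / M.δ ^ 2 := by
    simp [wedge, w, latPt]; field_simp
  rw [hw] at hk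
  have hpos : 0 < M.b * (τ.im / M.δ ^ 2) := mul_pos M.b_pos (by positivity)
  have hk1 : (1 : ℤ) ≤ k := by
    by_contra! h
    have : (k : ℝ) ≤ 0 := by exact_mod_cast Int.lt_add_one_iff.1 (by simpa using h)
    nlinarith [pi_pos]
  have hk2 : (1 : ℝ) ≤ k := by exact_mod_cast hk1
  have : 2 * π ≤ M.b * (τ.im / M.δ ^ 2) := by rw [hk]; nlinarith [pi_pos]
  rw [← mul_div_assoc, le_div_iff₀ (by positivity)] at this
  linarith

/-- Nontrivial characters average to zero. -/
lemma integral_character (M : MagLattice τ) (hτ : 0 < τ.im) {m : ℤ × ℤ} (hm : m ≠ 0) :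
    ∫ x, exp (I * ((M.b * wedge (M.w m) x : ℝ) : ℂ)) ∂M.vol = 0 := by
  set F : ℂ → ℂ := fun x => exp (I * ((M.b * wedge (M.w m) x : ℝ) : ℂ))
  have hF : Continuous F := by
    have : Continuous fun x => wedge (M.w m) x := by fun_prop
    fun_prop
  have hadd : ∀ x y, F (x + y) = F x * F y := fun x y => by
    simp only [F, ← exp_add, wedge_add_right]
    congr 1; push_cast; ring
  have hper : ∀ n x, F (x + M.w n) = F x := fun n x => by
    obtain ⟨k, hk⟩ := M.flux m n
    rw [hadd]
    have : F (M.w n) = 1 := by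
      simp only [F, hk]
      rw [exp_eq_one_iff]
      exact ⟨k, by push_cast; ring⟩
    rw [this, mul_one]
  have hw : M.w m ≠ 0 := fun h => by
    apply hm
    have := M.coord_w hτ m
    rw [h] at this
    simp [sc, tc] at this
    exact Prod.ext (by exact_mod_cast this.1.symm) (by exact_mod_cast this.2.symm)
  obtain ⟨a, ha⟩ : ∃ a, F a ≠ 1 := by
    have hn : 0 < wedge (M.w m) (I * M.w m) := by
      have : wedge (M.w m) (I * M.w m) = ‖M.w m‖ ^ 2 := by
        rw [← normSq_eq_norm_sq, normSq_apply]; simp [wedge]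
      rw [this]; positivity
    set q := wedge (M.w m) (I * M.w m)
    refine ⟨((π / (M.b * q) : ℝ) : ℂ) * (I * M.w m), ?_⟩
    have h2 : wedge (M.w m) (((π / (M.b * q) : ℝ) : ℂ) * (I * M.w m))
        = π / (M.b * q) * q := by
      simp only [wedge, re_ofReal_mul, im_ofReal_mul, q]; ring
    have hb := M.b_pos
    have h3 : M.b * (π / (M.b * q) * q) = π := by field_simp
    simp only [F, h2, h3]
    rw [mul_comm, exp_pi_mul_I]
    norm_num
  have h := M.integral_cell_add hτ hF.aestronglyMeasurable hper a
  simp only [hadd] at h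
  rw [integral_mul_const] at h
  have : (∫ x, F x ∂M.vol) * (F a - 1) = 0 := by rw [mul_sub, h]; ring
  exact (mul_eq_zero.1 this).resolve_right (sub_ne_zero.2 ha)

end MagLattice

/-! ## Covariant derivatives -/

/-- Covariant derivative in the direction `v` for the constant field `b`. -/
def covd (b : ℝ) (v : ℂ) (φ : ℂ → ℂ) (x : ℂ) : ℂ :=
  fderiv ℝ φ x v - I * ((b / 2 * wedge x v : ℝ) : ℂ) * φ x

lemma cov₁_aB (b : ℝ) (φ : ℂ → ℂ) : cov₁ (aB b) φ = covd b 1 φ := by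
  funext x
  simp [cov₁, covd, aB, wedge]

lemma cov₂_aB (b : ℝ) (φ : ℂ → ℂ) : cov₂ (aB b) φ = covd b I φ := by
  funext x
  simp [cov₂, covd, aB, wedge]

lemma negLap_aB (b : ℝ) (φ : ℂ → ℂ) (x : ℂ) :
    negLap (aB b) φ x = -(covd b 1 (covd b 1 φ) x + covd b I (covd b I φ) x) := by
  simp [negLap, cov₁_aB, cov₂_aB]

lemma contDiff_covd {b : ℝ} {v : ℂ} {φ : ℂ → ℂ} (h : ContDiff ℝ ∞ φ) :
    ContDiff ℝ ∞ (covd b v φ) := by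
  unfold covd
  refine (h.fderiv_right (m := ∞) (by simp) |>.clm_apply contDiff_const).sub (ContDiff.mul ?_ h)
  refine contDiff_const.mul (ofRealCLM.contDiff.comp ?_)
  exact contDiff_const.mul (contDiff_wedge contDiff_id contDiff_const)

lemma contDiff_negLap {b : ℝ} {φ : ℂ → ℂ} (h : ContDiff ℝ ∞ φ) :
    ContDiff ℝ ∞ (negLap (aB b) φ) := by
  have : negLap (aB b) φ = fun x => -(covd b 1 (covd b 1 φ) x + covd b I (covd b I φ) x) :=
    funext (negLap_aB b φ)
  rw [this]
  exact ((contDiff_covd (contDiff_covd h)).add (contDiff_covd (contDiff_covd h))).neg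

/-- Magnetic translation by `z`, with an additional constant phase. -/
def mtr (b : ℝ) (z : ℂ) (c : ℝ) (f : ℂ → ℂ) (x : ℂ) : ℂ :=
  exp (I * ((b / 2 * wedge z x + c : ℝ) : ℂ)) * f (x - z)

lemma contDiff_mtr (b : ℝ) (z : ℂ) (c : ℝ) {f : ℂ → ℂ} (hf : ContDiff ℝ ∞ f) :
    ContDiff ℝ ∞ (mtr b z c f) :=
  (contDiff_const.mul (ofRealCLM.contDiff.comp ((contDiff_const.mul ((contDiff_const.mul
    imCLM.contDiff).sub (contDiff_const.mul reCLM.contDiff))).add contDiff_const))).cexp.mul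
    (hf.comp (contDiff_id.sub contDiff_const))

lemma hasFDerivAt_wedge_left (z x : ℂ) :
    HasFDerivAt (fun x => wedge z x) (z.re • imCLM - z.im • reCLM) x := by
  unfold wedge
  exact (imCLM.hasFDerivAt.const_mul z.re).sub (reCLM.hasFDerivAt.const_mul z.im)

lemma hasFDerivAt_phase (b : ℝ) (z : ℂ) (c : ℝ) (x : ℂ) :
    HasFDerivAt (fun x => exp (I * ((b / 2 * wedge z x + c : ℝ) : ℂ)))
      (exp (I * ((b / 2 * wedge z x + c : ℝ) : ℂ)) •
        (I • ofRealCLM.comp ((b / 2) • (z.re • imCLM - z.im • reCLM)))) x := by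
  have h1 : HasFDerivAt (fun x => b / 2 * wedge z x + c)
      ((b / 2) • (z.re • imCLM - z.im • reCLM)) x :=
    ((hasFDerivAt_wedge_left z x).const_mul (b / 2)).add_const c
  have h2 := ofRealCLM.hasFDerivAt.comp x h1
  exact (h2.const_mul I).cexp

lemma covd_mtr (b : ℝ) (z : ℂ) (c : ℝ) (v : ℂ) {f : ℂ → ℂ} (hf : Differentiable ℝ f) (x : ℂ) :
    covd b v (mtr b z c f) x = mtr b z c (covd b v f) x := by
  have h1 := hasFDerivAt_phase b z c x
  have h2 : HasFDerivAt (fun x => f (x - z)) (fderiv ℝ f (x - z)) x := by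
    have := (hf (x - z)).hasFDerivAt.comp x ((hasFDerivAt_id x).sub_const z)
    simpa [Function.comp_def] using this
  have h3 := h1.mul h2
  unfold covd
  rw [show mtr b z c f = fun x => exp (I * ((b / 2 * wedge z x + c : ℝ) : ℂ)) * f (x - z) from rfl,
    show fderiv ℝ (fun x => exp (I * ((b / 2 * wedge z x + c : ℝ) : ℂ)) * f (x - z)) x = _ from
      h3.fderiv]
  simp only [mtr, wedge, sub_re, sub_im]
  simp
  ring

lemma covd_mtr' (b : ℝ) (z : ℂ) (c : ℝ) (v : ℂ) {f : ℂ → ℂ} (hf : Differentiable ℝ f) :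
    covd b v (mtr b z c f) = mtr b z c (covd b v f) := funext (covd_mtr b z c v hf)

lemma negLap_mtr (b : ℝ) (z : ℂ) (c : ℝ) {f : ℂ → ℂ} (hf : ContDiff ℝ ∞ f) (x : ℂ) :
    negLap (aB b) (mtr b z c f) x = mtr b z c (negLap (aB b) f) x := by
  have hd : Differentiable ℝ f := hf.differentiable (by simp)
  rw [negLap_aB, covd_mtr' _ _ _ _ hd, covd_mtr' _ _ _ _ hd,
    covd_mtr _ _ _ _ ((contDiff_covd hf).differentiable (by simp)),
    covd_mtr _ _ _ _ ((contDiff_covd hf).differentiable (by simp))]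
  simp only [mtr, negLap_aB]
  ring

namespace MagLattice

lemma equi_iff_mtr (M : MagLattice τ) (f : ℂ → ℂ) :
    M.Equi f ↔ ∀ m, mtr M.b (M.w m) (M.c m) f = f := by
  have key : ∀ m x, mtr M.b (M.w m) (M.c m) f (x + M.w m) = M.e m x * f x := fun m x => by
    simp only [mtr, e, chi_eq, wedge_add_right, wedge_self, add_sub_cancel_right, add_zero]
  constructor
  · intro h m
    funext x
    have := key m (x - M.w m)
    rwa [← h, sub_add_cancel] at this
  · intro h m x
    rw [← key, h]

lemma IsSection.covd {M : MagLattice τ} {f : ℂ → ℂ} (h : M.IsSection f) (v : ℂ) :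
    M.IsSection (covd M.b v f) := by
  refine ⟨contDiff_covd h.1, (M.equi_iff_mtr _).2 fun m => ?_⟩
  rw [← covd_mtr' _ _ _ _ (h.1.differentiable (by simp)), (M.equi_iff_mtr f).1 h.equi]

lemma IsSection.negLap {M : MagLattice τ} {f : ℂ → ℂ} (h : M.IsSection f) :
    M.IsSection (negLap (aB M.b) f) := by
  refine ⟨contDiff_negLap h.1, fun m x => ?_⟩
  rw [negLap_aB, negLap_aB, ((h.covd 1).covd 1).2, ((h.covd I).covd I).2]
  ring

lemma exists_bound_of_periodic (M : MagLattice τ) (hτ : 0 < τ.im) {F : ℂ → ℝ} (hF : Continuous F)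
    (hper : ∀ m x, F (x + M.w m) = F x) : ∃ B, 0 ≤ B ∧ ∀ x, |F x| ≤ B := by
  obtain ⟨B, hB⟩ := (isCompact_closedBall (0 : ℂ) (M.δ⁻¹ * (1 + ‖τ‖))).exists_bound_of_continuousOn
    hF.continuousOn
  refine ⟨max B 0, le_max_right _ _, fun x => ?_⟩
  rw [← M.red_add_w x, hper]
  exact (hB _ (mem_closedBall_zero_iff.2 (M.norm_le_of_mem_cell (M.red_mem hτ x)))).trans
    (le_max_left _ _)

lemma Equi.exists_bound {M : MagLattice τ} (hτ : 0 < τ.im) {f : ℂ → ℂ} (h : M.Equi f)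
    (hc : Continuous f) : ∃ B, 0 ≤ B ∧ ∀ x, ‖f x‖ ≤ B := by
  obtain ⟨B, h0, hB⟩ := M.exists_bound_of_periodic hτ hc.norm (fun m x => h.norm m x)
  exact ⟨B, h0, fun x => by simpa using hB x⟩

lemma integrable_of_continuous (M : MagLattice τ) {F : ℂ → ℂ} (hF : Continuous F) :
    Integrable F M.vol := by
  have h := hF.continuousOn.integrableOn_compact (μ := volume)
    (isCompact_closedBall (0 : ℂ) (M.δ⁻¹ * (1 + ‖τ‖)))
  exact h.mono_set (fun _ hx => mem_closedBall_zero_iff.2 (M.norm_le_of_mem_cell hx))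

/-- The derivative of a periodic function averages to zero. -/
lemma integral_fderiv_eq_zero (M : MagLattice τ) (hτ : 0 < τ.im) {F : ℂ → ℂ}
    (hF : ContDiff ℝ ∞ F) (hper : ∀ m x, F (x + M.w m) = F x) (v : ℂ) :
    ∫ x, fderiv ℝ F x v ∂M.vol = 0 := by
  set G : ℂ → ℂ := fun x => fderiv ℝ F x v
  have hGc : Continuous G :=
    ((hF.fderiv_right (m := ∞) (by simp)).clm_apply contDiff_const).continuous
  have hGper : ∀ m x, G (x + M.w m) = G x := fun m x => by
    have : (fun x => F (x + M.w m)) = F := funext (hper m)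
    simp only [G]
    rw [← fderiv_comp_add_right, this]
  obtain ⟨B, hB0, hB⟩ := M.exists_bound_of_periodic hτ hGc.norm
    (fun m x => by rw [hGper])
  have hsw : ∫ x, (∫ t in Set.Ioc (0 : ℝ) 1, G (x + (t : ℂ) * v)) ∂M.vol
      = ∫ t in Set.Ioc (0 : ℝ) 1, (∫ x, G (x + (t : ℂ) * v) ∂M.vol) := by
    refine integral_integral_swap ?_
    refine Integrable.of_bound (C := B) ?_ (.of_forall fun p => ?_)
    · exact (hGc.comp (by fun_prop)).aestronglyMeasurable
    · change ‖G (p.1 + (p.2 : ℂ) * v)‖ ≤ B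
      simpa using hB (p.1 + (p.2 : ℂ) * v)
  have h1 : ∀ x, ∫ t in Set.Ioc (0 : ℝ) 1, G (x + (t : ℂ) * v) = F (x + v) - F x := fun x => by
    rw [← intervalIntegral.integral_of_le zero_le_one]
    have hd : ∀ t : ℝ, HasDerivAt (fun t : ℝ => F (x + (t : ℂ) * v)) (G (x + (t : ℂ) * v)) t := fun t => by
      have h2 : HasDerivAt (fun t : ℝ => x + (t : ℂ) * v) v t := by
        simpa using ((hasDerivAt_id t).ofReal_comp.mul_const v).const_add x
      exact ((hF.differentiable (by simp)) _).hasFDerivAt.comp_hasDerivAt t h2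
    rw [intervalIntegral.integral_eq_sub_of_hasDerivAt (fun t _ => hd t)]
    · simp
    · exact (hGc.comp (by fun_prop)).intervalIntegrable _ _
  have h2 : ∀ t : ℝ, ∫ x, G (x + (t : ℂ) * v) ∂M.vol = ∫ x, G x ∂M.vol := fun t =>
    M.integral_cell_add hτ hGc.aestronglyMeasurable hGper _
  simp only [h1, h2] at hsw
  rw [integral_sub (f := fun x => F (x + v))
    (M.integrable_of_continuous (hF.continuous.comp (continuous_add_const v)))
    (M.integrable_of_continuous hF.continuous),
    M.integral_cell_add hτ hF.continuous.aestronglyMeasurable hper, sub_self] at hsw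
  simpa using hsw.symm

end MagLattice

lemma hasFDerivAt_conj_mul {f g : ℂ → ℂ} {x : ℂ} (hf : DifferentiableAt ℝ f x)
    (hg : DifferentiableAt ℝ g x) :
    HasFDerivAt (fun x => conj (f x) * g x)
      (conj (f x) • fderiv ℝ g x + g x • (conjCLE : ℂ →L[ℝ] ℂ).comp (fderiv ℝ f x)) x :=
  ((conjCLE : ℂ →L[ℝ] ℂ).hasFDerivAt.comp x hf.hasFDerivAt).mul hg.hasFDerivAt

lemma fderiv_conj_mul {b : ℝ} {f g : ℂ → ℂ} {x : ℂ} (v : ℂ) (hf : DifferentiableAt ℝ f x)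
    (hg : DifferentiableAt ℝ g x) :
    fderiv ℝ (fun x => conj (f x) * g x) x v =
      conj (covd b v f x) * g x + conj (f x) * covd b v g x := by
  rw [(hasFDerivAt_conj_mul hf hg).fderiv]
  have h2 : conj (2 : ℂ) = 2 := map_ofNat _ 2
  simp [covd, h2]
  ring

lemma integral_covd {b : ℝ} {v : ℂ} {f g : ℂ → ℂ} (hf : Differentiable ℝ f)
    (hg : Differentiable ℝ g) (h0 : Integrable fun x => conj (f x) * g x)
    (h1 : Integrable fun x => conj (covd b v f x) * g x)
    (h2 : Integrable fun x => conj (f x) * covd b v g x) :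
    ∫ x, conj (covd b v f x) * g x = -∫ x, conj (f x) * covd b v g x := by
  have e : ∀ x, fderiv ℝ (fun x => conj (f x) * g x) x v =
      conj (covd b v f x) * g x + conj (f x) * covd b v g x :=
    fun x => fderiv_conj_mul v (hf x) (hg x)
  have := integral_mul_fderiv_eq_neg_fderiv_mul_of_integrable (μ := (volume : Measure ℂ))
    (f := fun _ => (1 : ℂ)) (g := fun x => conj (f x) * g x) (v := v) (by simp)
    (by simp only [one_mul, e]; exact h1.add h2) (by simpa using h0) (by simp)
    (fun x _ => (hasFDerivAt_conj_mul (hf x) (hg x)).differentiableAt)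
  simp only [one_mul, e] at this
  rw [integral_add h1 h2] at this
  simp at this
  linear_combination this

/-- Symmetry of the magnetic Laplacian on the plane. -/
lemma integral_negLap {b : ℝ} {f g : ℂ → ℂ} (hf : ContDiff ℝ ∞ f) (hg : ContDiff ℝ ∞ g)
    (h : ∀ v, (Integrable fun x => conj (covd b v f x) * g x) ∧
      (Integrable fun x => conj (f x) * covd b v g x) ∧
      (Integrable fun x => conj (covd b v f x) * covd b v g x) ∧
      (Integrable fun x => conj (covd b v (covd b v f) x) * g x) ∧
      (Integrable fun x => conj (f x) * covd b v (covd b v g) x)) :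
    ∫ x, conj (negLap (aB b) f x) * g x = ∫ x, conj (f x) * negLap (aB b) g x := by
  have df := hf.differentiable (by simp)
  have dg := hg.differentiable (by simp)
  have key : ∀ v, ∫ x, conj (covd b v (covd b v f) x) * g x
      = ∫ x, conj (f x) * covd b v (covd b v g) x := fun v => by
    obtain ⟨a1, a2, a3, a4, a5⟩ := h v
    rw [integral_covd ((contDiff_covd hf).differentiable (by simp)) dg a1 a4 a3,
      integral_covd df ((contDiff_covd hg).differentiable (by simp)) a2 a3 a5, neg_neg]
  simp only [negLap_aB, map_neg, map_add, neg_mul, add_mul, mul_neg, mul_add, integral_neg]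
  rw [integral_add (h 1).2.2.2.1 (h I).2.2.2.1, integral_add (h 1).2.2.2.2 (h I).2.2.2.2, key, key]

lemma tsupport_covd_subset {b : ℝ} {v : ℂ} {f : ℂ → ℂ} :
    tsupport (covd b v f) ⊆ tsupport f := by
  refine closure_minimal (fun x hx => ?_) (isClosed_tsupport f)
  by_contra h
  apply hx
  have h1 : fderiv ℝ f x = 0 := by
    have : x ∉ Function.support (fderiv ℝ f) := fun h' => h (support_fderiv_subset ℝ h')
    simpa using this
  have h2 : f x = 0 := image_eq_zero_of_notMem_tsupport h
  simp [covd, h1, h2]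

lemma hasCompactSupport_covd {b : ℝ} {v : ℂ} {f : ℂ → ℂ} (h : HasCompactSupport f) :
    HasCompactSupport (covd b v f) :=
  h.mono' ((subset_tsupport _).trans tsupport_covd_subset)

lemma support_negLap_subset {b : ℝ} {f : ℂ → ℂ} {x : ℂ} (h : negLap (aB b) f x ≠ 0) :
    x ∈ tsupport f := by
  by_contra hx
  apply h
  have h2 : ∀ v, covd b v (covd b v f) x = 0 := fun v =>
    image_eq_zero_of_notMem_tsupport fun h' => hx (tsupport_covd_subset (tsupport_covd_subset h'))
  simp [negLap_aB, h2]

lemma integrable_conj_mul_of_compact {f g : ℂ → ℂ} (hf : Continuous f) (hg : Continuous g)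
    (hs : HasCompactSupport f) : Integrable fun x => conj (f x) * g x := by
  refine ((continuous_conj.comp hf).mul hg).integrable_of_hasCompactSupport ?_
  exact (hs.comp_left (g := conj) (by simp)).mul_right

lemma integral_negLap_of_compact {b : ℝ} {f g : ℂ → ℂ} (hf : ContDiff ℝ ∞ f)
    (hg : ContDiff ℝ ∞ g) (hs : HasCompactSupport f) :
    ∫ x, conj (negLap (aB b) f x) * g x = ∫ x, conj (f x) * negLap (aB b) g x := by
  have d := fun v => contDiff_covd (b := b) (v := v) hf
  have d' := fun v => contDiff_covd (b := b) (v := v) hg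
  have s := fun v => hasCompactSupport_covd (b := b) (v := v) hs
  refine integral_negLap hf hg (fun v => ⟨?_, ?_, ?_, ?_, ?_⟩)
  · exact integrable_conj_mul_of_compact (d v).continuous hg.continuous (s v)
  · exact integrable_conj_mul_of_compact hf.continuous (d' v).continuous hs
  · exact integrable_conj_mul_of_compact (d v).continuous (d' v).continuous (s v)
  · exact integrable_conj_mul_of_compact (contDiff_covd (d v)).continuous hg.continuous
      (hasCompactSupport_covd (s v))
  · exact integrable_conj_mul_of_compact hf.continuous (contDiff_covd (d' v)).continuous hs

namespace MagLattice

lemma integral_covd_cell {M : MagLattice τ} (hτ : 0 < τ.im) {f g : ℂ → ℂ} (hf : M.IsSection f)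
    (hg : M.IsSection g) (v : ℂ) :
    ∫ x, conj (BdG.covd M.b v f x) * g x ∂M.vol = -∫ x, conj (f x) * BdG.covd M.b v g x ∂M.vol := by
  have hF : ContDiff ℝ ∞ fun x => conj (f x) * g x :=
    ((conjCLE : ℂ →L[ℝ] ℂ).contDiff.comp hf.1).mul hg.1
  have h := M.integral_fderiv_eq_zero hτ hF (fun m x => Equi.conj_mul hf.equi hg.equi m x) v
  have e : ∀ x, fderiv ℝ (fun x => conj (f x) * g x) x v =
      conj (BdG.covd M.b v f x) * g x + conj (f x) * BdG.covd M.b v g x :=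
    fun x => fderiv_conj_mul v (hf.1.differentiable (by simp) x) (hg.1.differentiable (by simp) x)
  simp only [e] at h
  rw [integral_add] at h
  · linear_combination h
  · exact M.integrable_of_continuous ((continuous_conj.comp (hf.covd v).1.continuous).mul
      hg.1.continuous)
  · exact M.integrable_of_continuous ((continuous_conj.comp hf.1.continuous).mul
      (hg.covd v).1.continuous)

/-- Quadratic form of the magnetic Laplacian on sections. -/
lemma integral_conj_negLap {M : MagLattice τ} (hτ : 0 < τ.im) {f g : ℂ → ℂ} (hf : M.IsSection f)
    (hg : M.IsSection g) :
    ∫ x, conj (BdG.negLap (aB M.b) f x) * g x ∂M.vol =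
      (∫ x, conj (BdG.covd M.b 1 f x) * BdG.covd M.b 1 g x ∂M.vol) +
      ∫ x, conj (BdG.covd M.b I f x) * BdG.covd M.b I g x ∂M.vol := by
  simp only [negLap_aB, map_neg, map_add, neg_mul, add_mul, integral_neg]
  rw [integral_add, integral_covd_cell hτ (hf.covd 1) hg, integral_covd_cell hτ (hf.covd I) hg]
  · ring
  · exact M.integrable_of_continuous ((continuous_conj.comp ((hf.covd 1).covd 1).1.continuous).mul
      hg.1.continuous)
  · exact M.integrable_of_continuous ((continuous_conj.comp ((hf.covd I).covd I).1.continuous).mul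
      hg.1.continuous)

lemma integral_negLap_cell {M : MagLattice τ} (hτ : 0 < τ.im) {f g : ℂ → ℂ} (hf : M.IsSection f)
    (hg : M.IsSection g) :
    ∫ x, conj (BdG.negLap (aB M.b) f x) * g x ∂M.vol =
      ∫ x, conj (f x) * BdG.negLap (aB M.b) g x ∂M.vol := by
  have e : ∀ p q : ℂ → ℂ, ∫ x, conj (p x) * q x ∂M.vol = conj (∫ x, conj (q x) * p x ∂M.vol) := fun p q => by
    rw [← integral_conj]
    refine integral_ext fun x => ?_
    simp only [map_mul, conj_conj]
    ring
  rw [e f, integral_conj_negLap hτ hf hg, integral_conj_negLap hτ hg hf, map_add, ← e, ← e]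

end MagLattice

/-! ## Radial functions -/

lemma hasFDerivAt_normSq (z : ℂ) :
    HasFDerivAt (fun z : ℂ => normSq z) ((2 * z.re) • reCLM + (2 * z.im) • imCLM) z := by
  have h : (fun z : ℂ => normSq z) = fun z => z.re * z.re + z.im * z.im := by
    funext z; exact normSq_apply z
  rw [h]
  have h1 := (reCLM.hasFDerivAt (x := z)).mul (reCLM.hasFDerivAt (x := z))
  have h2 := (imCLM.hasFDerivAt (x := z)).mul (imCLM.hasFDerivAt (x := z))
  convert! h1.add h2 using 1
  ext <;> (simp; ring)

lemma covd_radial {b : ℝ} {u u' : ℝ → ℝ} (hu : ∀ s, HasDerivAt u (u' s) s) (v z : ℂ) :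
    covd b v (fun z => (u (normSq z) : ℂ)) z =
      ((2 * (z.re * v.re + z.im * v.im) * u' (normSq z) : ℝ) : ℂ)
        - I * ((b / 2 * wedge z v * u (normSq z) : ℝ) : ℂ) := by
  have h1 := ofRealCLM.hasFDerivAt.comp z ((hu (normSq z)).comp_hasFDerivAt z (hasFDerivAt_normSq z))
  have h2 : HasFDerivAt (fun z => (u (normSq z) : ℂ)) _ z := h1
  rw [covd, h2.fderiv]
  simp
  ring

lemma negLap_radial {b : ℝ} {u u' u'' : ℝ → ℝ} (hu : ∀ s, HasDerivAt u (u' s) s)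
    (hu' : ∀ s, HasDerivAt u' (u'' s) s) (z : ℂ) :
    negLap (aB b) (fun z => (u (normSq z) : ℂ)) z =
      ((-4 * u' (normSq z) - 4 * normSq z * u'' (normSq z)
        + b ^ 2 / 4 * normSq z * u (normSq z) : ℝ) : ℂ) := by
  have hU := (hu (normSq z)).comp_hasFDerivAt z (hasFDerivAt_normSq z)
  have hU' := (hu' (normSq z)).comp_hasFDerivAt z (hasFDerivAt_normSq z)
  have key : ∀ v : ℂ, covd b v (covd b v (fun z => (u (normSq z) : ℂ))) z =
      ((2 * (v.re * v.re + v.im * v.im) * u' (normSq z)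
        + 4 * ((z.re * v.re + z.im * v.im) * (z.re * v.re + z.im * v.im)) * u'' (normSq z)
        - (b / 2 * wedge z v) * (b / 2 * wedge z v) * u (normSq z) : ℝ) : ℂ)
      - I * ((2 * b * wedge z v * (z.re * v.re + z.im * v.im) * u' (normSq z) : ℝ) : ℂ) := fun v => by
    rw [show covd b v (fun z => (u (normSq z) : ℂ)) = _ from funext (covd_radial hu v)]
    have hl : HasFDerivAt (fun z : ℂ => 2 * (z.re * v.re + z.im * v.im))
        ((2 : ℝ) • (v.re • reCLM + v.im • imCLM)) z := by
      have := ((reCLM.hasFDerivAt (x := z)).mul_const v.re).add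
        ((imCLM.hasFDerivAt (x := z)).mul_const v.im)
      exact this.const_mul 2
    have hw : HasFDerivAt (fun z : ℂ => b / 2 * wedge z v)
        ((b / 2) • (v.im • reCLM - v.re • imCLM)) z := by
      unfold wedge
      have := ((reCLM.hasFDerivAt (x := z)).mul_const v.im).sub
        ((imCLM.hasFDerivAt (x := z)).mul_const v.re)
      exact this.const_mul (b / 2)
    have h1 := ofRealCLM.hasFDerivAt.comp z (hl.mul hU')
    have h2 := (ofRealCLM.hasFDerivAt.comp z (hw.mul hU)).const_mul I
    have h3 : HasFDerivAt (fun z : ℂ =>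
        ((2 * (z.re * v.re + z.im * v.im) * u' (normSq z) : ℝ) : ℂ)
        - I * ((b / 2 * wedge z v * u (normSq z) : ℝ) : ℂ)) _ z := h1.sub h2
    rw [covd, h3.fderiv]
    apply Complex.ext <;> simp [wedge] <;> ring
  rw [negLap_aB, key, key]
  apply Complex.ext <;> simp [wedge, normSq_apply, pow_two] <;> ring

/-- The phase `e^{-i b/2 x ∧ y}` of a magnetic translation invariant kernel. -/
def ph (b : ℝ) (x y : ℂ) : ℂ := exp (-(I * ((b / 2 * wedge x y : ℝ) : ℂ)))

@[simp] lemma norm_ph (b : ℝ) (x y : ℂ) : ‖ph b x y‖ = 1 := by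
  rw [ph, ← mul_neg, ← ofReal_neg, mul_comm]; exact norm_exp_ofReal_mul_I _

lemma ph_swap (b : ℝ) (x y : ℂ) : ph b y x = conj (ph b x y) := by
  rw [ph, ph, ← exp_conj]
  congr 1
  rw [wedge_swap y x]
  have h2 : conj (2 : ℂ) = 2 := map_ofNat _ 2
  simp [h2]

lemma ph_mul_mtr (b : ℝ) (f : ℂ → ℂ) (x y : ℂ) : f (x - y) * ph b x y = mtr b y 0 f x := by
  rw [mtr, ph, mul_comm, wedge_swap x y]
  simp

lemma negLap_kernel {b : ℝ} {f : ℂ → ℂ} (hf : ContDiff ℝ ∞ f) (x y : ℂ) :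
    negLap (aB b) (fun x => f (x - y) * ph b x y) x = negLap (aB b) f (x - y) * ph b x y := by
  have h : (fun x => f (x - y) * ph b x y) = mtr b y 0 f := funext fun x => ph_mul_mtr b f x y
  rw [h, negLap_mtr b y 0 hf, ph_mul_mtr]

@[fun_prop]
lemma continuous_ph {X : Type*} [TopologicalSpace X] {b : ℝ} {f g : X → ℂ} (hf : Continuous f)
    (hg : Continuous g) : Continuous fun x => ph b (f x) (g x) := by
  unfold ph; fun_prop

/-! ## Kernels and tensor products -/

lemma L2_inner_eq {X : Type*} [MeasurableSpace X] {μ : Measure X} (u w : Lp ℂ 2 μ) :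
    ⟪u, w⟫_ℂ = ∫ x, conj (u x) * w x ∂μ := by
  rw [L2.inner_def]
  refine integral_ext fun x => ?_
  simp [RCLike.inner_apply, mul_comm]

lemma L2_integrable_conj_mul {X : Type*} [MeasurableSpace X] {μ : Measure X} (u w : Lp ℂ 2 μ) :
    Integrable (fun x => conj (u x) * w x) μ := by
  refine (L2.integrable_inner (𝕜 := ℂ) u w).congr (.of_forall fun x => ?_)
  simp [RCLike.inner_apply, mul_comm]

namespace MagLattice

variable (M : MagLattice τ)

lemma coeFn_conjH (u : M.H) : (M.conjH u : ℂ → ℂ) =ᵐ[M.vol] fun x => conj (u x) :=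
  Lp.coeFn_star u

@[simp] lemma conjH_conjH (u : M.H) : M.conjH (M.conjH u) = u := star_star u

lemma inner_conjH_conjH (u w : M.H) : ⟪M.conjH u, M.conjH w⟫_ℂ = conj ⟪u, w⟫_ℂ := by
  rw [L2_inner_eq, L2_inner_eq, ← integral_conj]
  refine integral_congr_ae ?_
  filter_upwards [M.coeFn_conjH u, M.coeFn_conjH w] with x h1 h2
  simp [h1, h2]

@[simp] lemma norm_conjH (u : M.H) : ‖M.conjH u‖ = ‖u‖ := by
  have h := M.inner_conjH_conjH u u
  rw [inner_self_eq_norm_sq_to_K, inner_self_eq_norm_sq_to_K] at h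
  have h2 : ‖M.conjH u‖ ^ 2 = ‖u‖ ^ 2 := by
    have h3 := congrArg re h
    simpa [← ofReal_pow] using h3
  exact (sq_eq_sq₀ (norm_nonneg _) (norm_nonneg _)).1 h2

lemma memLp_tens (u w : M.H) : MemLp (fun p : ℂ × ℂ => u p.1 * w p.2) 2 (M.vol.prod M.vol) := by
  have hm : AEStronglyMeasurable (fun p : ℂ × ℂ => u p.1 * w p.2) (M.vol.prod M.vol) :=
    (Lp.aestronglyMeasurable u).comp_fst.mul (Lp.aestronglyMeasurable w).comp_snd
  rw [memLp_two_iff_integrable_sq_norm hm]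
  have h1 := (memLp_two_iff_integrable_sq_norm (Lp.aestronglyMeasurable u)).1 (Lp.memLp u)
  have h2 := (memLp_two_iff_integrable_sq_norm (Lp.aestronglyMeasurable w)).1 (Lp.memLp w)
  refine (h1.mul_prod h2).congr (.of_forall fun p => ?_)
  simp [mul_pow]

/-- The kernel `u(x) w(y)`. -/
def tens (u w : M.H) : M.HH := (M.memLp_tens u w).toLp _

lemma coeFn_tens (u w : M.H) :
    (M.tens u w : ℂ × ℂ → ℂ) =ᵐ[M.vol.prod M.vol] fun p => u p.1 * w p.2 :=
  (M.memLp_tens u w).coeFn_toLp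

lemma pair_eq_inner (u w : M.H) (κ : M.HH) : M.pair u w κ = ⟪M.tens u w, κ⟫_ℂ := by
  rw [L2_inner_eq, pair]
  refine integral_congr_ae ?_
  filter_upwards [M.coeFn_tens u w] with p h
  simp [h]

lemma pair_congr {u u' w w' : ℂ → ℂ} (hu : u =ᵐ[M.vol] u') (hw : w =ᵐ[M.vol] w') (κ : M.HH) :
    M.pair u w κ = M.pair u' w' κ := by
  refine integral_congr_ae ?_
  have h1 := Measure.quasiMeasurePreserving_fst (μ := M.vol) (ν := M.vol) |>.ae_eq_comp hu
  have h2 := Measure.quasiMeasurePreserving_snd (μ := M.vol) (ν := M.vol) |>.ae_eq_comp hw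
  filter_upwards [h1, h2] with p e1 e2
  simp only [Function.comp] at e1 e2
  simp [e1, e2]

lemma inner_tens_tens (u w u' w' : M.H) :
    ⟪M.tens u w, M.tens u' w'⟫_ℂ = ⟪u, u'⟫_ℂ * ⟪w, w'⟫_ℂ := by
  rw [← pair_eq_inner, pair, L2_inner_eq, L2_inner_eq, ← integral_prod_mul]
  refine integral_congr_ae ?_
  filter_upwards [M.coeFn_tens u' w'] with p h
  simp only [h]
  ring

lemma norm_tens (u w : M.H) : ‖M.tens u w‖ = ‖u‖ * ‖w‖ := by
  have h := M.inner_tens_tens u w u w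
  rw [inner_self_eq_norm_sq_to_K, inner_self_eq_norm_sq_to_K, inner_self_eq_norm_sq_to_K] at h
  have h2 : ‖M.tens u w‖ ^ 2 = (‖u‖ * ‖w‖) ^ 2 := by
    rw [mul_pow]; exact_mod_cast h
  exact (sq_eq_sq₀ (norm_nonneg _) (by positivity)).1 h2

lemma tens_add_left (u u' w : M.H) : M.tens (u + u') w = M.tens u w + M.tens u' w := by
  apply Lp.ext
  have h1 := Measure.quasiMeasurePreserving_fst (μ := M.vol) (ν := M.vol) |>.ae_eq_comp
    (Lp.coeFn_add u u')
  filter_upwards [h1, M.coeFn_tens (u + u') w, M.coeFn_tens u w, M.coeFn_tens u' w,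
    Lp.coeFn_add (M.tens u w) (M.tens u' w)] with p e1 e2 e3 e4 e5
  simp only [Function.comp, Pi.add_apply] at e1
  rw [e2, e5, Pi.add_apply, e3, e4, e1]; ring

lemma tens_add_right (u w w' : M.H) : M.tens u (w + w') = M.tens u w + M.tens u w' := by
  apply Lp.ext
  have h1 := Measure.quasiMeasurePreserving_snd (μ := M.vol) (ν := M.vol) |>.ae_eq_comp
    (Lp.coeFn_add w w')
  filter_upwards [h1, M.coeFn_tens u (w + w'), M.coeFn_tens u w, M.coeFn_tens u w',
    Lp.coeFn_add (M.tens u w) (M.tens u w')] with p e1 e2 e3 e4 e5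
  simp only [Function.comp, Pi.add_apply] at e1
  rw [e2, e5, Pi.add_apply, e3, e4, e1]; ring

lemma tens_smul_left (c : ℂ) (u w : M.H) : M.tens (c • u) w = c • M.tens u w := by
  apply Lp.ext
  have h1 := Measure.quasiMeasurePreserving_fst (μ := M.vol) (ν := M.vol) |>.ae_eq_comp
    (Lp.coeFn_smul c u)
  filter_upwards [h1, M.coeFn_tens (c • u) w, M.coeFn_tens u w,
    Lp.coeFn_smul c (M.tens u w)] with p e1 e2 e3 e5
  simp only [Function.comp, Pi.smul_apply] at e1
  rw [e2, e5, Pi.smul_apply, e3, e1, smul_eq_mul, smul_eq_mul]; ring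

lemma tens_smul_right (c : ℂ) (u w : M.H) : M.tens u (c • w) = c • M.tens u w := by
  apply Lp.ext
  have h1 := Measure.quasiMeasurePreserving_snd (μ := M.vol) (ν := M.vol) |>.ae_eq_comp
    (Lp.coeFn_smul c w)
  filter_upwards [h1, M.coeFn_tens u (c • w), M.coeFn_tens u w,
    Lp.coeFn_smul c (M.tens u w)] with p e1 e2 e3 e5
  simp only [Function.comp, Pi.smul_apply] at e1
  rw [e2, e5, Pi.smul_apply, e3, e1, smul_eq_mul, smul_eq_mul]; ring

/-- The sesquilinear form `(u, w) ↦ ⟨κ, w ⊗ ū⟩`. -/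
def kerForm (κ : M.HH) : M.H →L⋆[ℂ] M.H →L[ℂ] ℂ :=
  LinearMap.mkContinuous₂
    (LinearMap.mk₂'ₛₗ (starRingEnd ℂ) (RingHom.id ℂ)
      (fun u w => ⟪κ, M.tens w (M.conjH u)⟫_ℂ)
      (fun u u' w => by simp only [map_add, tens_add_right, inner_add_right])
      (fun c u w => by
        rw [M.conjH.map_smulₛₗ, tens_smul_right, inner_smul_right, smul_eq_mul])
      (fun u w w' => by simp only [tens_add_left, inner_add_right])
      (fun c u w => by
        rw [tens_smul_left, inner_smul_right]; rfl))
    ‖κ‖ (fun u w => by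
      have h := norm_inner_le_norm (𝕜 := ℂ) κ (M.tens w (M.conjH u))
      rw [norm_tens, norm_conjH, mul_comm ‖w‖, ← mul_assoc] at h
      exact h)

/-- The operator with integral kernel `κ`. -/
def kerOp (κ : M.HH) : M.H →L[ℂ] M.H :=
  InnerProductSpace.continuousLinearMapOfBilin (M.kerForm κ)

lemma inner_kerOp (κ : M.HH) (u w : M.H) :
    ⟪w, M.kerOp κ u⟫_ℂ = ⟪M.tens w (M.conjH u), κ⟫_ℂ := by
  have h : ⟪M.kerOp κ u, w⟫_ℂ = ⟪κ, M.tens w (M.conjH u)⟫_ℂ :=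
    InnerProductSpace.continuousLinearMapOfBilin_apply _ _ _
  rw [← inner_conj_symm, h, inner_conj_symm]

lemma norm_kerOp_le (κ : M.HH) : ‖M.kerOp κ‖ ≤ ‖κ‖ := by
  refine ContinuousLinearMap.opNorm_le_bound _ (norm_nonneg _) fun u => ?_
  have h : ‖M.kerOp κ u‖ * ‖M.kerOp κ u‖ ≤ ‖M.kerOp κ u‖ * (‖κ‖ * ‖u‖) := by
    have h1 : ‖⟪M.kerOp κ u, M.kerOp κ u⟫_ℂ‖ = ‖M.kerOp κ u‖ * ‖M.kerOp κ u‖ := by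
      rw [inner_self_eq_norm_sq_to_K]
      simp [pow_two]
    rw [← h1, inner_kerOp]
    refine (norm_inner_le_norm _ _).trans ?_
    rw [norm_tens, norm_conjH]
    nlinarith
  rcases (norm_nonneg (M.kerOp κ u)).eq_or_lt with h0 | h0
  · rw [← h0]; positivity
  · exact le_of_mul_le_mul_left h h0

lemma kerOp_add (κ κ' : M.HH) : M.kerOp (κ + κ') = M.kerOp κ + M.kerOp κ' := by
  refine ContinuousLinearMap.ext fun u => ext_inner_left ℂ fun w => ?_
  rw [_root_.add_apply, inner_add_right, inner_kerOp, inner_kerOp, inner_kerOp, inner_add_right]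

lemma kerOp_smul (c : ℂ) (κ : M.HH) : M.kerOp (c • κ) = c • M.kerOp κ := by
  refine ContinuousLinearMap.ext fun u => ext_inner_left ℂ fun w => ?_
  rw [_root_.smul_apply, inner_smul_right, inner_kerOp, inner_kerOp, inner_smul_right]

/-- `kerOp` as a bounded linear map. -/
def kerOpL : M.HH →L[ℂ] (M.H →L[ℂ] M.H) :=
  LinearMap.mkContinuous ⟨⟨M.kerOp, M.kerOp_add⟩, M.kerOp_smul⟩ 1
    (fun κ => by rw [one_mul]; exact M.norm_kerOp_le κ)

lemma kerOp_tens (u w v : M.H) : M.kerOp (M.tens u w) v = ⟪M.conjH w, v⟫_ℂ • u := by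
  refine ext_inner_left ℂ fun z => ?_
  have h : ⟪M.conjH v, w⟫_ℂ = ⟪M.conjH w, v⟫_ℂ := by
    rw [← M.conjH_conjH w, inner_conjH_conjH, inner_conj_symm, conjH_conjH]
  rw [inner_kerOp, inner_tens_tens, inner_smul_right, mul_comm, h]

lemma integrable_ker_mul (κ : M.HH) (u : M.H) :
    Integrable (fun p : ℂ × ℂ => κ p * u p.2) (M.vol.prod M.vol) := by
  have h1 := (Lp.memLp u).comp_snd M.vol
  have h := h1.integrable_mul (Lp.memLp κ)
  refine h.congr (.of_forall fun p => ?_)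
  simp [mul_comm]

lemma hasL2Kernel_kerOp (κ : M.HH) : M.HasL2Kernel (M.kerOp κ) κ := fun u => by
  have hi := M.integrable_ker_mul κ u
  refine Integrable.ae_eq_of_forall_setIntegral_eq _ _ ((Lp.memLp _).integrable (by norm_num))
    hi.integral_prod_left fun s hs _ => ?_
  set w : M.H := indicatorConstLp 2 hs (measure_ne_top _ _) (1 : ℂ)
  have hw : (w : ℂ → ℂ) =ᵐ[M.vol] s.indicator fun _ => 1 := indicatorConstLp_coeFn
  have h1 : ∫ x in s, (M.kerOp κ u) x ∂M.vol = ⟪w, M.kerOp κ u⟫_ℂ := by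
    rw [L2_inner_eq, ← integral_indicator hs]
    refine integral_congr_ae ?_
    filter_upwards [hw] with x hx
    rw [hx]
    by_cases h : x ∈ s <;> simp [h]
  rw [h1, inner_kerOp, ← pair_eq_inner, ← integral_indicator hs,
    M.pair_congr hw (M.coeFn_conjH u), pair]
  have h2 : ∀ p : ℂ × ℂ, conj (s.indicator (fun _ => (1 : ℂ)) p.1) * conj (conj (u p.2)) * κ p
      = (Prod.fst ⁻¹' s).indicator (fun p : ℂ × ℂ => κ p * u p.2) p := fun p => by
    by_cases h : p.1 ∈ s <;> simp [h, mul_comm]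
  simp only [h2]
  rw [integral_prod _ (hi.indicator (measurable_fst hs))]
  refine integral_ext fun x => ?_
  by_cases h : x ∈ s
  · rw [indicator_of_mem h]
    refine integral_ext fun y => ?_
    simp [h]
  · simp [h]

lemma orthonormal_tens {ι ι' : Type*} {e : ι → M.H} {g : ι' → M.H} (he : Orthonormal ℂ e)
    (hg : Orthonormal ℂ g) : Orthonormal ℂ (fun p : ι × ι' => M.tens (e p.1) (g p.2)) := by
  classical
  rw [orthonormal_iff_ite] at he hg ⊢
  rintro ⟨i, j⟩ ⟨i', j'⟩
  rw [inner_tens_tens, he, hg]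
  by_cases h1 : i = i' <;> by_cases h2 : j = j' <;> simp [h1, h2]

lemma tens_total {ι ι' : Type*} (e : HilbertBasis ι ℂ M.H) (g : HilbertBasis ι' ℂ M.H)
    (κ : M.HH) (h : ∀ i j, ⟪M.tens (e i) (g j), κ⟫_ℂ = 0) : κ = 0 := by
  have h1 : ∀ j, M.kerOp κ (M.conjH (g j)) = 0 := fun j => by
    rw [← e.repr.map_eq_zero_iff]
    ext i
    rw [e.repr_apply_apply, inner_kerOp, conjH_conjH, h]
    rfl
  have h2 : ∀ u, M.kerOp κ u = 0 := by
    intro u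
    have h3 : ∀ z, ⟪z, M.kerOp κ u⟫_ℂ = 0 := by
      intro z
      have h4 : (adjoint (M.kerOp κ)) z = 0 := by
        apply (map_eq_zero_iff M.conjH (fun a b hab => by
          rw [← M.conjH_conjH a, hab, conjH_conjH])).1
        rw [← g.repr.map_eq_zero_iff]
        ext j
        rw [g.repr_apply_apply, ← M.conjH_conjH (g j), inner_conjH_conjH,
          adjoint_inner_right, h1]
        simp
      rw [← adjoint_inner_left, h4, inner_zero_left]
    exact inner_self_eq_zero.1 (h3 _)
  have h3 : ∀ u w, ⟪M.tens w u, κ⟫_ℂ = 0 := by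
    intro u w
    rw [← M.conjH_conjH u, ← inner_kerOp, h2, inner_zero_right]
  have hint : Integrable (κ : ℂ × ℂ → ℂ) (M.vol.prod M.vol) := (Lp.memLp κ).integrable (by norm_num)
  rw [Lp.eq_zero_iff_ae_eq_zero]
  have key : ∀ s t : Set ℂ, MeasurableSet s → MeasurableSet t →
      ∫ p in s ×ˢ t, κ p ∂(M.vol.prod M.vol) = 0 := by
    intro s t hs ht
    have := h3 (indicatorConstLp 2 ht (measure_ne_top _ _) (1 : ℂ))
      (indicatorConstLp 2 hs (measure_ne_top _ _) (1 : ℂ))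
    rw [← pair_eq_inner, M.pair_congr indicatorConstLp_coeFn indicatorConstLp_coeFn, pair] at this
    rw [← this, ← integral_indicator (hs.prod ht)]
    refine integral_ext fun p => ?_
    by_cases h1 : p.1 ∈ s <;> by_cases h2 : p.2 ∈ t <;> simp [h1, h2]
  refine hint.ae_eq_zero_of_forall_setIntegral_eq_zero fun S hS _ => ?_
  induction S, hS using MeasurableSpace.induction_on_inter generateFrom_prod.symm isPiSystem_prod with
  | empty => simp
  | basic S hS =>
    obtain ⟨s, hs, t, ht, rfl⟩ := hS
    exact key s t hs ht
  | compl S hS ih =>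
    have := key univ univ MeasurableSet.univ MeasurableSet.univ
    rw [Set.univ_prod_univ, setIntegral_univ] at this
    rw [setIntegral_compl hS hint, this, ih (measure_lt_top _ _), sub_zero]
  | iUnion f hd hm ih =>
    rw [integral_iUnion hm hd hint.integrableOn]
    simp [ih]

/-- Products of Hilbert bases. -/
def tensBasis {ι ι' : Type*} (e : HilbertBasis ι ℂ M.H) (g : HilbertBasis ι' ℂ M.H) :
    HilbertBasis (ι × ι') ℂ M.HH :=
  HilbertBasis.mkOfOrthogonalEqBot (M.orthonormal_tens e.orthonormal g.orthonormal) (by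
    rw [Submodule.eq_bot_iff]
    intro κ hκ
    refine M.tens_total e g κ fun i j => ?_
    exact (Submodule.mem_orthogonal _ _).1 hκ _ (Submodule.subset_span ⟨(i, j), rfl⟩))

@[simp] lemma tensBasis_apply {ι ι' : Type*} (e : HilbertBasis ι ℂ M.H)
    (g : HilbertBasis ι' ℂ M.H) (p : ι × ι') :
    M.tensBasis e g p = M.tens (e p.1) (g p.2) := by
  simp [tensBasis]

lemma isCompactOperator_kerOp (κ : M.HH) : IsCompactOperator (M.kerOp κ) := by
  obtain ⟨s, b, -⟩ := exists_hilbertBasis ℂ M.H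
  have h := ((M.tensBasis b b).hasSum_repr κ).mapL M.kerOpL
  have hc : IsClosed {A : M.H →L[ℂ] M.H | IsCompactOperator A} :=
    isClosed_setOfPred_isCompactOperator
  refine hc.mem_of_tendsto h (.of_forall fun S => ?_)
  have hr : ∀ u w : M.H, IsCompactOperator (M.kerOp (M.tens u w)) := fun u w => by
    have : M.kerOp (M.tens u w) = (toSpanSingleton ℂ u).comp
        (innerSL ℂ (M.conjH w)) := by
      refine ContinuousLinearMap.ext fun v => ?_
      rw [kerOp_tens]
      simp
    rw [this]
    have h1 : IsCompactOperator (innerSL ℂ (M.conjH w)) :=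
      isCompactOperator_of_locallyCompactSpace_dom _
    exact h1.clm_comp (toSpanSingleton ℂ u)
  have hz : IsCompactOperator ((0 : M.H →L[ℂ] M.H)) := isCompactOperator_zero
  refine Finset.sum_induction _ (fun A : M.H →L[ℂ] M.H => IsCompactOperator A)
    (fun A B hA hB => hA.add hB) hz fun p _ => ?_
  rw [map_smul]
  have := hr (b p.1) (b p.2)
  rw [tensBasis_apply]
  exact this.smul ((M.tensBasis b b).repr κ p)

/-- Complex conjugates of a Hilbert basis. -/
def conjBasis {ι : Type*} (e : HilbertBasis ι ℂ M.H) : HilbertBasis ι ℂ M.H :=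
  HilbertBasis.mkOfOrthogonalEqBot (v := fun i => M.conjH (e i))
    (by
      classical
      rw [orthonormal_iff_ite]
      intro i j
      rw [inner_conjH_conjH, orthonormal_iff_ite.1 e.orthonormal]
      split_ifs <;> simp)
    (by
      rw [Submodule.eq_bot_iff]
      intro u hu
      have : M.conjH u = 0 := by
        rw [← e.repr.map_eq_zero_iff]
        ext i
        rw [e.repr_apply_apply, ← M.conjH_conjH (e i), inner_conjH_conjH,
          (Submodule.mem_orthogonal _ _).1 hu _ (Submodule.subset_span ⟨i, rfl⟩)]
        simp
      rw [← M.conjH_conjH u, this, map_zero])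

@[simp] lemma conjBasis_apply {ι : Type*} (e : HilbertBasis ι ℂ M.H) (i : ι) :
    M.conjBasis e i = M.conjH (e i) := by
  simp [conjBasis]

end MagLattice

/-! ## Periodized kernels -/

/-- Continuous functions on the plane of decay `|z|⁻³`. -/
structure Nice (K : ℂ → ℂ) : Prop where
  cont : Continuous K
  decay : ∃ C : ℝ, 0 ≤ C ∧ ∀ z, ‖K z‖ ≤ C * (1 + ‖z‖) ^ (-3 : ℝ)

lemma integrable_decay_three : Integrable (fun z : ℂ => (1 + ‖z‖) ^ (-3 : ℝ)) :=
  integrable_one_add_norm (by rw [finrank_real_complex]; norm_num)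

lemma Nice.integrable {K : ℂ → ℂ} (h : Nice K) : Integrable K := by
  obtain ⟨C, -, hC⟩ := h.decay
  exact (integrable_decay_three.const_mul C).mono' h.cont.aestronglyMeasurable
    (Eventually.of_forall hC)

lemma Nice.exists_bound {K : ℂ → ℂ} (h : Nice K) : ∃ C, 0 ≤ C ∧ ∀ z, ‖K z‖ ≤ C := by
  obtain ⟨C, hC0, hC⟩ := h.decay
  refine ⟨C, hC0, fun z => (hC z).trans ?_⟩
  have := Real.rpow_le_one_of_one_le_of_nonpos (x := 1 + ‖z‖) (z := -3)
    (by linarith [norm_nonneg z]) (by norm_num)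
  nlinarith

lemma Nice.of_compact {K : ℂ → ℂ} (h : Continuous K) (hs : HasCompactSupport K) : Nice K := by
  refine ⟨h, ?_⟩
  have hc : Continuous fun z => ‖K z‖ * (1 + ‖z‖) ^ (3 : ℝ) := by
    refine h.norm.mul (Continuous.rpow_const (by fun_prop) fun z => Or.inr (by norm_num))
  obtain ⟨C, hC⟩ := (hs.norm.mul_right (f' := fun z => (1 + ‖z‖) ^ (3 : ℝ))).exists_bound_of_continuous hc
  refine ⟨C, (norm_nonneg _).trans (hC 0), fun z => ?_⟩
  have h1 := hC z
  have h0 : 0 ≤ ‖K z‖ * (1 + ‖z‖) ^ (3 : ℝ) := by positivity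
  have h1 : ‖K z‖ * (1 + ‖z‖) ^ (3 : ℝ) ≤ C := (norm_of_nonneg h0).symm.trans_le h1
  rw [Real.rpow_neg (by positivity), ← div_eq_mul_inv, le_div_iff₀ (by positivity)]
  exact h1

lemma measurable_tsum_of_summable {ι X : Type*} [Countable ι] [MeasurableSpace X] {t : ι → X → ℂ}
    (ht : ∀ m, Measurable (t m)) (hs : ∀ p, Summable fun m => t m p) :
    Measurable fun p => ∑' m, t m p := by
  refine measurable_of_tendsto_metrizable' (atTop : Filter (Finset ι))
    (f := fun s p => ∑ m ∈ s, t m p) (fun s => Finset.measurable_fun_sum s fun m _ => ht m) ?_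
  rw [tendsto_pi_nhds]
  intro p
  exact (hs p).hasSum

namespace MagLattice

variable (M : MagLattice τ)

/-- The summands of the periodization of the kernel `K(x - y) e^{-i b/2 x ∧ y}`. -/
def perTerm (K : ℂ → ℂ) (m : ℤ × ℤ) (x y : ℂ) : ℂ :=
  K (x - (y + M.w m)) * ph M.b x (y + M.w m) * M.e m y

/-- The kernel on the cell of the operator with kernel `K(x - y) e^{-i b/2 x ∧ y}` on the plane. -/
def perK (K : ℂ → ℂ) (x y : ℂ) : ℂ := ∑' m, M.perTerm K m x y

/-- The operator with kernel `K(x - y) e^{-i b/2 x ∧ y}`. -/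
def conv (K : ℂ → ℂ) (f : ℂ → ℂ) (x : ℂ) : ℂ := ∫ y, K (x - y) * ph M.b x y * f y

lemma norm_perTerm (K : ℂ → ℂ) (m : ℤ × ℤ) (x y : ℂ) :
    ‖M.perTerm K m x y‖ = ‖K (x - (y + M.w m))‖ := by
  simp [perTerm, norm_e]

lemma continuous_e (m : ℤ × ℤ) : Continuous (M.e m) := by
  unfold e chi
  fun_prop

lemma continuous_perTerm {K : ℂ → ℂ} (hK : Continuous K) (m : ℤ × ℤ) :
    Continuous fun p : ℂ × ℂ => M.perTerm K m p.1 p.2 := by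
  have := M.continuous_e m
  unfold perTerm
  fun_prop

variable {M}

lemma summable_shift (hτ : 0 < τ.im) {K : ℂ → ℂ} (hK : Nice K) :
    ∃ B : ℝ, 0 ≤ B ∧ ∀ x, Summable (fun m => ‖K (x - M.w m)‖) ∧ ∑' m, ‖K (x - M.w m)‖ ≤ B := by
  obtain ⟨C, hC0, hC⟩ := hK.decay
  obtain ⟨B, hB0, hB⟩ := M.exists_sum_decay_bound hτ (p := 3) (by norm_num)
  have hs : ∀ x, Summable (fun m => C * (1 + ‖x - M.w m‖) ^ (-3 : ℝ)) ∧
      ∑' m, C * (1 + ‖x - M.w m‖) ^ (-3 : ℝ) ≤ C * B := fun x => by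
    have h1 : ∀ m, (1 + ‖-x + M.w m‖) ^ (-3 : ℝ) = (1 + ‖x - M.w m‖) ^ (-3 : ℝ) := fun m => by
      rw [← norm_neg (-x + M.w m)]
      congr 3; ring
    have h2 := hB (-x)
    simp only [h1] at h2
    refine ⟨h2.1.mul_left C, ?_⟩
    rw [tsum_mul_left]
    exact mul_le_mul_of_nonneg_left h2.2 hC0
  refine ⟨C * B, by positivity, fun x => ?_⟩
  have h3 : Summable (fun m => ‖K (x - M.w m)‖) :=
    (hs x).1.of_nonneg_of_le (fun m => norm_nonneg _) fun m => hC _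
  exact ⟨h3, (h3.tsum_le_tsum (fun m => hC _) (hs x).1).trans (hs x).2⟩

lemma summable_perTerm (hτ : 0 < τ.im) {K : ℂ → ℂ} (hK : Nice K) :
    ∃ B : ℝ, 0 ≤ B ∧ ∀ x y, Summable (fun m => ‖M.perTerm K m x y‖) ∧
      ∑' m, ‖M.perTerm K m x y‖ ≤ B := by
  obtain ⟨B, hB0, hB⟩ := summable_shift hτ hK
  refine ⟨B, hB0, fun x y => ?_⟩
  simpa only [norm_perTerm, sub_add_eq_sub_sub] using hB (x - y)

lemma exists_bound_perK (hτ : 0 < τ.im) {K : ℂ → ℂ} (hK : Nice K) :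
    ∃ B : ℝ, 0 ≤ B ∧ ∀ x y, ‖M.perK K x y‖ ≤ B := by
  obtain ⟨B, hB0, hB⟩ := summable_perTerm hτ hK
  exact ⟨B, hB0, fun x y => (norm_tsum_le_tsum_norm (hB x y).1).trans (hB x y).2⟩

lemma measurable_perK (hτ : 0 < τ.im) {K : ℂ → ℂ} (hK : Nice K) :
    Measurable fun p : ℂ × ℂ => M.perK K p.1 p.2 := by
  obtain ⟨B, hB0, hB⟩ := summable_perTerm hτ hK
  exact measurable_tsum_of_summable (fun m => (M.continuous_perTerm hK.cont m).measurable)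
    fun p => (hB p.1 p.2).1.of_norm

/-- Unfolding of an integral over the cell against a periodized kernel. -/
lemma integral_perK_mul (hτ : 0 < τ.im) {K : ℂ → ℂ} (hK : Nice K) {f : ℂ → ℂ} (hf : M.Equi f)
    (hm : Measurable f) (hi : Integrable f M.vol) (x : ℂ) :
    Integrable (fun y => K (x - y) * ph M.b x y * f y) ∧
    M.conv K f x = ∫ y, M.perK K x y * f y ∂M.vol := by
  obtain ⟨B, hB0, hB⟩ := summable_perTerm hτ hK
  have hKm : Measurable fun y => K (x - y) * ph M.b x y := by
    have := hK.cont
    exact Continuous.measurable (by fun_prop)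
  have hterm : ∀ m y, K (x - (y + M.w m)) * ph M.b x (y + M.w m) * f (y + M.w m)
      = M.perTerm K m x y * f y := fun m y => by rw [hf m y, perTerm]; ring
  have hmt : ∀ m, Measurable fun y => M.perTerm K m x y * f y := fun m =>
    (((M.continuous_perTerm hK.cont m).comp (Continuous.prodMk_right x)).measurable).mul hm
  have hsum : ∑' m, ∫⁻ y, ‖M.perTerm K m x y * f y‖ₑ ∂M.vol ≤
      ENNReal.ofReal B * ∫⁻ y, ‖f y‖ₑ ∂M.vol := by
    rw [← lintegral_tsum (fun m => (hmt m).enorm.aemeasurable), ← lintegral_const_mul _ hm.enorm]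
    refine lintegral_mono fun y => ?_
    simp only [enorm_mul, ENNReal.tsum_mul_right]
    gcongr
    have h1 : ∀ m, ‖M.perTerm K m x y‖ₑ = ENNReal.ofReal ‖M.perTerm K m x y‖ :=
      fun m => (ofReal_norm _).symm
    simp only [h1]
    rw [← ENNReal.ofReal_tsum_of_nonneg (fun m => norm_nonneg _) (hB x y).1]
    exact ENNReal.ofReal_le_ofReal (hB x y).2
  have hlt : ∑' m, ∫⁻ y, ‖M.perTerm K m x y * f y‖ₑ ∂M.vol < ⊤ :=
    hsum.trans_lt (ENNReal.mul_lt_top ENNReal.ofReal_lt_top hi.2)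
  have hint : Integrable (fun y => K (x - y) * ph M.b x y * f y) := by
    refine ⟨(hKm.mul hm).aestronglyMeasurable, ?_⟩
    rw [HasFiniteIntegral, M.lintegral_unfold hτ]
    simpa only [hterm] using hlt
  refine ⟨hint, ?_⟩
  have h1 := (M.hasSum_integral_unfold hτ hint).tsum_eq
  simp only [hterm] at h1
  rw [conv, ← h1, ← integral_tsum (fun m => (hmt m).aestronglyMeasurable) hlt.ne]
  refine integral_ext fun y => ?_
  simp only [perK]
  rw [tsum_mul_right]

lemma ph_add_w (x y : ℂ) (m : ℤ × ℤ) :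
    ph M.b (x + M.w m) (y + M.w m) = M.e m x * ph M.b x y * conj (M.e m y) := by
  rw [ph, ph, e, e, ← exp_conj, ← exp_add, ← exp_add]
  congr 1
  simp only [chi_eq, wedge_add_left, wedge_add_right, wedge_self, map_mul, conj_I, conj_ofReal]
  rw [wedge_swap x (M.w m)]
  push_cast
  ring

lemma conv_equi (K : ℂ → ℂ) {f : ℂ → ℂ} (hf : M.Equi f) : M.Equi (M.conv K f) := fun m x => by
  rw [conv, ← integral_add_right_eq_self _ (M.w m), conv, ← integral_const_mul]
  refine integral_ext fun y => ?_
  rw [ph_add_w, hf m y, add_sub_add_right_eq_sub]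
  linear_combination (K (x - y) * M.e m x * ph M.b x y * f y) * M.conj_e_mul m y

lemma perK_equi_right (K : ℂ → ℂ) (x y : ℂ) (n : ℤ × ℤ) :
    M.perK K x (y + M.w n) = M.perK K x y * conj (M.e n y) := by
  rw [perK, perK, ← (Equiv.addRight n).tsum_eq (fun m => M.perTerm K m x y), ← tsum_mul_right]
  refine tsum_congr fun m => ?_
  simp only [Equiv.coe_addRight, perTerm]
  rw [e_cocycle, add_assoc y, ← w_add, add_comm n m]
  linear_combination -(K (x - (y + M.w (m + n))) * ph M.b x (y + M.w (m + n)) *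
    M.e m (y + M.w n)) * M.conj_e_mul n y

lemma conj_perK_equi (K : ℂ → ℂ) (x : ℂ) : M.Equi fun y => conj (M.perK K x y) := fun m y => by
  simp only
  rw [perK_equi_right]
  simp [mul_comm]

/-- Periodized kernels of hermitian kernels are hermitian. -/
lemma perK_swap {K : ℂ → ℂ} (hK : ∀ z, K (-z) = conj (K z)) (x y : ℂ) :
    M.perK K y x = conj (M.perK K x y) := by
  rw [perK, perK, conj_tsum, ← (Equiv.neg _).tsum_eq (fun m => M.perTerm K m y x)]
  refine tsum_congr fun m => ?_
  simp only [Equiv.neg_apply, perTerm, map_mul]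
  have h1 : y - (x + M.w (-m)) = -(x - (y + M.w m)) := by rw [w_neg]; ring
  have h3 := ph_add_w (M := M) (y + M.w m) x (-m)
  have h4 : y + M.w m + M.w (-m) = y := by rw [w_neg]; ring
  have h5 : M.e (-m) (y + M.w m) * M.e m y = 1 := by
    rw [← e_cocycle, neg_add_cancel, e_zero]
  have h6 : conj (M.e m y) = M.e (-m) (y + M.w m) := by
    linear_combination M.e (-m) (y + M.w m) * M.conj_e_mul m y - conj (M.e m y) * h5
  rw [h4] at h3
  rw [h1, hK, h3, h6, ph_swap M.b x (y + M.w m)]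
  linear_combination conj (K (x - (y + M.w m))) * M.e (-m) (y + M.w m) *
    conj (ph M.b x (y + M.w m)) * M.conj_e_mul (-m) x

lemma memLp_perK (hτ : 0 < τ.im) {K : ℂ → ℂ} (hK : Nice K) :
    MemLp (fun p : ℂ × ℂ => M.perK K p.1 p.2) 2 (M.vol.prod M.vol) := by
  obtain ⟨B, -, hB⟩ := exists_bound_perK hτ hK
  exact MemLp.of_bound (measurable_perK hτ hK).aestronglyMeasurable B
    (.of_forall fun p => hB _ _)

variable (M) in
open Classical in
/-- The periodized kernel as an element of `𝔥 ⊗ 𝔥^*`. -/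
def kerH (K : ℂ → ℂ) : M.HH :=
  if h : MemLp (fun p : ℂ × ℂ => M.perK K p.1 p.2) 2 (M.vol.prod M.vol) then h.toLp _ else 0

lemma coeFn_kerH (hτ : 0 < τ.im) {K : ℂ → ℂ} (hK : Nice K) :
    (M.kerH K : ℂ × ℂ → ℂ) =ᵐ[M.vol.prod M.vol] fun p => M.perK K p.1 p.2 := by
  rw [kerH, dif_pos (memLp_perK hτ hK)]
  exact MemLp.coeFn_toLp _

lemma measurable_e_prod : Measurable fun p : (ℤ × ℤ) × ℂ => M.e p.1 p.2 := by
  have := fun m => (M.continuous_e m).measurable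
  refine measurable_from_prod_countable_right (f := fun p : (ℤ × ℤ) × ℂ => M.e p.1 p.2) ?_
  intro m
  exact this m

lemma measurable_ext {u : ℂ → ℂ} (hu : Measurable u) : Measurable (fun x => M.ext u x) := by
  have h1 := (measurable_e_prod (M := M)).comp (M.measurable_idx.prodMk M.measurable_red)
  exact h1.mul (hu.comp M.measurable_red)

lemma ext_ae_eq (hτ : 0 < τ.im) (u : ℂ → ℂ) : M.ext u =ᵐ[M.vol] u := by
  filter_upwards [ae_restrict_mem (M.measurableSet_cell hτ)] with x hx
  exact M.ext_of_mem hτ u hx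

lemma measurable_extL (u : M.H) : Measurable (M.ext u) :=
  measurable_ext (Lp.stronglyMeasurable u).measurable

lemma integrable_L (u : M.H) : Integrable u M.vol := (Lp.memLp u).integrable (by norm_num)

lemma integrable_extL (hτ : 0 < τ.im) (u : M.H) : Integrable (M.ext u) M.vol :=
  (integrable_L u).congr (ext_ae_eq hτ u).symm

/-- The operator with a periodized kernel is a convolution. -/
lemma coeFn_kerOp_kerH (hτ : 0 < τ.im) {K : ℂ → ℂ} (hK : Nice K) (u : M.H) :
    (M.kerOp (M.kerH K) u : ℂ → ℂ) =ᵐ[M.vol] M.conv K (M.ext u) := by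
  have h1 := M.hasL2Kernel_kerOp (M.kerH K) u
  have h2 := Measure.ae_ae_of_ae_prod (coeFn_kerH (M := M) hτ hK)
  filter_upwards [h1, h2] with x hx h
  rw [hx, (integral_perK_mul hτ hK (M.ext_equi hτ u) (measurable_extL u) (integrable_extL hτ u) x).2]
  refine integral_congr_ae ?_
  filter_upwards [h, ext_ae_eq hτ u] with y e1 e2
  rw [e1, e2]

lemma inner_kerOp_swap (hτ : 0 < τ.im) {K : ℂ → ℂ} (hK : Nice K) (hs : ∀ z, K (-z) = conj (K z))
    (u w : M.H) : ⟪M.kerOp (M.kerH K) u, w⟫_ℂ = ⟪u, M.kerOp (M.kerH K) w⟫_ℂ := by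
  rw [inner_kerOp, ← inner_conj_symm, inner_kerOp, ← pair_eq_inner, ← pair_eq_inner, pair, pair,
    ← integral_conj, ← integral_prod_swap]
  refine integral_congr_ae ?_
  have h1 := coeFn_kerH (M := M) hτ hK
  have h2 := (Measure.measurePreserving_swap (μ := M.vol) (ν := M.vol)).quasiMeasurePreserving.ae_eq_comp h1
  have c1 := Measure.quasiMeasurePreserving_snd (μ := M.vol) (ν := M.vol) |>.ae_eq_comp
    (M.coeFn_conjH u)
  have c2 := Measure.quasiMeasurePreserving_snd (μ := M.vol) (ν := M.vol) |>.ae_eq_comp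
    (M.coeFn_conjH w)
  have c3 := Measure.quasiMeasurePreserving_fst (μ := M.vol) (ν := M.vol) |>.ae_eq_comp
    (M.coeFn_conjH u)
  filter_upwards [h1, h2, c1, c2, c3] with p e1 e2 e3 e4 e5
  simp only [Function.comp] at e2 e3 e4 e5
  simp only [map_mul, conj_conj, Prod.fst_swap, Prod.snd_swap] at e2 ⊢
  rw [e1, e2, e4, e5, perK_swap hs, conj_conj, conj_conj]
  ring

lemma integrable_shift_mul (hτ : 0 < τ.im) {K L : ℂ → ℂ} (hK : Nice K) (hL : Nice L) :
    (∀ m, Integrable fun u => ‖K (u - M.w m)‖ * ‖L u‖) ∧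
    Summable fun m => ∫ u, ‖K (u - M.w m)‖ * ‖L u‖ := by
  obtain ⟨B, hB0, hB⟩ := summable_shift hτ hK
  have hKc := hK.cont
  have hLc := hL.cont
  have hmeas : ∀ m, Continuous fun u => ‖K (u - M.w m)‖ * ‖L u‖ := fun m => by fun_prop
  have hsum : ∑' m, ∫⁻ u, ENNReal.ofReal (‖K (u - M.w m)‖ * ‖L u‖) ≤
      ENNReal.ofReal B * ∫⁻ u, ‖L u‖ₑ := by
    rw [← lintegral_tsum (fun m => (hmeas m).measurable.ennreal_ofReal.aemeasurable),
      ← lintegral_const_mul _ hLc.measurable.enorm]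
    refine lintegral_mono fun u => ?_
    rw [← ofReal_norm (L u), ← ENNReal.ofReal_mul hB0, ← ENNReal.ofReal_tsum_of_nonneg
      (fun m => by positivity) ((hB u).1.mul_right _), tsum_mul_right]
    exact ENNReal.ofReal_le_ofReal (mul_le_mul_of_nonneg_right (hB u).2 (norm_nonneg _))
  have hlt : ∑' m, ∫⁻ u, ENNReal.ofReal (‖K (u - M.w m)‖ * ‖L u‖) < ⊤ :=
    hsum.trans_lt (ENNReal.mul_lt_top ENNReal.ofReal_lt_top hL.integrable.2)
  have hi : ∀ m, Integrable fun u => ‖K (u - M.w m)‖ * ‖L u‖ := fun m => by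
    obtain ⟨C, -, hC⟩ := hK.exists_bound
    refine (hL.integrable.norm.const_mul C).mono' (hmeas m).aestronglyMeasurable
      (.of_forall fun u => ?_)
    rw [norm_of_nonneg (by positivity)]
    exact mul_le_mul_of_nonneg_right (hC _) (norm_nonneg _)
  refine ⟨hi, (ENNReal.summable_toReal hlt.ne).congr fun m => ?_⟩
  rw [integral_eq_lintegral_of_nonneg_ae (.of_forall fun u => by positivity)
    (hmeas m).aestronglyMeasurable]

lemma wedge_neg_left (x y : ℂ) : wedge (-x) y = -wedge x y := by simp [wedge]; ring

lemma phase_identity (m : ℤ × ℤ) (x u : ℂ) :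
    conj (M.perTerm (fun _ => 1) m x (x - u)) * ph M.b x (x - u) =
      exp (I * ((M.b * wedge (M.w (-m)) x : ℝ) : ℂ)) *
        exp (I * ((M.b / 2 * wedge (M.w m) u - M.c m : ℝ) : ℂ)) := by
  simp only [perTerm, ph, e, one_mul, map_mul]
  rw [← exp_conj, ← exp_conj, ← exp_add, ← exp_add, ← exp_add]
  congr 1
  simp only [chi_eq, wedge_add_right, wedge_sub_right, wedge_self, map_mul, map_neg, conj_I,
    conj_ofReal, w_neg, wedge_neg_left]
  rw [wedge_swap x (M.w m)]
  push_cast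
  ring

lemma measurable_perK_right (hτ : 0 < τ.im) {K : ℂ → ℂ} (hK : Nice K) (x : ℂ) :
    Measurable fun y => M.perK K x y :=
  Measurable.of_uncurry_left (f := fun x y => M.perK K x y) (measurable_perK hτ hK)

variable (M) in
/-- The summands of the trace formula, after the substitution `u = x - y`. -/
def traceTerm (K L : ℂ → ℂ) (m : ℤ × ℤ) (x u : ℂ) : ℂ :=
  exp (I * ((M.b * wedge (M.w (-m)) x : ℝ) : ℂ)) *
    (conj (K (u - M.w m)) * L u * exp (I * ((M.b / 2 * wedge (M.w m) u - M.c m : ℝ) : ℂ)))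

lemma continuous_traceTerm {K L : ℂ → ℂ} (hK : Continuous K) (hL : Continuous L) (m : ℤ × ℤ) :
    Continuous fun p : ℂ × ℂ => M.traceTerm K L m p.1 p.2 := by
  unfold traceTerm
  fun_prop

lemma norm_traceTerm (K L : ℂ → ℂ) (m : ℤ × ℤ) (x u : ℂ) :
    ‖M.traceTerm K L m x u‖ = ‖K (u - M.w m)‖ * ‖L u‖ := by
  simp only [traceTerm, norm_mul, mul_comm I, norm_exp_ofReal_mul_I, RCLike.norm_conj, one_mul,
    mul_one]

lemma integrable_traceTerm_prod (hτ : 0 < τ.im) {K L : ℂ → ℂ} (hK : Nice K) (hL : Nice L)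
    (m : ℤ × ℤ) : Integrable (fun p : ℂ × ℂ => M.traceTerm K L m p.1 p.2) (M.vol.prod volume) := by
  have h := (integrable_const (1 : ℝ) (μ := M.vol)).mul_prod ((integrable_shift_mul (M := M) hτ hK hL).1 m)
  refine h.mono' (continuous_traceTerm hK.cont hL.cont m).aestronglyMeasurable
    (.of_forall fun p => ?_)
  rw [norm_traceTerm, one_mul]

lemma integrable_traceTerm (hτ : 0 < τ.im) {K L : ℂ → ℂ} (hK : Nice K) (hL : Nice L)
    (m : ℤ × ℤ) (x : ℂ) : Integrable (fun u => M.traceTerm K L m x u) := by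
  refine ((integrable_shift_mul hτ hK hL).1 m).mono'
    ((continuous_traceTerm hK.cont hL.cont m).comp
      (Continuous.prodMk_right x)).aestronglyMeasurable
      (.of_forall fun u => (norm_traceTerm K L m x u).le)

lemma integral_conj_perK_mul_perK (hτ : 0 < τ.im) {K L : ℂ → ℂ} (hK : Nice K) (hL : Nice L)
    (x : ℂ) : ∫ y, conj (M.perK K x y) * M.perK L x y ∂M.vol
      = ∑' m, ∫ u, M.traceTerm K L m x u := by
  obtain ⟨BK, hBK0, hBK⟩ := exists_bound_perK hτ hK
  have hm : Measurable fun y => conj (M.perK K x y) :=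
    continuous_conj.measurable.comp (measurable_perK_right hτ hK x)
  have hint : Integrable (fun y => conj (M.perK K x y)) M.vol :=
    Integrable.of_bound hm.aestronglyMeasurable BK
      (.of_forall fun y => by simpa using hBK x y)
  have h2 := (integral_perK_mul hτ hL (conj_perK_equi K x) hm hint x).2
  simp only [mul_comm (conj _)]
  rw [← h2, conv, ← integral_sub_left_eq_self _ _ x]
  have h3 : ∀ u, L (x - (x - u)) * ph M.b x (x - u) * conj (M.perK K x (x - u))
      = ∑' m, M.traceTerm K L m x u := fun u => by
    rw [perK, conj_tsum, ← tsum_mul_left]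
    refine tsum_congr fun m => ?_
    have h4 := phase_identity (M := M) m x u
    have h5 : x - (x - u + M.w m) = u - M.w m := by ring
    simp only [perTerm, one_mul, traceTerm, map_mul] at h4 ⊢
    rw [h5, sub_sub_cancel]
    linear_combination conj (K (u - M.w m)) * L u * h4
  simp only [h3]
  refine ((hasSum_integral_of_summable_integral_norm
    (fun m => integrable_traceTerm hτ hK hL m x) ?_).tsum_eq).symm
  simpa only [norm_traceTerm] using (integrable_shift_mul (M := M) hτ hK hL).2

lemma inner_kerH_kerH_eq (hτ : 0 < τ.im) {K L : ℂ → ℂ} (hK : Nice K) (hL : Nice L) :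
    ⟪M.kerH K, M.kerH L⟫_ℂ = ∫ x, ∫ y, conj (M.perK K x y) * M.perK L x y ∂M.vol ∂M.vol := by
  have h3 := L2_integrable_conj_mul (M.kerH K) (M.kerH L)
  rw [L2_inner_eq, integral_prod _ h3]
  refine integral_congr_ae ?_
  filter_upwards [Measure.ae_ae_of_ae_prod (coeFn_kerH hτ hK),
    Measure.ae_ae_of_ae_prod (coeFn_kerH hτ hL)] with x e1 e2
  refine integral_congr_ae ?_
  filter_upwards [e1, e2] with y e3 e4
  rw [e3, e4]

lemma exp_c_zero : exp (I * ((-M.c 0 : ℝ) : ℂ)) = 1 := by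
  have h8 := M.e_zero 0
  rw [e, chi_eq] at h8
  have h9 : exp (-(I * ((M.c 0 : ℝ) : ℂ))) = 1 := by
    rw [exp_neg]
    simpa using h8
  simpa using h9

/-- Trace formula: terms with a nontrivial lattice translation average out. -/
lemma inner_kerH_kerH (hτ : 0 < τ.im) {K L : ℂ → ℂ} (hK : Nice K) (hL : Nice L) :
    ⟪M.kerH K, M.kerH L⟫_ℂ = (M.vol.real univ : ℂ) * ∫ u, conj (K u) * L u := by
  obtain ⟨hi, hs⟩ := integrable_shift_mul hτ hK hL
  have hGi := integrable_traceTerm_prod (M := M) hτ hK hL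
  rw [inner_kerH_kerH_eq hτ hK hL]
  simp only [integral_conj_perK_mul_perK hτ hK hL]
  have hnI : ∀ m x, ‖∫ u, M.traceTerm K L m x u‖ ≤ ∫ u, ‖K (u - M.w m)‖ * ‖L u‖ := fun m x => by
    simpa only [norm_traceTerm] using norm_integral_le_integral_norm (fun u => M.traceTerm K L m x u)
  have h5 := hasSum_integral_of_summable_integral_norm (μ := M.vol)
    (F := fun m x => ∫ u, M.traceTerm K L m x u) (fun m => (hGi m).integral_prod_left) (by
      refine (hs.mul_left (M.vol.real univ)).of_nonneg_of_le
        (fun m => integral_nonneg fun x => norm_nonneg _) fun m => ?_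
      calc ∫ x, ‖∫ u, M.traceTerm K L m x u‖ ∂M.vol
          ≤ ∫ _x, (∫ u, ‖K (u - M.w m)‖ * ‖L u‖) ∂M.vol :=
            integral_mono (hGi m).integral_prod_left.norm (integrable_const _) (hnI m)
        _ = _ := by rw [integral_const]; rfl)
  rw [← h5.tsum_eq, tsum_eq_single 0]
  · have h6 : ∀ x u, M.traceTerm K L 0 x u = conj (K u) * L u * exp (I * ((-M.c 0 : ℝ) : ℂ)) :=
      fun x u => by simp [traceTerm]
    simp only [h6, exp_c_zero, mul_one, integral_const]
    simp
  · intro m hm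
    have h10 := integral_integral_swap (f := fun x u => M.traceTerm K L m x u) (hGi m)
    rw [h10]
    simp only [traceTerm, integral_mul_const]
    rw [M.integral_character hτ (neg_ne_zero.2 hm)]
    simp

end MagLattice

/-! ## Smoothing operators and eigen-sections -/

/-- Concentrating kernels recover the value at a point of continuity. -/
lemma tendsto_concentrating {Φ : ℂ → ℂ} (hΦ : Integrable Φ) {g : ℂ → ℂ} (hg : Measurable g) {B : ℝ}
    (hB : ∀ y, ‖g y‖ ≤ B) {x : ℂ} (hx : ContinuousAt g x) :
    Tendsto (fun r : ℝ => ((r ^ 2 : ℝ) : ℂ) * ∫ y, Φ ((r : ℂ) * (x - y)) * g y)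
      atTop (𝓝 ((∫ z, Φ z) * g x)) := by
  have h1 : ∀ᶠ r : ℝ in atTop, ∫ z, Φ z * g (x - (r⁻¹ : ℝ) • z) =
      ((r ^ 2 : ℝ) : ℂ) * ∫ y, Φ ((r : ℂ) * (x - y)) * g y := by
    filter_upwards [eventually_gt_atTop 0] with r hr
    have h2 := Measure.integral_comp_smul volume (fun z => Φ z * g (x - (r⁻¹ : ℝ) • z)) r
    rw [← integral_sub_left_eq_self _ _ x] at h2
    rw [finrank_real_complex, abs_of_pos (by positivity)] at h2
    have h3 : ∀ y, Φ (r • (x - y)) * g (x - r⁻¹ • r • (x - y)) = Φ ((r : ℂ) * (x - y)) * g y := fun y => by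
      rw [smul_smul, inv_mul_cancel₀ hr.ne', one_smul, sub_sub_cancel, real_smul]
    simp only [h3] at h2
    rw [h2, real_smul, ← mul_assoc, ← ofReal_mul, mul_inv_cancel₀ (by positivity)]
    simp
  refine Tendsto.congr' h1 ?_
  rw [← integral_mul_const]
  refine tendsto_integral_filter_of_dominated_convergence (fun z => ‖Φ z‖ * B) ?_ ?_ ?_ ?_
  · refine Eventually.of_forall fun r => hΦ.1.mul ?_
    exact (hg.comp (by fun_prop)).aestronglyMeasurable
  · refine Eventually.of_forall fun r => Eventually.of_forall fun z => ?_
    rw [norm_mul]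
    exact mul_le_mul_of_nonneg_left (hB _) (norm_nonneg _)
  · exact hΦ.norm.mul_const B
  · refine Eventually.of_forall fun z => Tendsto.const_mul _ ?_
    have h4 : Tendsto (fun r : ℝ => x - r⁻¹ • z) atTop (𝓝 x) := by
      have := (tendsto_inv_atTop_zero (𝕜 := ℝ)).smul_const z
      simpa using this.const_sub x
    exact hx.tendsto.comp h4

/-- Smooth hermitian kernels whose covariant Laplacian is hermitian as well. -/
structure Rad (b : ℝ) (φ : ℂ → ℂ) : Prop where
  smooth : ContDiff ℝ ∞ φ
  herm : ∀ z, φ (-z) = conj (φ z)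
  herm' : ∀ z, negLap (aB b) φ (-z) = conj (negLap (aB b) φ z)

lemma rad_of_radial (b : ℝ) {u : ℝ → ℝ} (hu : ContDiff ℝ ∞ u) :
    Rad b (fun z => (u (normSq z) : ℂ)) := by
  have hd : ∀ s, HasDerivAt u (deriv u s) s := fun s =>
    (hu.differentiable (by simp)).differentiableAt.hasDerivAt
  have hu' : ContDiff ℝ ∞ (deriv u) := ((contDiff_infty_iff_deriv).1 hu).2
  have hd' : ∀ s, HasDerivAt (deriv u) (deriv (deriv u) s) s := fun s =>
    (hu'.differentiable (by simp)).differentiableAt.hasDerivAt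
  refine ⟨?_, fun z => by simp, fun z => ?_⟩
  · have h1 : ContDiff ℝ ∞ (fun z : ℂ => normSq z) := by
      have : (fun z : ℂ => normSq z) = fun z => reCLM z * reCLM z + imCLM z * imCLM z := by
        ext z; simp [normSq_apply]
      rw [this]
      fun_prop
    exact ofRealCLM.contDiff.comp (hu.comp h1)
  · rw [negLap_radial hd hd', negLap_radial hd hd', normSq_neg, conj_ofReal]

/-- A radial bump, supported in a disk of radius `1 / r`. -/
def bump (r : ℝ) (z : ℂ) : ℂ := (smoothTransition (1 - r ^ 2 * normSq z) : ℂ)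

lemma bump_rad (b r : ℝ) : Rad b (bump r) :=
  rad_of_radial b (u := fun s => smoothTransition (1 - r ^ 2 * s))
    (smoothTransition.contDiff.comp (by fun_prop))

lemma bump_compact {r : ℝ} (hr : 0 < r) : HasCompactSupport (bump r) := by
  refine HasCompactSupport.intro (isCompact_closedBall (0 : ℂ) r⁻¹) fun z hz => ?_
  rw [mem_closedBall_zero_iff, not_le] at hz
  have h1 : 1 ≤ r ^ 2 * normSq z := by
    rw [normSq_eq_norm_sq, ← mul_pow]
    have : 1 ≤ r * ‖z‖ := by
      rw [inv_lt_iff_one_lt_mul₀ hr] at hz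
      rw [mul_comm]; exact hz.le
    exact one_le_pow₀ this
  rw [bump, smoothTransition.zero_of_nonpos (by linarith), ofReal_zero]

lemma bump_nice {r : ℝ} (hr : 0 < r) : Nice (bump r) :=
  Nice.of_compact (bump_rad 1 r).smooth.continuous (bump_compact hr)

lemma bump_scale (r : ℝ) (z : ℂ) : bump r z = bump 1 ((r : ℂ) * z) := by
  simp [bump, normSq_mul, normSq_ofReal, pow_two, mul_assoc]

lemma integral_bump_ne_zero : ∫ z, bump 1 z ≠ 0 := by
  have h : ∫ z, bump 1 z = ((∫ z : ℂ, smoothTransition (1 - 1 ^ 2 * normSq z) : ℝ) : ℂ) :=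
    integral_complex_ofReal
  rw [h, ofReal_ne_zero]
  have hc : Continuous fun z : ℂ => smoothTransition (1 - 1 ^ 2 * normSq z) :=
    smoothTransition.continuous.comp (by fun_prop)
  have hi : Integrable fun z : ℂ => smoothTransition (1 - 1 ^ 2 * normSq z) := by
    have := (bump_nice one_pos).integrable.re
    simpa [bump] using this
  refine (hc.integral_pos_of_hasCompactSupport_nonneg_nonzero (x := 0) ?_
    (fun z => smoothTransition.nonneg _) (by simp)).ne'
  have := (bump_compact one_pos).comp_left (g := re) (by simp)
  exact this

namespace MagLattice

variable {M : MagLattice τ}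

lemma IsSection.continuous {f : ℂ → ℂ} (h : M.IsSection f) : Continuous f := h.1.continuous

variable (M) in
open Classical in
/-- The class of `f` in `𝔥`. -/
def toH (f : ℂ → ℂ) : M.H := if h : MemLp f 2 M.vol then h.toLp f else 0

lemma memLp_of_bound {f : ℂ → ℂ} (hm : Measurable f) {B : ℝ} (hB : ∀ x, ‖f x‖ ≤ B) :
    MemLp f 2 M.vol :=
  MemLp.of_bound hm.aestronglyMeasurable B (Eventually.of_forall hB)

lemma coeFn_toH_of_memLp {f : ℂ → ℂ} (h : MemLp f 2 M.vol) : (M.toH f : ℂ → ℂ) =ᵐ[M.vol] f := by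
  rw [toH, dif_pos h]
  exact h.coeFn_toLp

lemma Equi.memLp (hτ : 0 < τ.im) {f : ℂ → ℂ} (h : M.Equi f) (hc : Continuous f) :
    MemLp f 2 M.vol := by
  obtain ⟨B, -, hB⟩ := h.exists_bound hτ hc
  exact memLp_of_bound hc.measurable hB

lemma coeFn_toH (hτ : 0 < τ.im) {f : ℂ → ℂ} (h : M.IsSection f) :
    (M.toH f : ℂ → ℂ) =ᵐ[M.vol] f :=
  coeFn_toH_of_memLp (h.equi.memLp hτ h.continuous)

lemma toH_eq_of_ae (hτ : 0 < τ.im) {f : ℂ → ℂ} (h : M.IsSection f) {u : M.H}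
    (hu : (u : ℂ → ℂ) =ᵐ[M.vol] f) : M.toH f = u :=
  Lp.ext ((coeFn_toH hτ h).trans hu.symm)

lemma inner_toH (hτ : 0 < τ.im) {f : ℂ → ℂ} (h : M.IsSection f) (u : M.H) :
    ⟪M.toH f, u⟫_ℂ = ∫ x, conj (f x) * u x ∂M.vol := by
  rw [L2_inner_eq]
  refine integral_congr_ae ?_
  filter_upwards [coeFn_toH hτ h] with x hx
  rw [hx]

lemma inner_toH_toH (hτ : 0 < τ.im) {f g : ℂ → ℂ} (hf : M.IsSection f) (hg : M.IsSection g) :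
    ⟪M.toH f, M.toH g⟫_ℂ = ∫ x, conj (f x) * g x ∂M.vol := by
  rw [inner_toH hτ hf]
  refine integral_congr_ae ?_
  filter_upwards [coeFn_toH hτ hg] with x hx
  rw [hx]

lemma equi_ae_unfold (hτ : 0 < τ.im) {f g : ℂ → ℂ} (hf : M.Equi f) (hg : M.Equi g)
    (hfm : Measurable f) (hgm : Measurable g) (h : f =ᵐ[M.vol] g) : f =ᵐ[volume] g := by
  have hs : MeasurableSet {x | ¬ f x = g x} := (measurableSet_eq_fun hfm hgm).compl
  rw [EventuallyEq, ae_iff, ← lintegral_indicator_one hs, M.lintegral_unfold hτ]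
  refine ENNReal.tsum_eq_zero.2 fun m => ?_
  rw [← lintegral_zero (μ := M.vol)]
  refine lintegral_congr_ae ?_
  filter_upwards [h] with x hx
  rw [indicator_of_notMem]
  simp [hf m x, hg m x, hx]

lemma Equi.eq_of_ae (hτ : 0 < τ.im) {f g : ℂ → ℂ} (hf : M.Equi f) (hg : M.Equi g)
    (hfc : Continuous f) (hgc : Continuous g) (h : f =ᵐ[M.vol] g) : f = g :=
  (Continuous.ae_eq_iff_eq volume hfc hgc).1 (equi_ae_unfold hτ hf hg hfc.measurable hgc.measurable h)

lemma locallyIntegrable (hτ : 0 < τ.im) {f : ℂ → ℂ} (hf : M.Equi f) (hm : Measurable f)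
    (hi : Integrable f M.vol) : LocallyIntegrable f := by
  let K : ℂ → ℂ := fun z => (((1 + ‖z‖ ^ 2) ^ 2)⁻¹ : ℝ)
  have hK : Nice K := by
    refine ⟨?_, 4, by norm_num, fun z => ?_⟩
    · exact continuous_ofReal.comp (Continuous.inv₀ (by fun_prop) fun z => by positivity)
    · have h0 := norm_nonneg z
      have hr : (1 + ‖z‖) ^ (-3 : ℝ) = ((1 + ‖z‖) ^ 3)⁻¹ := by
        rw [Real.rpow_neg (by positivity)]
        norm_cast
      rw [hr]
      simp only [K]
      rw [norm_real, norm_of_nonneg (by positivity), ← div_eq_mul_inv, inv_eq_one_div,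
        div_le_div_iff₀ (by positivity) (by positivity)]
      have h1 : (1 + ‖z‖) ^ 2 ≤ 2 * (1 + ‖z‖ ^ 2) := by nlinarith [sq_nonneg (1 - ‖z‖)]
      have h2 : (1 + ‖z‖) ^ 3 ≤ (1 + ‖z‖) ^ 4 := pow_le_pow_right₀ (by linarith) (by norm_num)
      have h3 : (1 + ‖z‖) ^ 4 ≤ (2 * (1 + ‖z‖ ^ 2)) ^ 2 := by
        rw [show (1 + ‖z‖) ^ 4 = ((1 + ‖z‖) ^ 2) ^ 2 by ring]
        exact pow_le_pow_left₀ (by positivity) h1 2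
      nlinarith
  have h1 := ((integral_perK_mul hτ hK hf hm hi 0).1.locallyIntegrable.locallyIntegrableOn
    univ).continuousOn_mul (g := fun y => (((1 + ‖y‖ ^ 2) ^ 2 : ℝ) : ℂ)) (by fun_prop)
    isClosed_univ.isLocallyClosed
  rw [locallyIntegrableOn_univ] at h1
  convert! h1 using 2 with y
  have h2 : (((1 + ‖y‖ ^ 2) ^ 2 : ℝ) : ℂ) ≠ 0 := by
    rw [ofReal_ne_zero]; positivity
  simp only [K, zero_sub, norm_neg, ph, wedge_zero_left, mul_zero, ofReal_zero, neg_zero,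
    exp_zero, mul_one, ofReal_inv]
  field_simp

/-- Convolution with a smooth compactly supported kernel smoothes. -/
lemma contDiff_conv {φ : ℂ → ℂ} (hφ : ContDiff ℝ ∞ φ) (hc : HasCompactSupport φ)
    {f : ℂ → ℂ} (hf : LocallyIntegrable f) : ContDiff ℝ ∞ (M.conv φ f) := by
  have h := contDiffOn_convolution_right_with_param_comp (𝕜 := ℝ) (μ := volume) (n := (⊤ : ℕ∞))
    (P := ℂ) (G := ℂ) (ContinuousLinearMap.mul ℝ ℂ) (s := univ) (v := fun x => x)
    contDiffOn_id (f := f) (g := fun x z => φ z * ph M.b x (x - z)) (k := tsupport φ)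
    isOpen_univ hc (fun p x _ hx => by
      simp [image_eq_zero_of_notMem_tsupport hx]) hf (by
      refine ContDiff.contDiffOn ?_
      have h1 : ContDiff ℝ ∞ fun p : ℂ × ℂ => wedge p.1 (p.1 - p.2) := by
        simp only [wedge, sub_re, sub_im]
        have r1 : ContDiff ℝ ∞ fun p : ℂ × ℂ => p.1.re := reCLM.contDiff.comp contDiff_fst
        have r2 : ContDiff ℝ ∞ fun p : ℂ × ℂ => p.1.im := imCLM.contDiff.comp contDiff_fst
        have r3 : ContDiff ℝ ∞ fun p : ℂ × ℂ => p.2.re := reCLM.contDiff.comp contDiff_snd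
        have r4 : ContDiff ℝ ∞ fun p : ℂ × ℂ => p.2.im := imCLM.contDiff.comp contDiff_snd
        exact (r1.mul (r2.sub r4)).sub (r2.mul (r1.sub r3))
      have h2 : ContDiff ℝ ∞ fun p : ℂ × ℂ => ph M.b p.1 (p.1 - p.2) := by
        have h3 : ContDiff ℝ ∞ fun p : ℂ × ℂ => ((M.b / 2 * wedge p.1 (p.1 - p.2) : ℝ) : ℂ) :=
          ofRealCLM.contDiff.comp (contDiff_const.mul h1)
        exact ((contDiff_const.mul h3).neg).cexp
      exact (hφ.comp contDiff_snd).mul h2)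
  rw [contDiffOn_univ] at h
  convert! h using 2 with x
  simp only [conv, convolution, ContinuousLinearMap.mul_apply', sub_sub_cancel]
  refine integral_ext fun y => ?_
  ring

lemma isSection_conv (hτ : 0 < τ.im) {φ : ℂ → ℂ} (hφ : ContDiff ℝ ∞ φ) (hc : HasCompactSupport φ)
    {f : ℂ → ℂ} (hf : M.Equi f) (hm : Measurable f) (hi : Integrable f M.vol) :
    M.IsSection (M.conv φ f) :=
  ⟨contDiff_conv hφ hc (locallyIntegrable hτ hf hm hi), conv_equi φ hf⟩

lemma isSection_conv_ext (hτ : 0 < τ.im) {φ : ℂ → ℂ} (hφ : ContDiff ℝ ∞ φ)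
    (hc : HasCompactSupport φ) (u : M.H) : M.IsSection (M.conv φ (M.ext u)) :=
  isSection_conv hτ hφ hc (M.ext_equi hτ u) (measurable_extL u) (integrable_extL hτ u)

lemma toH_conv_ext (hτ : 0 < τ.im) {φ : ℂ → ℂ} (hφ : ContDiff ℝ ∞ φ)
    (hc : HasCompactSupport φ) (u : M.H) :
    M.toH (M.conv φ (M.ext u)) = M.kerOp (M.kerH φ) u :=
  toH_eq_of_ae hτ (isSection_conv_ext hτ hφ hc u)
    (coeFn_kerOp_kerH hτ (Nice.of_compact hφ.continuous hc) u)

lemma conv_congr {φ f g : ℂ → ℂ} (h : f =ᵐ[volume] g) : M.conv φ f = M.conv φ g := by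
  funext x
  refine integral_congr_ae ?_
  filter_upwards [h] with y hy
  rw [hy]

lemma ext_toH_ae (hτ : 0 < τ.im) {f : ℂ → ℂ} (h : M.IsSection f) : M.ext (M.toH f) =ᵐ[volume] f :=
  equi_ae_unfold hτ (M.ext_equi hτ _) h.equi (measurable_extL _) h.continuous.measurable
    ((ext_ae_eq hτ _).trans (coeFn_toH hτ h))

/-- Action of a convolution on a section. -/
lemma kerOp_toH (hτ : 0 < τ.im) {K : ℂ → ℂ} (hK : Nice K) {f : ℂ → ℂ} (h : M.IsSection f) :
    (M.kerOp (M.kerH K) (M.toH f) : ℂ → ℂ) =ᵐ[M.vol] M.conv K f := by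
  rw [← conv_congr (ext_toH_ae hτ h)]
  exact coeFn_kerOp_kerH hτ hK _

/-- If the integration by parts is justified, then the covariant Laplacian passes through a
convolution with a radial kernel. -/
lemma conv_negLap_of {φ : ℂ → ℂ} (hφ : Rad M.b φ) {f : ℂ → ℂ} {x : ℂ}
    (h : ∫ y, conj (negLap (aB M.b) (fun y => φ (y - x) * ph M.b y x) y) * f y
      = ∫ y, conj (φ (y - x) * ph M.b y x) * negLap (aB M.b) f y) :
    M.conv φ (negLap (aB M.b) f) x = M.conv (negLap (aB M.b) φ) f x := by
  have h1 : ∀ y, conj (φ (y - x) * ph M.b y x) = φ (x - y) * ph M.b x y := fun y => by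
    rw [← neg_sub x y, hφ.herm, ph_swap M.b x y]
    simp
  have h2 : ∀ y, conj (negLap (aB M.b) (fun y => φ (y - x) * ph M.b y x) y)
      = negLap (aB M.b) φ (x - y) * ph M.b x y := fun y => by
    rw [negLap_kernel hφ.smooth, ← neg_sub x y, hφ.herm', ph_swap M.b x y]
    simp
  simp only [h1, h2] at h
  exact h.symm

lemma conv_negLap {φ : ℂ → ℂ} (hφ : Rad M.b φ) (hc : HasCompactSupport φ) {f : ℂ → ℂ}
    (hf : ContDiff ℝ ∞ f) (x : ℂ) :
    M.conv φ (negLap (aB M.b) f) x = M.conv (negLap (aB M.b) φ) f x := by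
  refine conv_negLap_of hφ (integral_negLap_of_compact ?_ hf ?_)
  · have h1 : (fun y => φ (y - x) * ph M.b y x) = mtr M.b x 0 φ := funext fun y => ph_mul_mtr _ _ _ _
    rw [h1]
    exact contDiff_mtr _ _ _ hφ.smooth
  · have h1 := hc.comp_homeomorph (Homeomorph.subRight x)
    exact h1.mul_right

end MagLattice

lemma norm_concentrating_le {Φ : ℂ → ℂ} (hΦ : Integrable Φ) {g : ℂ → ℂ} {B : ℝ}
    (hB : ∀ y, ‖g y‖ ≤ B) (x : ℂ) {r : ℝ} (hr : 0 < r) :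
    ‖((r ^ 2 : ℝ) : ℂ) * ∫ y, Φ ((r : ℂ) * (x - y)) * g y‖ ≤ (∫ z, ‖Φ z‖) * B := by
  have h2 := Measure.integral_comp_smul volume (fun z => ‖Φ z‖) r
  rw [← integral_sub_left_eq_self _ _ x, finrank_real_complex, abs_of_pos (by positivity)] at h2
  have hi : Integrable fun y => ‖Φ ((r : ℂ) * (x - y))‖ := by
    have h := ((hΦ.norm.comp_smul hr.ne').comp_sub_left x)
    simpa using h
  have h3 : ‖∫ y, Φ ((r : ℂ) * (x - y)) * g y‖ ≤ ∫ y, ‖Φ ((r : ℂ) * (x - y))‖ * B := by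
    refine norm_integral_le_of_norm_le (hi.mul_const B) (.of_forall fun y => ?_)
    rw [norm_mul]
    exact mul_le_mul_of_nonneg_left (hB y) (norm_nonneg _)
  rw [integral_mul_const] at h3
  simp only [real_smul] at h2
  rw [h2] at h3
  rw [norm_mul, norm_real, norm_of_nonneg (by positivity)]
  calc r ^ 2 * ‖∫ y, Φ ((r : ℂ) * (x - y)) * g y‖
      ≤ r ^ 2 * (((r ^ 2)⁻¹ • ∫ z, ‖Φ z‖) * B) := by gcongr
    _ = (∫ z, ‖Φ z‖) * B := by rw [smul_eq_mul]; field_simp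

lemma hasCompactSupport_negLap {b : ℝ} {φ : ℂ → ℂ} (h : HasCompactSupport φ) :
    HasCompactSupport (negLap (aB b) φ) :=
  HasCompactSupport.intro h fun x hx => by
    by_contra h2
    exact hx (support_negLap_subset h2)

namespace MagLattice

variable {M : MagLattice τ}

lemma kerOp_isSymmetric (hτ : 0 < τ.im) {K : ℂ → ℂ} (hK : Nice K)
    (hs : ∀ z, K (-z) = conj (K z)) : (M.kerOp (M.kerH K) : M.H →ₗ[ℂ] M.H).IsSymmetric :=
  fun u w => inner_kerOp_swap hτ hK hs u w

lemma convex_cell (hτ : 0 < τ.im) : Convex ℝ M.cell := fun x hx y hy a b ha hb hab => by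
  rw [M.mem_cell_iff hτ] at hx hy ⊢
  have h1 : M.tc (a • x + b • y) = a * M.tc x + b * M.tc y := by
    simp only [tc, real_smul, add_im, mul_im, ofReal_re, ofReal_im]
    ring
  have h2 : M.sc (a • x + b • y) = a * M.sc x + b * M.sc y := by
    rw [sc, h1]
    simp only [sc, real_smul, add_re, mul_re, ofReal_re, ofReal_im]
    ring
  rw [h1, h2]
  exact ⟨convex_Ico 0 1 hx.1 hy.1 ha hb hab, convex_Ico 0 1 hx.2 hy.2 ha hb hab⟩

/-- The smoothing operators separate the points of `𝔥`. -/
lemma eq_zero_of_bump (hτ : 0 < τ.im) {u : M.H}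
    (h : ∀ r : ℝ, 0 < r → M.kerOp (M.kerH (bump r)) u = 0) : u = 0 := by
  have key : ∀ g : BoundedContinuousFunction ℂ ℂ, ⟪M.toH g, u⟫_ℂ = 0 := fun g => by
    have hgm := g.continuous.measurable
    have hg := coeFn_toH_of_memLp (M := M) (memLp_of_bound hgm g.norm_coe_le_norm)
    have hG : M.ext (M.toH g) =ᵐ[volume] M.ext g := by
      refine equi_ae_unfold hτ (M.ext_equi hτ _) (M.ext_equi hτ _) (measurable_extL _)
        (measurable_ext hgm) ?_
      exact (ext_ae_eq hτ _).trans (hg.trans (ext_ae_eq hτ _).symm)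
    have hGb : ∀ y, ‖M.ext g y‖ ≤ ‖g‖ := fun y => by
      rw [ext, norm_mul, norm_e, one_mul]
      exact g.norm_coe_le_norm _
    have hb := (bump_nice one_pos).integrable
    set c := ∫ z, bump 1 z
    have hconv : ∀ r x, ((r ^ 2 : ℝ) : ℂ) * M.conv (bump r) (M.ext g) x =
        ((r ^ 2 : ℝ) : ℂ) * ∫ y, bump 1 ((r : ℂ) * (x - y)) * (ph M.b x y * M.ext g y) := by
      intro r x
      simp only [conv, bump_scale r, mul_assoc]
    have hGpb : ∀ x y, ‖ph M.b x y * M.ext g y‖ ≤ ‖g‖ := fun x y => by simpa using hGb y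
    have hGpm : ∀ x, Measurable fun y => ph M.b x y * M.ext g y := fun x =>
      (Continuous.measurable (by fun_prop)).mul (measurable_ext hgm)
    have hlim : ∀ᵐ x ∂M.vol, Tendsto (fun r : ℝ => conj (((r ^ 2 : ℝ) : ℂ) *
        M.conv (bump r) (M.ext g) x) * u x) atTop (𝓝 (conj (c * g x) * u x)) := by
      have hfr := (convex_cell (M := M) hτ).addHaar_frontier volume
      have hfr' : ∀ᵐ x ∂M.vol, x ∉ frontier M.cell :=
        ae_restrict_of_ae (measure_eq_zero_iff_ae_notMem.1 hfr)
      filter_upwards [hfr', ae_restrict_mem (M.measurableSet_cell hτ)] with x hx1 hx2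
      have hxi : x ∈ interior M.cell := by
        by_contra h0
        exact hx1 ⟨subset_closure hx2, h0⟩
      have hev : (fun y => ph M.b x y * M.ext g y) =ᶠ[𝓝 x] fun y => ph M.b x y * g y := by
        filter_upwards [mem_interior_iff_mem_nhds.1 hxi] with y hy
        rw [M.ext_of_mem hτ _ hy]
      have hca : ContinuousAt (fun y => ph M.b x y * M.ext g y) x := by
        refine ContinuousAt.congr ?_ hev.symm
        have := g.continuous
        exact Continuous.continuousAt (by fun_prop)
      have h3 := tendsto_concentrating hb (hGpm x) (hGpb x) hca
      simp only [← hconv] at h3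
      have h4 : ph M.b x x * M.ext g x = g x := by
        rw [M.ext_of_mem hτ _ hx2]; simp [ph, wedge_self]
      rw [h4] at h3
      exact ((continuous_conj.tendsto _).comp h3).mul_const _
    have hzero : ∀ᶠ r : ℝ in atTop, ∫ x, conj (((r ^ 2 : ℝ) : ℂ) *
        M.conv (bump r) (M.ext g) x) * u x ∂M.vol = 0 := by
      filter_upwards [eventually_gt_atTop 0] with r hr
      have h5 := inner_kerOp_swap hτ (bump_nice hr) (bump_rad M.b r).herm (M.toH g) u
      rw [h r hr, inner_zero_right, L2_inner_eq] at h5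
      have h6 : ∫ x, conj (((r ^ 2 : ℝ) : ℂ) * M.conv (bump r) (M.ext g) x) * u x ∂M.vol
          = ((r ^ 2 : ℝ) : ℂ) * ∫ x, conj (M.kerOp (M.kerH (bump r)) (M.toH g) x) * u x ∂M.vol := by
        rw [← integral_const_mul]
        refine integral_congr_ae ?_
        filter_upwards [coeFn_kerOp_kerH hτ (bump_nice hr) (M.toH g)] with x hx
        rw [hx, conv_congr hG, map_mul, conj_ofReal, mul_assoc]
      rw [h6, h5, mul_zero]
    have hT : Tendsto (fun r : ℝ => ∫ x, conj (((r ^ 2 : ℝ) : ℂ) *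
        M.conv (bump r) (M.ext g) x) * u x ∂M.vol) atTop
        (𝓝 (∫ x, conj (c * g x) * u x ∂M.vol)) := by
      refine tendsto_integral_filter_of_dominated_convergence
        (fun x => (∫ z, ‖bump 1 z‖) * ‖g‖ * ‖u x‖) ?_ ?_ ?_ hlim
      · filter_upwards [eventually_gt_atTop 0] with r hr
        have hcn := (contDiff_conv (M := M) (bump_rad M.b r).smooth (bump_compact hr)
          (locallyIntegrable hτ (M.ext_equi hτ g) (measurable_ext hgm)
            ((memLp_of_bound (measurable_ext hgm) hGb).integrable (by norm_num)))).continuous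
        exact (Continuous.aestronglyMeasurable (by fun_prop)).mul (Lp.aestronglyMeasurable u)
      · filter_upwards [eventually_gt_atTop 0] with r hr
        refine Eventually.of_forall fun x => ?_
        rw [norm_mul, RCLike.norm_conj, hconv]
        exact mul_le_mul_of_nonneg_right (norm_concentrating_le hb (hGpb x) x hr) (norm_nonneg _)
      · exact (integrable_L u).norm.const_mul _
    have h7 : ∫ x, conj (c * g x) * u x ∂M.vol = 0 :=
      tendsto_nhds_unique hT (tendsto_const_nhds.congr' (hzero.mono fun r hr => hr.symm))
    have h8 : ∫ x, conj (c * g x) * u x ∂M.vol = conj c * ⟪M.toH g, u⟫_ℂ := by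
      rw [L2_inner_eq, ← integral_const_mul]
      refine integral_congr_ae ?_
      filter_upwards [hg] with x hx
      rw [hx, map_mul, mul_assoc]
    rw [h8] at h7
    exact (mul_eq_zero.1 h7).resolve_left ((map_ne_zero _).2 integral_bump_ne_zero)
  have hd := Lp.boundedContinuousFunction_dense ℂ M.vol (p := 2) (by norm_num)
  have hcl : IsClosed {w : M.H | ⟪w, u⟫_ℂ = 0} := isClosed_eq (by fun_prop) (by fun_prop)
  have hsub : (Lp.boundedContinuousFunction ℂ 2 M.vol : Set M.H) ⊆ {w : M.H | ⟪w, u⟫_ℂ = 0} := by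
    intro w hw
    obtain ⟨g, hg⟩ := Lp.mem_boundedContinuousFunction_iff.1 hw
    have hgm := g.continuous.measurable
    have h9 : M.toH g = w := by
      refine Lp.ext ((coeFn_toH_of_memLp (memLp_of_bound hgm g.norm_coe_le_norm)).trans ?_)
      rw [← hg]
      exact (ContinuousMap.coeFn_toAEEqFun M.vol g.toContinuousMap).symm
    rw [mem_ofPred_eq, ← h9]
    exact key g
  have h10 : u ∈ {w : M.H | ⟪w, u⟫_ℂ = 0} :=
    closure_minimal hsub hcl (hd u)
  exact inner_self_eq_zero.1 h10

/-- The smooth sections are dense in `𝔥`. -/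
lemma eq_zero_of_section (hτ : 0 < τ.im) {u : M.H}
    (h : ∀ f, M.IsSection f → ⟪M.toH f, u⟫_ℂ = 0) : u = 0 := by
  refine eq_zero_of_bump hτ fun r hr => ?_
  refine ext_inner_left ℂ fun w => ?_
  have hr' := bump_rad M.b r
  rw [inner_zero_right, ← inner_kerOp_swap hτ (bump_nice hr) hr'.herm,
    ← toH_conv_ext hτ hr'.smooth (bump_compact hr)]
  exact h _ (isSection_conv_ext hτ hr'.smooth (bump_compact hr) w)

lemma eq_of_section (hτ : 0 < τ.im) {u w : M.H}
    (h : ∀ f, M.IsSection f → ⟪M.toH f, u⟫_ℂ = ⟪M.toH f, w⟫_ℂ) : u = w := by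
  rw [← sub_eq_zero]
  refine eq_zero_of_section hτ fun f hf => ?_
  rw [inner_sub_right, h f hf, sub_self]

lemma inner_negLap (hτ : 0 < τ.im) {f g : ℂ → ℂ} (hf : M.IsSection f) (hg : M.IsSection g) :
    ⟪M.toH (negLap (aB M.b) f), M.toH g⟫_ℂ = ⟪M.toH f, M.toH (negLap (aB M.b) g)⟫_ℂ := by
  rw [inner_toH_toH hτ hf.negLap hg, inner_toH_toH hτ hf hg.negLap, integral_negLap_cell hτ hf hg]

/-- The covariant Laplacian of a smoothed function. -/
lemma toH_negLap_conv (hτ : 0 < τ.im) {φ : ℂ → ℂ} (hφ : Rad M.b φ) (hc : HasCompactSupport φ)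
    (u : M.H) : M.toH (negLap (aB M.b) (M.conv φ (M.ext u)))
      = M.kerOp (M.kerH (negLap (aB M.b) φ)) u := by
  have hn := Nice.of_compact hφ.smooth.continuous hc
  have hn' := Nice.of_compact (contDiff_negLap hφ.smooth).continuous
    (hasCompactSupport_negLap (b := M.b) hc)
  have hsec := isSection_conv_ext hτ hφ.smooth hc u
  refine eq_of_section hτ fun f hf => ?_
  rw [← inner_negLap hτ hf hsec, toH_conv_ext hτ hφ.smooth hc, ← inner_kerOp_swap hτ hn hφ.herm,
    ← inner_kerOp_swap hτ hn' hφ.herm', L2_inner_eq, L2_inner_eq]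
  refine integral_congr_ae ?_
  filter_upwards [kerOp_toH hτ hn hf.negLap, kerOp_toH hτ hn' hf] with x h1 h2
  rw [h1, h2, conv_negLap hφ hc hf.1]

lemma kerOp_toH_negLap (hτ : 0 < τ.im) {φ : ℂ → ℂ} (hφ : Rad M.b φ) (hc : HasCompactSupport φ)
    {f : ℂ → ℂ} (hf : M.IsSection f) : M.kerOp (M.kerH φ) (M.toH (negLap (aB M.b) f))
      = M.kerOp (M.kerH (negLap (aB M.b) φ)) (M.toH f) := by
  have hn := Nice.of_compact hφ.smooth.continuous hc
  have hn' := Nice.of_compact (contDiff_negLap hφ.smooth).continuous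
    (hasCompactSupport_negLap (b := M.b) hc)
  refine Lp.ext ?_
  filter_upwards [kerOp_toH hτ hn hf.negLap, kerOp_toH hτ hn' hf] with x h1 h2
  rw [h1, h2, conv_negLap hφ hc hf.1]

variable (M) in
/-- Smooth eigen-sections of the covariant Laplacian. -/
def IsEig (f : ℂ → ℂ) (l : ℝ) : Prop :=
  M.IsSection f ∧ ∀ x, negLap (aB M.b) f x = (l : ℂ) * f x

lemma negLap_const_mul {b : ℝ} (z : ℂ) {f : ℂ → ℂ} (hf : ContDiff ℝ ∞ f) (x : ℂ) :
    negLap (aB b) (fun x => z * f x) x = z * negLap (aB b) f x := by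
  have h1 : ∀ v, ∀ g : ℂ → ℂ, ContDiff ℝ ∞ g →
      covd b v (fun x => z * g x) = fun x => z * covd b v g x := fun v g hg => by
    funext x
    simp only [covd]
    rw [fderiv_const_mul (hg.differentiable (by simp)).differentiableAt]
    simp
    ring
  rw [negLap_aB, negLap_aB, h1 1 f hf, h1 I f hf, h1 1 _ (contDiff_covd hf),
    h1 I _ (contDiff_covd hf)]
  ring

lemma IsSection.const_mul {f : ℂ → ℂ} (hf : M.IsSection f) (z : ℂ) :
    M.IsSection fun x => z * f x :=
  ⟨contDiff_const.mul hf.1, fun m x => by simp only [hf.2 m x]; ring⟩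

lemma toH_const_mul (hτ : 0 < τ.im) {f : ℂ → ℂ} (hf : M.IsSection f) (z : ℂ) :
    M.toH (fun x => z * f x) = z • M.toH f := by
  refine toH_eq_of_ae hτ (hf.const_mul z) ?_
  filter_upwards [Lp.coeFn_smul z (M.toH f), coeFn_toH hτ hf] with x h1 h2
  rw [h1, Pi.smul_apply, h2, smul_eq_mul]

/-- The eigenvectors of smoothing operators are spanned by eigen-sections. -/
lemma inner_eq_zero_of_eigenspace (hτ : 0 < τ.im) {φ : ℂ → ℂ} (hφ : Rad M.b φ)
    (hc : HasCompactSupport φ) {u : M.H}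
    (hu : ∀ f l, M.IsEig f l → ⟪M.toH f, u⟫_ℂ = 0) {z : ℂ} (hz : z ≠ 0) {w : M.H}
    (hw : M.kerOp (M.kerH φ) w = z • w) : ⟪w, u⟫_ℂ = 0 := by
  have hn := Nice.of_compact hφ.smooth.continuous hc
  have hn' := Nice.of_compact (contDiff_negLap hφ.smooth).continuous
    (hasCompactSupport_negLap (b := M.b) hc)
  set Z := M.kerOp (M.kerH φ) with hZ
  have hsym := kerOp_isSymmetric (M := M) hτ hn hφ.herm
  have hfd := ContinuousLinearMap.finite_dimensional_eigenspace (T := Z)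
    (M.isCompactOperator_kerOp _) z hz
  set W := Module.End.eigenspace (Z : M.H →ₗ[ℂ] M.H) z with hW
  have hmem : ∀ {w}, w ∈ W ↔ Z w = z • w := fun {w} => Module.End.mem_eigenspace_iff
  by_cases hw0 : w = 0
  · rw [hw0, inner_zero_left]
  have hzr : conj z = z := hsym.conj_eigenvalue_eq_self
    (Module.End.hasEigenvalue_of_hasEigenvector ⟨hmem.2 hw, hw0⟩)
  let s : M.H → ℂ → ℂ := fun w x => z⁻¹ * M.conv φ (M.ext w) x
  have hs : ∀ w, M.IsSection (s w) := fun w =>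
    (isSection_conv_ext hτ hφ.smooth hc w).const_mul _
  have hsw : ∀ w, w ∈ W → M.toH (s w) = w := fun w hw => by
    rw [toH_const_mul hτ (isSection_conv_ext hτ hφ.smooth hc w),
      toH_conv_ext hτ hφ.smooth hc, ← hZ, hmem.1 hw, smul_smul, inv_mul_cancel₀ hz, one_smul]
  let D : M.H →L[ℂ] M.H := z⁻¹ • M.kerOp (M.kerH (negLap (aB M.b) φ))
  have hDa : ∀ w, D w = z⁻¹ • M.kerOp (M.kerH (negLap (aB M.b) φ)) w := fun w => rfl
  have hD : ∀ w, M.toH (negLap (aB M.b) (s w)) = D w := fun w => by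
    have h1 : negLap (aB M.b) (s w) = fun x => z⁻¹ * negLap (aB M.b) (M.conv φ (M.ext w)) x :=
      funext fun x => negLap_const_mul _ (isSection_conv_ext hτ hφ.smooth hc w).1 x
    rw [h1, toH_const_mul hτ (isSection_conv_ext hτ hφ.smooth hc w).negLap,
      toH_negLap_conv hτ hφ hc]
    rfl
  have hDW : ∀ w ∈ W, D w ∈ W := fun w hw => by
    rw [hmem, ← hD, kerOp_toH_negLap hτ hφ hc (hs w), hsw w hw, hD]
    rw [hDa, smul_smul, mul_inv_cancel₀ hz, one_smul]
  have hDs : (D : M.H →ₗ[ℂ] M.H).IsSymmetric := fun u w => by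
    change ⟪D u, w⟫_ℂ = ⟪u, D w⟫_ℂ
    rw [hDa, hDa, inner_smul_left, inner_smul_right, map_inv₀, hzr, inner_kerOp_swap hτ hn' hφ.herm']
  let DW : W →ₗ[ℂ] W := (D : M.H →ₗ[ℂ] M.H).restrict hDW
  have hDWs : DW.IsSymmetric := fun u w => hDs u w
  let B := hDWs.eigenvectorBasis rfl
  have hB : ∀ i, ⟪((B i : W) : M.H), u⟫_ℂ = 0 := fun i => by
    have h1 := hDWs.apply_eigenvectorBasis rfl i
    have h2 : D (B i : W) = ((hDWs.eigenvalues rfl i : ℝ) : ℂ) • ((B i : W) : M.H) :=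
      congrArg Subtype.val h1
    have h3 := hu (s (B i : W)) (hDWs.eigenvalues rfl i) ⟨hs _, fun x => by
      have h4 : negLap (aB M.b) (s (B i : W)) =
          fun x => ((hDWs.eigenvalues rfl i : ℝ) : ℂ) * s (B i : W) x := by
        refine Equi.eq_of_ae hτ (hs _).negLap.equi ((hs _).const_mul _).equi
          (hs _).negLap.continuous ((hs _).const_mul _).continuous ?_
        have h5 : M.toH (negLap (aB M.b) (s (B i : W))) =
            M.toH (fun x => ((hDWs.eigenvalues rfl i : ℝ) : ℂ) * s (B i : W) x) := by
          rw [hD, h2, toH_const_mul hτ (hs _), hsw _ (B i).2]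
        exact (coeFn_toH hτ (hs _).negLap).symm.trans
          (h5 ▸ coeFn_toH hτ ((hs _).const_mul _))
      rw [h4]⟩
    rwa [hsw _ (B i).2] at h3
  have h6 := B.sum_repr ⟨w, hmem.2 hw⟩
  have h7 : w = ∑ i, B.repr ⟨w, hmem.2 hw⟩ i • ((B i : W) : M.H) := by
    have := congrArg Subtype.val h6
    simpa using this.symm
  rw [h7, sum_inner]
  refine sum_eq_zero fun i _ => ?_
  rw [inner_smul_left, hB, mul_zero]

/-- The eigen-sections are total. -/
lemma eq_zero_of_isEig (hτ : 0 < τ.im) {u : M.H}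
    (hu : ∀ f l, M.IsEig f l → ⟪M.toH f, u⟫_ℂ = 0) : u = 0 := by
  refine eq_zero_of_bump hτ fun r hr => ?_
  have hr' := bump_rad M.b r
  have hsym := kerOp_isSymmetric (M := M) hτ (bump_nice hr) hr'.herm
  have h1 := ContinuousLinearMap.orthogonalComplement_iSup_eigenspaces_eq_bot
    (T := M.kerOp (M.kerH (bump r))) (M.isCompactOperator_kerOp _) hsym
  rw [← Submodule.mem_bot ℂ, ← h1, ← Submodule.iInf_orthogonal, Submodule.mem_iInf]
  intro z
  rw [Submodule.mem_orthogonal]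
  intro w hw
  have hw' : M.kerOp (M.kerH (bump r)) w = z • w := Module.End.mem_eigenspace_iff.1 hw
  rw [← inner_kerOp_swap hτ (bump_nice hr) hr'.herm, hw', inner_smul_left]
  rcases eq_or_ne z 0 with rfl | hz
  · simp
  · rw [inner_eq_zero_of_eigenspace hτ hr' (bump_compact hr) hu hz hw', mul_zero]

end MagLattice

/-! ## The heat kernel -/

/-- The Gaussian `e^{-A |z|²}`. -/
def gau (A : ℝ) (z : ℂ) : ℂ := (rexp (-A * normSq z) : ℂ)

lemma gau_rad (b A : ℝ) : Rad b (gau A) :=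
  rad_of_radial b (u := fun s => rexp (-A * s)) (Real.contDiff_exp.comp (by fun_prop))

lemma continuous_gau (A : ℝ) : Continuous (gau A) := (gau_rad 1 A).smooth.continuous

lemma norm_gau (A : ℝ) (z : ℂ) : ‖gau A z‖ = rexp (-A * ‖z‖ ^ 2) := by
  rw [gau, norm_real, norm_of_nonneg (exp_pos _).le, normSq_eq_norm_sq]

/-- A polynomial times a Gaussian decays. -/
lemma nice_of_gaussian {K : ℂ → ℂ} (hK : Continuous K) {C A : ℝ} (hC : 0 ≤ C) (hA : 0 < A)
    (h : ∀ z, ‖K z‖ ≤ C * (1 + ‖z‖) ^ 2 * rexp (-A * ‖z‖ ^ 2)) : Nice K := by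
  have h1 : Tendsto (fun x : ℝ => (1 + x) ^ 5 * rexp (-A * x ^ 2)) atTop
      (𝓝 0) := by
    have h2 : Tendsto (fun x : ℝ => (1 + x) ^ 5 * rexp (-(1 + x))) atTop
        (𝓝 0) :=
      (Real.tendsto_pow_mul_exp_neg_atTop_nhds_zero 5).comp
        (tendsto_atTop_add_const_left _ 1 tendsto_id)
    refine squeeze_zero' ?_ ?_ h2
    · filter_upwards [eventually_ge_atTop 0] with x hx
      positivity
    · filter_upwards [eventually_ge_atTop (1 + 2 / A)] with x hx
      have h0 : 0 < 2 / A := by positivity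
      have h3 : 1 + x ≤ A * x ^ 2 := by
        have : 2 ≤ A * x := by
          rw [mul_comm, ← div_le_iff₀ hA]; linarith
        nlinarith
      exact mul_le_mul_of_nonneg_left (Real.exp_le_exp.2 (by linarith))
        (pow_nonneg (by linarith) _)
  have hcont : Continuous fun x : ℝ => (1 + x) ^ 5 * rexp (-A * x ^ 2) := by fun_prop
  obtain ⟨R, hR⟩ := eventually_atTop.1 (h1.eventually (gt_mem_nhds one_pos))
  obtain ⟨B, hB⟩ := isCompact_Icc.exists_bound_of_continuousOn (s := Icc 0 R) hcont.continuousOn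
  refine ⟨hK, C * max B 1, by positivity, fun z => ?_⟩
  have h4 : (1 + ‖z‖) ^ 5 * rexp (-A * ‖z‖ ^ 2) ≤ max B 1 := by
    rcases le_total ‖z‖ R with h5 | h5
    · exact ((le_abs_self _).trans (hB ‖z‖ ⟨norm_nonneg z, h5⟩)).trans (le_max_left _ _)
    · exact (hR _ h5).le.trans (le_max_right _ _)
  rw [Real.rpow_neg (by positivity), ← div_eq_mul_inv, le_div_iff₀ (by positivity)]
  calc ‖K z‖ * (1 + ‖z‖) ^ (3 : ℝ) = ‖K z‖ * (1 + ‖z‖) ^ 3 := by norm_cast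
    _ ≤ C * (1 + ‖z‖) ^ 2 * rexp (-A * ‖z‖ ^ 2) * (1 + ‖z‖) ^ 3 := by gcongr; exact h z
    _ = C * ((1 + ‖z‖) ^ 5 * rexp (-A * ‖z‖ ^ 2)) := by ring
    _ ≤ C * max B 1 := by gcongr

/-- `∇_v` of a Gaussian is the Gaussian times this linear function. -/
def gauL (b A : ℝ) (v z : ℂ) : ℂ :=
  ((-2 * A * (z.re * v.re + z.im * v.im) : ℝ) : ℂ) - I * ((b / 2 * wedge z v : ℝ) : ℂ)

lemma covd_gau (b A : ℝ) (v : ℂ) : covd b v (gau A) = fun z => gauL b A v z * gau A z := by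
  have hd : ∀ s : ℝ, HasDerivAt (fun s => rexp (-A * s)) (-A * rexp (-A * s)) s := fun s => by
    have := ((hasDerivAt_id s).const_mul (-A)).exp
    simpa [mul_comm] using this
  funext z
  have h := covd_radial (b := b) hd v z
  rw [show gau A = fun z => ((rexp (-A * normSq z) : ℝ) : ℂ) from rfl, h]
  simp only [gauL]
  push_cast
  ring

lemma norm_gauL_le (b A : ℝ) (v z : ℂ) :
    ‖gauL b A v z‖ ≤ (4 * |A| + |b|) * ‖v‖ * ‖z‖ := by
  have h1 := abs_re_le_norm z
  have h2 := abs_im_le_norm z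
  have h3 := abs_re_le_norm v
  have h4 := abs_im_le_norm v
  have e1 : |z.re * v.re| ≤ ‖z‖ * ‖v‖ := by rw [abs_mul]; gcongr
  have e2 : |z.im * v.im| ≤ ‖z‖ * ‖v‖ := by rw [abs_mul]; gcongr
  have e3 : |z.re * v.im| ≤ ‖z‖ * ‖v‖ := by rw [abs_mul]; gcongr
  have e4 : |z.im * v.re| ≤ ‖z‖ * ‖v‖ := by rw [abs_mul]; gcongr
  rw [gauL]
  refine (norm_sub_le _ _).trans ?_
  rw [norm_mul, norm_I, one_mul, norm_real, norm_real, norm_eq_abs, norm_eq_abs,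
    abs_mul, abs_mul, abs_mul, abs_div, wedge]
  have e5 := abs_add_le (z.re * v.re) (z.im * v.im)
  have e6 := abs_sub (z.re * v.im) (z.im * v.re)
  norm_num
  have := abs_nonneg A
  have := abs_nonneg b
  nlinarith

lemma covd_covd_gau (b A : ℝ) (v : ℂ) : covd b v (covd b v (gau A)) =
    fun z => (gauL b A v v + gauL b A v z ^ 2) * gau A z := by
  have hL : ∀ z, HasFDerivAt (gauL b A v)
      ((((-2 * A) • (v.re • reCLM + v.im • imCLM) : ℂ →L[ℝ] ℝ).smulRight (1 : ℂ)) -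
        ((b / 2) • (v.im • reCLM - v.re • imCLM) : ℂ →L[ℝ] ℝ).smulRight I) z := fun z => by
    have h := ((((-2 * A) • (v.re • reCLM + v.im • imCLM) : ℂ →L[ℝ] ℝ).smulRight (1 : ℂ)) -
        ((b / 2) • (v.im • reCLM - v.re • imCLM) : ℂ →L[ℝ] ℝ).smulRight I).hasFDerivAt (x := z)
    convert! h using 1
    funext w
    apply Complex.ext <;> simp [gauL, wedge, -mul_eq_mul_left_iff, -mul_eq_mul_right_iff] <;> ring
  have hg : ∀ z, HasFDerivAt (gau A) (fderiv ℝ (gau A) z) z := fun z =>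
    ((gau_rad b A).smooth.differentiable (by simp)).differentiableAt.hasFDerivAt
  funext z
  rw [covd_gau]
  have h1 := ((hL z).mul (hg z)).fderiv
  have h2 := congrFun (covd_gau b A v) z
  simp only [covd] at h2 ⊢
  rw [show (fun z => gauL b A v z * gau A z) = gauL b A v * gau A from rfl, h1]
  simp only [_root_.add_apply, _root_.smul_apply, smul_eq_mul]
  have h3 : ((((-2 * A) • (v.re • reCLM + v.im • imCLM) : ℂ →L[ℝ] ℝ).smulRight (1 : ℂ)) -
        ((b / 2) • (v.im • reCLM - v.re • imCLM) : ℂ →L[ℝ] ℝ).smulRight I) v = gauL b A v v := by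
    apply Complex.ext <;> simp [gauL, wedge, -mul_eq_mul_left_iff, -mul_eq_mul_right_iff] <;> ring
  rw [h3]
  linear_combination gauL b A v z * h2

lemma nice_gau {A : ℝ} (hA : 0 < A) : Nice (gau A) :=
  nice_of_gaussian (continuous_gau A) zero_le_one hA fun z => by
    rw [norm_gau, one_mul]
    exact le_mul_of_one_le_left (exp_pos _).le (one_le_pow₀ (by linarith [norm_nonneg z]))

lemma nice_covd_gau (b : ℝ) {A : ℝ} (hA : 0 < A) (v : ℂ) : Nice (covd b v (gau A)) := by
  refine nice_of_gaussian (contDiff_covd (gau_rad b A).smooth).continuous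
    (C := (4 * |A| + |b|) * ‖v‖) (by positivity) hA fun z => ?_
  rw [covd_gau]
  rw [norm_mul, norm_gau]
  have h := norm_gauL_le b A v z
  have h1 : ‖z‖ ≤ (1 + ‖z‖) ^ 2 := by nlinarith
  gcongr
  exact h.trans (by gcongr)

lemma nice_covd_covd_gau (b : ℝ) {A : ℝ} (hA : 0 < A) (v : ℂ) :
    Nice (covd b v (covd b v (gau A))) := by
  refine nice_of_gaussian (contDiff_covd (contDiff_covd (gau_rad b A).smooth)).continuous
    (C := ‖gauL b A v v‖ + ((4 * |A| + |b|) * ‖v‖) ^ 2) (by positivity) hA fun z => ?_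
  rw [covd_covd_gau]
  rw [norm_mul, norm_gau]
  have h := norm_gauL_le b A v z
  have h0 := norm_nonneg z
  have h1 : ‖z‖ ^ 2 ≤ (1 + ‖z‖) ^ 2 := by gcongr; linarith
  have h2 : 1 ≤ (1 + ‖z‖) ^ 2 := one_le_pow₀ (by linarith)
  gcongr
  calc ‖gauL b A v v + gauL b A v z ^ 2‖ ≤ ‖gauL b A v v‖ + ‖gauL b A v z‖ ^ 2 := by
        rw [← norm_pow]; exact norm_add_le _ _
    _ ≤ ‖gauL b A v v‖ * (1 + ‖z‖) ^ 2 + ((4 * |A| + |b|) * ‖v‖ * ‖z‖) ^ 2 := by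
        gcongr
        exact le_mul_of_one_le_right (norm_nonneg _) h2
    _ ≤ _ := by
        rw [mul_pow _ ‖z‖, add_mul _ (_ ^ 2)]
        exact add_le_add le_rfl (mul_le_mul_of_nonneg_left h1 (sq_nonneg _))

lemma integrable_conj_mtr_mul {b : ℝ} {K : ℂ → ℂ} (hK : Nice K) {g : ℂ → ℂ} (hg : Continuous g)
    {B : ℝ} (hB : ∀ y, ‖g y‖ ≤ B) (x : ℂ) :
    Integrable fun y => conj (mtr b x 0 K y) * g y := by
  have hKc := hK.cont
  have hc : Continuous fun y => conj (mtr b x 0 K y) * g y := by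
    unfold mtr; fun_prop
  refine ((hK.integrable.comp_sub_right x).norm.mul_const B).mono' hc.aestronglyMeasurable
    (.of_forall fun y => ?_)
  have h1 : ‖mtr b x 0 K y‖ = ‖K (y - x)‖ := by
    rw [mtr, norm_mul, mul_comm I, norm_exp_ofReal_mul_I, one_mul]
  rw [norm_mul, RCLike.norm_conj, h1]
  exact mul_le_mul_of_nonneg_left (hB y) (norm_nonneg _)

lemma integral_gau (A : ℝ) (hA : 0 < A) : ∫ z, gau A z = ((π / A : ℝ) : ℂ) := by
  have h := GaussianFourier.integral_rexp_neg_mul_sq_norm (V := ℂ) hA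
  rw [finrank_real_complex] at h
  norm_num at h
  have h2 : ∫ z, gau A z = ((∫ z : ℂ, rexp (-(A * ‖z‖ ^ 2)) : ℝ) : ℂ) := by
    rw [← integral_complex_ofReal]
    refine integral_ext fun z => ?_
    simp only [gau, normSq_eq_norm_sq, neg_mul]
  rw [h2, h]

lemma integrable_gau_mul {g : ℂ → ℂ} (hg : Measurable g) {B : ℝ} (hB : ∀ y, ‖g y‖ ≤ B) (x : ℂ)
    {A : ℝ} (hA : 0 < A) : Integrable fun y => gau A (x - y) * g y := by
  refine (((nice_gau hA).integrable.comp_sub_left x).norm.mul_const B).mono'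
    (((continuous_gau A).comp (by fun_prop)).measurable.mul hg).aestronglyMeasurable
    (.of_forall fun y => ?_)
  rw [norm_mul]
  exact mul_le_mul_of_nonneg_left (hB y) (norm_nonneg _)

/-- Derivative of a Gaussian integral in the parameter of the Gaussian. -/
lemma hasDerivAt_integral_gau {g : ℂ → ℂ} (hg : Measurable g) {B : ℝ} (hB : ∀ y, ‖g y‖ ≤ B)
    (x : ℂ) {A : ℝ} (hA : 0 < A) :
    Integrable (fun y => (normSq (x - y) : ℂ) * gau A (x - y) * g y) ∧
    HasDerivAt (fun A => ∫ y, gau A (x - y) * g y)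
      (-∫ y, (normSq (x - y) : ℂ) * gau A (x - y) * g y) A := by
  have hmG : ∀ A, Measurable fun y => gau A (x - y) := fun A =>
    ((continuous_gau A).comp (by fun_prop)).measurable
  have hmN : Measurable fun y : ℂ => (normSq (x - y) : ℂ) :=
    (continuous_ofReal.comp (continuous_normSq.comp (by fun_prop))).measurable
  have hN : Nice fun z => (normSq z : ℂ) * gau (A / 2) z :=
    nice_of_gaussian ((continuous_ofReal.comp continuous_normSq).mul (continuous_gau _))
      zero_le_one (half_pos hA) fun z => by
        rw [norm_mul, norm_gau, norm_real, norm_of_nonneg (normSq_nonneg _), normSq_eq_norm_sq,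
          one_mul]
        gcongr
        linarith
  have h := hasDerivAt_integral_of_dominated_loc_of_deriv_le (μ := volume)
    (F := fun A y => gau A (x - y) * g y) (x₀ := A)
    (F' := fun A y => -((normSq (x - y) : ℂ) * gau A (x - y) * g y))
    (bound := fun y => ‖(normSq (x - y) : ℂ) * gau (A / 2) (x - y)‖ * B)
    (s := Set.Ioi (A / 2)) (Ioi_mem_nhds (by linarith))
    (.of_forall fun A => ((hmG A).mul hg).aestronglyMeasurable)
    (integrable_gau_mul hg hB x hA)
    (((hmN.mul (hmG A)).mul hg).neg.aestronglyMeasurable)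
    (.of_forall fun y a ha => ?_)
    ((hN.integrable.comp_sub_left x).norm.mul_const B)
    (.of_forall fun y a ha => ?_)
  · rw [integral_neg] at h
    exact ⟨by simpa using h.1.neg, h.2⟩
  · have ha : A / 2 < a := ha
    rw [norm_neg, norm_mul, norm_mul, norm_mul, norm_gau, norm_gau]
    have := hB y
    gcongr
  · have h1 : HasDerivAt (fun a : ℝ => rexp (-a * normSq (x - y)))
        (rexp (-a * normSq (x - y)) * (-1 * normSq (x - y))) a :=
      ((hasDerivAt_id a).neg.mul_const _).exp
    have h2 := h1.ofReal_comp.mul_const (g y)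
    convert! h2 using 1
    rw [gau]
    push_cast
    ring

/-- The exponent of the heat kernel of `-Δ_{a_b}`. -/
def heatA (b t : ℝ) : ℝ := b / 4 * (Real.cosh (b * t) / Real.sinh (b * t))

/-- The prefactor of the heat kernel of `-Δ_{a_b}`. -/
def heatC (b t : ℝ) : ℝ := b / (4 * π * Real.sinh (b * t))

/-- The heat kernel of `-Δ_{a_b}`, up to the phase. -/
def heat (b t : ℝ) (z : ℂ) : ℂ := (heatC b t : ℂ) * gau (heatA b t) z

variable {b t : ℝ}

lemma sinh_bt_pos (hb : 0 < b) (ht : 0 < t) : 0 < Real.sinh (b * t) :=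
  sinh_pos_iff.2 (mul_pos hb ht)

lemma heatA_pos (hb : 0 < b) (ht : 0 < t) : 0 < heatA b t := by
  have := sinh_bt_pos hb ht
  have := Real.cosh_pos (b * t)
  unfold heatA
  positivity

lemma tendsto_cosh_bt (b : ℝ) : Tendsto (fun t => Real.cosh (b * t)) (𝓝[>] 0) (𝓝 1) :=
  (Continuous.tendsto' (by fun_prop) 0 1 (by simp)).mono_left nhdsWithin_le_nhds

lemma tendsto_heatA (hb : 0 < b) : Tendsto (heatA b) (𝓝[>] 0) atTop := by
  have hs : Tendsto (fun t => Real.sinh (b * t)) (𝓝[>] 0) (𝓝[>] 0) := tendsto_nhdsWithin_iff.2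
    ⟨(Continuous.tendsto' (by fun_prop) 0 0 (by simp)).mono_left nhdsWithin_le_nhds,
      eventually_mem_nhdsWithin.mono fun t ht => sinh_bt_pos hb ht⟩
  exact ((tendsto_cosh_bt b).pos_mul_atTop one_pos
    (tendsto_inv_nhdsGT_zero.comp hs)).const_mul_atTop (by positivity)

lemma hasDerivAt_heatA (hb : 0 < b) (ht : 0 < t) :
    HasDerivAt (heatA b) (-(4 * heatA b t ^ 2 - b ^ 2 / 4)) t := by
  have hs := (sinh_bt_pos hb ht).ne'
  have h0 : HasDerivAt (fun t => b * t) b t := by simpa using (hasDerivAt_id t).const_mul b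
  have h := ((h0.cosh.div h0.sinh hs).const_mul (b / 4))
  convert! h using 1
  have h2 := Real.cosh_sq (b * t)
  unfold heatA
  field_simp
  rw [h2]
  ring

lemma hasDerivAt_heatC (hb : 0 < b) (ht : 0 < t) :
    HasDerivAt (heatC b) (-(4 * heatA b t) * heatC b t) t := by
  have h0 : HasDerivAt (fun t => b * t) b t := by simpa using (hasDerivAt_id t).const_mul b
  have h := (hasDerivAt_const t b).div (h0.sinh.const_mul (4 * π)) (by positivity)
  convert! h using 1
  unfold heatA heatC
  field_simp
  ring

lemma nice_heat (hb : 0 < b) (ht : 0 < t) : Nice (heat b t) := by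
  obtain ⟨h1, C, hC, h2⟩ := nice_gau (heatA_pos hb ht)
  refine ⟨continuous_const.mul h1, ‖(heatC b t : ℂ)‖ * C, by positivity, fun z => ?_⟩
  rw [heat, norm_mul, mul_assoc]
  exact mul_le_mul_of_nonneg_left (h2 z) (norm_nonneg _)

namespace MagLattice

variable {M : MagLattice τ}

lemma conv_negLap_gau {f : ℂ → ℂ} (hτ : 0 < τ.im) (hf : M.IsSection f) {A : ℝ} (hA : 0 < A)
    (x : ℂ) : M.conv (gau A) (negLap (aB M.b) f) x = M.conv (negLap (aB M.b) (gau A)) f x := by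
  refine conv_negLap_of (gau_rad _ A) ?_
  have hs := (gau_rad M.b A).smooth
  simp only [ph_mul_mtr]
  refine integral_negLap (contDiff_mtr _ _ _ hs) hf.1 fun v => ?_
  have e1 := covd_mtr' M.b x 0 v (hs.differentiable (by simp))
  have e2 := covd_mtr' M.b x 0 v ((contDiff_covd (b := M.b) (v := v) hs).differentiable (by simp))
  rw [e1, e2]
  have hfv := hf.covd v
  have hfvv := hfv.covd v
  obtain ⟨B0, -, hB0⟩ := hf.equi.exists_bound hτ hf.continuous
  obtain ⟨B1, -, hB1⟩ := hfv.equi.exists_bound hτ hfv.continuous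
  obtain ⟨B2, -, hB2⟩ := hfvv.equi.exists_bound hτ hfvv.continuous
  exact ⟨integrable_conj_mtr_mul (nice_covd_gau _ hA v) hf.continuous hB0 x,
    integrable_conj_mtr_mul (nice_gau hA) hfv.continuous hB1 x,
    integrable_conj_mtr_mul (nice_covd_gau _ hA v) hfv.continuous hB1 x,
    integrable_conj_mtr_mul (nice_covd_covd_gau _ hA v) hf.continuous hB0 x,
    integrable_conj_mtr_mul (nice_gau hA) hfvv.continuous hB2 x⟩

/-- The heat kernel acts on eigen-sections by `e^{-λ t}`. -/
lemma conv_heat (hτ : 0 < τ.im) {f : ℂ → ℂ} {l : ℝ} (hf : M.IsEig f l) (ht : 0 < t) (x : ℂ) :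
    M.conv (heat M.b t) f x = (rexp (-l * t) : ℂ) * f x := by
  have hb := M.b_pos
  obtain ⟨B, -, hB⟩ := hf.1.equi.exists_bound hτ hf.1.continuous
  set g : ℂ → ℂ := fun y => ph M.b x y * f y
  have hgc : Continuous g := by
    have := hf.1.continuous
    fun_prop
  have hgB : ∀ y, ‖g y‖ ≤ B := fun y => by simpa [g] using hB y
  set F : ℝ → ℂ := fun A => ∫ y, gau A (x - y) * g y with hF
  set F' : ℝ → ℂ := fun A => -∫ y, (normSq (x - y) : ℂ) * gau A (x - y) * g y with hF'
  have hd : ∀ A, 0 < A → HasDerivAt F (F' A) A := fun A hA =>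
    (hasDerivAt_integral_gau hgc.measurable hgB x hA).2
  have hconvF : ∀ A, M.conv (gau A) f x = F A := fun A => by
    simp only [conv, hF, g, mul_assoc]
  have hode : ∀ A, 0 < A → (l : ℂ) * F A =
      ((4 * A : ℝ) : ℂ) * F A + ((4 * A ^ 2 - M.b ^ 2 / 4 : ℝ) : ℂ) * F' A := fun A hA => by
    have h1 := conv_negLap_gau hτ hf.1 hA x
    have h2 : M.conv (gau A) (negLap (aB M.b) f) x = (l : ℂ) * F A := by
      rw [← hconvF, conv, conv, ← integral_const_mul]
      refine integral_ext fun y => ?_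
      simp only [hf.2]
      ring
    have hd1 : ∀ s : ℝ, HasDerivAt (fun s => rexp (-A * s)) (-A * rexp (-A * s)) s := fun s => by
      have := ((hasDerivAt_id s).const_mul (-A)).exp
      simpa [mul_comm] using this
    have hd2 : ∀ s : ℝ, HasDerivAt (fun s => -A * rexp (-A * s))
        (-A * (-A * rexp (-A * s))) s := fun s => (hd1 s).const_mul (-A)
    have h3 : ∀ z, negLap (aB M.b) (gau A) z = ((4 * A : ℝ) : ℂ) * gau A z -
        ((4 * A ^ 2 - M.b ^ 2 / 4 : ℝ) : ℂ) * ((normSq z : ℂ) * gau A z) := fun z => by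
      have := negLap_radial (b := M.b) hd1 hd2 z
      rw [show gau A = fun z => ((rexp (-A * normSq z) : ℝ) : ℂ) from rfl, this]
      push_cast
      ring
    rw [← h2, h1, conv]
    obtain ⟨hi, -⟩ := hasDerivAt_integral_gau hgc.measurable hgB x hA
    have hi0 := integrable_gau_mul hgc.measurable hgB x hA
    simp only [hF, hF']
    rw [mul_neg, ← sub_eq_add_neg, ← integral_const_mul, ← integral_const_mul,
      ← integral_sub (hi0.const_mul _) (hi.const_mul _)]
    refine integral_ext fun y => ?_
    simp only [h3, g]
    ring
  set Y : ℝ → ℂ := fun t => (rexp (l * t) : ℂ) * ((heatC M.b t : ℂ) * F (heatA M.b t)) with hY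
  have hYd : ∀ t ∈ Set.Ioi (0 : ℝ), HasDerivAt Y 0 t := by
    intro t ht
    have ht : 0 < t := ht
    have h1 : HasDerivAt (fun t : ℝ => F (heatA M.b t)) _ t :=
      (hd _ (heatA_pos hb ht)).scomp t (hasDerivAt_heatA hb ht)
    have h2 := (hasDerivAt_heatC hb ht).ofReal_comp
    have h3 : HasDerivAt (fun t : ℝ => rexp (l * t)) (rexp (l * t) * (l * 1)) t :=
      ((hasDerivAt_id t).const_mul l).exp
    convert! h3.ofReal_comp.mul (h2.mul h1) using 1
    have h4 := hode _ (heatA_pos hb ht)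
    simp only [real_smul, Pi.mul_apply]
    push_cast at h4 ⊢
    linear_combination (-(cexp (l * t) * heatC M.b t)) * h4
  have hconst : ∀ s ∈ Set.Ioi (0 : ℝ), Y s = Y t := by
    intro s hs
    exact (isOpen_Ioi.is_const_of_deriv_eq_zero isPreconnected_Ioi
      (fun t ht => (hYd t ht).differentiableAt.differentiableWithinAt)
      (fun t ht => (hYd t ht).deriv) hs ht)
  have hlim : Tendsto Y (𝓝[>] 0) (𝓝 (f x)) := by
    have h1 := (tendsto_concentrating (nice_gau one_pos).integrable hgc.measurable hgB
      hgc.continuousAt (x := x)).comp (Real.tendsto_sqrt_atTop.comp (tendsto_heatA hb))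
    have h2 : Tendsto (fun t : ℝ => ((rexp (l * t) *
        (π * Real.cosh (M.b * t))⁻¹ : ℝ) : ℂ)) (𝓝[>] 0)
        (𝓝 ((1 * (π * 1)⁻¹ : ℝ) : ℂ)) :=
      (continuous_ofReal.tendsto _).comp (((Continuous.tendsto' (by fun_prop) 0 1
        (by simp)).mono_left nhdsWithin_le_nhds).mul
        (((tendsto_cosh_bt M.b).const_mul _).inv₀ (by positivity)))
    have h3 := h2.mul h1
    have hval : ((1 * (π * 1)⁻¹ : ℝ) : ℂ) * ((∫ z, gau 1 z) * g x) = f x := by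
      rw [integral_gau 1 one_pos]
      have : (π : ℂ) ≠ 0 := ofReal_ne_zero.2 pi_pos.ne'
      simp only [g, ph, wedge_self]
      push_cast
      field_simp
      simp
    rw [hval] at h3
    refine h3.congr' ?_
    filter_upwards [self_mem_nhdsWithin] with t ht
    have hA := heatA_pos hb ht
    have hscale : ∀ y, gau 1 (((√(heatA M.b t) : ℝ) : ℂ) * (x - y)) =
        gau (heatA M.b t) (x - y) := by
      intro y
      rw [gau, gau, normSq_mul, normSq_ofReal, mul_self_sqrt hA.le]
      congr 2; ring
    simp only [Function.comp_apply, hscale, sq_sqrt hA.le]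
    rw [hY]
    have hs := (sinh_bt_pos hb ht).ne'
    have hc := (Real.cosh_pos (M.b * t)).ne'
    have h5 : (π * Real.cosh (M.b * t))⁻¹ * heatA M.b t = heatC M.b t := by
      unfold heatA heatC
      field_simp
    simp only [hF]
    rw [← h5]
    push_cast
    ring
  have hYt : Y t = f x := by
    refine tendsto_nhds_unique (tendsto_const_nhds.congr' ?_) hlim
    filter_upwards [self_mem_nhdsWithin] with s hs
    exact (hconst s hs).symm
  have h6 : M.conv (heat M.b t) f x = (heatC M.b t : ℂ) * F (heatA M.b t) := by
    rw [← hconvF, conv, conv, ← integral_const_mul]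
    refine integral_ext fun y => ?_
    simp only [heat]
    ring
  rw [h6, ← hYt, hY]
  simp only
  rw [← mul_assoc, ← ofReal_mul, ← Real.exp_add]
  simp

end MagLattice

namespace MagLattice

/-! ## The eigenbasis -/

variable {M : MagLattice τ}

lemma negLap_add {b : ℝ} {f g : ℂ → ℂ} (hf : ContDiff ℝ ∞ f) (hg : ContDiff ℝ ∞ g) (x : ℂ) :
    negLap (aB b) (fun x => f x + g x) x = negLap (aB b) f x + negLap (aB b) g x := by
  have h1 : ∀ v, ∀ f g : ℂ → ℂ, ContDiff ℝ ∞ f → ContDiff ℝ ∞ g →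
      BdG.covd b v (fun x => f x + g x) = fun x => BdG.covd b v f x + BdG.covd b v g x := fun v f g hf hg => by
    funext x
    simp only [BdG.covd]
    rw [fderiv_fun_add (hf.differentiable (by simp)).differentiableAt
      (hg.differentiable (by simp)).differentiableAt]
    simp
    ring
  rw [negLap_aB, negLap_aB, negLap_aB, h1 1 f g hf hg, h1 I f g hf hg,
    h1 1 _ _ (contDiff_covd hf) (contDiff_covd hg), h1 I _ _ (contDiff_covd hf) (contDiff_covd hg)]
  ring

lemma IsSection.add {f g : ℂ → ℂ} (hf : M.IsSection f) (hg : M.IsSection g) :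
    M.IsSection fun x => f x + g x :=
  ⟨hf.1.add hg.1, fun m x => by simp only [hf.2 m x, hg.2 m x]; ring⟩

lemma toH_add (hτ : 0 < τ.im) {f g : ℂ → ℂ} (hf : M.IsSection f) (hg : M.IsSection g) :
    M.toH (fun x => f x + g x) = M.toH f + M.toH g := by
  refine toH_eq_of_ae hτ (hf.add hg) ?_
  filter_upwards [Lp.coeFn_add (M.toH f) (M.toH g), coeFn_toH hτ hf, coeFn_toH hτ hg]
    with x h1 h2 h3
  rw [h1, Pi.add_apply, h2, h3]

variable (M) in
/-- The eigenspace of the covariant Laplacian. -/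
def eigSub (hτ : 0 < τ.im) (l : ℝ) : Submodule ℂ M.H where
  carrier := {u | ∃ f, M.IsEig f l ∧ M.toH f = u}
  add_mem' := by
    rintro _ _ ⟨f, hf, rfl⟩ ⟨g, hg, rfl⟩
    refine ⟨fun x => f x + g x, ⟨hf.1.add hg.1, fun x => ?_⟩, toH_add hτ hf.1 hg.1⟩
    rw [negLap_add hf.1.1 hg.1.1, hf.2, hg.2]
    ring
  zero_mem' := by
    have h : M.IsSection fun _ => 0 := ⟨contDiff_const, fun m x => by simp⟩
    refine ⟨fun _ => 0, ⟨h, fun x => ?_⟩, ?_⟩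
    · simpa using negLap_const_mul 0 h.1 x
    · exact toH_eq_of_ae hτ h (Lp.coeFn_zero _ _ _)
  smul_mem' := by
    rintro z _ ⟨f, hf, rfl⟩
    refine ⟨fun x => z * f x, ⟨hf.1.const_mul z, fun x => ?_⟩, toH_const_mul hτ hf.1 z⟩
    rw [negLap_const_mul z hf.1.1, hf.2]
    ring

lemma mem_eigSub (hτ : 0 < τ.im) {l : ℝ} {u : M.H} :
    u ∈ M.eigSub hτ l ↔ ∃ f, M.IsEig f l ∧ M.toH f = u := Iff.rfl

lemma kerOp_heat (hτ : 0 < τ.im) {l t : ℝ} (ht : 0 < t) {u : M.H} (hu : u ∈ M.eigSub hτ l) :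
    M.kerOp (M.kerH (heat M.b t)) u = (rexp (-l * t) : ℂ) • u := by
  obtain ⟨f, hf, rfl⟩ := hu
  refine Lp.ext ?_
  filter_upwards [kerOp_toH hτ (nice_heat M.b_pos ht) hf.1, coeFn_toH hτ hf.1,
    Lp.coeFn_smul (rexp (-l * t) : ℂ) (M.toH f)] with x h1 h2 h3
  rw [h1, h3, Pi.smul_apply, h2, conv_heat hτ hf ht, smul_eq_mul]

lemma inner_eig_orthogonal (hτ : 0 < τ.im) {l l' : ℝ} (hl : l ≠ l') {u w : M.H}
    (hu : u ∈ M.eigSub hτ l) (hw : w ∈ M.eigSub hτ l') : ⟪u, w⟫_ℂ = 0 := by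
  obtain ⟨f, hf, rfl⟩ := hu
  obtain ⟨g, hg, rfl⟩ := hw
  have h := inner_negLap hτ hf.1 hg.1
  rw [funext hf.2, funext hg.2, toH_const_mul hτ hf.1, toH_const_mul hτ hg.1, inner_smul_left,
    inner_smul_right, conj_ofReal] at h
  have h1 : ((l - l' : ℝ) : ℂ) * ⟪M.toH f, M.toH g⟫_ℂ = 0 := by
    push_cast
    linear_combination h
  exact (mul_eq_zero.1 h1).resolve_left (ofReal_ne_zero.2 (sub_ne_zero.2 hl))

lemma orthonormal_conjH {ι : Type*} {e : ι → M.H} (he : Orthonormal ℂ e) :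
    Orthonormal ℂ fun i => M.conjH (e i) := by
  classical
  rw [orthonormal_iff_ite] at he ⊢
  intro i j
  rw [inner_conjH_conjH, he]
  split_ifs <;> simp

lemma finiteDimensional_eigSub (hτ : 0 < τ.im) (l : ℝ) :
    FiniteDimensional ℂ (M.eigSub hτ l) := by
  set κ := M.kerH (heat M.b 1)
  set z := rexp (-l * 1)
  have hz : 0 < z := exp_pos _
  have key : ∀ (n : ℕ) (e : Fin n → M.H), Orthonormal ℂ e → (∀ i, e i ∈ M.eigSub hτ l) →
      (n : ℝ) * z ^ 2 ≤ ‖κ‖ ^ 2 := fun n e he hmem => by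
    have ho := (M.orthonormal_tens he (orthonormal_conjH he)).comp (fun i : Fin n => (i, i))
      (fun i j h => (Prod.mk.inj h).1)
    have hb := ho.sum_inner_products_le κ (s := Finset.univ)
    refine le_trans (le_of_eq ?_) hb
    have h1 : ∀ i, ‖⟪((fun p : Fin n × Fin n => M.tens (e p.1) (M.conjH (e p.2))) ∘
        fun i : Fin n => (i, i)) i, κ⟫_ℂ‖ ^ 2 = z ^ 2 := fun i => by
      simp only [Function.comp]
      rw [← inner_kerOp, kerOp_heat hτ one_pos (hmem i), inner_smul_right,
        inner_self_eq_norm_sq_to_K, he.1 i, norm_mul, norm_real, norm_of_nonneg hz.le]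
      simp
    simp only [h1]
    simp
  refine Module.rank_lt_aleph0_iff.1 ?_
  refine lt_of_le_of_lt (rank_le (n := ⌊‖κ‖ ^ 2 / z ^ 2⌋₊) fun s hs => ?_) Cardinal.natCast_lt_aleph0
  let S := Submodule.span ℂ (Set.range fun i : s => ((i : M.eigSub hτ l) : M.H))
  have hlin : LinearIndependent ℂ fun i : s => ((i : M.eigSub hτ l) : M.H) :=
    hs.map' (M.eigSub hτ l).subtype (Submodule.ker_subtype _)
  have hfr : Module.finrank ℂ S = s.card := by
    rw [finrank_span_eq_card hlin]; simp
  have hfd : FiniteDimensional ℂ S := FiniteDimensional.span_of_finite ℂ (Set.finite_range _)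
  have hSle : S ≤ M.eigSub hτ l := Submodule.span_le.2 (by rintro _ ⟨i, rfl⟩; exact i.1.2)
  have hb := key _ (fun i => ((stdOrthonormalBasis ℂ S i : S) : M.H))
    ((stdOrthonormalBasis ℂ S).orthonormal.comp_linearIsometry S.subtypeₗᵢ)
    (fun i => hSle (stdOrthonormalBasis ℂ S i).2)
  rw [hfr] at hb
  refine Nat.le_floor ?_
  rw [le_div_iff₀ (by positivity)]
  exact hb

end MagLattice

/-- A Hilbert basis of `𝔥` of smooth eigen-sections. -/
structure EigenBasis (M : MagLattice τ) where
  ι : Type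
  e : HilbertBasis ι ℂ M.H
  f : ι → ℂ → ℂ
  lam : ι → ℝ
  isEig : ∀ i, M.IsEig (f i) (lam i)
  toH_f : ∀ i, M.toH (f i) = e i

namespace MagLattice
variable {M : MagLattice τ}

lemma nonempty_eigenBasis (hτ : 0 < τ.im) : Nonempty (EigenBasis M) := by
  have := finiteDimensional_eigSub (M := M) hτ
  let ι : Type := Σ l : ℝ, Fin (Module.finrank ℂ (M.eigSub hτ l))
  let v : ι → M.H := fun i => (stdOrthonormalBasis ℂ (M.eigSub hτ i.1) i.2 : M.eigSub hτ i.1)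
  have hmem : ∀ i, v i ∈ M.eigSub hτ i.1 := fun i =>
    (stdOrthonormalBasis ℂ (M.eigSub hτ i.1) i.2).2
  have hv : Orthonormal ℂ v := by
    refine ⟨fun i => ?_, fun i j hij => ?_⟩
    · have := (stdOrthonormalBasis ℂ (M.eigSub hτ i.1)).orthonormal.1 i.2
      exact this
    · obtain ⟨l, i⟩ := i
      obtain ⟨l', j⟩ := j
      by_cases h : l = l'
      · subst h
        have h2 : i ≠ j := fun h => hij (by rw [h])
        exact (stdOrthonormalBasis ℂ (M.eigSub hτ l)).orthonormal.2 h2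
      · exact inner_eig_orthogonal hτ h (hmem ⟨l, i⟩) (hmem ⟨l', j⟩)
  have htot : (Submodule.span ℂ (Set.range v))ᗮ = ⊥ := by
    rw [Submodule.eq_bot_iff]
    intro u hu
    refine eq_zero_of_isEig hτ fun f l hf => ?_
    have h1 : M.toH f ∈ M.eigSub hτ l := ⟨f, hf, rfl⟩
    have h2 := (stdOrthonormalBasis ℂ (M.eigSub hτ l)).sum_repr ⟨M.toH f, h1⟩
    have h3 := congrArg Subtype.val h2
    simp only [Submodule.coe_sum, Submodule.coe_smul] at h3
    rw [← h3, sum_inner]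
    refine sum_eq_zero fun i _ => ?_
    rw [inner_smul_left, (Submodule.mem_orthogonal _ _).1 hu (v ⟨l, i⟩)
      (Submodule.subset_span ⟨_, rfl⟩), mul_zero]
  choose f hf using fun i => (mem_eigSub hτ).1 (hmem i)
  exact ⟨⟨ι, HilbertBasis.mkOfOrthogonalEqBot hv htot, f, fun i => i.1, fun i => (hf i).1,
    fun i => by rw [(hf i).2, HilbertBasis.coe_mkOfOrthogonalEqBot]⟩⟩

end MagLattice

namespace EigenBasis
variable {M : MagLattice τ} (B : EigenBasis M)

lemma isSection (i : B.ι) : M.IsSection (B.f i) := (B.isEig i).1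

lemma mem_eigSub (hτ : 0 < τ.im) (i : B.ι) : B.e i ∈ M.eigSub hτ (B.lam i) :=
  ⟨_, B.isEig i, B.toH_f i⟩

lemma coeFn_e (hτ : 0 < τ.im) (i : B.ι) : (B.e i : ℂ → ℂ) =ᵐ[M.vol] B.f i :=
  B.toH_f i ▸ MagLattice.coeFn_toH hτ (B.isSection i)

lemma norm_e (i : B.ι) : ‖B.e i‖ = 1 := B.e.orthonormal.1 i

lemma inner_self (i : B.ι) : ⟪B.e i, B.e i⟫_ℂ = 1 := by
  rw [inner_self_eq_norm_sq_to_K, B.norm_e]; simp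

lemma inner_ne {i j : B.ι} (h : i ≠ j) : ⟪B.e i, B.e j⟫_ℂ = 0 := B.e.orthonormal.2 h

include B in
lemma lam_nonneg (hτ : 0 < τ.im) (i : B.ι) : 0 ≤ B.lam i := by
  have hs := B.isSection i
  have h := MagLattice.integral_conj_negLap hτ hs hs
  have h0 := MagLattice.inner_toH_toH hτ hs hs
  rw [B.toH_f, B.inner_self] at h0
  have h1 : ∫ x, conj (negLap (aB M.b) (B.f i) x) * B.f i x ∂M.vol = (B.lam i : ℂ) := by
    simp only [(B.isEig i).2, map_mul, conj_ofReal, mul_assoc]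
    rw [integral_const_mul, ← h0, mul_one]
  have h2 : ∀ g : ℂ → ℂ, 0 ≤ (∫ x, conj (g x) * g x ∂M.vol).re := fun g => by
    have : ∫ x, conj (g x) * g x ∂M.vol = ((∫ x, ‖g x‖ ^ 2 ∂M.vol : ℝ) : ℂ) := by
      rw [← integral_complex_ofReal]
      refine integral_ext fun x => ?_
      rw [mul_comm, mul_conj, normSq_eq_norm_sq]
    rw [this, ofReal_re]
    exact integral_nonneg fun x => by positivity
  rw [h1] at h
  have h3 := congrArg re h
  rw [ofReal_re, add_re] at h3
  rw [h3]
  exact add_nonneg (h2 _) (h2 _)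

/-- Matrix elements in the eigenbasis. -/
lemma inner_kerOp (κ : M.HH) (i j : B.ι) :
    ⟪B.e i, M.kerOp κ (B.e j)⟫_ℂ = ⟪M.tensBasis B.e (M.conjBasis B.e) (i, j), κ⟫_ℂ := by
  rw [MagLattice.inner_kerOp]
  simp

lemma hasSum_heat_mul (hτ : 0 < τ.im) {t : ℝ} (ht : 0 < t) {L : ℂ → ℂ} (hL : Nice L) :
    HasSum (fun i => (rexp (-B.lam i * t) : ℂ) * ⟪B.e i, M.kerOp (M.kerH L) (B.e i)⟫_ℂ)
      ((M.vol.real univ : ℂ) * ∫ u, heat M.b t u * L u) := by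
  have hn := nice_heat M.b_pos ht
  have h1 := (M.tensBasis B.e (M.conjBasis B.e)).hasSum_inner_mul_inner (M.kerH (heat M.b t))
    (M.kerH L)
  rw [MagLattice.inner_kerH_kerH hτ hn hL] at h1
  have h2 : ∀ i j, ⟪M.kerH (heat M.b t), M.tensBasis B.e (M.conjBasis B.e) (i, j)⟫_ℂ =
      conj ((rexp (-B.lam j * t) : ℂ) * ⟪B.e i, B.e j⟫_ℂ) := fun i j => by
    rw [← inner_conj_symm, ← B.inner_kerOp, MagLattice.kerOp_heat hτ ht (B.mem_eigSub hτ j),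
      inner_smul_right]
  have hinj : Function.Injective fun i : B.ι => (i, i) := fun i j h => (Prod.mk.inj h).1
  rw [← hinj.hasSum_iff] at h1
  · convert! h1 using 1
    · funext i
      simp only [Function.comp]
      rw [h2, ← B.inner_kerOp, B.inner_self, mul_one, conj_ofReal]
    · congr 1
      refine integral_ext fun u => ?_
      simp [heat, gau, ← exp_conj]
  · rintro ⟨i, j⟩ hij
    have : i ≠ j := fun h => hij ⟨i, by simp [h]⟩
    rw [h2, B.inner_ne this]
    simp

lemma hasSum_heat (hτ : 0 < τ.im) {t : ℝ} (ht : 0 < t) :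
    HasSum (fun i => rexp (-2 * t * B.lam i))
      (M.vol.real univ * (M.b / (4 * π * Real.sinh (2 * M.b * t)))) := by
  have h := B.hasSum_heat_mul hτ ht (nice_heat M.b_pos ht)
  rw [← hasSum_ofReal]
  convert! h using 1
  · funext i
    rw [MagLattice.kerOp_heat hτ ht (B.mem_eigSub hτ i), inner_smul_right, B.inner_self, mul_one,
      ← ofReal_mul, ← Real.exp_add]
    congr 2; ring
  · have h1 : ∀ u, heat M.b t u * heat M.b t u =
        ((heatC M.b t ^ 2 : ℝ) : ℂ) * gau (2 * heatA M.b t) u := fun u => by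
      have : gau (2 * heatA M.b t) u = gau (heatA M.b t) u * gau (heatA M.b t) u := by
        rw [gau, gau, ← ofReal_mul, ← Real.exp_add]
        congr 2; ring
      rw [this, heat]
      push_cast
      ring
    simp only [h1]
    have hA := heatA_pos M.b_pos ht
    rw [integral_const_mul, integral_gau _ (by positivity), ← ofReal_mul, ← ofReal_mul]
    congr 2
    have hs := (sinh_bt_pos M.b_pos ht).ne'
    have hc := (Real.cosh_pos (M.b * t)).ne'
    have hb := M.b_pos.ne'
    have hp := pi_pos.ne'
    rw [mul_assoc 2, Real.sinh_two_mul]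
    unfold heatA heatC
    field_simp

end EigenBasis

/-! ## Traces of functions of the covariant Laplacian, and the density -/

/-- Two discrete measures on `[0, 1]` with proportional moments of order `≥ 1` are proportional. -/
lemma tsum_eq_of_moments {ι κ : Type} {x : ι → ℝ} {y : κ → ℝ} (hx : ∀ i, x i ∈ Icc (0 : ℝ) 1)
    (hy : ∀ i, y i ∈ Icc (0 : ℝ) 1) {c : ℝ} (hc : 0 ≤ c) (hxs : Summable x) (hys : Summable y)
    (hmom : ∀ n : ℕ, ∑' i, x i ^ (n + 1) = c * ∑' i, y i ^ (n + 1)) {h : ℝ → ℝ}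
    (hh : ContinuousOn h (Icc 0 1)) :
    (Summable fun i => x i * h (x i)) ∧ (Summable fun i => y i * h (y i)) ∧
    ∑' i, x i * h (x i) = c * ∑' i, y i * h (y i) := by
  have hsum : ∀ {α : Type} {z : α → ℝ}, (∀ i, z i ∈ Icc (0 : ℝ) 1) → Summable z →
      ∀ {g : ℝ → ℝ} {C : ℝ}, (∀ s ∈ Icc (0 : ℝ) 1, |g s| ≤ C) →
      Summable (fun i => z i * g (z i)) ∧ |∑' i, z i * g (z i)| ≤ C * ∑' i, z i := by
    intro α z hz hzs g C hg
    have h1 : ∀ i, ‖z i * g (z i)‖ ≤ C * z i := fun i => by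
      rw [norm_mul, norm_of_nonneg (hz i).1, norm_eq_abs, mul_comm]
      exact mul_le_mul_of_nonneg_right (hg _ (hz i)) (hz i).1
    refine ⟨(hzs.mul_left C).of_norm_bounded h1, ?_⟩
    rw [← tsum_mul_left]
    exact tsum_of_norm_bounded (hzs.mul_left C).hasSum h1
  obtain ⟨C, hC⟩ := isCompact_Icc.exists_bound_of_continuousOn hh
  have e1 := hsum hx hxs hC
  have e2 := hsum hy hys hC
  refine ⟨e1.1, e2.1, ?_⟩
  have hpoly : ∀ p : Polynomial ℝ, ∑' i, x i * p.eval (x i) = c * ∑' i, y i * p.eval (y i) := by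
    have hpe : ∀ {α : Type} {z : α → ℝ}, (∀ i, z i ∈ Icc (0 : ℝ) 1) → Summable z →
        ∀ p : Polynomial ℝ, ∑' i, z i * p.eval (z i) =
          ∑ n ∈ range (p.natDegree + 1), p.coeff n * ∑' i, z i ^ (n + 1) := by
      intro α z hz hzs p
      have h2 : ∀ n, Summable fun i => p.coeff n * z i ^ (n + 1) := fun n => by
        refine Summable.mul_left _ (hzs.of_nonneg_of_le (fun i => pow_nonneg (hz i).1 _) fun i => ?_)
        exact pow_le_of_le_one (hz i).1 (hz i).2 (by simp)
      simp only [← tsum_mul_left]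
      rw [← Summable.tsum_finsetSum (fun n _ => h2 n)]
      refine tsum_congr fun i => ?_
      rw [Polynomial.eval_eq_sum_range, mul_sum]
      refine sum_congr rfl fun n _ => ?_
      ring
    intro p
    rw [hpe hx hxs, hpe hy hys, mul_sum]
    refine sum_congr rfl fun n _ => ?_
    rw [hmom]
    ring
  have hD : ∀ ε > 0, |∑' i, x i * h (x i) - c * ∑' i, y i * h (y i)| ≤
      ε * (∑' i, x i + c * ∑' i, y i) := fun ε hε => by
    obtain ⟨p, hp⟩ := exists_polynomial_near_of_continuousOn 0 1 h hh ε hε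
    have hp' : ∀ s ∈ Icc (0 : ℝ) 1, |h s - p.eval s| ≤ ε := fun s hs => by
      rw [abs_sub_comm]; exact (hp s hs).le
    have hpC : ∃ C, ∀ s ∈ Icc (0 : ℝ) 1, |p.eval s| ≤ C :=
      isCompact_Icc.exists_bound_of_continuousOn p.continuous.continuousOn
    obtain ⟨C', hC'⟩ := hpC
    have d1 := (hsum hx hxs hp').2
    have d2 := (hsum hy hys hp').2
    simp only [mul_sub] at d1 d2
    rw [e1.1.tsum_sub (hsum hx hxs hC').1] at d1
    rw [e2.1.tsum_sub (hsum hy hys hC').1] at d2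
    rw [hpoly p] at d1
    have d3 : |c * (∑' i, y i * h (y i) - ∑' i, y i * p.eval (y i))| ≤ c * (ε * ∑' i, y i) := by
      rw [abs_mul, abs_of_nonneg hc]
      exact mul_le_mul_of_nonneg_left d2 hc
    rw [abs_le] at d1 d3 ⊢
    constructor <;> nlinarith
  have h0 : |∑' i, x i * h (x i) - c * ∑' i, y i * h (y i)| ≤ 0 := by
    set S := ∑' i, x i + c * ∑' i, y i
    have hS : 0 ≤ S := add_nonneg (tsum_nonneg fun i => (hx i).1)
      (mul_nonneg hc (tsum_nonneg fun i => (hy i).1))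
    refine le_of_forall_pos_le_add fun ε hε => ?_
    have := hD (ε / (S + 1)) (by positivity)
    refine this.trans ?_
    rw [zero_add, div_mul_eq_mul_div, div_le_iff₀ (by positivity)]
    nlinarith
  linarith [abs_nonpos_iff.1 h0]

lemma fermi_pos (h : ℝ) : 0 < fermi h := by unfold fermi; positivity

lemma fermi_lt_one (h : ℝ) : fermi h < 1 := by
  unfold fermi
  exact inv_lt_one_of_one_lt₀ (by linarith [exp_pos (2 * h)])

/-- A primitive of the Fermi function. -/
def fermiG (T x : ℝ) : ℝ := -(T / 2) * Real.log (1 + rexp (-(2 * x / T)))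

lemma hasDerivAt_fermiG {T : ℝ} (hT : 0 < T) (x : ℝ) :
    HasDerivAt (fermiG T) (fermi (x / T)) x := by
  have h1 : HasDerivAt (fun x => -(2 * x / T)) (-(2 * 1 / T)) x :=
    (((hasDerivAt_id x).const_mul 2).div_const T).neg
  have h2 := ((h1.exp.const_add 1).log (by positivity)).const_mul (-(T / 2))
  convert! h2 using 1
  unfold fermi
  rw [Real.exp_neg, ← mul_div_assoc]
  have := (exp_pos (2 * x / T)).ne'
  field_simp
  ring

lemma fermi_antitone : Antitone fermi := fun a b hab => by
  unfold fermi
  gcongr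

lemma fermiG_sub {T : ℝ} (hT : 0 < T) {x y : ℝ} (hxy : x ≤ y) :
    (y - x) * fermi (y / T) ≤ fermiG T y - fermiG T x ∧
    fermiG T y - fermiG T x ≤ (y - x) * fermi (x / T) := by
  rcases hxy.eq_or_lt with rfl | h
  · simp
  obtain ⟨c, hc, hcd⟩ := exists_hasDerivAt_eq_slope (fermiG T) (fun x => fermi (x / T)) h
    (fun z _ => (hasDerivAt_fermiG hT z).continuousAt.continuousWithinAt)
    (fun z _ => hasDerivAt_fermiG hT z)
  have hyx : 0 < y - x := by linarith
  rw [eq_div_iff hyx.ne', mul_comm] at hcd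
  rw [← hcd]
  constructor <;> refine mul_le_mul_of_nonneg_left (fermi_antitone ?_) hyx.le
  · exact div_le_div_of_nonneg_right hc.2.le hT.le
  · exact div_le_div_of_nonneg_right hc.1.le hT.le

lemma tendsto_fermiG {T : ℝ} (hT : 0 < T) : Tendsto (fermiG T) atTop (𝓝 0) := by
  have h1 : Tendsto (fun x : ℝ => rexp (-(2 * x / T))) atTop (𝓝 0) := by
    refine Real.tendsto_exp_neg_atTop_nhds_zero.comp ?_
    exact (tendsto_id.const_mul_atTop two_pos).atTop_div_const hT
  have h2 := ((h1.const_add 1).log (by norm_num)).const_mul (-(T / 2))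
  rw [show fermiG T = fun x => -(T / 2) * Real.log (1 + rexp (-(2 * x / T))) from rfl]
  simpa using h2

/-- Bounds on sums of the Fermi function over Landau levels. -/
lemma sum_fermi_landau {b T m : ℝ} (hb : 0 < b) (hT : 0 < T) (hm : 0 ≤ m)
    (hs : Summable fun n : ℕ => fermi ((b * (2 * n + 1) - m) / T)) :
    m - b ≤ 2 * b * ∑' n : ℕ, fermi ((b * (2 * n + 1) - m) / T) ∧
    2 * b * ∑' n : ℕ, fermi ((b * (2 * n + 1) - m) / T) ≤ m + b + T := by
  set p : ℕ → ℝ := fun n => b * (2 * n + 1) - m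
  have hp1 : ∀ n, p (n + 1) = p n + 2 * b := fun n => by simp only [p]; push_cast; ring
  have hlim : Tendsto (fun n => fermiG T (p n)) atTop (𝓝 0) := by
    refine (tendsto_fermiG hT).comp ?_
    refine tendsto_atTop_add_const_right _ _ (Tendsto.const_mul_atTop hb ?_)
    exact tendsto_atTop_add_const_right _ _
      (tendsto_natCast_atTop_atTop.const_mul_atTop two_pos)
  have hlim' : Tendsto (fun n => fermiG T (p n - 2 * b)) atTop (𝓝 0) := by
    refine (tendsto_fermiG hT).comp ?_
    refine tendsto_atTop_add_const_right _ (-(2 * b)) ?_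
    refine tendsto_atTop_add_const_right _ _ (Tendsto.const_mul_atTop hb ?_)
    exact tendsto_atTop_add_const_right _ _
      (tendsto_natCast_atTop_atTop.const_mul_atTop two_pos)
  have hpart := hs.hasSum.tendsto_sum_nat.const_mul (2 * b)
  constructor
  · have h1 : ∀ N : ℕ, fermiG T (p N) - fermiG T (p 0) ≤
        2 * b * ∑ n ∈ range N, fermi (p n / T) := fun N => by
      induction N with
      | zero => simp
      | succ N ih =>
        rw [sum_range_succ, mul_add]
        have := (fermiG_sub hT (show p N ≤ p (N + 1) by rw [hp1]; linarith)).2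
        have e : p (N + 1) - p N = 2 * b := by rw [hp1]; ring
        rw [e] at this
        linarith
    have h2 := le_of_tendsto_of_tendsto' (hlim.sub_const _) hpart h1
    refine le_trans ?_ h2
    have h3 : rexp (-(2 * p 0 / T)) ≤ 1 + rexp (-(2 * p 0 / T)) := by linarith
    have h4 := Real.log_le_log (exp_pos _) h3
    rw [Real.log_exp] at h4
    have h5 := mul_le_mul_of_nonneg_left h4 (half_pos hT).le
    have h6 : T / 2 * (-(2 * p 0 / T)) = -p 0 := by field_simp
    rw [h6] at h5
    have h7 : p 0 = b - m := by simp [p]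
    unfold fermiG
    linarith
  · have h1 : ∀ N : ℕ, 2 * b * ∑ n ∈ range N, fermi (p n / T) ≤
        fermiG T (p N - 2 * b) - fermiG T (p 0 - 2 * b) := fun N => by
      induction N with
      | zero => simp
      | succ N ih =>
        rw [sum_range_succ, mul_add]
        have := (fermiG_sub hT (show p N - 2 * b ≤ p N by linarith)).1
        have e : p N - (p N - 2 * b) = 2 * b := by ring
        rw [e] at this
        rw [hp1, add_sub_cancel_right]
        linarith
    have h2 := le_of_tendsto_of_tendsto' hpart (hlim'.sub_const _) h1
    refine h2.trans ?_
    have h7 : p 0 = b - m := by simp [p]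
    have h8 : 0 ≤ -(2 * (p 0 - 2 * b) / T) := by
      rw [h7, neg_nonneg]
      exact div_nonpos_of_nonpos_of_nonneg (by linarith) hT.le
    have h3 : 1 + rexp (-(2 * (p 0 - 2 * b) / T)) ≤
        rexp 1 * rexp (-(2 * (p 0 - 2 * b) / T)) := by
      have e1 := Real.one_le_exp h8
      have e2 := Real.add_one_le_exp 1
      nlinarith
    have h4 := Real.log_le_log (by positivity) h3
    rw [← Real.exp_add, Real.log_exp] at h4
    have h5 := mul_le_mul_of_nonneg_left h4 (half_pos hT).le
    have h6 : T / 2 * (1 + -(2 * (p 0 - 2 * b) / T)) = T / 2 - (p 0 - 2 * b) := by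
      field_simp
      ring
    rw [h6, h7] at h5
    unfold fermiG
    rw [h7]
    linarith

namespace EigenBasis
variable {M : MagLattice τ} (B : EigenBasis M)

/-- The sum of the Fermi function over the eigenvalues is a sum over Landau levels. -/
lemma sum_fermi (hτ : 0 < τ.im) {T : ℝ} (hT : 0 < T) (m : ℝ) :
    (Summable fun i => fermi ((B.lam i - m) / T)) ∧
    (Summable fun n : ℕ => fermi ((M.b * (2 * n + 1) - m) / T)) ∧
    ∑' i, fermi ((B.lam i - m) / T) = M.vol.real univ * (M.b / (2 * π)) *
      ∑' n : ℕ, fermi ((M.b * (2 * n + 1) - m) / T) := by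
  have hb := M.b_pos
  set x : B.ι → ℝ := fun i => rexp (-(2 * B.lam i / T))
  set y : ℕ → ℝ := fun n => rexp (-(2 * (M.b * (2 * n + 1)) / T))
  have hx : ∀ i, x i ∈ Icc (0 : ℝ) 1 := fun i => by
    refine ⟨(exp_pos _).le, exp_le_one_iff.2 ?_⟩
    have := B.lam_nonneg hτ i
    rw [neg_nonpos]; positivity
  have hy : ∀ i, y i ∈ Icc (0 : ℝ) 1 := fun n => by
    refine ⟨(exp_pos _).le, exp_le_one_iff.2 ?_⟩
    rw [neg_nonpos]; positivity
  have hxm : ∀ n : ℕ, HasSum (fun i => x i ^ (n + 1)) (M.vol.real univ *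
      (M.b / (4 * π * Real.sinh (2 * M.b * ((n + 1) / T))))) := by
    intro n
    convert! B.hasSum_heat hτ (t := (n + 1) / T) (by positivity) using 1
    funext i
    simp only [x]
    rw [← Real.exp_nat_mul]
    congr 1
    push_cast
    field_simp
  have hym : ∀ n : ℕ, HasSum (fun i => y i ^ (n + 1))
      (1 / (2 * Real.sinh (2 * M.b * ((n + 1) / T)))) := by
    intro n
    set s := 2 * M.b * ((n + 1 : ℝ) / T)
    have hs : 0 < s := by positivity
    have hr : rexp (-(2 * s)) < 1 := by
      rw [← Real.exp_zero]; exact Real.exp_lt_exp.2 (by linarith)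
    have h1 := (hasSum_geometric_of_lt_one (exp_pos (-(2 * s))).le hr).mul_left (rexp (-s))
    convert! h1 using 1
    · funext i
      simp only [y]
      rw [← Real.exp_nat_mul, ← Real.exp_nat_mul, ← Real.exp_add]
      congr 1
      simp only [s]
      push_cast
      field_simp
      ring
    · rw [Real.sinh_eq, Real.exp_neg, Real.exp_neg, two_mul s, Real.exp_add]
      have h2 : 1 < rexp s := Real.one_lt_exp_iff.2 hs
      have h3 : rexp s * rexp s - 1 ≠ 0 := by nlinarith
      have h4 : rexp s ≠ 0 := (exp_pos s).ne'
      have h5 : rexp s - (rexp s)⁻¹ ≠ 0 := by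
        intro h
        field_simp at h
        apply h3
        linarith
      have h6 : 1 - (rexp s * rexp s)⁻¹ ≠ 0 := by
        intro h
        field_simp at h
        apply h3
        linarith
      field_simp
  have h := tsum_eq_of_moments hx hy (c := M.vol.real univ * (M.b / (2 * π)))
    (by positivity) (by simpa using (hxm 0).summable) (by simpa using (hym 0).summable)
    (fun n => by
      rw [(hxm n).tsum_eq, (hym n).tsum_eq]
      have hs : 0 < Real.sinh (2 * M.b * ((n + 1 : ℝ) / T)) := sinh_pos_iff.2 (by positivity)
      have := pi_pos
      field_simp
      norm_num) (h := fun s => (s + rexp (-(2 * m / T)))⁻¹) (by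
      refine ContinuousOn.inv₀ (by fun_prop) fun s hs => ?_
      have := hs.1
      positivity)
  have key : ∀ l, rexp (-(2 * l / T)) * (rexp (-(2 * l / T)) + rexp (-(2 * m / T)))⁻¹
      = fermi ((l - m) / T) := by
    intro l
    have h1 : rexp (2 * ((l - m) / T)) = rexp (-(2 * m / T)) / rexp (-(2 * l / T)) := by
      rw [← Real.exp_sub]
      congr 1
      ring
    rw [fermi, h1]
    have := exp_pos (-(2 * l / T))
    have := exp_pos (-(2 * m / T))
    field_simp
  simpa only [x, y, key] using h

end EigenBasis

namespace EigenBasis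
variable {M : MagLattice τ} (B : EigenBasis M)

/-- `⟨e_i, Z e_i⟩` for the operator `Z` with kernel `K(x - y) e^{-i b/2 x ∧ y}` is `∫ K q_i`. -/
def q (i : B.ι) (u : ℂ) : ℂ := ∫ x, conj (B.f i x) * (ph M.b x (x - u) * B.f i (x - u)) ∂M.vol

lemma integral_norm_sq (hτ : 0 < τ.im) (i : B.ι) (u : ℂ) : ∫ x, ‖B.f i (x - u)‖ ^ 2 ∂M.vol = 1 := by
  have hs := B.isSection i
  have hc := hs.continuous
  have h0 := MagLattice.inner_toH_toH hτ hs hs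
  rw [B.toH_f, B.inner_self] at h0
  have h1 := M.integral_cell_add hτ (F := fun x => ((‖B.f i x‖ ^ 2 : ℝ) : ℂ))
    (Continuous.aestronglyMeasurable (by fun_prop))
    (fun m x => by simp only [hs.equi.norm m x]) (-u)
  rw [integral_complex_ofReal, integral_complex_ofReal] at h1
  have h2 : ∫ x, ‖B.f i x‖ ^ 2 ∂M.vol = 1 := by
    apply ofReal_injective
    rw [ofReal_one, h0, ← integral_complex_ofReal]
    refine integral_ext fun x => ?_
    rw [mul_comm (conj _), mul_conj, normSq_eq_norm_sq]
  rw [h2] at h1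
  simpa [sub_eq_add_neg] using ofReal_injective h1

lemma integrable_norm_sq (hτ : 0 < τ.im) (i : B.ι) (u : ℂ) :
    Integrable (fun x => ‖B.f i (x - u)‖ ^ 2) M.vol := by
  by_contra h
  have := B.integral_norm_sq hτ i u
  rw [integral_undef h] at this
  exact zero_ne_one this

lemma norm_q_le (hτ : 0 < τ.im) (i : B.ι) (u : ℂ) : ‖B.q i u‖ ≤ 1 := by
  have h0 := B.integral_norm_sq hτ i 0
  have h1 := B.integral_norm_sq hτ i u
  have i0 := B.integrable_norm_sq hτ i 0
  have i1 := B.integrable_norm_sq hτ i u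
  have h2 : ‖B.q i u‖ ≤ ∫ x, (‖B.f i (x - 0)‖ ^ 2 + ‖B.f i (x - u)‖ ^ 2) / 2 ∂M.vol := by
    refine norm_integral_le_of_norm_le ((i0.add i1).div_const 2)
      (.of_forall fun x => ?_)
    simp only [norm_mul, RCLike.norm_conj, norm_ph, one_mul, sub_zero]
    nlinarith [sq_nonneg (‖B.f i x‖ - ‖B.f i (x - u)‖)]
  rw [integral_div, integral_add i0 i1, h0, h1] at h2
  linarith

lemma continuous_q (hτ : 0 < τ.im) (i : B.ι) : Continuous (B.q i) := by
  have hs := B.isSection i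
  have hc := hs.continuous
  obtain ⟨C, hC0, hC⟩ := hs.equi.exists_bound hτ hc
  refine continuous_of_dominated (bound := fun _ => C * C)
    (fun u => Continuous.aestronglyMeasurable (by fun_prop))
    (fun u => Eventually.of_forall fun x => ?_) (integrable_const _)
    (.of_forall fun x => by fun_prop)
  simp only [norm_mul, RCLike.norm_conj, norm_ph, one_mul]
  exact mul_le_mul (hC _) (hC _) (norm_nonneg _) hC0

lemma integral_conj_conv (hτ : 0 < τ.im) (i : B.ι) {K : ℂ → ℂ} (hK : Integrable K) :
    ∫ x, conj (B.f i x) * M.conv K (B.f i) x ∂M.vol = ∫ u, K u * B.q i u := by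
  have hs := B.isSection i
  have hc := hs.continuous
  obtain ⟨C, hC0, hC⟩ := hs.equi.exists_bound hτ hc
  have h1 : ∀ x, conj (B.f i x) * M.conv K (B.f i) x =
      ∫ u, K u * (conj (B.f i x) * (ph M.b x (x - u) * B.f i (x - u))) := fun x => by
    rw [MagLattice.conv, ← integral_sub_left_eq_self _ _ x, ← integral_const_mul]
    refine integral_ext fun u => ?_
    simp only [sub_sub_cancel]
    ring
  have hi : Integrable (Function.uncurry fun x u =>
      K u * (conj (B.f i x) * (ph M.b x (x - u) * B.f i (x - u)))) (M.vol.prod volume) := by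
    refine Integrable.mono' (g := fun p : ℂ × ℂ => (C * C) * ‖K p.2‖)
      ((integrable_const (C * C)).mul_prod hK.norm) ?_ (.of_forall fun p => ?_)
    · refine hK.1.comp_snd.mul ?_
      exact Continuous.aestronglyMeasurable (by fun_prop)
    · obtain ⟨x, u⟩ := p
      simp only [Function.uncurry, norm_mul, RCLike.norm_conj, norm_ph, one_mul]
      rw [mul_comm]
      exact mul_le_mul_of_nonneg_right (mul_le_mul (hC _) (hC _) (norm_nonneg _) hC0)
        (norm_nonneg _)
  simp only [h1]
  rw [integral_integral_swap hi]
  simp only [integral_const_mul, q]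

lemma inner_kerOp_kerH (hτ : 0 < τ.im) (i : B.ι) {K : ℂ → ℂ} (hK : Nice K) :
    ⟪B.e i, M.kerOp (M.kerH K) (B.e i)⟫_ℂ = ∫ u, K u * B.q i u := by
  rw [← B.integral_conj_conv hτ i hK.integrable, ← B.toH_f, MagLattice.inner_toH hτ (B.isSection i)]
  refine integral_congr_ae ?_
  filter_upwards [MagLattice.kerOp_toH hτ hK (B.isSection i)] with x hx
  rw [hx]

lemma summable_exp (hτ : 0 < τ.im) {t : ℝ} (ht : 0 < t) :
    Summable fun i => rexp (-B.lam i * t) := by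
  convert! (B.hasSum_heat hτ (half_pos ht)).summable using 1
  funext i
  congr 1
  ring

include B in
lemma countable_ι (hτ : 0 < τ.im) : Countable B.ι := by
  have h := (B.summable_exp hτ one_pos).countable_support
  rw [Function.support_eq_univ fun i => (exp_pos _).ne'] at h
  exact Set.countable_univ_iff.1 h

lemma hasSum_integral_mul_q (hτ : 0 < τ.im) {t : ℝ} (ht : 0 < t) {K : ℂ → ℂ} (hK : Integrable K) :
    HasSum (fun i => (rexp (-B.lam i * t) : ℂ) * ∫ u, K u * B.q i u)
      (∫ u, K u * ∑' i, (rexp (-B.lam i * t) : ℂ) * B.q i u) := by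
  have hcount : Countable B.ι := B.countable_ι hτ
  have hbd : ∀ i u, ‖K u * ((rexp (-B.lam i * t) : ℂ) * B.q i u)‖ ≤
      rexp (-B.lam i * t) * ‖K u‖ := fun i u => by
    rw [norm_mul, norm_mul, norm_real, norm_of_nonneg (exp_pos _).le, mul_comm]
    exact mul_le_mul_of_nonneg_right (mul_le_of_le_one_right (exp_pos _).le
      (B.norm_q_le hτ i u)) (norm_nonneg _)
  have hint : ∀ i, Integrable fun u => K u * ((rexp (-B.lam i * t) : ℂ) * B.q i u) :=
    fun i => (hK.norm.const_mul _).mono' (hK.1.mul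
      (continuous_const.mul (B.continuous_q hτ i)).aestronglyMeasurable) (.of_forall (hbd i))
  have h := hasSum_integral_of_summable_integral_norm hint (by
    refine ((B.summable_exp hτ ht).mul_right (∫ u, ‖K u‖)).of_nonneg_of_le
      (fun i => integral_nonneg fun u => norm_nonneg _) fun i => ?_
    rw [← integral_const_mul]
    exact integral_mono (hint i).norm (hK.norm.const_mul _) (hbd i))
  simpa only [← tsum_mul_left, mul_left_comm (K _), integral_const_mul] using h

/-- The diagonal of the heat kernel in phase space. -/
lemma tsum_exp_mul_q (hτ : 0 < τ.im) {t : ℝ} (ht : 0 < t) :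
    (fun u => ∑' i, (rexp (-B.lam i * t) : ℂ) * B.q i u) =ᵐ[volume]
      fun u => (M.vol.real univ : ℂ) * heat M.b t u := by
  have hsum := B.summable_exp hτ ht
  have hcont : Continuous fun u => ∑' i, (rexp (-B.lam i * t) : ℂ) * B.q i u := by
    refine continuous_tsum (fun i => continuous_const.mul (B.continuous_q hτ i)) hsum fun i u => ?_
    rw [norm_mul, norm_real, norm_of_nonneg (exp_pos _).le]
    exact mul_le_of_le_one_right (exp_pos _).le (B.norm_q_le hτ i u)
  have hheat := (nice_heat M.b_pos ht).cont
  refine ae_eq_of_integral_contDiff_smul_eq hcont.locallyIntegrable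
    (Continuous.locallyIntegrable (by fun_prop)) fun g hg hgc => ?_
  have hL : Nice fun u => (g u : ℂ) :=
    Nice.of_compact (by have := hg.continuous; fun_prop) (hgc.comp_left (g := ofReal) rfl)
  have h1 := B.hasSum_heat_mul hτ ht hL
  simp only [B.inner_kerOp_kerH hτ _ hL] at h1
  simp only [real_smul]
  rw [(B.hasSum_integral_mul_q hτ ht hL.integrable).unique h1, ← integral_const_mul]
  refine integral_ext fun u => ?_
  ring

/-- The trace of an operator with kernel `K(x - y) e^{-i b/2 x ∧ y}` is `|Ω| K(0)`. -/
lemma tsum_eq_density (hτ : 0 < τ.im) {K : ℂ → ℂ} (hK : Integrable K) (hKc : ContinuousAt K 0)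
    {a : B.ι → ℝ} (ha : ∀ i, (a i : ℂ) = ∫ x, conj (B.f i x) * M.conv K (B.f i) x ∂M.vol)
    (hs : Summable a) : ((∑' i, a i : ℝ) : ℂ) = (M.vol.real univ : ℂ) * K 0 := by
  have hb := M.b_pos
  have hq : ∀ i, (a i : ℂ) = ∫ u, K u * B.q i u := fun i => by
    rw [ha, B.integral_conj_conv hτ i hK]
  have key : ∀ t, 0 < t → ∑' i, (rexp (-B.lam i * t) : ℂ) * (a i : ℂ) =
      (M.vol.real univ : ℂ) * ∫ u, K u * heat M.b t u := fun t ht => by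
    have h2 := B.hasSum_integral_mul_q hτ ht hK
    simp only [← hq] at h2
    rw [h2.tsum_eq, ← integral_const_mul]
    refine integral_congr_ae ?_
    filter_upwards [B.tsum_exp_mul_q hτ ht] with u hu
    rw [hu]
    ring
  -- both sides as `t → 0`
  have hpeak := tendsto_integral_comp_smul_smul_of_integrable' (μ := volume)
    (φ := fun z : ℂ => π⁻¹ * rexp (-1 * ‖z‖ ^ 2)) (fun z => by positivity) (by
      have h := integral_gau 1 one_pos
      have h2 : ∫ z, gau 1 z = ((∫ z : ℂ, rexp (-1 * ‖z‖ ^ 2) : ℝ) : ℂ) := by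
        rw [← integral_complex_ofReal]
        refine integral_ext fun z => ?_
        simp only [gau, normSq_eq_norm_sq]
      rw [h2] at h
      rw [integral_const_mul, ofReal_injective h]
      have := pi_pos
      field_simp) (by
      rw [finrank_real_complex]
      have h1 : Tendsto (fun s : ℝ => s ^ 1 * rexp (-s)) atTop (𝓝 0) :=
        Real.tendsto_pow_mul_exp_neg_atTop_nhds_zero 1
      have h2 : Tendsto (fun z : ℂ => ‖z‖ ^ 2) (Bornology.cobounded ℂ) atTop :=
        (tendsto_pow_atTop two_ne_zero).comp tendsto_norm_cobounded_atTop
      have h3 := (h1.comp h2).const_mul π⁻¹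
      rw [mul_zero] at h3
      refine h3.congr fun z => ?_
      simp only [Function.comp, pow_one, neg_mul, one_mul]
      ring) hK hKc
  have hR := hpeak.comp (Real.tendsto_sqrt_atTop.comp (tendsto_heatA hb))
  have hL : Tendsto (fun t => ∑' i, (rexp (-B.lam i * t) : ℂ) * (a i : ℂ))
      (𝓝[>] 0) (𝓝 (∑' i, (a i : ℂ))) := by
    refine tendsto_tsum_of_dominated_convergence hs.norm (fun i => ?_) ?_
    · exact (Continuous.tendsto' (by fun_prop) 0 _ (by simp)).mono_left nhdsWithin_le_nhds
    · filter_upwards [self_mem_nhdsWithin] with t ht i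
      have ht : 0 < t := ht
      have := B.lam_nonneg hτ i
      rw [norm_mul, norm_real, norm_real, norm_of_nonneg (exp_pos _).le]
      refine mul_le_of_le_one_left (norm_nonneg _) (exp_le_one_iff.2 ?_)
      nlinarith
  have hRt : Tendsto (fun t => (M.vol.real univ : ℂ) * ∫ u, K u * heat M.b t u)
      (𝓝[>] 0) (𝓝 ((M.vol.real univ : ℂ) * K 0)) := by
    refine Tendsto.const_mul _ ?_
    have h1 : Tendsto (fun t => (((Real.cosh (M.b * t))⁻¹ : ℝ) : ℂ))
        (𝓝[>] 0) (𝓝 ((1⁻¹ : ℝ) : ℂ)) :=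
      (continuous_ofReal.tendsto _).comp ((tendsto_cosh_bt M.b).inv₀ one_ne_zero)
    have h2 := h1.mul hR
    simp only [inv_one, ofReal_one, one_mul] at h2
    refine h2.congr' ?_
    filter_upwards [self_mem_nhdsWithin] with t ht
    have hA := heatA_pos hb ht
    simp only [Function.comp]
    rw [← integral_const_mul]
    refine integral_ext fun u => ?_
    have h3 : ‖√(heatA M.b t) • (0 - u)‖ ^ 2 = heatA M.b t * normSq u := by
      rw [zero_sub, norm_smul, norm_neg, mul_pow, norm_of_nonneg (sqrt_nonneg _),
        sq_sqrt hA.le, normSq_eq_norm_sq]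
    simp only [h3, finrank_real_complex, sq_sqrt hA.le]
    simp only [real_smul, heat, gau]
    have h5 : heatC M.b t = (Real.cosh (M.b * t))⁻¹ * (heatA M.b t * π⁻¹) := by
      have hs := (sinh_bt_pos hb ht).ne'
      have := pi_pos.ne'
      unfold heatA heatC
      field_simp
    rw [h5, neg_one_mul, neg_mul]
    push_cast
    ring
  rw [ofReal_tsum]
  refine tendsto_nhds_unique hL (hRt.congr' ?_)
  filter_upwards [self_mem_nhdsWithin] with t ht
  exact (key t ht).symm

end EigenBasis

/-! ## Normal states -/

namespace MagLattice.IsNormal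
variable {M : MagLattice τ} {v : ℂ → ℝ} {μ T : ℝ} {γ : M.H →L[ℂ] M.H} {k : ℂ → ℂ → ℂ}

/-- The chemical potential shifted by the direct self-interaction. -/
def _root_.BdG.chem (v : ℂ → ℝ) (μ : ℝ) (k : ℂ → ℂ → ℂ) : ℝ := μ - (k 0 0).re * ∫ x, v x

lemma kernel_eq (hN : M.IsNormal v μ T γ k) (x y : ℂ) : k x y = k (x - y) 0 * ph M.b x y := by
  have h := hN.mt_invariant y (x - y) 0
  rw [sub_add_cancel, zero_add] at h
  rw [h, ph, wedge_zero_right, wedge_sub_right, wedge_self, wedge_swap y x]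
  simp
  ring

lemma density_eq (hN : M.IsNormal v μ T γ k) : density k = fun _ => (k 0 0).re := by
  funext x
  rw [density, hN.kernel_eq x x, sub_self, ph, wedge_self]
  simp

lemma direct_eq (hN : M.IsNormal v μ T γ k) (x : ℂ) :
    direct v (density k) x - μ = -chem v μ k := by
  rw [direct, hN.density_eq, integral_mul_const, integral_sub_left_eq_self v volume x, chem]
  ring

lemma kernel_continuous (hN : M.IsNormal v μ T γ k) : Continuous fun z => k z 0 :=
  hN.continuous.comp (Continuous.prodMk_left 0)

lemma kernel_integrable (hN : M.IsNormal v μ T γ k) : Integrable fun z => k z 0 := by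
  refine hN.integrable.comp_neg.congr (.of_forall fun z => ?_)
  simp only
  rw [hN.kernel_eq 0 (-z)]
  simp [ph]

lemma oneBody_iff (hN : M.IsNormal v μ T γ k) (u f : M.H) : M.OneBody v μ k u f ↔
    ∀ φ, M.IsSection φ → ∫ x, conj (negLap (aB M.b) φ x + ((-chem v μ k : ℝ) : ℂ) * φ x) * u x ∂M.vol
      = ∫ x, conj (φ x) * f x ∂M.vol := by
  unfold OneBody Schr
  simp only [hN.direct_eq]

variable (B : EigenBasis M)

lemma oneBody_iff_inner (hτ : 0 < τ.im) (hN : M.IsNormal v μ T γ k) (u f : M.H) :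
    M.OneBody v μ k u f ↔ ∀ φ, M.IsSection φ →
      ⟪M.toH (negLap (aB M.b) φ), u⟫_ℂ - (chem v μ k : ℂ) * ⟪M.toH φ, u⟫_ℂ = ⟪M.toH φ, f⟫_ℂ := by
  rw [hN.oneBody_iff]
  refine forall₂_congr fun φ hφ => ?_
  have h : M.IsSection fun x => negLap (aB M.b) φ x + ((-chem v μ k : ℝ) : ℂ) * φ x :=
    hφ.negLap.add (hφ.const_mul _)
  rw [← inner_toH hτ h, ← inner_toH hτ hφ, toH_add hτ hφ.negLap (hφ.const_mul _),
    toH_const_mul hτ hφ, inner_add_left, inner_smul_left, conj_ofReal]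
  push_cast
  rw [neg_mul, ← sub_eq_add_neg]

lemma oneBody_e (hτ : 0 < τ.im) (hN : M.IsNormal v μ T γ k) (i : B.ι) :
    M.OneBody v μ k (B.e i) (((B.lam i - chem v μ k : ℝ) : ℂ) • B.e i) := by
  rw [hN.oneBody_iff_inner hτ]
  intro φ hφ
  rw [← B.toH_f i, inner_negLap hτ hφ (B.isSection i), funext (B.isEig i).2,
    toH_const_mul hτ (B.isSection i), inner_smul_right, inner_smul_right]
  push_cast
  ring

lemma inner_of_oneBody (hτ : 0 < τ.im) (hN : M.IsNormal v μ T γ k) {E : ℝ} {u : M.H}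
    (hu : M.OneBody v μ k u ((E : ℂ) • u)) (i : B.ι) (h : ⟪B.e i, u⟫_ℂ ≠ 0) :
    B.lam i - chem v μ k = E := by
  have h1 := (hN.oneBody_iff_inner hτ _ _).1 hu _ (B.isSection i)
  rw [funext (B.isEig i).2, toH_const_mul hτ (B.isSection i), inner_smul_left, inner_smul_right,
    conj_ofReal, B.toH_f] at h1
  have h2 : ((B.lam i - chem v μ k - E : ℝ) : ℂ) * ⟪B.e i, u⟫_ℂ = 0 := by
    push_cast
    linear_combination h1
  have h3 := (mul_eq_zero.1 h2).resolve_right h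
  linarith [ofReal_eq_zero.1 h3]

lemma gamma_e (hτ : 0 < τ.im) (hN : M.IsNormal v μ T γ k) (i : B.ι) :
    γ (B.e i) = ((fermi ((B.lam i - chem v μ k) / T) : ℝ) : ℂ) • B.e i :=
  hN.self_consistent _ _ (hN.oneBody_e B hτ i)

lemma hasSum_fermi (hτ : 0 < τ.im) (hT : 0 < T) (hN : M.IsNormal v μ T γ k) :
    HasSum (fun i => fermi ((B.lam i - chem v μ k) / T)) (M.vol.real univ * (k 0 0).re) := by
  have hs := (B.sum_fermi hτ hT (chem v μ k)).1
  have h := B.tsum_eq_density hτ hN.kernel_integrable hN.kernel_continuous.continuousAt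
    (a := fun i => fermi ((B.lam i - chem v μ k) / T)) (fun i => by
      have h1 := hN.kernel (B.f i) (B.e i) (B.isSection i) (B.coeFn_e hτ i)
      have h2 : ⟪B.e i, γ (B.e i)⟫_ℂ = ((fermi ((B.lam i - chem v μ k) / T) : ℝ) : ℂ) := by
        rw [hN.gamma_e B hτ, inner_smul_right, B.inner_self, mul_one]
      rw [← h2, ← B.toH_f i, inner_toH hτ (B.isSection i), B.toH_f i]
      refine integral_congr_ae ?_
      filter_upwards [h1] with x hx
      rw [hx, conv]
      simp only [hN.kernel_eq x]) hs
  have h2 := congrArg re h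
  rw [ofReal_re, re_ofReal_mul] at h2
  rw [← h2]
  exact hs.hasSum

lemma vol_pos (hτ : 0 < τ.im) : 0 < M.vol.real univ := by
  rw [measureReal_def, vol, Measure.restrict_apply_univ]
  exact ENNReal.toReal_pos (M.volume_cell_ne_zero hτ) M.volume_cell_lt_top.ne

lemma density_nonneg (hτ : 0 < τ.im) (hT : 0 < T) (hN : M.IsNormal v μ T γ k) :
    0 ≤ (k 0 0).re := by
  obtain ⟨B⟩ := nonempty_eigenBasis (M := M) hτ
  have h := (hN.hasSum_fermi B hτ hT).nonneg fun i => (fermi_pos _).le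
  exact (mul_nonneg_iff_of_pos_left (vol_pos hτ)).1 h

lemma density_bounds (hτ : 0 < τ.im) (hT : 0 < T) (hN : M.IsNormal v μ T γ k)
    (hm : 0 ≤ chem v μ k) :
    chem v μ k - M.b ≤ 4 * π * (k 0 0).re ∧
    4 * π * (k 0 0).re ≤ chem v μ k + M.b + T := by
  obtain ⟨B⟩ := nonempty_eigenBasis (M := M) hτ
  have h := (hN.hasSum_fermi B hτ hT).tsum_eq
  obtain ⟨-, h2, h3⟩ := B.sum_fermi hτ hT (chem v μ k)
  have h4 := sum_fermi_landau M.b_pos hT hm h2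
  rw [h, mul_assoc] at h3
  have h5 := mul_left_cancel₀ (vol_pos hτ).ne' h3
  have h6 : 4 * π * (k 0 0).re =
      2 * M.b * ∑' n : ℕ, fermi ((M.b * (2 * n + 1) - chem v μ k) / T) := by
    rw [h5]
    have := pi_pos
    field_simp
    ring
  rw [h6]
  exact h4

end MagLattice.IsNormal

/-- For weak fields and low temperatures the shifted chemical potential of a normal state stays
in a compact interval. -/
lemma exists_chem_bounds {μ : ℝ} (hμ : 0 < μ) {v : ℂ → ℝ} (hv : ∀ x, v x ≤ 0) :
    ∃ C, ∀ {τ : ℂ} (_ : 0 < τ.im) (M : MagLattice τ) (T : ℝ), M.b < μ / 2 → 0 < T → T < μ / 2 →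
      ∀ (γ : M.H →L[ℂ] M.H) (k : ℂ → ℂ → ℂ), M.IsNormal v μ T γ k →
        μ ≤ chem v μ k ∧ chem v μ k ≤ C := by
  set V := -∫ x, v x with hV
  have hV0 : 0 ≤ V := by
    rw [hV, ← integral_neg]
    exact integral_nonneg fun x => by simpa using hv x
  refine ⟨μ + 2 * μ / (4 * π - V) * V, fun hτ M T hb hT hT' γ k hN => ?_⟩
  have hd := hN.density_nonneg hτ hT
  have hm : chem v μ k = μ + (k 0 0).re * V := by rw [chem, hV]; ring
  have hm1 : μ ≤ chem v μ k := by rw [hm]; nlinarith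
  obtain ⟨h1, h2⟩ := hN.density_bounds hτ hT (hμ.le.trans hm1)
  rw [hm] at h1 h2
  have hpos : 0 < 4 * π - V := by
    by_contra h
    nlinarith
  refine ⟨hm1, ?_⟩
  rw [hm]
  have : (k 0 0).re ≤ 2 * μ / (4 * π - V) := by
    rw [le_div_iff₀ hpos]
    linarith
  nlinarith

/-! ## Operators diagonal in a Hilbert basis -/

section Diagonal

variable {ι H : Type*} [NormedAddCommGroup H] [InnerProductSpace ℂ H]

lemma hasSum_norm_sq (e : HilbertBasis ι ℂ H) (x : H) :
    HasSum (fun i => ‖⟪e i, x⟫_ℂ‖ ^ 2) (‖x‖ ^ 2) := by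
  have h := e.hasSum_inner_mul_inner x x
  have h2 := hasSum_re h
  convert h2 using 1
  · funext i
    rw [← inner_conj_symm x (e i), mul_comm, mul_conj, normSq_eq_norm_sq]
    norm_cast
  · rw [inner_self_eq_norm_sq_to_K]
    norm_cast

lemma ext_coeff (e : HilbertBasis ι ℂ H) {x y : H} (h : ∀ i, ⟪e i, x⟫_ℂ = ⟪e i, y⟫_ℂ) : x = y := by
  apply e.repr.injective
  ext i
  rw [e.repr_apply_apply, e.repr_apply_apply, h i]

/-- `D` is the diagonal operator with entries `a`. -/
def IsDiag (e : HilbertBasis ι ℂ H) (a : ι → ℂ) (D : H →L[ℂ] H) : Prop :=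
  ∀ i x, ⟪e i, D x⟫_ℂ = a i * ⟪e i, x⟫_ℂ

lemma norm_le_of_coeff (e : HilbertBasis ι ℂ H) {x y : H} {C : ℝ} (hC : 0 ≤ C)
    (h : ∀ i, ‖⟪e i, x⟫_ℂ‖ ≤ C * ‖⟪e i, y⟫_ℂ‖) : ‖x‖ ≤ C * ‖y‖ := by
  refine le_of_sq_le_sq ?_ (by positivity)
  rw [mul_pow]
  refine hasSum_le (fun i => ?_) (hasSum_norm_sq e x) ((hasSum_norm_sq e y).mul_left (C ^ 2))
  rw [← mul_pow]
  exact pow_le_pow_left₀ (norm_nonneg _) (h i) 2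

lemma IsDiag.norm_le {e : HilbertBasis ι ℂ H} {a : ι → ℂ} {D : H →L[ℂ] H} (hD : IsDiag e a D)
    {C : ℝ} (hC : 0 ≤ C) (h : ∀ i, ‖a i‖ ≤ C) : ‖D‖ ≤ C := by
  refine D.opNorm_le_bound hC fun x => norm_le_of_coeff e hC fun i => ?_
  rw [hD, norm_mul]
  exact mul_le_mul_of_nonneg_right (h i) (norm_nonneg _)

lemma exists_isDiag (e : HilbertBasis ι ℂ H) (a : ι → ℂ) {C : ℝ} (h : ∀ i, ‖a i‖ ≤ C) :
    ∃ D : H →L[ℂ] H, IsDiag e a D := by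
  have hm : ∀ x : H, Memℓp (fun i => a i * e.repr x i) 2 := fun x => by
    have h1 : Memℓp (fun i => (C : ℂ) * e.repr x i) 2 := (lp.memℓp (e.repr x)).const_mul (C : ℂ)
    refine Memℓp.mono (g := fun i => ‖(C : ℂ) * e.repr x i‖) (memℓp_norm_iff.2 h1) fun i => ?_
    rw [norm_mul, norm_mul]
    refine mul_le_mul_of_nonneg_right ((h i).trans ?_) (norm_nonneg _)
    simpa using le_abs_self C
  let L : H →ₗ[ℂ] H :=
    { toFun := fun x => e.repr.symm ⟨fun i => a i * e.repr x i, hm x⟩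
      map_add' := fun x y => by
        rw [← map_add]
        congr 1
        ext i
        simp [mul_add]
        rfl
      map_smul' := fun z x => by
        rw [RingHom.id_apply, ← map_smul]
        congr 1
        ext i
        simp
        ring }
  have hL : ∀ i x, ⟪e i, L x⟫_ℂ = a i * ⟪e i, x⟫_ℂ := fun i x => by
    rw [← e.repr_apply_apply, ← e.repr_apply_apply]
    simp [L]
  refine ⟨L.mkContinuous |C| fun x => norm_le_of_coeff e (abs_nonneg C) fun i => ?_, hL⟩
  rw [hL, norm_mul]
  exact mul_le_mul_of_nonneg_right ((h i).trans (le_abs_self C)) (norm_nonneg _)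

lemma IsDiag.apply_basis {e : HilbertBasis ι ℂ H} {a : ι → ℂ} {D : H →L[ℂ] H} (hD : IsDiag e a D)
    (i : ι) : D (e i) = a i • e i := by
  classical
  refine ext_coeff e fun j => ?_
  rw [hD, inner_smul_right, orthonormal_iff_ite.1 e.orthonormal]
  split_ifs with h <;> simp [h]

lemma IsDiag.of_apply_basis {e : HilbertBasis ι ℂ H} {a : ι → ℂ} {D : H →L[ℂ] H}
    (h : ∀ i, D (e i) = a i • e i) : IsDiag e a D := by
  classical
  intro i x
  have h1 := ((e.hasSum_repr x).mapL D).mapL (innerSL ℂ (e i))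
  have h2 := ((e.hasSum_repr x).mapL (innerSL ℂ (e i))).mul_left (a i)
  suffices hf : (fun j => innerSL ℂ (e i) (D (e.repr x j • e j))) =
      fun j => a i * innerSL ℂ (e i) (e.repr x j • e j) by
    rw [hf] at h1
    exact h1.unique h2
  funext j
  simp only [innerSL_apply_apply, map_smul, h,
    orthonormal_iff_ite.1 e.orthonormal]
  split_ifs with hij
  · rw [hij]; ring
  · ring

lemma IsDiag.inner_swap {e : HilbertBasis ι ℂ H} {a : ι → ℝ} {D : H →L[ℂ] H}
    (hD : IsDiag e (fun i => (a i : ℂ)) D) (x y : H) : ⟪D x, y⟫_ℂ = ⟪x, D y⟫_ℂ := by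
  rw [← e.tsum_inner_mul_inner (D x) y, ← e.tsum_inner_mul_inner x (D y)]
  refine tsum_congr fun i => ?_
  rw [hD i y, ← inner_conj_symm (D x), hD i x, map_mul, inner_conj_symm, conj_ofReal]
  ring

lemma IsDiag.isSelfAdjoint [CompleteSpace H] {e : HilbertBasis ι ℂ H} {a : ι → ℝ} {D : H →L[ℂ] H}
    (hD : IsDiag e (fun i => (a i : ℂ)) D) : IsSelfAdjoint D :=
  isSelfAdjoint_iff_isSymmetric.2 hD.inner_swap

lemma IsDiag.hasSum_inner {e : HilbertBasis ι ℂ H} {a : ι → ℝ} {D : H →L[ℂ] H}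
    (hD : IsDiag e (fun i => (a i : ℂ)) D) (x : H) :
    HasSum (fun i => a i * ‖⟪e i, x⟫_ℂ‖ ^ 2) (⟪x, D x⟫_ℂ).re := by
  have h2 := hasSum_re (e.hasSum_inner_mul_inner x (D x))
  convert h2 using 1
  funext i
  rw [hD, ← inner_conj_symm x (e i), mul_left_comm, mul_comm (conj _), mul_conj,
    normSq_eq_norm_sq]
  change _ = ((a i : ℂ) * ((‖⟪e i, x⟫_ℂ‖ ^ 2 : ℝ) : ℂ)).re
  rw [re_ofReal_mul, ofReal_re]

lemma IsDiag.isCompactOperator [CompleteSpace H] {e : HilbertBasis ι ℂ H} {a : ι → ℂ}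
    {D : H →L[ℂ] H} (hD : IsDiag e a D) (h : ∀ r > 0, {i | r ≤ ‖a i‖}.Finite) :
    IsCompactOperator D := by
  classical
  have hr : ∀ u w : H, IsCompactOperator ((toSpanSingleton ℂ u).comp
      (innerSL ℂ w)) := fun u w => by
    have h1 : IsCompactOperator (innerSL ℂ w) :=
      isCompactOperator_of_locallyCompactSpace_dom _
    exact h1.clm_comp (toSpanSingleton ℂ u)
  let A : Finset ι → H →L[ℂ] H := fun S => ∑ i ∈ S, a i •
    (toSpanSingleton ℂ (e i)).comp (innerSL ℂ (e i))
  have hA : ∀ S, IsCompactOperator (A S) := fun S => by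
    have hz : IsCompactOperator ((0 : H →L[ℂ] H)) := isCompactOperator_zero
    refine Finset.sum_induction _ (fun A : H →L[ℂ] H => IsCompactOperator A)
      (fun A B hA hB => hA.add hB) hz fun i _ => ?_
    exact (hr (e i) (e i)).smul (a i)
  have hAi : ∀ S i x, ⟪e i, A S x⟫_ℂ = (if i ∈ S then a i else 0) * ⟪e i, x⟫_ℂ := fun S i x => by
    simp only [A, _root_.sum_apply, inner_sum, _root_.smul_apply,
      ContinuousLinearMap.comp_apply, ContinuousLinearMap.toSpanSingleton_apply,
      inner_smul_right, innerSL_apply_apply, orthonormal_iff_ite.1 e.orthonormal]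
    simp only [mul_ite, mul_one, mul_zero, sum_ite_eq, ite_mul, zero_mul]
  have hc : IsClosed {A : H →L[ℂ] H | IsCompactOperator A} :=
    isClosed_setOfPred_isCompactOperator
  refine hc.closure_subset_iff.2 subset_rfl ?_
  rw [Metric.mem_closure_iff]
  intro r hr0
  refine ⟨A (h (r / 2) (by positivity)).toFinset, hA _, ?_⟩
  rw [dist_eq_norm]
  have hd : IsDiag e (fun i => if r / 2 ≤ ‖a i‖ then 0 else a i)
      (D - A (h (r / 2) (by positivity)).toFinset) := fun i x => by
    rw [_root_.sub_apply, inner_sub_right, hD, hAi]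
    simp only [Set.Finite.mem_toFinset, mem_ofPred_eq]
    split_ifs <;> ring
  refine (hd.norm_le (C := r / 2) (by positivity) fun i => ?_).trans_lt (by linarith)
  split_ifs with hi
  · simp; positivity
  · exact (not_le.1 hi).le

end Diagonal

section NegativeEigenvalue

variable {ι H : Type*} [NormedAddCommGroup H] [InnerProductSpace ℂ H] [CompleteSpace H]

lemma exists_eigenvector_norm [Nontrivial H] {S : H →L[ℂ] H} (hS : 0 ≤ S)
    (hc : IsCompactOperator S) (h0 : 0 < ‖S‖) : ∃ x : H, x ≠ 0 ∧ S x = (‖S‖ : ℂ) • x := by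
  have h1 : ‖S‖ ∈ spectrum ℝ S := CStarAlgebra.norm_mem_spectrum_of_nonneg hS
  have h2 : (‖S‖ : ℂ) ∈ spectrum ℂ S := spectrum.algebraMap_mem ℂ h1
  have h3 : ((‖S‖ : ℝ) : ℂ) ≠ 0 := by exact_mod_cast h0.ne'
  obtain ⟨x, hx⟩ := ((hc.hasEigenvalue_iff_mem_spectrum h3).2 h2).exists_hasEigenvector
  exact ⟨x, hx.2, hx.apply_eq_smul⟩

omit [CompleteSpace H] in
lemma norm_sq_le_inner_of_nonneg {S : H →L[ℂ] H} (hS : 0 ≤ S) {c : ℝ} (hc : 0 < c)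
    (h : ‖S‖ ≤ 1 / c) (z : H) : c * ‖S z‖ ^ 2 ≤ (⟪z, S z⟫_ℂ).re := by
  have hp := (nonneg_iff_isPositive S).1 hS
  have h1 := hp.re_inner_nonneg_right (z - (c : ℂ) • S z)
  have h2 : (⟪S z, S (S z)⟫_ℂ).re ≤ 1 / c * ‖S z‖ ^ 2 := by
    calc (⟪S z, S (S z)⟫_ℂ).re ≤ ‖S z‖ * ‖S (S z)‖ :=
          (re_le_norm _).trans (norm_inner_le_norm _ _)
      _ ≤ ‖S z‖ * (1 / c * ‖S z‖) := by
          gcongr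
          exact S.le_of_opNorm_le h _
      _ = _ := by ring
  have h3 : ⟪z, S (S z)⟫_ℂ = ((‖S z‖ ^ 2 : ℝ) : ℂ) := by
    rw [← hp.inner_left_eq_inner_right, inner_self_eq_norm_sq_to_K]
    norm_cast
  have h4 : ⟪S z, S z⟫_ℂ = ((‖S z‖ ^ 2 : ℝ) : ℂ) := by
    rw [inner_self_eq_norm_sq_to_K]
    norm_cast
  rw [map_sub, map_smul, inner_sub_left, inner_sub_right, inner_sub_right, inner_smul_left,
    inner_smul_left, inner_smul_right, inner_smul_right, h3, h4, conj_ofReal] at h1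
  simp only [RCLike.re_eq_complex_re, sub_re, re_ofReal_mul, ofReal_re] at h1
  have h5 : c * (c * (⟪S z, S (S z)⟫_ℂ).re) ≤ c * ‖S z‖ ^ 2 := by
    calc c * (c * (⟪S z, S (S z)⟫_ℂ).re) ≤ c * (c * (1 / c * ‖S z‖ ^ 2)) := by gcongr
      _ = _ := by field_simp
  linarith

/-- If the quadratic form of `K + V`, with `K` diagonal of compact resolvent, takes a negative
value on a finite combination of eigenvectors of `K`, then `K + V` has a negative eigenvalue. -/
theorem exists_neg_eigenvalue (e : HilbertBasis ι ℂ H) {κ : ι → ℝ} (hκ : ∀ i, 0 ≤ κ i)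
    (hfin : ∀ m : ℝ, {i | κ i ≤ m}.Finite) {V : H →L[ℂ] H} (hV : ∀ x y, ⟪V x, y⟫_ℂ = ⟪x, V y⟫_ℂ)
    (F : Finset ι) (c : ι → ℂ)
    (hneg : ∑ i ∈ F, κ i * ‖c i‖ ^ 2 +
      (⟪∑ i ∈ F, c i • e i, V (∑ i ∈ F, c i • e i)⟫_ℂ).re < 0) :
    ∃ E : ℝ, E < 0 ∧ ∃ x y : H, x ≠ 0 ∧ (∀ i, ⟪e i, y⟫_ℂ = κ i * ⟪e i, x⟫_ℂ) ∧
      y + V x = (E : ℂ) • x := by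
  classical
  set x₀ : H := ∑ i ∈ F, c i • e i with hx₀
  have hcoef : ∀ i, ⟪e i, x₀⟫_ℂ = if i ∈ F then c i else 0 := fun i => by
    rw [hx₀, inner_sum]
    simp [inner_smul_right, orthonormal_iff_ite.1 e.orthonormal]
  obtain ⟨C, hC0, hC⟩ : ∃ C : ℝ, 0 < C ∧ ‖V‖ < C := ⟨‖V‖ + 1, by positivity, by linarith⟩
  have hκC : ∀ i, 0 < κ i + C := fun i => by linarith [hκ i]
  let r : ι → ℝ := fun i => (√(κ i + C))⁻¹
  have hr0 : ∀ i, 0 < r i := fun i => inv_pos.2 (sqrt_pos.2 (hκC i))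
  have hr2 : ∀ i, r i * r i * (κ i + C) = 1 := fun i => by
    have := mul_self_sqrt (hκC i).le
    have h' := (sqrt_pos.2 (hκC i)).ne'
    simp only [r]
    field_simp
    rw [sq_sqrt (hκC i).le]
  have hrle : ∀ i, ‖((r i : ℝ) : ℂ)‖ ≤ (Real.sqrt C)⁻¹ := fun i => by
    rw [norm_real, norm_eq_abs, abs_of_pos (hr0 i)]
    exact inv_anti₀ (sqrt_pos.2 hC0) (Real.sqrt_le_sqrt (by linarith [hκ i]))
  obtain ⟨R, hR⟩ := exists_isDiag e (fun i => ((r i : ℝ) : ℂ)) hrle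
  have hRn : ‖R‖ ≤ (Real.sqrt C)⁻¹ := hR.norm_le (by positivity) hrle
  have hRc : IsCompactOperator R := hR.isCompactOperator fun ε hε => by
    refine (hfin ((ε ^ 2)⁻¹)).subset fun i hi => ?_
    simp only [mem_ofPred_eq, norm_real, norm_eq_abs, abs_of_pos (hr0 i)] at hi ⊢
    have h1 : ε ^ 2 ≤ r i * r i := by nlinarith [hr0 i]
    have h2 := hr2 i
    have h3 : ε ^ 2 * (κ i + C) ≤ 1 := by nlinarith [hκC i]
    rw [← one_div, le_div_iff₀ (by positivity)]
    nlinarith [sq_nonneg ε]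
  set W : H →L[ℂ] H := R ∘L V ∘L R with hW
  have hRsym := hR.inner_swap
  have hWsym : ∀ x y, ⟪W x, y⟫_ℂ = ⟪x, W y⟫_ℂ := fun x y => by
    simp only [hW, ContinuousLinearMap.comp_apply]
    rw [hRsym, hV, hRsym]
  have hWn : ‖W‖ < 1 := by
    calc ‖W‖ ≤ ‖R‖ * (‖V‖ * ‖R‖) :=
          (opNorm_comp_le _ _).trans
            (mul_le_mul_of_nonneg_left (opNorm_comp_le _ _) (norm_nonneg _))
      _ ≤ (Real.sqrt C)⁻¹ * (‖V‖ * (Real.sqrt C)⁻¹) := by gcongr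
      _ = ‖V‖ / C := by
          have := mul_self_sqrt hC0.le
          rw [div_eq_mul_inv, ← this, mul_inv, mul_self_sqrt hC0.le]; ring
      _ < 1 := by rw [div_lt_one hC0]; exact hC
  let u := Units.oneSub (-W) (by rwa [norm_neg])
  set U : H →L[ℂ] H := ↑u⁻¹ with hU
  have hu : (u : H →L[ℂ] H) = 1 + W := by simp [u]
  have hUl : ∀ x, U (x + W x) = x := fun x => by
    have h := u.inv_mul
    rw [hu] at h
    exact congrArg (fun A : H →L[ℂ] H => A x) h
  have hUr : ∀ x, U x + W (U x) = x := fun x => by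
    have h := u.mul_inv
    rw [hu] at h
    exact congrArg (fun A : H →L[ℂ] H => A x) h
  have hUsym : ∀ x y, ⟪U x, y⟫_ℂ = ⟪x, U y⟫_ℂ := fun x y => by
    conv_lhs => rw [← hUr y]
    conv_rhs => rw [← hUr x]
    rw [inner_add_left, inner_add_right, hWsym]
  set S : H →L[ℂ] H := R ∘L U ∘L R with hSdef
  have hSpos : 0 ≤ S := by
    rw [nonneg_iff_isPositive, isPositive_def']
    refine ⟨isSelfAdjoint_iff_isSymmetric.2 fun x y => ?_, fun x => ?_⟩
    · change ⟪R (U (R x)), y⟫_ℂ = ⟪x, R (U (R y))⟫_ℂ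
      rw [hRsym, hUsym, hRsym]
    · rw [reApplyInnerSelf_apply]
      change 0 ≤ (⟪R (U (R x)), x⟫_ℂ).re
      rw [hRsym]
      have h0 : ⟪U (R x), R x⟫_ℂ = ⟪U (R x), U (R x)⟫_ℂ + ⟪U (R x), W (U (R x))⟫_ℂ := by
        rw [← inner_add_right, hUr]
      rw [h0, add_re]
      have h1 : ‖⟪U (R x), W (U (R x))⟫_ℂ‖ ≤ ‖U (R x)‖ * ‖U (R x)‖ := by
        refine (norm_inner_le_norm _ _).trans ?_
        gcongr
        simpa using W.le_of_opNorm_le hWn.le (U (R x))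
      have h2 := Complex.abs_re_le_norm ⟪U (R x), W (U (R x))⟫_ℂ
      have h3 : (⟪U (R x), U (R x)⟫_ℂ).re = ‖U (R x)‖ * ‖U (R x)‖ :=
        inner_self_eq_norm_mul_norm (𝕜 := ℂ) _
      rw [h3]
      linarith [abs_le.1 (h2.trans h1)]
  have hSc : IsCompactOperator S := by
    rw [hSdef, ← ContinuousLinearMap.comp_assoc]
    exact hRc.clm_comp (R ∘L U)
  have hx₀0 : x₀ ≠ 0 := fun h => by
    have h0 : ∀ i ∈ F, c i = 0 := fun i hi => by
      have := hcoef i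
      rw [h, inner_zero_right, if_pos hi] at this
      exact this.symm
    rw [h, map_zero, inner_zero_right, zero_re, add_zero] at hneg
    refine hneg.not_ge (sum_nonneg fun i _ => mul_nonneg (hκ i) (by positivity))
  have : Nontrivial H := nontrivial_of_ne _ _ hx₀0
  have hbig : 1 / C < ‖S‖ := by
    by_contra hle
    rw [not_lt] at hle
    set p : H := ∑ i ∈ F, ((√(κ i + C) : ℂ) * c i) • e i
    have hpc : ∀ i, ⟪e i, p⟫_ℂ = if i ∈ F then (√(κ i + C) : ℂ) * c i else 0 :=
      fun i => by
        simp [p, orthonormal_iff_ite.1 e.orthonormal]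
    set z₁ : H := ∑ i ∈ F, (((κ i + C : ℝ) : ℂ) * c i) • e i
    have hz₁c : ∀ i, ⟪e i, z₁⟫_ℂ = if i ∈ F then ((κ i + C : ℝ) : ℂ) * c i else 0 :=
      fun i => by
        simp [z₁, orthonormal_iff_ite.1 e.orthonormal]
    have hRp : R p = x₀ := ext_coeff e fun i => by
      rw [hR, hpc, hcoef]
      split_ifs
      · rw [← mul_assoc, ← ofReal_mul, inv_mul_cancel₀ (sqrt_pos.2 (hκC i)).ne']
        simp
      · simp
    have hRz : R z₁ = p := ext_coeff e fun i => by
      rw [hR, hpc, hz₁c]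
      split_ifs
      · rw [← mul_assoc, ← ofReal_mul]
        congr 2
        have h' := sqrt_pos.2 (hκC i)
        simp only [r]
        rw [inv_mul_eq_iff_eq_mul₀ h'.ne', mul_self_sqrt (hκC i).le]
      · simp
    have hSz : S (z₁ + V x₀) = x₀ := by
      change R (U (R (z₁ + V x₀))) = x₀
      rw [map_add R, hRz, ← hRp]
      congr 1
      exact hUl p
    have h1 := norm_sq_le_inner_of_nonneg hSpos hC0 hle (z₁ + V x₀)
    rw [hSz, inner_add_left, add_re, hV] at h1
    have h2 : (⟪z₁, x₀⟫_ℂ).re = ∑ i ∈ F, κ i * ‖c i‖ ^ 2 + C * ‖x₀‖ ^ 2 := by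
      have h3 : ‖x₀‖ ^ 2 = ∑ i ∈ F, ‖c i‖ ^ 2 := by
        refine (hasSum_norm_sq e x₀).unique ?_
        have : (∑ i ∈ F, ‖c i‖ ^ 2) = ∑ i ∈ F, ‖⟪e i, x₀⟫_ℂ‖ ^ 2 :=
          sum_congr rfl fun i hi => by rw [hcoef, if_pos hi]
        rw [this]
        refine hasSum_sum_of_ne_finset_zero fun i hi => by
          rw [hcoef, if_neg hi]; simp
      rw [h3, mul_sum, ← sum_add_distrib, sum_inner, re_sum]
      refine sum_congr rfl fun i hi => ?_
      rw [inner_smul_left, hcoef, if_pos hi, map_mul, conj_ofReal, mul_assoc, mul_comm (conj _),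
        mul_conj, normSq_eq_norm_sq, ← ofReal_mul, ofReal_re]
      ring
    linarith
  have hs0 : 0 < ‖S‖ := lt_trans (by positivity) hbig
  obtain ⟨x, hx, hSx⟩ := exists_eigenvector_norm hSpos hSc hs0
  have hs0' : (‖S‖ : ℂ) ≠ 0 := by exact_mod_cast hs0.ne'
  refine ⟨1 / ‖S‖ - C, ?_, x, ((1 / ‖S‖ - C : ℝ) : ℂ) • x - V x, hx, fun i => ?_,
    sub_add_cancel _ _⟩
  · rw [sub_neg, one_div_lt hs0 hC0]
    exact hbig
  · have h1 := congrArg (fun y => ⟪e i, y⟫_ℂ) hSx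
    have h2 := congrArg (fun y => ⟪e i, y⟫_ℂ) (hUr (R x))
    have h4 : W (U (R x)) = R (V (S x)) := rfl
    rw [h4, hSx, map_smul, map_smul] at h2
    have h5 : S x = R (U (R x)) := rfl
    simp only [h5, hR i, inner_smul_right, inner_add_right] at h1 h2
    rw [inner_sub_right, inner_smul_right]
    have h3 : ((r i : ℝ) : ℂ) * r i * (κ i + C) = 1 := by exact_mod_cast hr2 i
    push_cast
    field_simp
    linear_combination (κ i + C : ℂ) * h1 - (κ i + C : ℂ) * r i * h2 +
      (‖S‖ * ⟪e i, V x⟫_ℂ - ⟪e i, x⟫_ℂ) * h3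

end NegativeEigenvalue

/-! ## Functions and traces of diagonal operators -/

section Cfc

variable {H : Type*} [NormedAddCommGroup H] [InnerProductSpace ℂ H]

lemma aeval_apply_eigenvector (p : Polynomial ℝ) {A : H →L[ℂ] H} {x : H} {l : ℝ}
    (h : A x = (l : ℂ) • x) : Polynomial.aeval A p x = ((p.eval l : ℝ) : ℂ) • x := by
  induction p using Polynomial.induction_on' with
  | add p q hp hq =>
    rw [map_add, _root_.add_apply, hp, hq, Polynomial.eval_add, ← add_smul]
    push_cast
    rfl
  | monomial n a =>
    have hn : ∀ n : ℕ, (A ^ n) x = ((l ^ n : ℝ) : ℂ) • x := fun n => by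
      induction n with
      | zero => simp
      | succ n ih =>
        rw [pow_succ', mul_apply_eq_comp, ih, map_smul, h, smul_smul, pow_succ]
        push_cast
        rfl
    rw [Polynomial.aeval_monomial, Polynomial.eval_monomial, mul_apply_eq_comp, hn,
      Algebra.algebraMap_eq_smul_one, _root_.smul_apply,
      one_apply_eq_self, ← coe_smul, smul_smul]
    push_cast
    rfl

lemma cfc_apply_eigenvector [CompleteSpace H] {f : ℝ → ℝ} (hf : Continuous f) {A : H →L[ℂ] H}
    (hA : IsSelfAdjoint A) {x : H} {l : ℝ} (h : A x = (l : ℂ) • x) :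
    cfc f A x = ((f l : ℝ) : ℂ) • x := by
  by_cases hx : x = 0
  · simp [hx]
  have : Nontrivial H := nontrivial_of_ne _ _ hx
  have hl : l ∈ Icc (-‖A‖) ‖A‖ := by
    have h1 := A.le_opNorm x
    rw [h, norm_smul, norm_real, norm_eq_abs] at h1
    exact abs_le.1 (le_of_mul_le_mul_right h1 (norm_pos_iff.2 hx))
  have hs : ∀ y ∈ spectrum ℝ A, y ∈ Icc (-‖A‖) ‖A‖ := fun y hy =>
    abs_le.1 (spectrum.norm_le_norm_of_mem hy)
  rw [← sub_eq_zero, ← norm_le_zero_iff]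
  refine le_of_forall_pos_le_add fun r hr => ?_
  obtain ⟨p, hp⟩ := exists_polynomial_near_of_continuousOn (-‖A‖) ‖A‖ f hf.continuousOn
    (r / (2 * ‖x‖)) (div_pos hr (by positivity))
  have h1 : ‖cfc f A - Polynomial.aeval A p‖ ≤ r / (2 * ‖x‖) := by
    rw [← cfc_polynomial p A hA, ← cfc_sub f p.eval A hf.continuousOn p.continuous.continuousOn]
    refine norm_cfc_le (by positivity) fun y hy => ?_
    rw [norm_eq_abs, abs_sub_comm]
    exact (hp y (hs y hy)).le
  have h2 : cfc f A x - ((f l : ℝ) : ℂ) • x = (cfc f A - Polynomial.aeval A p) x +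
      ((p.eval l - f l : ℝ) : ℂ) • x := by
    rw [_root_.sub_apply, aeval_apply_eigenvector p h]
    push_cast
    module
  rw [h2, zero_add]
  refine (norm_add_le _ _).trans ?_
  rw [norm_smul, norm_real, norm_eq_abs]
  have h3 := (cfc f A - Polynomial.aeval A p).le_of_opNorm_le h1 x
  have h4 := mul_le_mul_of_nonneg_right (hp l hl).le (norm_nonneg x)
  have h5 : r / (2 * ‖x‖) * ‖x‖ = r / 2 := by field_simp
  linarith

lemma IsDiag.cfc [CompleteSpace H] {ι : Type*} {e : HilbertBasis ι ℂ H} {a : ι → ℝ}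
    {D : H →L[ℂ] H} (hD : IsDiag e (fun i => (a i : ℂ)) D) {f : ℝ → ℝ} (hf : Continuous f) :
    IsDiag e (fun i => ((f (a i) : ℝ) : ℂ)) (cfc f D) :=
  IsDiag.of_apply_basis fun i => cfc_apply_eigenvector hf hD.isSelfAdjoint (hD.apply_basis i)

end Cfc

lemma IsDiag.hasTrace {ι E : Type} [NormedAddCommGroup E] [InnerProductSpace ℂ E]
    {e : HilbertBasis ι ℂ E} {a : ι → ℂ} {D : E →L[ℂ] E} (hD : IsDiag e a D) {t : ℂ}
    (ha : HasSum a t) : HasTrace D t := by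
  intro ι' g
  have hterm : ∀ j i, ‖a i * (‖⟪g j, e i⟫_ℂ‖ ^ 2 : ℝ)‖ = ‖a i‖ * ‖⟪g j, e i⟫_ℂ‖ ^ 2 := fun j i => by
    rw [norm_mul, norm_real, norm_eq_abs, abs_of_nonneg (by positivity)]
  have hcol : ∀ i, HasSum (fun j => ‖⟪g j, e i⟫_ℂ‖ ^ 2) 1 := fun i => by
    simpa [e.orthonormal.1 i] using hasSum_norm_sq g (e i)
  have hs : Summable fun p : ι × ι' => a p.1 * ((‖⟪g p.2, e p.1⟫_ℂ‖ ^ 2 : ℝ) : ℂ) := by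
    refine Summable.of_norm ?_
    refine (summable_prod_of_nonneg fun p => norm_nonneg _).2 ⟨fun i => ?_, ?_⟩
    · simp only [hterm]
      exact ((hcol i).mul_left _).summable
    · simp only [hterm, tsum_mul_left, (hcol _).tsum_eq, mul_one]
      exact ha.summable.norm
  have h1 : HasSum (fun p : ι × ι' => a p.1 * ((‖⟪g p.2, e p.1⟫_ℂ‖ ^ 2 : ℝ) : ℂ)) t := by
    have h2 := hs.hasSum.prod_fiberwise fun i => (hasSum_ofReal.2 (hcol i)).mul_left (a i)
    simp only [ofReal_one, mul_one] at h2
    rw [ha.unique h2]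
    exact hs.hasSum
  have h3 := (Equiv.prodComm ι' ι).hasSum_iff.2 h1
  refine h3.prod_fiberwise fun j => ?_
  have h4 := e.hasSum_inner_mul_inner (g j) (D (g j))
  suffices hf : (fun i => ⟪g j, e i⟫_ℂ * ⟪e i, D (g j)⟫_ℂ) =
      fun i => a i * ((‖⟪g j, e i⟫_ℂ‖ ^ 2 : ℝ) : ℂ) by
    rw [hf] at h4
    exact h4
  funext i
  rw [hD, ← inner_conj_symm (e i) (g j), mul_left_comm, mul_conj, normSq_eq_norm_sq]

/-! ## The entropy of perturbed diagonal matrices -/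

section Klein

open Matrix

lemma mul_log_le {x d : ℝ} (hx : 0 ≤ x) (hd : 0 < d) :
    -negMulLog x ≤ -negMulLog d + (Real.log d + 1) * (x - d) + (x - d) ^ 2 / d := by
  rcases hx.eq_or_lt with rfl | hx
  · simp only [negMulLog]
    have : (0 - d) ^ 2 / d = d := by field_simp; ring
    rw [this]
    nlinarith
  have h := Real.log_le_sub_one_of_pos (div_pos hx hd)
  rw [Real.log_div hx.ne' hd.ne'] at h
  have h2 := mul_le_mul_of_nonneg_left h hx.le
  have h3 : (x - d) ^ 2 / d = x * (x / d) - 2 * x + d := by field_simp; ring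
  rw [h3, negMulLog, negMulLog]
  nlinarith

variable {n : Type*} [Fintype n] [DecidableEq n]

/-- Klein's inequality with a quadratic remainder. -/
lemma sum_negMulLog_le {d x : n → ℝ} (hd : ∀ a, 0 < d a) (hx : ∀ a, 0 ≤ x a)
    {Δ U : Matrix n n ℂ} (hU : U ∈ unitaryGroup n ℂ)
    (h : diagonal (fun a => (d a : ℂ)) + Δ = U * diagonal (fun a => (x a : ℂ)) * star U) :
    -∑ c, negMulLog (x c) ≤ -∑ a, negMulLog (d a) +
      ∑ a, ((Real.log (d a) + 1) * (Δ a a).re + (∑ b, ‖Δ a b‖ ^ 2) / d a) := by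
  have hU1 : U * star U = 1 := mem_unitaryGroup_iff.1 hU
  have hU2 : star U * U = 1 := mem_unitaryGroup_iff'.1 hU
  have hrow : ∀ a, ∑ c, ‖U a c‖ ^ 2 = 1 := fun a => by
    have h1 := congrFun (congrFun hU1 a) a
    rw [mul_apply, one_apply_eq] at h1
    have h2 : ∀ c, U a c * (star U) c a = ((‖U a c‖ ^ 2 : ℝ) : ℂ) := fun c => by
      rw [star_apply, ← normSq_eq_norm_sq, ← mul_conj]; rfl
    simp only [h2] at h1
    exact_mod_cast h1
  have hcol : ∀ c, ∑ a, ‖U a c‖ ^ 2 = 1 := fun c => by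
    have h1 := congrFun (congrFun hU2 c) c
    rw [mul_apply, one_apply_eq] at h1
    have h2 : ∀ a, (star U) c a * U a c = ((‖U a c‖ ^ 2 : ℝ) : ℂ) := fun a => by
      rw [star_apply, ← normSq_eq_norm_sq, ← mul_conj, mul_comm]; rfl
    simp only [h2] at h1
    exact_mod_cast h1
  have hΔ : ∀ a b, Δ a b = ∑ c, U a c * ((x c - d a : ℝ) : ℂ) * conj (U b c) := fun a b => by
    have h1 := congrFun (congrFun h a) b
    have h2 := congrFun (congrFun hU1 a) b
    rw [mul_apply] at h1 h2
    simp only [mul_diagonal, Matrix.add_apply, star_apply] at h1 h2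
    have h3 : Δ a b = (∑ c, U a c * (x c : ℂ) * star (U b c)) - diagonal (fun a => (d a : ℂ)) a b := by
      rw [← h1]; ring
    have h4 : diagonal (fun a => (d a : ℂ)) a b = ∑ c, d a * (U a c * star (U b c)) := by
      rw [← mul_sum, h2, diagonal_apply, one_apply]
      split_ifs <;> simp
    rw [h3, h4, ← sum_sub_distrib]
    refine sum_congr rfl fun c _ => ?_
    push_cast
    change _ = U a c * (x c - d a) * star (U b c)
    ring
  have hfirst : ∀ a, (Δ a a).re = ∑ c, ‖U a c‖ ^ 2 * (x c - d a) := fun a => by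
    rw [hΔ a a, re_sum]
    refine sum_congr rfl fun c _ => ?_
    rw [mul_right_comm, mul_conj, normSq_eq_norm_sq, ← ofReal_mul,
      ofReal_re]
  have hsecond : ∀ a, ∑ b, ‖Δ a b‖ ^ 2 = ∑ c, ‖U a c‖ ^ 2 * (x c - d a) ^ 2 := fun a => by
    let G : Matrix n n ℂ := U * diagonal (fun c => ((x c - d a : ℝ) : ℂ))
    have hGe : ∀ b c, G b c = U b c * ((x c - d a : ℝ) : ℂ) := fun b c => mul_diagonal _ _ _ _
    have hG : ∀ b, (G * star U) a b = Δ a b := fun b => by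
      rw [mul_apply, hΔ]
      exact sum_congr rfl fun c _ => by rw [hGe]; rfl
    have h1 : (G * star U) * star (G * star U) = G * star G := by
      rw [star_mul, star_star, Matrix.mul_assoc, ← Matrix.mul_assoc (star U), hU2, Matrix.one_mul]
    have hdiag : ∀ X : Matrix n n ℂ, (X * star X) a a = ((∑ b, ‖X a b‖ ^ 2 : ℝ) : ℂ) := fun X => by
      rw [mul_apply]
      push_cast
      refine sum_congr rfl fun c _ => ?_
      rw [star_apply, ← ofReal_pow, ← normSq_eq_norm_sq, ← mul_conj]; rfl
    have h2 := congrFun (congrFun h1 a) a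
    rw [hdiag, hdiag] at h2
    have h3 := ofReal_injective h2
    simp only [hG] at h3
    rw [h3]
    refine sum_congr rfl fun c _ => ?_
    rw [hGe, norm_mul, mul_pow, norm_real, norm_eq_abs, sq_abs]
  have hL : -∑ c, negMulLog (x c) = ∑ a, ∑ c, ‖U a c‖ ^ 2 * -negMulLog (x c) := by
    rw [sum_comm]
    simp_rw [← sum_mul, hcol, one_mul, sum_neg_distrib]
  have hR : ∀ a, ∑ c, ‖U a c‖ ^ 2 * (-negMulLog (d a) + (Real.log (d a) + 1) * (x c - d a) +
      (x c - d a) ^ 2 / d a) = -negMulLog (d a) + ((Real.log (d a) + 1) * (Δ a a).re +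
      (∑ b, ‖Δ a b‖ ^ 2) / d a) := fun a => by
    rw [hsecond, hfirst, mul_sum, sum_div]
    have : -negMulLog (d a) = ∑ c, ‖U a c‖ ^ 2 * -negMulLog (d a) := by
      rw [← sum_mul, hrow, one_mul]
    conv_rhs => rw [this]
    rw [← sum_add_distrib, ← sum_add_distrib]
    exact sum_congr rfl fun c _ => by ring
  rw [hL, ← sum_neg_distrib, ← sum_add_distrib]
  refine sum_le_sum fun a _ => ?_
  rw [← hR a]
  exact sum_le_sum fun c _ =>
    mul_le_mul_of_nonneg_left (mul_log_le (hx c) (hd a)) (by positivity)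

end Klein

section Perturb

open Matrix

/-- Second order perturbation of the entropy of a positive diagonal matrix. -/
theorem entropy_perturb {n : Type*} [Fintype n] [DecidableEq n] {d : n → ℝ} (hd : ∀ a, 0 < d a)
    {B : Matrix n n ℂ} (hB : B.IsHermitian) (hBd : ∀ a b, d a = d b → B a b = 0) {σ : ℝ}
    (hσ : ∑ a, ∑ b, ‖B a b‖ ^ 2 * ((Real.log (d a) + 1) / (d a - d b)) < σ) :
    ∃ ε₀ > 0, ∀ ε : ℝ, |ε| < ε₀ → ∀ (x : n → ℝ) (W : Matrix n n ℂ), W ∈ unitaryGroup n ℂ →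
      (∀ a, 0 ≤ x a) →
      diagonal (fun a => (d a : ℂ)) + (ε : ℂ) • B = W * diagonal (fun a => (x a : ℂ)) * star W →
      -∑ c, negMulLog (x c) ≤ -∑ a, negMulLog (d a) + ε ^ 2 * σ := by
  let D : Matrix n n ℂ := diagonal (fun a => (d a : ℂ))
  let Y : Matrix n n ℂ := Matrix.of fun a b => B a b / ((2 * (d b - d a) : ℝ) : ℂ)
  have hBs : ∀ a b, star (B b a) = B a b := fun a b => hB.apply a b
  have hYs : star Y = -Y := by
    ext a b
    simp only [star_apply, Y, of_apply, Matrix.neg_apply]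
    rw [star_div₀, hBs, star_def, conj_ofReal, ← div_neg]
    congr 1
    push_cast
    ring
  have hYD : Y * D - D * Y = (1 / 2 : ℂ) • B := by
    ext a b
    simp only [D, Matrix.sub_apply, mul_diagonal, diagonal_mul, Matrix.smul_apply, Y, of_apply,
      smul_eq_mul]
    by_cases h : d a = d b
    · simp [hBd a b h, h]
    · have h1 : ((d b : ℂ) - d a) ≠ 0 := by
        rw [← ofReal_sub, ofReal_ne_zero, sub_ne_zero]
        exact fun h' => h h'.symm
      push_cast
      field_simp
  let P : ℝ → Matrix n n ℂ := fun ε => 1 + (ε : ℂ) • Y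
  let N : ℝ → Matrix n n ℂ := fun ε => 1 - (ε : ℂ) • Y
  let Z : ℝ → Matrix n n ℂ := fun ε => B * Y - Y * B - (ε : ℂ) • (Y * B * Y)
  let Ψ : ℝ → Matrix n n ℂ := fun ε => (P ε)⁻¹ * Z ε * (N ε)⁻¹
  have hPc : Continuous P := by fun_prop
  have hNc : Continuous N := by fun_prop
  have hZc : Continuous Z := by fun_prop
  have hP0 : P 0 = 1 := by simp [P]
  have hN0 : N 0 = 1 := by simp [N]
  have hinv : ContinuousAt (fun A : Matrix n n ℂ => A⁻¹) 1 := by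
    refine continuousAt_matrix_inv _ ?_
    rw [det_one, Ring.inverse_eq_inv']
    exact continuousAt_inv₀ one_ne_zero
  have hPi : ContinuousAt (fun ε => (P ε)⁻¹) 0 :=
    ContinuousAt.comp (g := fun A : Matrix n n ℂ => A⁻¹) (by rw [hP0]; exact hinv) hPc.continuousAt
  have hNi : ContinuousAt (fun ε => (N ε)⁻¹) 0 :=
    ContinuousAt.comp (g := fun A : Matrix n n ℂ => A⁻¹) (by rw [hN0]; exact hinv) hNc.continuousAt
  have hΨc : ContinuousAt Ψ 0 := (hPi.mul hZc.continuousAt).mul hNi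
  have hΨab : ∀ a b, ContinuousAt (fun ε => Ψ ε a b) 0 := fun a b =>
    ContinuousAt.comp (g := fun A : Matrix n n ℂ => A a b)
      (continuous_id.matrix_elem a b).continuousAt hΨc
  let Φ : ℝ → ℝ := fun ε => ∑ a, ((Real.log (d a) + 1) * (Ψ ε a a).re +
    ε ^ 2 * ((∑ b, ‖Ψ ε a b‖ ^ 2) / d a))
  have hΦc : ContinuousAt Φ 0 := by
    refine tendsto_finsetSum _ fun a _ => ?_
    refine ContinuousAt.add (continuousAt_const.mul
      (continuous_re.continuousAt.comp (hΨab a a))) ?_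
    refine ContinuousAt.mul (by fun_prop) (ContinuousAt.div_const ?_ _)
    exact tendsto_finsetSum _ fun b _ => ((hΨab a b).norm.pow 2)
  have hΦ0 : Φ 0 < σ := by
    refine lt_of_eq_of_lt ?_ hσ
    refine sum_congr rfl fun a _ => ?_
    have h1 : Ψ 0 a a = ∑ b, ((‖B a b‖ ^ 2 / (d a - d b) : ℝ) : ℂ) := by
      have hΨ0 : Ψ 0 = B * Y - Y * B := by
        simp only [Ψ, Z, hP0, hN0, inv_one, ofReal_zero, zero_smul, sub_zero]
        rw [Matrix.one_mul, Matrix.mul_one]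
      rw [hΨ0, Matrix.sub_apply, mul_apply, mul_apply, ← sum_sub_distrib]
      refine sum_congr rfl fun b _ => ?_
      have h2 : B a b * B b a = ((‖B a b‖ ^ 2 : ℝ) : ℂ) := by
        rw [← hBs b a, ← normSq_eq_norm_sq, ← mul_conj]; rfl
      simp only [Y, of_apply]
      by_cases h : d a = d b
      · simp [hBd a b h, h]
      · rw [← mul_div_assoc, h2, div_mul_eq_mul_div, h2]
        have h1 : ((d b : ℂ) - d a) ≠ 0 := by
          rw [← ofReal_sub, ofReal_ne_zero, sub_ne_zero]
          exact fun h' => h h'.symm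
        have h3 : ((d a : ℂ) - d b) ≠ 0 := by rwa [← neg_sub, neg_ne_zero]
        push_cast
        field_simp
        ring
    rw [h1, re_sum]
    simp only [ofReal_re]
    rw [mul_sum]
    simp only [ne_eq, OfNat.ofNat_ne_zero, not_false_eq_true, zero_pow, zero_mul, add_zero]
    exact sum_congr rfl fun b _ => by ring
  have hdet : ∀ Q : ℝ → Matrix n n ℂ, Continuous Q → Q 0 = 1 → ∀ᶠ ε in 𝓝 0, IsUnit (Q ε).det :=
    fun Q hQ h0 => by
      have h1 : ContinuousAt (fun ε => (Q ε).det) 0 := hQ.matrix_det.continuousAt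
      have h2 := h1.eventually_ne (y := 0) (by simp [h0])
      filter_upwards [h2] with ε hε using isUnit_iff_ne_zero.2 hε
  have hev := (hΦc.eventually_lt_const hΦ0).and ((hdet P hPc hP0).and (hdet N hNc hN0))
  obtain ⟨ε₀, hε₀, hev⟩ := Metric.eventually_nhds_iff.1 hev
  refine ⟨ε₀, hε₀, fun ε hε x W hW hx hA => ?_⟩
  obtain ⟨h1, hPu, hNu⟩ := hev (y := ε) (by simpa using hε)
  have hPs : star (P ε) = N ε := by
    simp only [P, N, star_add, star_one, star_smul, hYs, star_def, conj_ofReal, smul_neg,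
      sub_eq_add_neg]
  have hNs : star (N ε) = P ε := by rw [← hPs, star_star]
  have hcomm : P ε * N ε = N ε * P ε := by
    simp only [P, N, Matrix.add_mul, Matrix.sub_mul, Matrix.mul_add, Matrix.mul_sub, Matrix.one_mul,
      Matrix.mul_one]
    abel
  set A : Matrix n n ℂ := D + (ε : ℂ) • B with hAdef
  have hconj : P ε * (D + ((ε : ℂ) ^ 2) • Ψ ε) * N ε = N ε * A * P ε := by
    have h2 : P ε * (((ε : ℂ) ^ 2) • Ψ ε) * N ε = ((ε : ℂ) ^ 2) • Z ε := by
      simp only [Ψ, Matrix.mul_smul, Matrix.smul_mul]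
      rw [Matrix.mul_assoc (P ε)⁻¹, Matrix.mul_nonsing_inv_cancel_left _ _ hPu, Matrix.mul_assoc,
        Matrix.nonsing_inv_mul _ hNu, Matrix.mul_one]
    rw [Matrix.mul_add, Matrix.add_mul, h2]
    have h3 : D * Y = Y * D - (1 / 2 : ℂ) • B := by rw [← hYD]; abel
    simp only [P, N, Z, hAdef, Matrix.add_mul, Matrix.sub_mul, Matrix.mul_add, Matrix.mul_sub,
      Matrix.one_mul, Matrix.mul_one, Matrix.smul_mul, Matrix.mul_smul, smul_sub, smul_add,
      smul_smul]
    simp only [h3, Matrix.mul_assoc, Matrix.mul_sub, Matrix.mul_smul, smul_sub, smul_smul]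
    module
  let V : Matrix n n ℂ := P ε * (N ε)⁻¹
  have hVs : star V = (P ε)⁻¹ * N ε := by
    have : star ((N ε)⁻¹) = (P ε)⁻¹ := by
      rw [star_eq_conjTranspose, conjTranspose_nonsing_inv, ← star_eq_conjTranspose, hNs]
    rw [star_mul, this, hPs]
  have hV : V ∈ unitaryGroup n ℂ := by
    rw [mem_unitaryGroup_iff, hVs]
    have h2 : (N ε)⁻¹ * (P ε)⁻¹ = (P ε)⁻¹ * (N ε)⁻¹ := by
      rw [← Matrix.mul_inv_rev, ← Matrix.mul_inv_rev, hcomm]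
    calc P ε * (N ε)⁻¹ * ((P ε)⁻¹ * N ε) = P ε * ((N ε)⁻¹ * (P ε)⁻¹) * N ε := by
          simp only [Matrix.mul_assoc]
      _ = 1 := by
          rw [h2, Matrix.mul_nonsing_inv_cancel_left _ _ hPu, Matrix.nonsing_inv_mul _ hNu]
  have hVA : star V * A * V = D + ((ε : ℂ) ^ 2) • Ψ ε := by
    calc star V * A * V = (P ε)⁻¹ * (N ε * A * P ε) * (N ε)⁻¹ := by
          rw [hVs]; simp only [V, Matrix.mul_assoc]
      _ = _ := by
          rw [← hconj, Matrix.mul_assoc (P ε), Matrix.nonsing_inv_mul_cancel_left _ _ hPu,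
            Matrix.mul_nonsing_inv_cancel_right _ _ hNu]
  have hU : star V * W ∈ unitaryGroup n ℂ := mul_mem (Unitary.star_mem hV) hW
  have h2 := sum_negMulLog_le hd hx (Δ := ((ε : ℂ) ^ 2) • Ψ ε) hU (by
    change D + _ = _
    rw [← hVA, hA, star_mul (star V) W, star_star]
    simp only [Matrix.mul_assoc])
  refine h2.trans ?_
  have h3 : ∑ a, ((Real.log (d a) + 1) * ((((ε : ℂ) ^ 2) • Ψ ε) a a).re +
      (∑ b, ‖(((ε : ℂ) ^ 2) • Ψ ε) a b‖ ^ 2) / d a) = ε ^ 2 * Φ ε := by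
    rw [mul_sum]
    refine sum_congr rfl fun a _ => ?_
    have h4 : ∀ b, ‖(((ε : ℂ) ^ 2) • Ψ ε) a b‖ ^ 2 = ε ^ 4 * ‖Ψ ε a b‖ ^ 2 := fun b => by
      rw [Matrix.smul_apply, norm_smul, mul_pow, norm_pow, norm_real, norm_eq_abs,
        sq_abs]
      ring
    simp only [h4]
    rw [← mul_sum, Matrix.smul_apply, smul_eq_mul, ← ofReal_pow,
      re_ofReal_mul]
    ring
  rw [h3]
  gcongr

end Perturb

section PerturbDiag

open Matrix

variable {H J : Type} [NormedAddCommGroup H] [InnerProductSpace ℂ H] [CompleteSpace H]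

/-- Rotation of finitely many vectors of a Hilbert basis. -/
lemma exists_rotate (E : HilbertBasis J ℂ H) (F : Finset J) {W : Matrix F F ℂ}
    [DecidableEq J] (hW : W ∈ unitaryGroup F ℂ) :
    ∃ g : HilbertBasis J ℂ H, (∀ j, j ∉ F → g j = E j) ∧
      ∀ j : F, g j = ∑ b : F, W b j • E b := by
  let g : J → H := fun j => if h : j ∈ F then ∑ b : F, W b ⟨j, h⟩ • E b else E j
  have hg1 : ∀ j, j ∉ F → g j = E j := fun j hj => dif_neg hj
  have hg2 : ∀ j : F, g j = ∑ b : F, W b j • E b := fun j => dif_pos j.2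
  have hE := orthonormal_iff_ite.1 E.orthonormal
  have hEF : ∀ a b : F, ⟪E a, E b⟫_ℂ = if a = b then 1 else 0 := fun a b => by
    rw [hE]; simp only [Subtype.ext_iff]
  have hW1 := mem_unitaryGroup_iff'.1 hW
  have hW2 := mem_unitaryGroup_iff.1 hW
  have ho : Orthonormal ℂ g := by
    rw [orthonormal_iff_ite]
    intro i j
    by_cases hi : i ∈ F <;> by_cases hj : j ∈ F
    · rw [hg2 ⟨i, hi⟩, hg2 ⟨j, hj⟩]
      simp only [sum_inner, inner_sum, inner_smul_left, inner_smul_right, hEF, mul_ite, mul_one,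
        mul_zero, sum_ite_eq', Finset.mem_univ, if_true]
      have h := congrFun (congrFun hW1 ⟨i, hi⟩) ⟨j, hj⟩
      rw [mul_apply, one_apply] at h
      simp only [Subtype.mk.injEq] at h
      rw [← h]
      exact sum_congr rfl fun b _ => mul_comm _ _
    · rw [hg2 ⟨i, hi⟩, hg1 j hj, sum_inner, if_neg (fun h : i = j => hj (h ▸ hi))]
      refine sum_eq_zero fun b _ => ?_
      rw [inner_smul_left, hE, if_neg (fun h : (b : J) = j => hj (h ▸ b.2)), mul_zero]
    · rw [hg2 ⟨j, hj⟩, hg1 i hi, inner_sum, if_neg (fun h : i = j => hi (h ▸ hj))]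
      refine sum_eq_zero fun b _ => ?_
      rw [inner_smul_right, hE, if_neg (fun h : i = (b : J) => hi (h ▸ b.2)), mul_zero]
    · rw [hg1 i hi, hg1 j hj, hE]
  have ht : (Submodule.span ℂ (Set.range g))ᗮ = ⊥ := by
    rw [Submodule.eq_bot_iff]
    intro x hx
    have hgx : ∀ j, ⟪g j, x⟫_ℂ = 0 := fun j =>
      (Submodule.mem_orthogonal _ _).1 hx _ (Submodule.subset_span ⟨j, rfl⟩)
    refine ext_coeff E fun j => ?_
    rw [inner_zero_right]
    by_cases hj : j ∈ F
    · have h1 : E j = ∑ i : F, conj (W ⟨j, hj⟩ i) • g i := by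
        simp only [hg2, smul_sum, smul_smul]
        rw [sum_comm]
        simp only [← sum_smul]
        have h2 : ∀ b : F, ∑ i : F, conj (W ⟨j, hj⟩ i) * W b i = if b = ⟨j, hj⟩ then 1 else 0 :=
          fun b => by
            have h := congrFun (congrFun hW2 b) ⟨j, hj⟩
            rw [mul_apply, one_apply] at h
            rw [← h]
            exact sum_congr rfl fun b _ => mul_comm _ _
        simp only [h2, ite_smul, one_smul, zero_smul, sum_ite_eq', Finset.mem_univ, if_true]
      rw [h1, sum_inner]
      exact sum_eq_zero fun i _ => by rw [inner_smul_left, hgx, mul_zero]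
    · rw [← hg1 j hj, hgx]
  refine ⟨HilbertBasis.mkOfOrthogonalEqBot ho ht, fun j hj => ?_, fun j => ?_⟩
  · rw [HilbertBasis.coe_mkOfOrthogonalEqBot, hg1 j hj]
  · rw [HilbertBasis.coe_mkOfOrthogonalEqBot, hg2]

/-- Second order perturbation of the entropy of a positive diagonal operator by a finite rank
operator. -/
theorem exists_hasTrace_negLog (E : HilbertBasis J ℂ H) {d : J → ℝ} (hd : ∀ a, 0 < d a)
    {Γ B : H →L[ℂ] H} (hΓ : IsDiag E (fun a => (d a : ℂ)) Γ)
    (hB : ∀ x y, ⟪B x, y⟫_ℂ = ⟪x, B y⟫_ℂ) (F : Finset J)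
    (hBF : ∀ a b, ¬(a ∈ F ∧ b ∈ F) → ⟪E a, B (E b)⟫_ℂ = 0)
    (hBd : ∀ a b, d a = d b → ⟪E a, B (E b)⟫_ℂ = 0)
    (hs : Summable fun a => negMulLog (d a)) {σ : ℝ}
    (hσ : ∑ a ∈ F, ∑ b ∈ F, ‖⟪E a, B (E b)⟫_ℂ‖ ^ 2 * ((Real.log (d a) + 1) / (d a - d b)) < σ) :
    ∃ ε₀ > 0, ∀ ε : ℝ, |ε| < ε₀ → 0 ≤ Γ + (ε : ℂ) • B →
      ∃ S : ℝ, HasTrace (negLog (Γ + (ε : ℂ) • B)) S ∧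
        -S ≤ -∑' a, negMulLog (d a) + ε ^ 2 * σ := by
  classical
  let Bm : Matrix F F ℂ := Matrix.of fun a b => ⟪E a, B (E b)⟫_ℂ
  have hBm : Bm.IsHermitian := by
    ext a b
    simp only [conjTranspose_apply, Bm, of_apply]
    rw [← hB, ← inner_conj_symm (E (a : J))]
    rfl
  have hσ' : ∑ a : F, ∑ b : F, ‖Bm a b‖ ^ 2 * ((Real.log (d a) + 1) / (d a - d b)) < σ := by
    refine lt_of_eq_of_lt ?_ hσ
    rw [← sum_coe_sort F]
    refine sum_congr rfl fun a _ => ?_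
    rw [← sum_coe_sort F]
    rfl
  obtain ⟨ε₀, hε₀, key⟩ := entropy_perturb (d := fun a : F => d a) (fun a => hd a) hBm
    (fun a b h => hBd a b h) hσ'
  refine ⟨ε₀, hε₀, fun ε hε hpos => ?_⟩
  set A : Matrix F F ℂ := diagonal (fun a : F => (d a : ℂ)) + (ε : ℂ) • Bm with hA
  have hAh : A.IsHermitian := by
    refine (isHermitian_diagonal_of_self_adjoint _ ?_).add ?_
    · ext a; simp
    · rw [IsHermitian, conjTranspose_smul, hBm, star_def, conj_ofReal]
  set W : Matrix F F ℂ := hAh.eigenvectorUnitary.1 with hWdef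
  have hW : W ∈ unitaryGroup F ℂ := hAh.eigenvectorUnitary.2
  set x : F → ℝ := hAh.eigenvalues
  have hspec : A = W * diagonal (fun a => (x a : ℂ)) * star W := by
    have h := hAh.spectral_theorem
    rw [Unitary.conjStarAlgAut_apply] at h
    exact h
  obtain ⟨g, hg1, hg2⟩ := exists_rotate E F hW
  have hEE := orthonormal_iff_ite.1 E.orthonormal
  have hBE : ∀ b, B (E b) = ∑ a : F, ⟪E a, B (E b)⟫_ℂ • E a := fun b => by
    refine ext_coeff E fun j => ?_
    rw [inner_sum]
    simp only [inner_smul_right, hEE]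
    by_cases hj : j ∈ F
    · rw [Finset.sum_eq_single ⟨j, hj⟩]
      · simp
      · intro a _ ha
        rw [if_neg (fun h => ha (Subtype.ext h.symm)), mul_zero]
      · simp
    · rw [hBF j b (fun h => hj h.1)]
      exact (sum_eq_zero fun a _ => by
        rw [if_neg (fun h => hj (by rw [h]; exact a.2)), mul_zero]).symm
  have hGE : ∀ b : F, (Γ + (ε : ℂ) • B) (E b) = ∑ a : F, A a b • E a := fun b => by
    rw [_root_.add_apply, _root_.smul_apply, hΓ.apply_basis, hBE, smul_sum]
    simp only [hA, Matrix.add_apply, Matrix.smul_apply, add_smul, sum_add_distrib]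
    congr 1
    · simp only [diagonal_apply, ite_smul, zero_smul, sum_ite_eq', Finset.mem_univ, if_true]
    · exact sum_congr rfl fun a _ => by rw [smul_smul]; rfl
  let x' : J → ℝ := fun j => if h : j ∈ F then x ⟨j, h⟩ else d j
  have hx1 : ∀ j, j ∉ F → x' j = d j := fun j hj => dif_neg hj
  have hx2 : ∀ j : F, x' j = x j := fun j => dif_pos j.2
  have hdiag : IsDiag g (fun j => (x' j : ℂ)) (Γ + (ε : ℂ) • B) := by
    refine IsDiag.of_apply_basis fun j => ?_
    by_cases hj : j ∈ F
    · have hAW : A * W = W * diagonal (fun a => (x a : ℂ)) := by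
        rw [hspec, Matrix.mul_assoc, mem_unitaryGroup_iff'.1 hW, Matrix.mul_one]
      rw [hx2 ⟨j, hj⟩, hg2 ⟨j, hj⟩, map_sum]
      simp only [map_smul, hGE, smul_sum, smul_smul]
      rw [sum_comm]
      refine sum_congr rfl fun a _ => ?_
      rw [← sum_smul]
      have h := congrFun (congrFun hAW a) ⟨j, hj⟩
      rw [mul_apply, mul_diagonal] at h
      congr 1
      rw [mul_comm (x _ : ℂ), ← h]
      exact sum_congr rfl fun b _ => mul_comm _ _
    · rw [hx1 j hj, hg1 j hj, _root_.add_apply, _root_.smul_apply, hΓ.apply_basis, hBE]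
      rw [sum_eq_zero, smul_zero, add_zero]
      intro a _
      rw [hBF a j (fun h => hj h.2), zero_smul]
  have hx0 : ∀ a, 0 ≤ x a := fun a => by
    have h := ((nonneg_iff_isPositive _).1 hpos).re_inner_nonneg_right (g a)
    rw [hdiag.apply_basis, inner_smul_right, inner_self_eq_norm_sq_to_K, g.orthonormal.1, hx2] at h
    simpa using h
  have hkey := key ε hε x W hW hx0 hspec
  have htr := (hdiag.cfc Real.continuous_negMulLog)
  have hsum : HasSum (fun j => negMulLog (x' j)) (∑' a, negMulLog (d a) +
      ∑ a ∈ F, (negMulLog (x' a) - negMulLog (d a))) := by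
    have h1 : HasSum (fun j => negMulLog (x' j) - negMulLog (d j))
        (∑ a ∈ F, (negMulLog (x' a) - negMulLog (d a))) :=
      hasSum_sum_of_ne_finset_zero fun j hj => by rw [hx1 j hj, sub_self]
    have h2 := hs.hasSum.add h1
    simp only [add_sub_cancel] at h2
    exact h2
  refine ⟨_, htr.hasTrace (hasSum_ofReal.2 hsum), ?_⟩
  rw [sum_sub_distrib, ← sum_coe_sort F, ← sum_coe_sort F]
  simp only [hx2]
  linarith

end PerturbDiag

/-! ## The symbol of `K_{Tb}` -/

lemma tanh_eq_fermi (x : ℝ) : Real.tanh x = 1 - 2 * fermi x := by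
  have h := exp_pos x
  have h2 : rexp (-x) = (rexp x)⁻¹ := Real.exp_neg x
  have h3 : rexp (2 * x) = rexp x * rexp x := by rw [two_mul, Real.exp_add]
  rw [fermi, Real.tanh_eq_sinh_div_cosh, Real.sinh_eq, Real.cosh_eq, h2, h3]
  field_simp
  ring

lemma tanh_le_one (x : ℝ) : Real.tanh x ≤ 1 := by
  rw [tanh_eq_fermi]; linarith [fermi_pos x]

lemma fermi_strictAnti : StrictAnti fermi := by
  intro a b hab
  unfold fermi
  have := exp_pos (2 * a)
  gcongr

lemma fermi_neg (x : ℝ) : fermi (-x) = 1 - fermi x := by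
  have h := tanh_eq_fermi (-x)
  rw [Real.tanh_neg, tanh_eq_fermi] at h
  linarith

lemma tanh_add_pos {x y : ℝ} (h : 0 < x + y) : 0 < Real.tanh x + Real.tanh y := by
  rw [tanh_eq_fermi, tanh_eq_fermi]
  have h1 := fermi_strictAnti (show -y < x by linarith)
  rw [fermi_neg] at h1
  linarith

lemma kT_nonneg {T : ℝ} (hT : 0 < T) (x y : ℝ) : 0 ≤ kT T x y := by
  unfold kT
  split_ifs with h
  · positivity
  rcases lt_or_gt_of_ne h with h' | h'
  · have h1 : 0 < -(x / T) + -(y / T) := by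
      rw [← neg_add, ← add_div, neg_pos]
      exact div_neg_of_neg_of_pos h' hT
    have h2 := tanh_add_pos h1
    rw [Real.tanh_neg, Real.tanh_neg] at h2
    exact div_nonneg_of_nonpos h'.le (by linarith)
  · have h1 : 0 < x / T + y / T := by rw [← add_div]; positivity
    exact div_nonneg h'.le (tanh_add_pos h1).le

lemma le_kT {T : ℝ} (hT : 0 < T) {x y : ℝ} (h : 0 < x + y) : (x + y) / 2 ≤ kT T x y := by
  rw [kT, if_neg h.ne']
  have h1 : 0 < x / T + y / T := by rw [← add_div]; positivity
  have := tanh_le_one (x / T)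
  have := tanh_le_one (y / T)
  exact div_le_div_of_nonneg_left h.le (tanh_add_pos h1) (by linarith)

lemma le_tanh {s : ℝ} (hs : 0 ≤ s) : s / (1 + s) ≤ Real.tanh s := by
  rw [tanh_eq_fermi, fermi]
  have h := Real.add_one_le_exp (2 * s)
  have h1 : 2 * (1 + rexp (2 * s))⁻¹ ≤ 1 / (1 + s) := by
    rw [← div_eq_mul_inv, div_le_div_iff₀ (by positivity) (by positivity)]
    linarith
  have h2 : s / (1 + s) = 1 - 1 / (1 + s) := by field_simp; ring
  linarith

lemma kT_le {T : ℝ} (hT : 0 < T) {x y : ℝ} (hx : 0 < x) (hy : 0 < y) :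
    kT T x y ≤ T + x + y := by
  have h : 0 < x + y := by linarith
  rw [kT, if_neg h.ne']
  have key : ∀ z, 0 < z → z ≤ x + y → z / (T + x + y) ≤ Real.tanh (z / T) := fun z hz hzx => by
    refine le_trans ?_ (le_tanh (by positivity))
    have : z / T / (1 + z / T) = z / (T + z) := by field_simp
    rw [this]
    exact div_le_div_of_nonneg_left hz.le (by positivity) (by linarith)
  have h1 := key x hx (by linarith)
  have h2 := key y hy (by linarith)
  have h3 : 0 < (x + y) / (T + x + y) := by positivity
  rw [div_le_iff₀ (lt_of_lt_of_le h3 (by rw [add_div]; linarith))]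
  have h4 : x + y = (T + x + y) * ((x + y) / (T + x + y)) := by field_simp
  calc x + y = (T + x + y) * ((x + y) / (T + x + y)) := h4
    _ ≤ _ := by gcongr; rw [add_div]; linarith

/-! ## Multiplication operators and `v^♯` -/

lemma exists_mulOp {X : Type*} [MeasurableSpace X] {m : Measure X} {g : X → ℝ} (hg : Measurable g)
    {C : ℝ} (hC : ∀ x, |g x| ≤ C) :
    ∃ V : Lp ℂ 2 m →L[ℂ] Lp ℂ 2 m, (∀ κ, (V κ : X → ℂ) =ᵐ[m] fun x => (g x : ℂ) * κ x) := by
  have hm : ∀ κ : Lp ℂ 2 m, MemLp (fun x => (g x : ℂ) * κ x) 2 m := fun κ => by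
    refine MemLp.of_le_mul (c := C) (Lp.memLp κ)
      ((measurable_ofReal.comp hg).aestronglyMeasurable.mul (Lp.aestronglyMeasurable κ)) ?_
    refine Eventually.of_forall fun x => ?_
    rw [norm_mul, norm_real, norm_eq_abs]
    exact mul_le_mul_of_nonneg_right (hC x) (norm_nonneg _)
  let L : Lp ℂ 2 m →ₗ[ℂ] Lp ℂ 2 m :=
    { toFun := fun κ => (hm κ).toLp _
      map_add' := fun κ η => by
        apply Lp.ext
        filter_upwards [(hm (κ + η)).coeFn_toLp, (hm κ).coeFn_toLp, (hm η).coeFn_toLp,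
          Lp.coeFn_add ((hm κ).toLp _) ((hm η).toLp _), Lp.coeFn_add κ η] with x h1 h2 h3 h4 h5
        rw [h1, h4, Pi.add_apply, h2, h3, h5, Pi.add_apply, mul_add]
      map_smul' := fun z κ => by
        apply Lp.ext
        filter_upwards [(hm (z • κ)).coeFn_toLp, (hm κ).coeFn_toLp,
          Lp.coeFn_smul z ((hm κ).toLp _), Lp.coeFn_smul z κ] with x h1 h2 h4 h5
        rw [h1, RingHom.id_apply, h4, Pi.smul_apply, h2, h5, Pi.smul_apply, smul_eq_mul,
          smul_eq_mul]
        ring }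
  refine ⟨L.mkContinuous C fun κ => ?_, fun κ => (hm κ).coeFn_toLp⟩
  refine Lp.norm_le_mul_norm_of_ae_le_mul ?_
  filter_upwards [(hm κ).coeFn_toLp] with x h1
  change ‖(hm κ).toLp _ x‖ ≤ _
  rw [h1, norm_mul, norm_real, norm_eq_abs]
  exact mul_le_mul_of_nonneg_right (hC x) (norm_nonneg _)

namespace MagLattice
variable {M : MagLattice τ}

lemma measurable_per {v : ℂ → ℝ} (hv : Measurable v) : Measurable (M.per v) := by
  have h1 : M.per v = fun x => ∑' m, v (x + M.w m) := rfl
  rw [h1]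
  exact Measurable.tsum fun m => hv.comp (measurable_id.add_const _)

lemma exists_per_bound (hτ : 0 < τ.im) {v : ℂ → ℝ} {C p : ℝ} (hp : 2 < p)
    (hv : ∀ x, |v x| ≤ C * (1 + ‖x‖) ^ (-p)) :
    ∃ D, ∀ x, Summable (fun m => v (x + M.w m)) ∧ |M.per v x| ≤ D := by
  obtain ⟨B, hB0, hB⟩ := M.exists_sum_decay_bound hτ hp
  refine ⟨|C| * B, fun x => ?_⟩
  have hs := (hB x).1.mul_left |C|
  have hle : ∀ m, ‖v (x + M.w m)‖ ≤ |C| * (1 + ‖x + M.w m‖) ^ (-p) := fun m =>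
    (hv _).trans (mul_le_mul_of_nonneg_right (le_abs_self C) (by positivity))
  refine ⟨Summable.of_norm_bounded hs hle, ?_⟩
  have h1 := tsum_of_norm_bounded hs.hasSum hle
  rw [tsum_mul_left] at h1
  exact h1.trans (mul_le_mul_of_nonneg_left (hB x).2 (abs_nonneg C))

lemma exists_vSharp (hτ : 0 < τ.im) {v : ℂ → ℝ} (hm : Measurable v)
    (hv : ∃ C p : ℝ, 2 < p ∧ ∀ x, |v x| ≤ C * (1 + ‖x‖) ^ (-p)) :
    ∃ V : M.HH →L[ℂ] M.HH, (∀ κ, M.VSharp v κ (V κ)) ∧ ∀ κ η, ⟪V κ, η⟫_ℂ = ⟪κ, V η⟫_ℂ := by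
  obtain ⟨C, p, hp, hC⟩ := hv
  obtain ⟨D, hD⟩ := exists_per_bound (M := M) hτ hp hC
  obtain ⟨V, hV⟩ := exists_mulOp (m := M.vol.prod M.vol) (g := fun q : ℂ × ℂ => M.per v (q.1 - q.2))
    ((measurable_per hm).comp (measurable_fst.sub measurable_snd)) (fun q => (hD _).2)
  refine ⟨V, hV, fun κ η => ?_⟩
  rw [L2_inner_eq, L2_inner_eq]
  refine integral_congr_ae ?_
  filter_upwards [hV κ, hV η] with q h1 h2
  rw [h1, h2, map_mul, conj_ofReal]
  ring

end MagLattice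

namespace EigenBasis
variable {M : MagLattice τ} (B : EigenBasis M) {v : ℂ → ℝ} {μ T : ℝ} {γ : M.H →L[ℂ] M.H}
  {k : ℂ → ℂ → ℂ}

lemma finite_lam_le (hτ : 0 < τ.im) (m : ℝ) : {i | B.lam i ≤ m}.Finite := by
  have h := (B.summable_exp hτ one_pos).tendsto_cofinite_zero
  have h2 := h.eventually_lt_const (exp_pos (-m))
  refine (eventually_cofinite.1 h2).subset fun i hi => ?_
  simp only [mem_ofPred_eq, mul_one, not_lt, Real.exp_le_exp] at hi ⊢
  linarith

lemma inner_tens_kernel (u w : M.H) (κ : M.HH) :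
    HasSum (fun p : B.ι × B.ι => ⟪u, B.e p.1⟫_ℂ * ⟪w, B.e p.2⟫_ℂ * ⟪M.tensBasis B.e B.e p, κ⟫_ℂ)
      ⟪M.tens u w, κ⟫_ℂ := by
  convert! (M.tensBasis B.e B.e).hasSum_inner_mul_inner (M.tens u w) κ using 1
  funext p
  rw [MagLattice.tensBasis_apply, MagLattice.inner_tens_tens]

include B in
lemma kOp_of_coeff (hτ : 0 < τ.im) (hN : M.IsNormal v μ T γ k) {κ β : M.HH}
    (h : ∀ p, ⟪M.tensBasis B.e B.e p, β⟫_ℂ =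
      kT T (B.lam p.1 - chem v μ k) (B.lam p.2 - chem v μ k) * ⟪M.tensBasis B.e B.e p, κ⟫_ℂ) :
    M.KOp v μ T k κ β := by
  intro E E' u w hu hw
  rw [MagLattice.pair_eq_inner, MagLattice.pair_eq_inner]
  refine (B.inner_tens_kernel u w β).unique ?_
  convert! (B.inner_tens_kernel u w κ).mul_left (kT T E E' : ℂ) using 1
  funext p
  by_cases h1 : ⟪B.e p.1, u⟫_ℂ = 0
  · rw [← inner_conj_symm, h1]; simp
  by_cases h2 : ⟪B.e p.2, w⟫_ℂ = 0
  · rw [← inner_conj_symm w, h2]; simp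
  rw [h p, hN.inner_of_oneBody B hτ hu p.1 h1, hN.inner_of_oneBody B hτ hw p.2 h2]
  ring

include B in
/-- A negative expectation value of `L_{Tb}` yields a negative eigenvalue. -/
theorem exists_neg_eigenvalue_lOp (hτ : 0 < τ.im) (hT : 0 < T) (hN : M.IsNormal v μ T γ k)
    {V : M.HH →L[ℂ] M.HH} (hV : ∀ κ, M.VSharp v κ (V κ))
    (hVs : ∀ κ η, ⟪V κ, η⟫_ℂ = ⟪κ, V η⟫_ℂ) (F : Finset (B.ι × B.ι)) (c : B.ι × B.ι → ℂ)
    (hneg : ∑ p ∈ F, kT T (B.lam p.1 - chem v μ k) (B.lam p.2 - chem v μ k) * ‖c p‖ ^ 2 +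
      (⟪∑ p ∈ F, c p • M.tensBasis B.e B.e p, V (∑ p ∈ F, c p • M.tensBasis B.e B.e p)⟫_ℂ).re < 0) :
    ∃ E : ℝ, E < 0 ∧ ∃ κ : M.HH, κ ≠ 0 ∧ M.LOp v μ T k κ ((E : ℂ) • κ) := by
  set m := chem v μ k
  obtain ⟨E, hE, x, y, hx, hy, hxy⟩ := exists_neg_eigenvalue (M.tensBasis B.e B.e)
    (κ := fun p => kT T (B.lam p.1 - m) (B.lam p.2 - m)) (fun p => kT_nonneg hT _ _) (fun a => by
      have hf := B.finite_lam_le hτ (3 * |m| + 2 * |a|)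
      refine (hf.prod hf).subset fun p hp => ?_
      simp only [mem_ofPred_eq, Set.mem_prod] at hp ⊢
      have h1 := B.lam_nonneg hτ p.1
      have h2 := B.lam_nonneg hτ p.2
      have ha := le_abs_self a
      have hm := le_abs_self m
      have ha0 := abs_nonneg a
      have hm0 := abs_nonneg m
      by_cases h : 0 < B.lam p.1 - m + (B.lam p.2 - m)
      · have h3 := (le_kT hT h).trans hp
        constructor <;> linarith
      · constructor <;> linarith) hVs F c hneg
  exact ⟨E, hE, x, hx, y, V x, B.kOp_of_coeff hτ hN hy, hV x, hxy.symm⟩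

end EigenBasis

/-! ## Operators on `𝔥 × 𝔥^*` -/

section FinitePert

variable {ι H : Type*} [NormedAddCommGroup H] [InnerProductSpace ℂ H]

lemma inner_finite_pert (e : HilbertBasis ι ℂ H) {B : H →L[ℂ] H}
    (hB : ∀ x y, ⟪B x, y⟫_ℂ = ⟪x, B y⟫_ℂ) {F : Finset ι}
    (hBF : ∀ a b, ¬(a ∈ F ∧ b ∈ F) → ⟪e a, B (e b)⟫_ℂ = 0) (x : H) :
    ‖B x‖ ^ 2 ≤ ‖B‖ ^ 2 * ∑ a ∈ F, ‖⟪e a, x⟫_ℂ‖ ^ 2 ∧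
      |(⟪x, B x⟫_ℂ).re| ≤ ‖B‖ * ∑ a ∈ F, ‖⟪e a, x⟫_ℂ‖ ^ 2 := by
  classical
  set y : H := ∑ a ∈ F, ⟪e a, x⟫_ℂ • e a with hy
  have hyc : ∀ a, ⟪e a, y⟫_ℂ = if a ∈ F then ⟪e a, x⟫_ℂ else 0 := fun a => by
    simp [hy, orthonormal_iff_ite.1 e.orthonormal]
  have hB0 : ∀ b, b ∉ F → B (e b) = 0 := fun b hb => ext_coeff e fun a => by
    rw [hBF a b (fun h => hb h.2), inner_zero_right]
  have hBxy : B x = B y := by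
    refine ext_coeff e fun a => ?_
    rw [← hB, ← hB]
    by_cases ha : a ∈ F
    · rw [← e.tsum_inner_mul_inner (B (e a)) x, ← e.tsum_inner_mul_inner (B (e a)) y]
      refine tsum_congr fun b => ?_
      rw [hyc]
      split_ifs with hb
      · rfl
      · rw [hB, hB0 b hb]; simp
    · rw [hB0 a ha]; simp
  have hyn : ‖y‖ ^ 2 = ∑ a ∈ F, ‖⟪e a, x⟫_ℂ‖ ^ 2 := by
    refine (hasSum_norm_sq e y).unique ?_
    have : ∑ a ∈ F, ‖⟪e a, x⟫_ℂ‖ ^ 2 = ∑ a ∈ F, ‖⟪e a, y⟫_ℂ‖ ^ 2 :=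
      sum_congr rfl fun a ha => by rw [hyc, if_pos ha]
    rw [this]
    exact hasSum_sum_of_ne_finset_zero fun a ha => by rw [hyc, if_neg ha]; simp
  rw [← hyn]
  constructor
  · rw [hBxy, ← mul_pow]
    exact pow_le_pow_left₀ (norm_nonneg _) (B.le_opNorm y) 2
  · rw [hBxy, ← hB, hBxy]
    refine (Complex.abs_re_le_norm _).trans ((norm_inner_le_norm _ _).trans ?_)
    rw [pow_two, ← mul_assoc]
    exact mul_le_mul_of_nonneg_right (B.le_opNorm y) (norm_nonneg _)

lemma nonneg_diag_add [CompleteSpace H] {e : HilbertBasis ι ℂ H} {d : ι → ℝ} {Γ B : H →L[ℂ] H}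
    (hΓ : IsDiag e (fun a => (d a : ℂ)) Γ) (hd : ∀ a, 0 ≤ d a)
    (hB : ∀ x y, ⟪B x, y⟫_ℂ = ⟪x, B y⟫_ℂ) {F : Finset ι}
    (hBF : ∀ a b, ¬(a ∈ F ∧ b ∈ F) → ⟪e a, B (e b)⟫_ℂ = 0) {m : ℝ} (hm : ∀ a ∈ F, m ≤ d a)
    {ε : ℝ} (hε : |ε| * ‖B‖ ≤ m) : 0 ≤ Γ + (ε : ℂ) • B := by
  rw [nonneg_iff_isPositive, isPositive_def']
  refine ⟨isSelfAdjoint_iff_isSymmetric.2 fun x y => ?_, fun x => ?_⟩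
  · change ⟪Γ x + (ε : ℂ) • B x, y⟫_ℂ = ⟪x, Γ y + (ε : ℂ) • B y⟫_ℂ
    rw [inner_add_left, inner_add_right, hΓ.inner_swap, inner_smul_left, inner_smul_right, hB,
      conj_ofReal]
  · rw [reApplyInnerSelf_apply]
    change 0 ≤ (⟪Γ x + (ε : ℂ) • B x, x⟫_ℂ).re
    rw [inner_add_left, hΓ.inner_swap, inner_smul_left, hB, conj_ofReal, add_re,
      re_ofReal_mul]
    have h1 := (inner_finite_pert e hB hBF x).2
    have h2 : ∑ a ∈ F, d a * ‖⟪e a, x⟫_ℂ‖ ^ 2 ≤ (⟪x, Γ x⟫_ℂ).re :=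
      sum_le_hasSum F (fun a _ => mul_nonneg (hd a) (by positivity)) (hΓ.hasSum_inner x)
    have h3 : m * ∑ a ∈ F, ‖⟪e a, x⟫_ℂ‖ ^ 2 ≤ ∑ a ∈ F, d a * ‖⟪e a, x⟫_ℂ‖ ^ 2 := by
      rw [mul_sum]
      exact sum_le_sum fun a ha => mul_le_mul_of_nonneg_right (hm a ha) (by positivity)
    have h4 : |ε * (⟪x, B x⟫_ℂ).re| ≤ m * ∑ a ∈ F, ‖⟪e a, x⟫_ℂ‖ ^ 2 := by
      rw [abs_mul]
      calc |ε| * |(⟪x, B x⟫_ℂ).re| ≤ |ε| * (‖B‖ * ∑ a ∈ F, ‖⟪e a, x⟫_ℂ‖ ^ 2) := by gcongr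
        _ = (|ε| * ‖B‖) * ∑ a ∈ F, ‖⟪e a, x⟫_ℂ‖ ^ 2 := by ring
        _ ≤ _ := mul_le_mul_of_nonneg_right hε (sum_nonneg fun _ _ => by positivity)
    linarith [abs_le.1 h4]

lemma IsDiag.mul {e : HilbertBasis ι ℂ H} {a b : ι → ℂ} {A D : H →L[ℂ] H}
    (hA : IsDiag e a A) (hD : IsDiag e b D) : IsDiag e (fun i => a i * b i) (A * D) := fun i x => by
  rw [mul_apply_eq_comp, hA, hD, mul_assoc]

lemma IsDiag.one_sub {e : HilbertBasis ι ℂ H} {a : ι → ℂ} {A : H →L[ℂ] H}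
    (hA : IsDiag e a A) : IsDiag e (fun i => 1 - a i) (1 - A) := fun i x => by
  rw [_root_.sub_apply, one_apply_eq_self, inner_sub_right, hA, sub_mul, one_mul]

lemma sq_le_of_finite_pert [CompleteSpace H] {e : HilbertBasis ι ℂ H} {d : ι → ℝ} {Q B : H →L[ℂ] H}
    (hQ : IsDiag e (fun a => (d a : ℂ)) Q) (hB : ∀ x y, ⟪B x, y⟫_ℂ = ⟪x, B y⟫_ℂ) {F : Finset ι}
    (hBF : ∀ a b, ¬(a ∈ F ∧ b ∈ F) → ⟪e a, B (e b)⟫_ℂ = 0) {m : ℝ} (hm : 0 < m)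
    (hmd : ∀ a ∈ F, m ≤ d a) : ∃ C : ℝ, B ^ 2 ≤ (C : ℂ) • Q ^ 2 := by
  have hQ2 : IsDiag e (fun a => ((d a * d a : ℝ) : ℂ)) (Q ^ 2) := by
    rw [pow_two]
    intro i x
    rw [hQ.mul hQ i x]
    push_cast
    rfl
  have hB2 : ∀ x y, ⟪(B ^ 2) x, y⟫_ℂ = ⟪B x, B y⟫_ℂ := fun x y => by
    rw [pow_two, mul_apply_eq_comp, hB]
  have hB2' : ∀ x y, ⟪x, (B ^ 2) y⟫_ℂ = ⟪B x, B y⟫_ℂ := fun x y => by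
    rw [pow_two, mul_apply_eq_comp, hB]
  refine ⟨‖B‖ ^ 2 / m ^ 2, ?_⟩
  rw [ContinuousLinearMap.le_def, isPositive_def']
  refine ⟨isSelfAdjoint_iff_isSymmetric.2 fun x y => ?_, fun x => ?_⟩
  · change ⟪((‖B‖ ^ 2 / m ^ 2 : ℝ) : ℂ) • (Q ^ 2) x - (B ^ 2) x, y⟫_ℂ =
      ⟪x, ((‖B‖ ^ 2 / m ^ 2 : ℝ) : ℂ) • (Q ^ 2) y - (B ^ 2) y⟫_ℂ
    rw [inner_sub_left, inner_sub_right, hB2, hB2', inner_smul_left, inner_smul_right,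
      hQ2.inner_swap, conj_ofReal]
  · rw [reApplyInnerSelf_apply]
    change 0 ≤ (⟪((‖B‖ ^ 2 / m ^ 2 : ℝ) : ℂ) • (Q ^ 2) x - (B ^ 2) x, x⟫_ℂ).re
    rw [inner_sub_left, hB2, inner_smul_left, hQ2.inner_swap, conj_ofReal, sub_re,
      re_ofReal_mul]
    have h1 := (inner_finite_pert e hB hBF x).1
    have h2 : ∑ a ∈ F, d a * d a * ‖⟪e a, x⟫_ℂ‖ ^ 2 ≤ (⟪x, (Q ^ 2) x⟫_ℂ).re :=
      sum_le_hasSum F (fun a _ => mul_nonneg (mul_self_nonneg _) (by positivity)) (hQ2.hasSum_inner x)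
    have h3 : m ^ 2 * ∑ a ∈ F, ‖⟪e a, x⟫_ℂ‖ ^ 2 ≤ ∑ a ∈ F, d a * d a * ‖⟪e a, x⟫_ℂ‖ ^ 2 := by
      rw [mul_sum]
      refine sum_le_sum fun a ha => mul_le_mul_of_nonneg_right ?_ (by positivity)
      rw [pow_two]
      exact mul_self_le_mul_self hm.le (hmd a ha)
    have h4 : (⟪B x, B x⟫_ℂ).re = ‖B x‖ ^ 2 := by
      rw [inner_self_eq_norm_sq_to_K]
      norm_cast
    rw [h4, sub_nonneg]
    refine h1.trans ?_
    rw [div_mul_eq_mul_div, le_div_iff₀ (by positivity), mul_assoc]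
    gcongr
    rw [mul_comm]
    exact h3.trans h2

end FinitePert

namespace MagLattice
variable {M : MagLattice τ}

lemma block_apply (A B C D : M.H →L[ℂ] M.H) (x y : M.H) :
    M.block A B C D (WithLp.toLp 2 (x, y)) = WithLp.toLp 2 (A x + B y, C x + D y) := rfl

/-- The Hilbert basis of `𝔥 × 𝔥^*` made of `(e_i, 0)` and `(0, ē_i)`. -/
def sumBasis {ι : Type} (e : HilbertBasis ι ℂ M.H) : HilbertBasis (ι ⊕ ι) ℂ M.HxH :=
  HilbertBasis.mkOfOrthogonalEqBot
    (v := Sum.elim (fun i => WithLp.toLp 2 (e i, 0)) fun i => WithLp.toLp 2 (0, M.conjH (e i)))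
    (by
      classical
      have he := orthonormal_iff_ite.1 e.orthonormal
      have hc := orthonormal_iff_ite.1 (M.conjBasis e).orthonormal
      simp only [conjBasis_apply] at hc
      rw [orthonormal_iff_ite]
      rintro (i | i) (j | j) <;> simp [WithLp.prod_inner_apply, he, hc])
    (by
      rw [Submodule.eq_bot_iff]
      intro u hu
      have h := fun s : ι ⊕ ι => (Submodule.mem_orthogonal _ _).1 hu _
        (Submodule.subset_span ⟨s, rfl⟩)
      have h1 : u.fst = 0 := ext_coeff e fun i => by
        have := h (Sum.inl i)
        simpa [WithLp.prod_inner_apply] using this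
      have h2 : u.snd = 0 := ext_coeff (M.conjBasis e) fun i => by
        have := h (Sum.inr i)
        simpa [WithLp.prod_inner_apply] using this
      have : u = WithLp.toLp 2 (u.fst, u.snd) := rfl
      rw [this, h1, h2]
      rfl)

lemma sumBasis_inl {ι : Type} (e : HilbertBasis ι ℂ M.H) (i : ι) :
    sumBasis e (Sum.inl i) = WithLp.toLp 2 (e i, 0) := by
  rw [sumBasis, HilbertBasis.coe_mkOfOrthogonalEqBot]; rfl

lemma sumBasis_inr {ι : Type} (e : HilbertBasis ι ℂ M.H) (i : ι) :
    sumBasis e (Sum.inr i) = WithLp.toLp 2 (0, M.conjH (e i)) := by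
  rw [sumBasis, HilbertBasis.coe_mkOfOrthogonalEqBot]; rfl

lemma gam_add (γ α : M.H →L[ℂ] M.H) (ε : ℝ) :
    M.Gam γ ((ε : ℂ) • α) = M.Gam γ 0 + (ε : ℂ) • M.offDiag α := by
  refine ContinuousLinearMap.ext fun u => ?_
  change WithLp.toLp 2 (γ u.fst + (ε : ℂ) • α u.snd,
    adjoint ((ε : ℂ) • α) u.fst + (1 - M.conjOp γ) u.snd) =
    WithLp.toLp 2 (γ u.fst + (0 : M.H →L[ℂ] M.H) u.snd + (ε : ℂ) • ((0 : M.H →L[ℂ] M.H) u.fst + α u.snd),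
      adjoint (0 : M.H →L[ℂ] M.H) u.fst + (1 - M.conjOp γ) u.snd +
        (ε : ℂ) • (adjoint α u.fst + (0 : M.H →L[ℂ] M.H) u.snd))
  rw [map_smulₛₗ, conj_ofReal]
  simp [add_comm]
  rfl

lemma offDiag_symm (α : M.H →L[ℂ] M.H) (x y : M.HxH) :
    ⟪M.offDiag α x, y⟫_ℂ = ⟪x, M.offDiag α y⟫_ℂ := by
  rw [WithLp.prod_inner_apply, WithLp.prod_inner_apply]
  change ⟪(0 : M.H →L[ℂ] M.H) x.fst + α x.snd, y.fst⟫_ℂ +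
    ⟪adjoint α x.fst + (0 : M.H →L[ℂ] M.H) x.snd, y.snd⟫_ℂ =
    ⟪x.fst, (0 : M.H →L[ℂ] M.H) y.fst + α y.snd⟫_ℂ +
    ⟪x.snd, adjoint α y.fst + (0 : M.H →L[ℂ] M.H) y.snd⟫_ℂ
  simp [adjoint_inner_left, adjoint_inner_right, add_comm]

lemma adjoint_kerOp_of_symm {κ : M.HH} (h : ∀ u w, ⟪M.tens u w, κ⟫_ℂ = ⟪M.tens w u, κ⟫_ℂ) :
    adjoint (M.kerOp κ) = M.conjOp (M.kerOp κ) := by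
  refine ContinuousLinearMap.ext fun u => ext_inner_left ℂ fun w => ?_
  change _ = ⟪w, M.conjH (M.kerOp κ (M.conjH u))⟫_ℂ
  rw [adjoint_inner_right, ← inner_conj_symm, inner_kerOp,
    ← M.conjH_conjH w, inner_conjH_conjH, inner_kerOp, conjH_conjH, conjH_conjH, h]

lemma hasTrace_adjoint_kerOp (κ ζ : M.HH) :
    HasTrace (adjoint (M.kerOp κ) ∘L M.kerOp ζ) ⟪κ, ζ⟫_ℂ := by
  intro ι e
  have h := (M.tensBasis e (M.conjBasis e)).hasSum_inner_mul_inner κ ζ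
  have h2 := (Equiv.prodComm ι ι).hasSum_iff.2 h
  refine h2.prod_fiberwise fun j => ?_
  rw [ContinuousLinearMap.comp_apply, adjoint_inner_right]
  convert! e.hasSum_inner_mul_inner (M.kerOp κ (e j)) (M.kerOp ζ (e j)) using 1
  funext i
  rw [inner_kerOp, ← inner_conj_symm, inner_kerOp, inner_conj_symm]
  simp

lemma conjOp_smul_real (ε : ℝ) (A : M.H →L[ℂ] M.H) :
    M.conjOp ((ε : ℂ) • A) = (ε : ℂ) • M.conjOp A := by
  refine ContinuousLinearMap.ext fun u => ?_
  change M.conjH ((ε : ℂ) • A (M.conjH u)) = (ε : ℂ) • M.conjH (A (M.conjH u))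
  rw [map_smulₛₗ, conj_ofReal]

end MagLattice

/-! ## The free energy of perturbed normal states -/

lemma fermi_le_exp (h : ℝ) : fermi h ≤ rexp (-(2 * h)) := by
  rw [fermi, Real.exp_neg]
  exact inv_anti₀ (exp_pos _) (by linarith)

lemma negMulLog_fermi_le (h : ℝ) : negMulLog (fermi h) ≤ fermi h * (1 + 2 * |h|) := by
  have hp := fermi_pos h
  rw [negMulLog, neg_mul, ← mul_neg]
  refine mul_le_mul_of_nonneg_left ?_ hp.le
  rw [fermi, Real.log_inv, neg_neg]
  have h1 : 1 + rexp (2 * h) ≤ rexp (1 + 2 * |h|) := by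
    rw [Real.exp_add]
    have h2 : rexp (2 * h) ≤ rexp (2 * |h|) :=
      Real.exp_le_exp.2 (by linarith [le_abs_self h])
    have h3 : 1 ≤ rexp (2 * |h|) := Real.one_le_exp (by positivity)
    have h4 := Real.add_one_le_exp (1 : ℝ)
    nlinarith
  calc Real.log (1 + rexp (2 * h)) ≤ Real.log (rexp (1 + 2 * |h|)) :=
        Real.log_le_log (by positivity) h1
    _ = _ := Real.log_exp _

lemma negMulLog_one_sub_le {f : ℝ} (h1 : f < 1) : negMulLog (1 - f) ≤ f := by
  have h := Real.one_sub_inv_le_log_of_pos (sub_pos.2 h1)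
  have h2 := mul_le_mul_of_nonneg_left h (sub_pos.2 h1).le
  rw [mul_sub, mul_inv_cancel₀ (sub_pos.2 h1).ne'] at h2
  rw [negMulLog]
  linarith

lemma log_fermi_sub (h : ℝ) : Real.log (fermi h) - Real.log (1 - fermi h) = -(2 * h) := by
  have h1 : 1 - fermi h = rexp (2 * h) * fermi h := by
    rw [fermi]
    have := exp_pos (2 * h)
    field_simp
    ring
  rw [h1, Real.log_mul (exp_pos _).ne' (fermi_pos h).ne', Real.log_exp]
  ring

namespace EigenBasis
open MagLattice
variable {M : MagLattice τ} (B : EigenBasis M) {v : ℂ → ℝ} {μ T : ℝ} {γ : M.H →L[ℂ] M.H}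
  {k : ℂ → ℂ → ℂ}

lemma inner_negLap_e (hτ : 0 < τ.im) {φ : ℂ → ℂ} (hφ : M.IsSection φ) (i : B.ι) :
    ⟪M.toH (negLap (aB M.b) φ), B.e i⟫_ℂ = B.lam i * ⟪M.toH φ, B.e i⟫_ℂ := by
  rw [← B.toH_f i, inner_negLap hτ hφ (B.isSection i), funext (B.isEig i).2,
    toH_const_mul hτ (B.isSection i), inner_smul_right]

lemma summable_lam_mul_fermi (hτ : 0 < τ.im) (hT : 0 < T) (m : ℝ) :
    Summable fun i => B.lam i * fermi ((B.lam i - m) / T) := by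
  have hs := (B.summable_exp hτ (inv_pos.2 hT)).mul_left (T * rexp (2 * m / T))
  refine Summable.of_nonneg_of_le (fun i => mul_nonneg (B.lam_nonneg hτ i) (fermi_pos _).le)
    (fun i => ?_) hs
  have h0 := B.lam_nonneg hτ i
  have h1 : B.lam i ≤ T * rexp (B.lam i / T) := by
    have := Real.add_one_le_exp (B.lam i / T)
    calc B.lam i = T * (B.lam i / T) := by field_simp
      _ ≤ _ := by gcongr; linarith
  calc B.lam i * fermi ((B.lam i - m) / T)
      ≤ T * rexp (B.lam i / T) * rexp (-(2 * ((B.lam i - m) / T))) :=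
        mul_le_mul h1 (fermi_le_exp _) (fermi_pos _).le (by positivity)
    _ = T * (rexp (B.lam i / T) * rexp (-(2 * ((B.lam i - m) / T)))) := by ring
    _ = T * (rexp (2 * m / T) * rexp (-B.lam i * T⁻¹)) := by
        rw [← Real.exp_add, ← Real.exp_add]
        congr 2
        field_simp
        ring
    _ = _ := by ring

lemma summable_negMulLog (hτ : 0 < τ.im) (hT : 0 < T) (m : ℝ) :
    Summable (fun i => negMulLog (fermi ((B.lam i - m) / T))) ∧
    Summable (fun i => negMulLog (1 - fermi ((B.lam i - m) / T))) := by
  have hf := (B.sum_fermi hτ hT m).1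
  constructor
  · have hs := (hf.mul_left (1 + 2 * |m| / T)).add
      ((B.summable_lam_mul_fermi hτ hT m).mul_left (2 / T))
    refine Summable.of_nonneg_of_le (fun i => Real.negMulLog_nonneg (fermi_pos _).le
      (fermi_lt_one _).le) (fun i => (negMulLog_fermi_le _).trans ?_) hs
    have h1 : |(B.lam i - m) / T| ≤ (B.lam i + |m|) / T := by
      rw [abs_div, abs_of_pos hT]
      gcongr
      refine (abs_sub _ _).trans ?_
      rw [abs_of_nonneg (B.lam_nonneg hτ i)]
    have h2 := (fermi_pos ((B.lam i - m) / T)).le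
    calc fermi ((B.lam i - m) / T) * (1 + 2 * |(B.lam i - m) / T|)
        ≤ fermi ((B.lam i - m) / T) * (1 + 2 * ((B.lam i + |m|) / T)) := by gcongr
      _ = _ := by ring
  · refine Summable.of_nonneg_of_le (fun i => Real.negMulLog_nonneg
      (by linarith [fermi_lt_one ((B.lam i - m) / T)]) (by linarith [fermi_pos ((B.lam i - m) / T)]))
      (fun i => negMulLog_one_sub_le (fermi_lt_one _)) hf

include B in
lemma exists_kinetic (hτ : 0 < τ.im) (hT : 0 < T) (hN : M.IsNormal v μ T γ k) :
    ∃ (t : ℝ) (A : M.H →L[ℂ] M.H), (∀ u, M.Schr (aB M.b) (fun _ => 0) (γ u) (A u)) ∧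
      HasTrace A t := by
  set m := chem v μ k
  have hs := B.summable_lam_mul_fermi hτ hT m
  obtain ⟨A, hA⟩ := exists_isDiag B.e
    (fun i => ((B.lam i * fermi ((B.lam i - m) / T) : ℝ) : ℂ))
    (C := ∑' i, B.lam i * fermi ((B.lam i - m) / T)) (fun i => by
      have h0 : ∀ i, 0 ≤ B.lam i * fermi ((B.lam i - m) / T) := fun i =>
        mul_nonneg (B.lam_nonneg hτ i) (fermi_pos _).le
      rw [norm_real, norm_eq_abs, abs_of_nonneg (h0 i)]
      exact hs.le_tsum i fun j _ => h0 j)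
  have hγ : IsDiag B.e (fun i => ((fermi ((B.lam i - m) / T) : ℝ) : ℂ)) γ :=
    IsDiag.of_apply_basis (hN.gamma_e B hτ)
  refine ⟨_, A, fun u φ hφ => ?_, hA.hasTrace (hasSum_ofReal.2 hs.hasSum)⟩
  simp only [ofReal_zero, zero_mul, add_zero]
  rw [← inner_toH hτ hφ.negLap, ← inner_toH hτ hφ,
    ← B.e.tsum_inner_mul_inner, ← B.e.tsum_inner_mul_inner (M.toH φ)]
  refine tsum_congr fun i => ?_
  rw [B.inner_negLap_e hτ hφ, hA, hγ]
  push_cast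
  ring

include B in
/-- Up to the pairing energy and the entropy the free energy depends on `γ` only. -/
lemma exists_freeEnergy (hτ : 0 < τ.im) (hT : 0 < T) (hN : M.IsNormal v μ T γ k)
    {V : M.HH →L[ℂ] M.HH} (hV : ∀ κ, M.VSharp v κ (V κ))
    (hVs : ∀ κ η, ⟪V κ, η⟫_ℂ = ⟪κ, V η⟫_ℂ) :
    ∃ G : ℝ, ∀ (κ : M.HH) (S : ℝ), HasTrace (negLog (M.Gam γ (M.kerOp κ))) S →
      M.HasFreeEnergy v μ T (aB M.b) γ k (M.kerOp κ) κ (G + (⟪κ, V κ⟫_ℂ).re / 2 - T * S) := by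
  obtain ⟨t, A, hA1, hA2⟩ := B.exists_kinetic hτ hT hN
  have hγ : IsDiag B.e (fun i => ((fermi ((B.lam i - chem v μ k) / T) : ℝ) : ℂ)) γ :=
    IsDiag.of_apply_basis (hN.gamma_e B hτ)
  have htr := hγ.hasTrace (hasSum_ofReal.2 (hN.hasSum_fermi B hτ hT))
  set N := M.vol.real univ * (k 0 0).re
  set c : ℝ := μ - chem v μ k with hc
  refine ⟨t + c * N / 2 + (∫ x, curl (aB M.b) x ^ 2 ∂M.vol) - μ * N, fun κ S hS =>
    ⟨t, c * N, (⟪κ, V κ⟫_ℂ).re, S, N, ⟨A, hA1, hA2⟩, ⟨(c : ℂ) • γ, fun u => ?_, fun ι e => ?_⟩,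
      ⟨M.kerOp (V κ), V κ, hV κ, M.hasL2Kernel_kerOp _, ?_⟩, hS, htr, by ring⟩⟩
  · filter_upwards [Lp.coeFn_smul (c : ℂ) (γ u)] with x hx
    have h1 := hN.direct_eq x
    have h2 : direct v (density k) x = c := by rw [hc]; linarith
    rw [h2, _root_.smul_apply, hx, Pi.smul_apply, smul_eq_mul]
  · have h := (htr ι e).mul_left (c : ℂ)
    push_cast at h ⊢
    convert! h using 1
    funext i
    change ⟪e i, (c : ℂ) • γ (e i)⟫_ℂ = _
    rw [inner_smul_right]
  · have h := hasTrace_adjoint_kerOp κ (V κ)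
    have h2 : (((⟪κ, V κ⟫_ℂ).re : ℝ) : ℂ) = ⟪κ, V κ⟫_ℂ := by
      rw [← conj_eq_iff_re, inner_conj_symm, hVs]
    rw [h2]
    exact h

/-- The diagonal entries of `Γ_{T,b}`. -/
def occ (T m : ℝ) : B.ι ⊕ B.ι → ℝ :=
  Sum.elim (fun i => fermi ((B.lam i - m) / T)) fun i => 1 - fermi ((B.lam i - m) / T)

lemma occ_pos (T m : ℝ) (s) : 0 < B.occ T m s := by
  rcases s with i | i
  · exact fermi_pos _
  · exact sub_pos.2 (fermi_lt_one _)

lemma occ_lt_one (T m : ℝ) (s) : B.occ T m s < 1 := by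
  rcases s with i | i
  · exact fermi_lt_one _
  · exact sub_lt_self _ (fermi_pos _)

lemma isDiag_gam (hτ : 0 < τ.im) (hN : M.IsNormal v μ T γ k) :
    IsDiag (sumBasis B.e) (fun s => (B.occ T (chem v μ k) s : ℂ)) (M.Gam γ 0) := by
  refine IsDiag.of_apply_basis fun s => ?_
  rcases s with i | i
  · rw [sumBasis_inl, Gam, block_apply, hN.gamma_e B hτ, occ,
      Sum.elim_inl, ← WithLp.toLp_smul]
    simp
  · rw [sumBasis_inr, Gam, block_apply, occ, Sum.elim_inr,
      ← WithLp.toLp_smul]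
    have : M.conjOp γ (M.conjH (B.e i)) =
        ((fermi ((B.lam i - chem v μ k) / T) : ℝ) : ℂ) • M.conjH (B.e i) := by
      change M.conjH (γ (M.conjH (M.conjH (B.e i)))) = _
      rw [M.conjH_conjH, hN.gamma_e B hτ, map_smulₛₗ, conj_ofReal]
    rw [_root_.sub_apply, this, one_apply_eq_self]
    simp [sub_smul]

/-- The matrix of `φ(α)`, `α` having the kernel `κ`. -/
lemma inner_offDiag (κ : M.HH) (i j : B.ι) :
    ⟪sumBasis B.e (Sum.inl i), M.offDiag (M.kerOp κ) (sumBasis B.e (Sum.inl j))⟫_ℂ = 0 ∧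
    ⟪sumBasis B.e (Sum.inr i), M.offDiag (M.kerOp κ) (sumBasis B.e (Sum.inr j))⟫_ℂ = 0 ∧
    ⟪sumBasis B.e (Sum.inl i), M.offDiag (M.kerOp κ) (sumBasis B.e (Sum.inr j))⟫_ℂ
      = ⟪M.tens (B.e i) (B.e j), κ⟫_ℂ ∧
    ⟪sumBasis B.e (Sum.inr j), M.offDiag (M.kerOp κ) (sumBasis B.e (Sum.inl i))⟫_ℂ
      = conj ⟪M.tens (B.e i) (B.e j), κ⟫_ℂ := by
  simp only [sumBasis_inl, sumBasis_inr, offDiag,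
    block_apply, WithLp.prod_inner_apply]
  have h : ⟪B.e i, M.kerOp κ (M.conjH (B.e j))⟫_ℂ = ⟪M.tens (B.e i) (B.e j), κ⟫_ℂ := by
    rw [MagLattice.inner_kerOp, M.conjH_conjH]
  refine ⟨by simp, by simp, by simp [h], ?_⟩
  rw [← h, inner_conj_symm]
  simp [adjoint_inner_right]

end EigenBasis

lemma fermi_entropy_eq {T x y : ℝ} (hT : 0 < T) (h : 0 < x + y) :
    ((Real.log (fermi (x / T)) - Real.log (1 - fermi (x / T))) +
      (Real.log (fermi (y / T)) - Real.log (1 - fermi (y / T)))) /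
      (fermi (x / T) - (1 - fermi (y / T))) = 4 / T * kT T x y := by
  have h1 : 0 < x / T + y / T := by rw [← add_div]; positivity
  rw [kT, if_neg h.ne', log_fermi_sub, log_fermi_sub]
  have h3 : fermi (x / T) - (1 - fermi (y / T)) = -((Real.tanh (x / T) + Real.tanh (y / T)) / 2) := by
    rw [tanh_eq_fermi, tanh_eq_fermi]; ring
  rw [h3]
  field_simp
  ring

namespace EigenBasis
open MagLattice
variable {M : MagLattice τ} (B : EigenBasis M) {v : ℂ → ℝ} {μ T : ℝ} {γ : M.H →L[ℂ] M.H}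
  {k : ℂ → ℂ → ℂ}

/-- The kernel `∑ c_ij e_i ⊗ e_j`. -/
def finKer (F : Finset B.ι) (c : B.ι → B.ι → ℂ) : M.HH :=
  ∑ i ∈ F, ∑ j ∈ F, c i j • M.tens (B.e i) (B.e j)

lemma inner_tens_finKer (F : Finset B.ι) (c : B.ι → B.ι → ℂ) (u w : M.H) :
    ⟪M.tens u w, B.finKer F c⟫_ℂ = ∑ i ∈ F, ∑ j ∈ F, c i j * (⟪u, B.e i⟫_ℂ * ⟪w, B.e j⟫_ℂ) := by
  simp only [finKer, inner_sum, inner_smul_right, inner_tens_tens]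

open Classical in
lemma inner_e_finKer (F : Finset B.ι) (c : B.ι → B.ι → ℂ) (i j : B.ι) :
    ⟪M.tens (B.e i) (B.e j), B.finKer F c⟫_ℂ = if i ∈ F ∧ j ∈ F then c i j else 0 := by
  rw [inner_tens_finKer]
  simp only [orthonormal_iff_ite.1 B.e.orthonormal, mul_ite, mul_one, mul_zero, sum_ite_eq]
  split_ifs <;> simp_all

lemma inner_finKer_symm (F : Finset B.ι) {c : B.ι → B.ι → ℂ} (hc : ∀ i j, c i j = c j i)
    (u w : M.H) : ⟪M.tens u w, B.finKer F c⟫_ℂ = ⟪M.tens w u, B.finKer F c⟫_ℂ := by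
  rw [inner_tens_finKer, inner_tens_finKer, sum_comm]
  refine sum_congr rfl fun j _ => sum_congr rfl fun i _ => ?_
  rw [hc i j]
  ring

lemma isSmooth_finKer (hτ : 0 < τ.im) (F : Finset B.ι) (c : B.ι → B.ι → ℂ) :
    M.IsSmooth (B.finKer F c) := by
  refine ⟨B.finKer F fun i j => c i j * B.lam j, fun u φ hφ => ?_⟩
  rw [M.pair_congr (EventuallyEq.refl _ _) (coeFn_toH hτ hφ.negLap).symm,
    M.pair_congr (EventuallyEq.refl _ _) (coeFn_toH hτ hφ).symm,
    pair_eq_inner, pair_eq_inner, inner_tens_finKer, inner_tens_finKer]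
  refine sum_congr rfl fun i _ => sum_congr rfl fun j _ => ?_
  rw [B.inner_negLap_e hτ hφ]
  ring

lemma sum_entropy_eq (hT : 0 < T) {m : ℝ} {F : Finset B.ι} (hF : ∀ i ∈ F, m < B.lam i)
    {c : B.ι → B.ι → ℂ} (hc : ∀ i j, c i j = c j i) :
    ∑ a ∈ F.disjSum F, ∑ b ∈ F.disjSum F, ‖⟪sumBasis B.e a,
        M.offDiag (M.kerOp (B.finKer F c)) (sumBasis B.e b)⟫_ℂ‖ ^ 2 *
        ((Real.log (B.occ T m a) + 1) / (B.occ T m a - B.occ T m b)) =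
    2 / T * ∑ i ∈ F, ∑ j ∈ F, kT T (B.lam i - m) (B.lam j - m) * ‖c i j‖ ^ 2 := by
  set f : B.ι → ℝ := fun i => fermi ((B.lam i - m) / T) with hf
  have hin : ∀ i ∈ F, ∀ j ∈ F, ⟪M.tens (B.e i) (B.e j), B.finKer F c⟫_ℂ = c i j :=
    fun i hi j hj => by rw [inner_e_finKer, if_pos ⟨hi, hj⟩]
  have h1 : ∑ a ∈ F.disjSum F, ∑ b ∈ F.disjSum F,
      ‖⟪sumBasis B.e a,
        M.offDiag (M.kerOp (B.finKer F c)) (sumBasis B.e b)⟫_ℂ‖ ^ 2 *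
        ((Real.log (B.occ T m a) + 1) / (B.occ T m a - B.occ T m b)) =
      (∑ i ∈ F, ∑ j ∈ F, ‖c i j‖ ^ 2 * ((Real.log (f i) + 1) / (f i - (1 - f j)))) +
      ∑ j ∈ F, ∑ i ∈ F, ‖c i j‖ ^ 2 * ((Real.log (1 - f j) + 1) / ((1 - f j) - f i)) := by
    rw [sum_disjSum]
    congr 1
    · refine sum_congr rfl fun i hi => ?_
      rw [sum_disjSum, sum_eq_zero, zero_add]
      · refine sum_congr rfl fun j hj => ?_
        rw [(B.inner_offDiag _ i j).2.2.1, hin i hi j hj]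
        rfl
      · intro j _
        rw [(B.inner_offDiag _ i j).1]
        simp
    · refine sum_congr rfl fun j hj => ?_
      rw [sum_disjSum, add_comm, sum_eq_zero, zero_add]
      · refine sum_congr rfl fun i hi => ?_
        rw [(B.inner_offDiag _ i j).2.2.2, hin i hi j hj, norm_conj]
        rfl
      · intro i _
        rw [(B.inner_offDiag _ j i).2.1]
        simp
  have h2 : (∑ i ∈ F, ∑ j ∈ F, ‖c i j‖ ^ 2 * ((Real.log (f i) + 1) / (f i - (1 - f j)))) +
      (∑ j ∈ F, ∑ i ∈ F, ‖c i j‖ ^ 2 * ((Real.log (1 - f j) + 1) / ((1 - f j) - f i))) =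
      ∑ i ∈ F, ∑ j ∈ F, ‖c i j‖ ^ 2 * ((Real.log (f i) - Real.log (1 - f j)) / (f i - (1 - f j))) := by
    rw [sum_comm (s := F) (t := F) (f := fun j i => ‖c i j‖ ^ 2 *
      ((Real.log (1 - f j) + 1) / ((1 - f j) - f i))), ← sum_add_distrib]
    refine sum_congr rfl fun i _ => ?_
    rw [← sum_add_distrib]
    refine sum_congr rfl fun j _ => ?_
    rw [← neg_sub (f i) (1 - f j), div_neg]
    ring
  have h3 : ∑ i ∈ F, ∑ j ∈ F, ‖c i j‖ ^ 2 *
      ((Real.log (f i) - Real.log (1 - f j)) / (f i - (1 - f j))) =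
      ∑ i ∈ F, ∑ j ∈ F, ‖c i j‖ ^ 2 *
      ((Real.log (f j) - Real.log (1 - f i)) / (f i - (1 - f j))) := by
    rw [sum_comm]
    refine sum_congr rfl fun i _ => sum_congr rfl fun j _ => ?_
    rw [hc j i]
    congr 2
    ring
  rw [h1, h2]
  have h4 : ∀ x y : ℝ, x = y → x = (x + y) / 2 := fun x y h => by rw [h]; ring
  rw [h4 _ _ h3, ← sum_add_distrib, sum_div, mul_sum]
  refine sum_congr rfl fun i hi => ?_
  rw [← sum_add_distrib, sum_div, mul_sum]
  refine sum_congr rfl fun j hj => ?_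
  have h5 := fermi_entropy_eq hT (x := B.lam i - m) (y := B.lam j - m)
    (by linarith [hF i hi, hF j hj])
  rw [← mul_add, ← add_div]
  have h6 : Real.log (f i) - Real.log (1 - f j) + (Real.log (f j) - Real.log (1 - f i)) =
      Real.log (f i) - Real.log (1 - f i) + (Real.log (f j) - Real.log (1 - f j)) := by ring
  rw [h6, h5]
  ring

include B in
/-- Symmetric trial kernels supported above the Fermi energy on which `4 K_{Tb} + v^♯` is negative
make the normal state unstable. -/
theorem unstable_of_trial (hτ : 0 < τ.im) (hT : 0 < T) (hN : M.IsNormal v μ T γ k)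
    {V : M.HH →L[ℂ] M.HH} (hV : ∀ κ, M.VSharp v κ (V κ))
    (hVs : ∀ κ η, ⟪V κ, η⟫_ℂ = ⟪κ, V η⟫_ℂ) {F : Finset B.ι}
    (hF : ∀ i ∈ F, chem v μ k < B.lam i) {c : B.ι → B.ι → ℂ} (hc : ∀ i j, c i j = c j i)
    (hneg : 4 * ∑ i ∈ F, ∑ j ∈ F, kT T (B.lam i - chem v μ k) (B.lam j - chem v μ k) * ‖c i j‖ ^ 2 +
      (⟪B.finKer F c, V (B.finKer F c)⟫_ℂ).re < 0) : M.Unstable v μ T γ k := by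
  set m := chem v μ k
  set κ := B.finKer F c with hκ
  set E := sumBasis B.e
  set d := B.occ T m
  set O := M.offDiag (M.kerOp κ)
  have hO := offDiag_symm (M.kerOp κ)
  have hΓ : IsDiag E (fun s => (d s : ℂ)) (M.Gam γ 0) := B.isDiag_gam hτ hN
  have hd0 : ∀ s, 0 < d s := B.occ_pos T m
  have hd1 : ∀ s, d s < 1 := B.occ_lt_one T m
  set F' : Finset (B.ι ⊕ B.ι) := F.disjSum F
  have hBF : ∀ a b, ¬(a ∈ F' ∧ b ∈ F') → ⟪E a, O (E b)⟫_ℂ = 0 := by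
    rintro (i | i) (j | j) h
    · exact (B.inner_offDiag κ i j).1
    · rw [(B.inner_offDiag κ i j).2.2.1, inner_e_finKer, if_neg (by simpa [F'] using h)]
    · rw [(B.inner_offDiag κ j i).2.2.2, inner_e_finKer,
        if_neg (by simpa [F', and_comm] using h), map_zero]
    · exact (B.inner_offDiag κ i j).2.1
  have hfd : ∀ i ∈ F, fermi ((B.lam i - m) / T) < 1 / 2 := fun i hi => by
    have h := fermi_strictAnti (show 0 < (B.lam i - m) / T from div_pos (sub_pos.2 (hF i hi)) hT)
    have h2 : fermi 0 = 1 / 2 := by rw [fermi]; norm_num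
    rwa [h2] at h
  have hBd : ∀ a b, d a = d b → ⟪E a, O (E b)⟫_ℂ = 0 := fun a b h => by
    by_cases hab : a ∈ F' ∧ b ∈ F'
    · obtain ⟨ha, hb⟩ := hab
      rcases a with i | i <;> rcases b with j | j
      · exact (B.inner_offDiag κ i j).1
      · have h3 : fermi ((B.lam i - m) / T) = 1 - fermi ((B.lam j - m) / T) := h
        linarith [hfd i (by simpa [F'] using ha), hfd j (by simpa [F'] using hb)]
      · have h3 : 1 - fermi ((B.lam i - m) / T) = fermi ((B.lam j - m) / T) := h
        linarith [hfd i (by simpa [F'] using ha), hfd j (by simpa [F'] using hb)]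
      · exact (B.inner_offDiag κ i j).2.1
    · exact hBF a b hab
  have hs : Summable fun s => negMulLog (d s) := by
    have h := B.summable_negMulLog hτ hT m
    exact Summable.sum _ h.1 h.2
  set K := ∑ i ∈ F, ∑ j ∈ F, kT T (B.lam i - m) (B.lam j - m) * ‖c i j‖ ^ 2 with hK
  set P := (⟪κ, V κ⟫_ℂ).re with hP
  obtain ⟨σ, hσ1, hσ2⟩ := exists_between (show 2 / T * K < -P / (2 * T) by
    rw [lt_div_iff₀ (by positivity)]
    have : 2 / T * K * (2 * T) = 4 * K := by field_simp; ring
    linarith)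
  obtain ⟨ε₁, hε₁, hent⟩ := exists_hasTrace_negLog E hd0 hΓ hO F' hBF hBd hs (σ := σ) (by
    rw [B.sum_entropy_eq hT hF hc]
    exact hσ1)
  obtain ⟨p, hp, hpd⟩ : ∃ p > 0, ∀ a ∈ F', p ≤ d a ∧ p ≤ 1 - d a := by
    have hpos : ∀ a, 0 < min (d a) (1 - d a) := fun a => lt_min (hd0 a) (sub_pos.2 (hd1 a))
    rcases F'.eq_empty_or_nonempty with h | h
    · exact ⟨1, one_pos, by simp [h]⟩
    · obtain ⟨a, ha, hmin⟩ := F'.exists_min_image (fun a => min (d a) (1 - d a)) h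
      exact ⟨_, hpos a, fun b hb => le_min_iff.1 (hmin b hb)⟩
  have hΓ' : IsDiag E (fun s => ((1 - d s : ℝ) : ℂ)) (1 - M.Gam γ 0) := by
    intro i x
    rw [hΓ.one_sub i x]
    push_cast
    rfl
  obtain ⟨G, hG⟩ := B.exists_freeEnergy hτ hT hN hV hVs
  refine ⟨M.kerOp κ, κ, ⟨M.hasL2Kernel_kerOp κ, B.isSmooth_finKer hτ F c,
    adjoint_kerOp_of_symm (B.inner_finKer_symm F hc), ?_⟩, ?_⟩
  · refine sq_le_of_finite_pert (d := fun s => d s * (1 - d s)) (F := F') (m := p * p) ?_ hO hBF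
      (by positivity) fun a ha => mul_le_mul (hpd a ha).1 (hpd a ha).2 hp.le (hd0 a).le
    intro i x
    rw [hΓ.mul hΓ' i x]
    push_cast
    rfl
  · have hpos : ∀ ε : ℝ, |ε| * ‖O‖ ≤ p → 0 ≤ M.Gam γ ((ε : ℂ) • M.kerOp κ) := fun ε hε => by
      rw [gam_add]
      exact nonneg_diag_add hΓ (fun a => (hd0 a).le) hO hBF (fun a ha => (hpd a ha).1) hε
    have hle : ∀ ε : ℝ, |ε| * ‖O‖ ≤ p → M.Gam γ ((ε : ℂ) • M.kerOp κ) ≤ 1 := fun ε hε => by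
      rw [← sub_nonneg, gam_add]
      have h := nonneg_diag_add hΓ' (fun a => (sub_pos.2 (hd1 a)).le) hO hBF
        (fun a ha => (hpd a ha).2) (ε := -ε) (by rwa [abs_neg])
      rw [ofReal_neg, neg_smul, ← sub_eq_add_neg, sub_sub] at h
      exact h
    refine ⟨min ε₁ (p / (‖O‖ + 1)), lt_min hε₁ (by positivity), fun ε hε0 hε => ?_⟩
    have hε1 : |ε| < ε₁ := hε.trans_le (min_le_left _ _)
    have hε2 : |ε| * ‖O‖ ≤ p := by
      have h1 := hε.trans_le (min_le_right _ _)
      rw [lt_div_iff₀ (by positivity)] at h1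
      nlinarith [abs_nonneg ε]
    refine ⟨⟨hpos ε hε2, hle ε hε2, ?_⟩, ?_⟩
    · rw [map_smulₛₗ, conj_ofReal, conjOp_smul_real,
        adjoint_kerOp_of_symm (B.inner_finKer_symm F hc)]
    · have hg := gam_add γ (M.kerOp κ) ε
      obtain ⟨S, hS, hSle⟩ := hent ε hε1 (by rw [← hg]; exact hpos ε hε2)
      have hk : (ε : ℂ) • M.kerOp κ = M.kerOp ((ε : ℂ) • κ) := (M.kerOp_smul _ _).symm
      have hk0 : M.kerOp (0 : M.HH) = 0 := by
        have := M.kerOp_smul 0 κ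
        simpa using this
      have hS0 : HasTrace (negLog (M.Gam γ 0)) ((∑' s, negMulLog (d s) : ℝ) : ℂ) :=
        (hΓ.cfc Real.continuous_negMulLog).hasTrace (hasSum_ofReal.2 hs.hasSum)
      have hF1 := hG ((ε : ℂ) • κ) S (by rw [← hk, hg]; exact hS)
      have hF0 := hG 0 (∑' s, negMulLog (d s)) (by rw [hk0]; exact hS0)
      rw [← hk] at hF1
      rw [hk0] at hF0
      refine ⟨_, _, hF1, hF0, ?_⟩
      have h1 : (⟪(ε : ℂ) • κ, V ((ε : ℂ) • κ)⟫_ℂ).re = ε ^ 2 * P := by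
        rw [map_smul, inner_smul_left, inner_smul_right, conj_ofReal, ← mul_assoc,
          ← ofReal_mul, re_ofReal_mul, pow_two]
      rw [h1, map_zero, inner_zero_right, zero_re]
      rw [lt_div_iff₀ (by positivity)] at hσ2
      have h2 : 0 < ε ^ 2 := by positivity
      have h3 : T * -S ≤ T * (-∑' s, negMulLog (d s) + ε ^ 2 * σ) := by gcongr
      nlinarith

end EigenBasis

/-! ## Localized pair functions -/

/-- `κ` is continuous and supported where both particles are within distance `ρ` of the origin. -/
structure LocKer (ρ : ℝ) (κ : ℂ × ℂ → ℂ) : Prop where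
  cont : Continuous κ
  supp : ∀ p, κ p ≠ 0 → ‖p.1‖ ≤ ρ ∧ ‖p.2‖ ≤ ρ

namespace LocKer
variable {ρ : ℝ} {κ η : ℂ × ℂ → ℂ}

lemma add (hκ : LocKer ρ κ) (hη : LocKer ρ η) : LocKer ρ (fun p => κ p + η p) :=
  ⟨hκ.cont.add hη.cont, fun p hp => by
    by_cases h : κ p = 0
    · exact hη.supp p fun h' => hp (by rw [h, h', add_zero])
    · exact hκ.supp p h⟩

lemma mul_left (hκ : LocKer ρ κ) {f : ℂ × ℂ → ℂ} (hf : Continuous f) :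
    LocKer ρ (fun p => f p * κ p) :=
  ⟨hf.mul hκ.cont, fun p hp => hκ.supp p (right_ne_zero_of_mul hp)⟩

lemma const_mul (hκ : LocKer ρ κ) (c : ℂ) : LocKer ρ (fun p => c * κ p) :=
  hκ.mul_left continuous_const

lemma hasCompactSupport (hκ : LocKer ρ κ) : HasCompactSupport κ := by
  refine HasCompactSupport.intro
    ((isCompact_closedBall (0 : ℂ) ρ).prod (isCompact_closedBall (0 : ℂ) ρ)) fun p hp => ?_
  by_contra h
  exact hp ⟨mem_closedBall_zero_iff.2 (hκ.supp p h).1, mem_closedBall_zero_iff.2 (hκ.supp p h).2⟩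

lemma memLp (hκ : LocKer ρ κ) {ν : Measure (ℂ × ℂ)} [IsFiniteMeasureOnCompacts ν] : MemLp κ 2 ν :=
  hκ.cont.memLp_of_hasCompactSupport hκ.hasCompactSupport

lemma exists_bound (hκ : LocKer ρ κ) : ∃ C, ∀ p, ‖κ p‖ ≤ C :=
  hκ.cont.bounded_above_of_compact_support hκ.hasCompactSupport

end LocKer

open Classical in
/-- The class of a square integrable function. -/
def cls {X : Type*} [MeasurableSpace X] (ν : Measure X) (κ : X → ℂ) : Lp ℂ 2 ν :=
  if h : MemLp κ 2 ν then h.toLp κ else 0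

section cls
variable {X : Type*} [MeasurableSpace X] {ν : Measure X} {κ η : X → ℂ}

lemma coeFn_cls (hκ : MemLp κ 2 ν) : cls ν κ =ᵐ[ν] κ := by
  rw [cls, dif_pos hκ]
  exact hκ.coeFn_toLp

lemma inner_cls (hκ : MemLp κ 2 ν) (hη : MemLp η 2 ν) :
    ⟪cls ν κ, cls ν η⟫_ℂ = ∫ p, conj (κ p) * η p ∂ν := by
  rw [L2_inner_eq]
  refine integral_congr_ae ?_
  filter_upwards [coeFn_cls hκ, coeFn_cls hη] with p h1 h2
  rw [h1, h2]

lemma cls_add (hκ : MemLp κ 2 ν) (hη : MemLp η 2 ν) :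
    cls ν (fun p => κ p + η p) = cls ν κ + cls ν η := by
  apply Lp.ext
  filter_upwards [coeFn_cls hκ, coeFn_cls hη, coeFn_cls (hκ.add hη),
    Lp.coeFn_add (cls ν κ) (cls ν η)] with p h1 h2 h3 h4
  exact h3.trans (by rw [h4, Pi.add_apply, Pi.add_apply, h1, h2])

lemma cls_const_mul (hκ : MemLp κ 2 ν) (c : ℂ) : cls ν (fun p => c * κ p) = c • cls ν κ := by
  apply Lp.ext
  filter_upwards [coeFn_cls hκ, coeFn_cls (hκ.const_mul c),
    Lp.coeFn_smul c (cls ν κ)] with p h1 h2 h3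
  rw [h2, h3, Pi.smul_apply, h1, smul_eq_mul]

end cls

/-- The Laplacian `-Δ_{a_b}` in the first variable. -/
def lapx (b : ℝ) (κ : ℂ × ℂ → ℂ) (p : ℂ × ℂ) : ℂ := negLap (aB b) (fun x => κ (x, p.2)) p.1

/-- Derivative in the first variable. -/
def dx (v : ℂ) (κ : ℂ × ℂ → ℂ) (p : ℂ × ℂ) : ℂ := fderiv ℝ κ p (v, 0)

lemma contDiff_dx {v : ℂ} {κ : ℂ × ℂ → ℂ} (h : ContDiff ℝ ∞ κ) : ContDiff ℝ ∞ (dx v κ) :=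
  (h.fderiv_right (m := ∞) (by simp)).clm_apply contDiff_const

lemma hasFDerivAt_slice {κ : ℂ × ℂ → ℂ} (h : Differentiable ℝ κ) (x y : ℂ) :
    HasFDerivAt (fun x => κ (x, y)) ((fderiv ℝ κ (x, y)).comp (ContinuousLinearMap.inl ℝ ℂ ℂ)) x :=
  (h (x, y)).hasFDerivAt.comp x (hasFDerivAt_prodMk_left x y)

lemma fderiv_slice {κ : ℂ × ℂ → ℂ} (h : Differentiable ℝ κ) (v x y : ℂ) :
    fderiv ℝ (fun x => κ (x, y)) x v = dx v κ (x, y) := by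
  rw [(hasFDerivAt_slice h x y).fderiv]
  rfl

lemma covd_covd (b : ℝ) (v : ℂ) {f : ℂ → ℂ} (hf : ContDiff ℝ ∞ f) (x : ℂ) :
    covd b v (covd b v f) x = fderiv ℝ (fun y => fderiv ℝ f y v) x v -
      I * ((b * wedge x v : ℝ) : ℂ) * fderiv ℝ f x v - ((b / 2 * wedge x v : ℝ) : ℂ) ^ 2 * f x := by
  have h1 : DifferentiableAt ℝ (fun y => fderiv ℝ f y v) x :=
    ((hf.fderiv_right (m := ∞) (by simp)).clm_apply contDiff_const).differentiable (by simp) x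
  have h2 : DifferentiableAt ℝ f x := hf.differentiable (by simp) x
  have h3 : HasFDerivAt (fun y => wedge y v) (v.im • reCLM - v.re • imCLM) x := by
    unfold wedge
    exact (reCLM.hasFDerivAt.mul_const v.im).sub (imCLM.hasFDerivAt.mul_const v.re)
  have h4 : HasFDerivAt (fun y => I * ((b / 2 * wedge y v : ℝ) : ℂ))
      (I • ofRealCLM.comp ((b / 2) • (v.im • reCLM - v.re • imCLM))) x :=
    (ofRealCLM.hasFDerivAt.comp x (h3.const_mul (b / 2))).const_mul I
  have h5 := h1.hasFDerivAt.sub (h4.mul h2.hasFDerivAt)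
  have h6 : covd b v f = fun y => fderiv ℝ f y v - I * ((b / 2 * wedge y v : ℝ) : ℂ) * f y := rfl
  rw [covd, h6, show fderiv ℝ (fun y => fderiv ℝ f y v - I * ((b / 2 * wedge y v : ℝ) : ℂ) * f y) x
    = _ from h5.fderiv]
  simp [wedge]
  ring_nf
  rw [I_sq]
  ring

/-- The first order part of `-Δ_{a_b}` in `b`. -/
def angx (κ : ℂ × ℂ → ℂ) (p : ℂ × ℂ) : ℂ :=
  I * (((-p.1.im : ℝ) : ℂ) * dx 1 κ p + (p.1.re : ℂ) * dx I κ p)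

lemma lapx_eq (b : ℝ) {κ : ℂ × ℂ → ℂ} (h : ContDiff ℝ ∞ κ) (p : ℂ × ℂ) :
    lapx b κ p = -(dx 1 (dx 1 κ) p + dx I (dx I κ) p) + b * angx κ p +
      (b : ℂ) ^ 2 * (((‖p.1‖ ^ 2 / 4 : ℝ) : ℂ) * κ p) := by
  obtain ⟨x, y⟩ := p
  have hs : ContDiff ℝ ∞ fun x => κ (x, y) := h.comp (contDiff_id.prodMk contDiff_const)
  have hd : Differentiable ℝ κ := h.differentiable (by simp)
  have hd' : ∀ v, Differentiable ℝ (dx v κ) := fun v => (contDiff_dx h).differentiable (by simp)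
  have h2 : ∀ v, fderiv ℝ (fun x => fderiv ℝ (fun x => κ (x, y)) x v) x v = dx v (dx v κ) (x, y) :=
    fun v => by
      have : (fun x => fderiv ℝ (fun x => κ (x, y)) x v) = fun x => dx v κ (x, y) :=
        funext fun x => fderiv_slice hd v x y
      rw [this, fderiv_slice (hd' v)]
  rw [lapx, negLap_aB, covd_covd b 1 hs, covd_covd b I hs, h2, h2, fderiv_slice hd, fderiv_slice hd]
  have h3 : ‖x‖ ^ 2 = x.re ^ 2 + x.im ^ 2 := by
    rw [← normSq_eq_norm_sq, normSq_apply]; ring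
  rw [angx, h3]
  simp [wedge]
  ring

lemma LocKer.dx {ρ : ℝ} {κ : ℂ × ℂ → ℂ} (hκ : LocKer ρ κ) (h : ContDiff ℝ ∞ κ) (v : ℂ) :
    LocKer ρ (dx v κ) := by
  refine ⟨(contDiff_dx h).continuous, fun p hp => ?_⟩
  have h1 : p ∈ tsupport κ := by
    refine support_fderiv_subset ℝ (f := κ) ?_
    intro h0
    exact hp (by rw [BdG.dx, h0]; rfl)
  have h2 : tsupport κ ⊆ Metric.closedBall (0 : ℂ) ρ ×ˢ Metric.closedBall (0 : ℂ) ρ :=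
    closure_minimal (fun q hq => ⟨mem_closedBall_zero_iff.2 (hκ.supp q hq).1,
      mem_closedBall_zero_iff.2 (hκ.supp q hq).2⟩) (Metric.isClosed_closedBall.prod Metric.isClosed_closedBall)
  exact ⟨mem_closedBall_zero_iff.1 (h2 h1).1, mem_closedBall_zero_iff.1 (h2 h1).2⟩

lemma LocKer.angx {ρ : ℝ} {κ : ℂ × ℂ → ℂ} (hκ : LocKer ρ κ) (h : ContDiff ℝ ∞ κ) :
    LocKer ρ (angx κ) :=
  (((hκ.dx h 1).mul_left (f := fun p => ((-p.1.im : ℝ) : ℂ)) (by fun_prop)).add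
    ((hκ.dx h I).mul_left (f := fun p => (p.1.re : ℂ)) (by fun_prop))).const_mul I

lemma LocKer.sq_mul {ρ : ℝ} {κ : ℂ × ℂ → ℂ} (hκ : LocKer ρ κ) :
    LocKer ρ (fun p => ((‖p.1‖ ^ 2 / 4 : ℝ) : ℂ) * κ p) :=
  hκ.mul_left (by fun_prop)

/-- The Laplacian without field in the first variable. -/
def lapx₀ (κ : ℂ × ℂ → ℂ) (p : ℂ × ℂ) : ℂ := -(BdG.dx 1 (BdG.dx 1 κ) p + BdG.dx I (BdG.dx I κ) p)

lemma LocKer.lapx₀ {ρ : ℝ} {κ : ℂ × ℂ → ℂ} (hκ : LocKer ρ κ) (h : ContDiff ℝ ∞ κ) :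
    LocKer ρ (lapx₀ κ) := by
  have h1 := (((hκ.dx h 1).dx (contDiff_dx h) 1).add
    ((hκ.dx h I).dx (contDiff_dx h) I)).const_mul (-1)
  have h2 : BdG.lapx₀ κ = fun p => -1 * (BdG.dx 1 (BdG.dx 1 κ) p + BdG.dx I (BdG.dx I κ) p) :=
    funext fun p => by rw [BdG.lapx₀, neg_one_mul]
  rw [h2]
  exact h1

lemma lapx_eq_lapx₀ (b : ℝ) {κ : ℂ × ℂ → ℂ} (h : ContDiff ℝ ∞ κ) :
    lapx b κ = fun p => (lapx₀ κ p + (b : ℂ) * angx κ p) +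
      (b : ℂ) ^ 2 * (((‖p.1‖ ^ 2 / 4 : ℝ) : ℂ) * κ p) := funext (lapx_eq b h)

lemma LocKer.lapx {ρ : ℝ} {κ : ℂ × ℂ → ℂ} (hκ : LocKer ρ κ) (h : ContDiff ℝ ∞ κ) (b : ℝ) :
    LocKer ρ (lapx b κ) := by
  rw [lapx_eq_lapx₀ b h]
  exact ((hκ.lapx₀ h).add ((hκ.angx h).const_mul b)).add (hκ.sq_mul.const_mul _)

lemma LocKer.cls_lapx {ρ : ℝ} {κ : ℂ × ℂ → ℂ} (hκ : LocKer ρ κ) (h : ContDiff ℝ ∞ κ) (b : ℝ) :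
    cls volume (BdG.lapx b κ) = cls volume (BdG.lapx₀ κ) + (b : ℂ) • cls volume (BdG.angx κ) +
      ((b : ℂ) ^ 2) • cls volume (fun p : ℂ × ℂ => ((‖p.1‖ ^ 2 / 4 : ℝ) : ℂ) * κ p) := by
  rw [lapx_eq_lapx₀ b h,
    BdG.cls_add ((hκ.lapx₀ h).add ((hκ.angx h).const_mul b)).memLp (hκ.sq_mul.const_mul _).memLp,
    BdG.cls_const_mul hκ.sq_mul.memLp, ← BdG.cls_const_mul (hκ.angx h).memLp,
    ← BdG.cls_add (hκ.lapx₀ h).memLp ((hκ.angx h).const_mul b).memLp]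

/-! ## Embedding localized pair functions into `𝔥 ⊗ 𝔥` -/

lemma exists_cell_center (hτ : 0 < τ.im) {ρ : ℝ} (hρ : 0 ≤ ρ) : ∃ ε > 0, ∀ M : MagLattice τ,
    M.b < ε → ∃ z : ℂ, ∀ x, ‖x - z‖ ≤ ρ → x ∈ M.cell := by
  set K := ρ * (1 + (1 + |τ.re|) / τ.im) with hK
  have hK0 : 0 ≤ K := by positivity
  refine ⟨1 / (4 * (K ^ 2 + 1) * τ.im), by positivity, fun M hb => ?_⟩
  have hδ := M.δ_pos
  have h1 : M.δ * K < 1 / 2 := by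
    refine lt_of_pow_lt_pow_left₀ 2 (by norm_num) ?_
    have h2 := M.two_pi_le hτ
    have h3 : M.δ ^ 2 ≤ M.b * τ.im := by nlinarith [Real.pi_gt_three, sq_nonneg M.δ]
    have h4 : M.b * τ.im < 1 / (4 * (K ^ 2 + 1)) := by
      calc M.b * τ.im < 1 / (4 * (K ^ 2 + 1) * τ.im) * τ.im := mul_lt_mul_of_pos_right hb hτ
        _ = _ := by field_simp
    rw [lt_div_iff₀ (by positivity)] at h4
    rw [mul_pow]
    nlinarith [sq_nonneg K, mul_nonneg (sq_nonneg K) (sq_nonneg M.δ)]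
  refine ⟨((M.δ⁻¹ : ℝ) : ℂ) * (((1 / 2 : ℝ) : ℂ) + ((1 / 2 : ℝ) : ℂ) * τ), fun x hx => ?_⟩
  set z := ((M.δ⁻¹ : ℝ) : ℂ) * (((1 / 2 : ℝ) : ℂ) + ((1 / 2 : ℝ) : ℂ) * τ) with hz
  obtain ⟨hs, ht⟩ := M.coord_comb hτ (1 / 2) (1 / 2)
  rw [← hz] at hs ht
  have hre := (abs_re_le_norm (x - z)).trans hx
  have him := (abs_im_le_norm (x - z)).trans hx
  have htc : |M.tc (x - z)| ≤ M.δ * ρ / τ.im := by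
    rw [MagLattice.tc, abs_div, abs_mul, abs_of_pos hδ, abs_of_pos hτ]
    gcongr
  have hsc : |M.sc (x - z)| ≤ M.δ * K := by
    rw [MagLattice.sc]
    refine (abs_sub _ _).trans ?_
    rw [abs_mul, abs_mul, abs_of_pos hδ]
    calc M.δ * |(x - z).re| + |M.tc (x - z)| * |τ.re| ≤ M.δ * ρ + M.δ * ρ / τ.im * |τ.re| := by
          gcongr
      _ ≤ M.δ * ρ + M.δ * ρ / τ.im * |τ.re| + M.δ * ρ / τ.im :=
          le_add_of_nonneg_right (by positivity)
      _ = M.δ * K := by rw [hK]; ring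
  have htc' : |M.tc (x - z)| ≤ M.δ * K := by
    refine htc.trans ?_
    have : M.δ * K = M.δ * ρ / τ.im + (M.δ * ρ + M.δ * ρ / τ.im * |τ.re|) := by rw [hK]; ring
    rw [this]
    exact le_add_of_nonneg_right (by positivity)
  have hx' : x = (x - z) + z := by ring
  rw [M.mem_cell_iff hτ, hx', M.sc_add, M.tc_add, hs, ht]
  have := abs_lt.1 (hsc.trans_lt h1)
  have := abs_lt.1 (htc'.trans_lt h1)
  constructor <;> constructor <;> linarith

/-- Magnetic translation by `z` of both particles. -/
def shift (b : ℝ) (z : ℂ) (κ : ℂ × ℂ → ℂ) (p : ℂ × ℂ) : ℂ :=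
  mtr b z 0 (fun x => mtr b z 0 (fun y => κ (x, y)) p.2) p.1

lemma shift_apply (b : ℝ) (z : ℂ) (κ : ℂ × ℂ → ℂ) (p : ℂ × ℂ) :
    shift b z κ p = exp (I * ((b / 2 * wedge z p.1 + 0 : ℝ) : ℂ)) *
      (exp (I * ((b / 2 * wedge z p.2 + 0 : ℝ) : ℂ)) * κ (p - (z, z))) := rfl

lemma norm_shift (b : ℝ) (z : ℂ) (κ : ℂ × ℂ → ℂ) (p : ℂ × ℂ) :
    ‖shift b z κ p‖ = ‖κ (p - (z, z))‖ := by
  rw [shift_apply, norm_mul, norm_mul, mul_comm I, mul_comm I, norm_exp_ofReal_mul_I,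
    norm_exp_ofReal_mul_I, one_mul, one_mul]

lemma conj_shift_mul (b : ℝ) (z : ℂ) (κ η : ℂ × ℂ → ℂ) (p : ℂ × ℂ) :
    conj (shift b z κ p) * shift b z η p = conj (κ (p - (z, z))) * η (p - (z, z)) := by
  have h : ∀ r : ℝ, conj (exp (I * (r : ℂ))) * exp (I * (r : ℂ)) = 1 := fun r => by
    rw [mul_comm, mul_conj, normSq_eq_norm_sq, mul_comm I, norm_exp_ofReal_mul_I]
    norm_num
  rw [shift_apply, shift_apply, map_mul, map_mul]
  linear_combination (conj (κ (p - (z, z))) * η (p - (z, z))) * h (b / 2 * wedge z p.1 + 0) *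
    (conj (exp (I * ((b / 2 * wedge z p.2 + 0 : ℝ) : ℂ))) *
      exp (I * ((b / 2 * wedge z p.2 + 0 : ℝ) : ℂ))) +
    (conj (κ (p - (z, z))) * η (p - (z, z))) * h (b / 2 * wedge z p.2 + 0)

lemma LocKer.shift {ρ : ℝ} {κ : ℂ × ℂ → ℂ} (hκ : LocKer ρ κ) (b : ℝ) (z : ℂ) :
    LocKer (ρ + ‖z‖) (shift b z κ) := by
  refine ⟨?_, fun p hp => ?_⟩
  · have h1 : BdG.shift b z κ = fun p : ℂ × ℂ => exp (I * ((b / 2 * wedge z p.1 + 0 : ℝ) : ℂ)) *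
      (exp (I * ((b / 2 * wedge z p.2 + 0 : ℝ) : ℂ)) * κ (p - (z, z))) := rfl
    rw [h1]
    unfold wedge
    have := hκ.cont.comp (continuous_id.sub (continuous_const (y := ((z, z) : ℂ × ℂ))))
    refine Continuous.mul (by fun_prop) (Continuous.mul (by fun_prop) this)
  · have h := hκ.supp (p - (z, z)) (norm_ne_zero_iff.1 (by
      rw [← norm_shift b z κ p]; exact norm_ne_zero_iff.2 hp))
    have h1 := norm_le_norm_add_norm_sub' p.1 z
    have h2 := norm_le_norm_add_norm_sub' p.2 z
    have h3 : ‖p.1 - z‖ ≤ ρ := h.1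
    have h4 : ‖p.2 - z‖ ≤ ρ := h.2
    constructor <;> linarith

namespace MagLattice
variable {M : MagLattice τ} {ρ : ℝ} {z : ℂ} {κ η : ℂ × ℂ → ℂ}

lemma vol_prod_vol : M.vol.prod M.vol = (volume : Measure (ℂ × ℂ)).restrict (M.cell ×ˢ M.cell) := by
  rw [vol, Measure.prod_restrict, ← Measure.volume_eq_prod]

lemma integral_eq_of_supp {g : ℂ × ℂ → ℂ} (hg : ∀ p, g p ≠ 0 → p.1 ∈ M.cell ∧ p.2 ∈ M.cell) :
    ∫ p, g p ∂(M.vol.prod M.vol) = ∫ p, g p := by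
  rw [vol_prod_vol]
  refine setIntegral_eq_integral_of_forall_compl_eq_zero fun p hp => ?_
  by_contra h
  exact hp (hg p h)

lemma mem_cell_of_shift_ne_zero {b : ℝ} (hκ : LocKer ρ κ) (hz : ∀ x, ‖x - z‖ ≤ ρ → x ∈ M.cell)
    {p : ℂ × ℂ} (hp : shift b z κ p ≠ 0) : p.1 ∈ M.cell ∧ p.2 ∈ M.cell := by
  have h := hκ.supp (p - (z, z)) (norm_ne_zero_iff.1 (by
    rw [← norm_shift b z κ p]; exact norm_ne_zero_iff.2 hp))
  exact ⟨hz _ h.1, hz _ h.2⟩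

variable (M) in
/-- The element of `𝔥 ⊗ 𝔥` given by a translate of `κ`. -/
def emb (z : ℂ) (κ : ℂ × ℂ → ℂ) : M.HH := cls (M.vol.prod M.vol) (shift M.b z κ)

lemma emb_add (hκ : LocKer ρ κ) (hη : LocKer ρ η) :
    M.emb z (fun p => κ p + η p) = M.emb z κ + M.emb z η := by
  rw [emb, emb, emb, ← cls_add (hκ.shift M.b z).memLp (hη.shift M.b z).memLp]
  congr 1
  funext p
  simp only [shift_apply]
  ring

lemma emb_const_mul (hκ : LocKer ρ κ) (c : ℂ) : M.emb z (fun p => c * κ p) = c • M.emb z κ := by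
  rw [emb, emb, ← cls_const_mul (hκ.shift M.b z).memLp]
  congr 1
  funext p
  simp only [shift_apply]
  ring

lemma coeFn_emb (hκ : LocKer ρ κ) : M.emb z κ =ᵐ[M.vol.prod M.vol] shift M.b z κ :=
  coeFn_cls (hκ.shift M.b z).memLp

lemma inner_emb (hz : ∀ x, ‖x - z‖ ≤ ρ → x ∈ M.cell) (hκ : LocKer ρ κ) (hη : LocKer ρ η) :
    ⟪M.emb z κ, M.emb z η⟫_ℂ = ⟪cls volume κ, cls volume η⟫_ℂ := by
  rw [inner_cls hκ.memLp hη.memLp, emb, emb,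
    inner_cls (hκ.shift M.b z).memLp (hη.shift M.b z).memLp, integral_eq_of_supp]
  · simp only [conj_shift_mul]
    rw [Measure.volume_eq_prod]
    exact integral_sub_right_eq_self (fun p => conj (κ p) * η p) _
  · exact fun p hp => mem_cell_of_shift_ne_zero hη hz (right_ne_zero_of_mul hp)

lemma norm_emb (hz : ∀ x, ‖x - z‖ ≤ ρ → x ∈ M.cell) (hκ : LocKer ρ κ) :
    ‖M.emb z κ‖ = ‖cls volume κ‖ := by
  rw [@norm_eq_sqrt_re_inner ℂ, @norm_eq_sqrt_re_inner ℂ, inner_emb hz hκ hκ]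

end MagLattice

namespace EigenBasis
variable {M : MagLattice τ} (B : EigenBasis M) {ρ : ℝ} {z : ℂ} {κ : ℂ × ℂ → ℂ}

lemma inner_emb_eq (hτ : 0 < τ.im) (hz : ∀ x, ‖x - z‖ ≤ ρ → x ∈ M.cell) (hκ : LocKer ρ κ)
    (i j : B.ι) : ⟪M.tens (B.e i) (B.e j), M.emb z κ⟫_ℂ =
      ∫ p : ℂ × ℂ, conj (B.f i p.1) * conj (B.f j p.2) * shift M.b z κ p := by
  rw [← MagLattice.pair_eq_inner, M.pair_congr (B.coeFn_e hτ i) (B.coeFn_e hτ j), MagLattice.pair,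
    ← MagLattice.integral_eq_of_supp (M := M)]
  · refine integral_congr_ae ?_
    filter_upwards [MagLattice.coeFn_emb (M := M) (z := z) hκ] with p h
    rw [h]
  · exact fun p hp => MagLattice.mem_cell_of_shift_ne_zero hκ hz (right_ne_zero_of_mul hp)

lemma inner_emb_swap (hτ : 0 < τ.im) (hz : ∀ x, ‖x - z‖ ≤ ρ → x ∈ M.cell) (hκ : LocKer ρ κ)
    (hs : ∀ x y, κ (x, y) = κ (y, x)) (i j : B.ι) :
    ⟪M.tens (B.e i) (B.e j), M.emb z κ⟫_ℂ = ⟪M.tens (B.e j) (B.e i), M.emb z κ⟫_ℂ := by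
  rw [B.inner_emb_eq hτ hz hκ, B.inner_emb_eq hτ hz hκ, Measure.volume_eq_prod,
    ← integral_prod_swap]
  refine integral_ext fun p => ?_
  have h : shift M.b z κ p.swap = shift M.b z κ p := by
    rw [shift_apply, shift_apply]
    have : κ (p.swap - (z, z)) = κ (p - (z, z)) := hs _ _
    rw [this]
    simp only [Prod.fst_swap, Prod.snd_swap]
    ring
  simp only [h, Prod.fst_swap, Prod.snd_swap]
  ring

lemma integrable_conj_mul_shift (hκ : LocKer ρ κ) (i j : B.ι) :
    Integrable fun p : ℂ × ℂ => conj (B.f i p.1) * conj (B.f j p.2) * shift M.b z κ p := by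
  have h : LocKer (ρ + ‖z‖) fun p : ℂ × ℂ =>
      (conj (B.f i p.1) * conj (B.f j p.2)) * shift M.b z κ p :=
    (hκ.shift M.b z).mul_left
      (((continuous_conj.comp ((B.isSection i).1.continuous.comp continuous_fst))).mul
        (continuous_conj.comp ((B.isSection j).1.continuous.comp continuous_snd)))
  exact h.cont.integrable_of_hasCompactSupport h.hasCompactSupport

lemma inner_emb_lapx (hτ : 0 < τ.im) (hz : ∀ x, ‖x - z‖ ≤ ρ → x ∈ M.cell) (hκ : LocKer ρ κ)
    (hd : ContDiff ℝ ∞ κ) (i j : B.ι) :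
    ⟪M.tens (B.e i) (B.e j), M.emb z (lapx M.b κ)⟫_ℂ =
      B.lam i * ⟪M.tens (B.e i) (B.e j), M.emb z κ⟫_ℂ := by
  have hl := hκ.lapx hd M.b
  rw [B.inner_emb_eq hτ hz hκ, B.inner_emb_eq hτ hz hl, Measure.volume_eq_prod,
    integral_prod_symm _ (B.integrable_conj_mul_shift hκ i j),
    integral_prod_symm _ (B.integrable_conj_mul_shift hl i j), ← integral_const_mul]
  refine integral_ext fun y => ?_
  set c := exp (I * ((M.b / 2 * wedge z y + 0 : ℝ) : ℂ)) with hc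
  set φ : ℂ → ℂ := fun x => c * κ (x, y - z) with hφ
  have hslice : ContDiff ℝ ∞ fun x => κ (x, y - z) := hd.comp (contDiff_id.prodMk contDiff_const)
  have hφd : ContDiff ℝ ∞ φ := contDiff_const.mul hslice
  have h1 : ∀ x, shift M.b z κ (x, y) = mtr M.b z 0 φ x := fun x => rfl
  have h2 : ∀ x, shift M.b z (lapx M.b κ) (x, y) = negLap (aB M.b) (mtr M.b z 0 φ) x := fun x => by
    rw [negLap_mtr _ _ _ hφd, hφ, mtr, MagLattice.negLap_const_mul _ hslice]
    rfl
  have hm := contDiff_mtr M.b z 0 hφd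
  have hcs : HasCompactSupport (mtr M.b z 0 φ) := by
    refine HasCompactSupport.intro (isCompact_closedBall (0 : ℂ) (ρ + ‖z‖)) fun x hx => ?_
    by_contra h
    exact hx (mem_closedBall_zero_iff.2 ((hκ.shift M.b z).supp (x, y) h).1)
  have h3 := integral_negLap_of_compact (b := M.b) hm (B.isSection i).1 hcs
  have h4 : ∀ x, negLap (aB M.b) (B.f i) x = B.lam i * B.f i x := (B.isEig i).2
  have h5 := congrArg conj h3
  rw [← integral_conj, ← integral_conj] at h5
  simp only [map_mul, conj_conj, h4, conj_ofReal] at h5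
  calc ∫ x, conj (B.f i x) * conj (B.f j y) * shift M.b z (lapx M.b κ) (x, y)
      = conj (B.f j y) * ∫ x, negLap (aB M.b) (mtr M.b z 0 φ) x * conj (B.f i x) := by
        rw [← integral_const_mul]
        refine integral_ext fun x => ?_
        simp only [h2]
        ring
    _ = _ := by
        rw [h5, ← integral_const_mul, ← integral_const_mul]
        refine integral_ext fun x => ?_
        simp only [h1]
        ring

end EigenBasis

/-! ## Spectral cut-offs of a trial vector -/

section cutoff
variable {H : Type*} [NormedAddCommGroup H] [InnerProductSpace ℂ H] {ι : Type*}

open Classical in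
lemma exists_isDiag_indicator (e : HilbertBasis ι ℂ H) (S : Set ι) :
    ∃ D : H →L[ℂ] H, (∀ i x, ⟪e i, D x⟫_ℂ = if i ∈ S then ⟪e i, x⟫_ℂ else 0) ∧
      ∀ x, ‖D x‖ ≤ ‖x‖ := by
  obtain ⟨D, hD⟩ := exists_isDiag e (fun i => if i ∈ S then 1 else 0) (C := 1) (fun i => by
    split_ifs <;> simp)
  have h : ∀ i x, ⟪e i, D x⟫_ℂ = if i ∈ S then ⟪e i, x⟫_ℂ else 0 := fun i x => by
    rw [hD, ite_mul, one_mul, zero_mul]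
  refine ⟨D, h, fun x => ?_⟩
  have := norm_le_of_coeff e zero_le_one (x := D x) (y := x) fun i => by
    rw [h, one_mul]
    split_ifs <;> simp
  simpa using this

/-- If `x (n + 1)` is close to `(1 - E / L) x n` then the part of `x 0` with `E ≤ 0` is small as
soon as some `x N` is. -/
lemma norm_cutoff_le (e : HilbertBasis ι ℂ H) {E : ι → ℝ} {x y : ℕ → H}
    (hy : ∀ n i, ⟪e i, y n⟫_ℂ = E i * ⟪e i, x n⟫_ℂ) {L : ℝ} (hL : 0 < L) {D : H →L[ℂ] H}
    (hD : ∀ i x, ⟪e i, D x⟫_ℂ = if i ∈ {i | E i ≤ 0} then ⟪e i, x⟫_ℂ else 0)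
    (hD1 : ∀ x, ‖D x‖ ≤ ‖x‖) (N : ℕ) :
    ‖D (x 0)‖ ≤ ‖x N‖ + ∑ n ∈ range N, ‖x (n + 1) - x n + ((L⁻¹ : ℝ) : ℂ) • y n‖ := by
  have hstep : ∀ n, ‖D (x n)‖ ≤
      ‖D (x (n + 1))‖ + ‖x (n + 1) - x n + ((L⁻¹ : ℝ) : ℂ) • y n‖ := fun n => by
    set r := x (n + 1) - x n + ((L⁻¹ : ℝ) : ℂ) • y n with hr
    have h1 : ‖D (x n)‖ ≤ 1 * ‖D (x (n + 1) - r)‖ := by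
      refine norm_le_of_coeff e zero_le_one fun i => ?_
      rw [hD, hD, one_mul]
      split_ifs with h
      · have h2 : x (n + 1) - r = x n - ((L⁻¹ : ℝ) : ℂ) • y n := by rw [hr]; abel
        rw [h2, inner_sub_right, inner_smul_right, hy]
        have h3 : ⟪e i, x n⟫_ℂ - ((L⁻¹ : ℝ) : ℂ) * (E i * ⟪e i, x n⟫_ℂ) =
            ((1 - L⁻¹ * E i : ℝ) : ℂ) * ⟪e i, x n⟫_ℂ := by push_cast; ring
        rw [h3, norm_mul, norm_real]
        have h4 : 1 ≤ 1 - L⁻¹ * E i := by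
          have : L⁻¹ * E i ≤ 0 := mul_nonpos_of_nonneg_of_nonpos (by positivity) h
          linarith
        exact le_mul_of_one_le_left (norm_nonneg _) (h4.trans (le_abs_self _))
      · simp
    rw [one_mul, map_sub] at h1
    exact h1.trans ((norm_sub_le _ _).trans (add_le_add_right (hD1 r) _))
  have hind : ∀ N, ‖D (x 0)‖ ≤
      ‖D (x N)‖ + ∑ n ∈ range N, ‖x (n + 1) - x n + ((L⁻¹ : ℝ) : ℂ) • y n‖ := fun N => by
    induction N with
    | zero => simp
    | succ N ih =>
      rw [sum_range_succ]
      have := hstep N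
      linarith
  exact (hind N).trans (add_le_add_left (hD1 _) _)

end cutoff

namespace EigenBasis
variable {M : MagLattice τ} (B : EigenBasis M)

lemma sum_kT_le {T m : ℝ} (hT : 0 < T) {F : Finset B.ι} (hF : ∀ i ∈ F, m < B.lam i)
    {c : B.ι → B.ι → ℂ} (hc : ∀ i j, c i j = c j i) :
    ∑ i ∈ F, ∑ j ∈ F, kT T (B.lam i - m) (B.lam j - m) * ‖c i j‖ ^ 2 ≤
      T * ∑ i ∈ F, ∑ j ∈ F, ‖c i j‖ ^ 2 +
        2 * ∑ i ∈ F, ∑ j ∈ F, (B.lam i - m) * ‖c i j‖ ^ 2 := by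
  have h1 : ∑ i ∈ F, ∑ j ∈ F, kT T (B.lam i - m) (B.lam j - m) * ‖c i j‖ ^ 2 ≤
      ∑ i ∈ F, ∑ j ∈ F, (T * ‖c i j‖ ^ 2 + (B.lam i - m) * ‖c i j‖ ^ 2 +
        (B.lam j - m) * ‖c i j‖ ^ 2) := by
    refine sum_le_sum fun i hi => sum_le_sum fun j hj => ?_
    rw [← add_mul, ← add_mul]
    have hi' := hF i hi
    have hj' := hF j hj
    exact mul_le_mul_of_nonneg_right (kT_le hT (by linarith) (by linarith)) (sq_nonneg _)
  have h2 : ∑ i ∈ F, ∑ j ∈ F, (B.lam j - m) * ‖c i j‖ ^ 2 =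
      ∑ i ∈ F, ∑ j ∈ F, (B.lam i - m) * ‖c i j‖ ^ 2 := by
    rw [sum_comm]
    refine sum_congr rfl fun i _ => sum_congr rfl fun j _ => ?_
    rw [hc]
  refine h1.trans_eq ?_
  simp only [sum_add_distrib]
  rw [h2]
  simp only [← mul_sum]
  ring

set_option maxHeartbeats 400000 in
/-- A symmetric trial vector localized above the Fermi level, cut off to finitely many
eigenvectors. -/
lemma exists_trial (hτ : 0 < τ.im) {T m : ℝ} (hT : 0 < T) (hm : 0 < m) {x y : ℕ → M.HH}
    (hy : ∀ n i j, ⟪M.tens (B.e i) (B.e j), y n⟫_ℂ =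
      ((B.lam i - m : ℝ) : ℂ) * ⟪M.tens (B.e i) (B.e j), x n⟫_ℂ)
    (hsym : ∀ i j, ⟪M.tens (B.e i) (B.e j), x 0⟫_ℂ = ⟪M.tens (B.e j) (B.e i), x 0⟫_ℂ)
    {N : ℕ} {L D : ℝ} (hL : 0 < L)
    (hD : ‖x N‖ + ∑ n ∈ range N, ‖x (n + 1) - x n + ((L⁻¹ : ℝ) : ℂ) • y n‖ < D)
    {U V : M.HH →L[ℂ] M.HH} {c₀ : ℝ} (hc₀ : 0 ≤ c₀)
    (hVU : ∀ κ, (⟪κ, V κ⟫_ℂ).re ≤ -(c₀ * ‖U κ‖ ^ 2)) (hU : ∀ κ, ‖U κ‖ ≤ ‖κ‖)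
    (hDU : 2 * D < ‖U (x 0)‖)
    (hneg : 4 * (T * ‖x 0‖ ^ 2 + 2 * (⟪x 0, y 0⟫_ℂ).re + 2 * m * D ^ 2) <
      c₀ * (‖U (x 0)‖ - 2 * D) ^ 2) :
    ∃ (F : Finset B.ι) (c : B.ι → B.ι → ℂ), (∀ i ∈ F, m < B.lam i) ∧ (∀ i j, c i j = c j i) ∧
      4 * ∑ i ∈ F, ∑ j ∈ F, kT T (B.lam i - m) (B.lam j - m) * ‖c i j‖ ^ 2 +
        (⟪B.finKer F c, V (B.finKer F c)⟫_ℂ).re < 0 := by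
  classical
  set e := M.tensBasis B.e B.e with he
  have hea : ∀ i j, e (i, j) = M.tens (B.e i) (B.e j) := fun i j => M.tensBasis_apply _ _ _
  have hye : ∀ n p, ⟪e p, y n⟫_ℂ = ((B.lam p.1 - m : ℝ) : ℂ) * ⟪e p, x n⟫_ℂ := fun n p => by
    rw [← Prod.mk.eta (p := p), hea, hy]
  set Θ := ‖x N‖ + ∑ n ∈ range N, ‖x (n + 1) - x n + ((L⁻¹ : ℝ) : ℂ) • y n‖ with hΘ
  have hΘ0 : 0 ≤ Θ := add_nonneg (norm_nonneg _) (sum_nonneg fun _ _ => norm_nonneg _)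
  set Λ := m + (‖y 0‖ / (D - Θ) + 1) with hΛ
  have hq : 0 ≤ ‖y 0‖ / (D - Θ) := div_nonneg (norm_nonneg _) (by linarith)
  have hΛm : m < Λ := by rw [hΛ]; linarith
  set F := (B.finite_lam_le hτ Λ).toFinset.filter (fun i => m < B.lam i) with hF
  have hmem : ∀ i, i ∈ F ↔ B.lam i ≤ Λ ∧ m < B.lam i := fun i => by
    simp [hF]
  set c : B.ι → B.ι → ℂ := fun i j => ⟪M.tens (B.e i) (B.e j), x 0⟫_ℂ with hc
  obtain ⟨P1, hP1, hP1n⟩ := exists_isDiag_indicator e {p | B.lam p.1 - m ≤ 0}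
  obtain ⟨P2, hP2, hP2n⟩ := exists_isDiag_indicator e {p | Λ < B.lam p.1}
  obtain ⟨Q, hQ, hQn⟩ := exists_isDiag_indicator e {p | p.1 ∉ F}
  obtain ⟨R, hR, hRn⟩ := exists_isDiag_indicator e {p | p.1 ∈ F ∧ p.2 ∉ F}
  have n1 : ‖P1 (x 0)‖ ≤ Θ := norm_cutoff_le e hye hL hP1 hP1n N
  have n2 : ‖P2 (x 0)‖ ≤ D - Θ := by
    have hpos : 0 < Λ - m := by linarith
    have h := norm_le_of_coeff e (C := (Λ - m)⁻¹) (by positivity) (x := P2 (x 0)) (y := y 0)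
      fun p => by
        rw [hP2, hye]
        split_ifs with h
        · have h' : Λ < B.lam p.1 := h
          rw [norm_mul, norm_real, norm_eq_abs, ← mul_assoc]
          refine le_mul_of_one_le_left (norm_nonneg _) ?_
          rw [← inv_mul_cancel₀ hpos.ne']
          exact mul_le_mul_of_nonneg_left ((by linarith : Λ - m ≤ B.lam p.1 - m).trans
            (le_abs_self _)) (by positivity)
        · rw [norm_zero]; positivity
    refine h.trans ?_
    rw [inv_mul_le_iff₀ hpos]
    have h3 : ‖y 0‖ / (D - Θ) ≤ Λ - m := by rw [hΛ]; linarith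
    exact (div_le_iff₀ (by linarith)).1 h3
  have nQ : ‖Q (x 0)‖ ≤ D := by
    have h : Q (x 0) = P1 (x 0) + P2 (x 0) := by
      refine ext_coeff e fun p => ?_
      rw [inner_add_right, hQ, hP1, hP2]
      simp only [mem_ofPred_eq, hmem]
      split_ifs <;> grind
    rw [h]
    exact (norm_add_le _ _).trans (by linarith)
  have nR : ‖R (x 0)‖ ≤ D := by
    refine le_trans ?_ nQ
    have h := (Equiv.prodComm B.ι B.ι).hasSum_iff.2 (hasSum_norm_sq e (Q (x 0)))
    refine le_of_sq_le_sq (hasSum_le (fun p => ?_) (hasSum_norm_sq e (R (x 0))) h) (norm_nonneg _)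
    obtain ⟨i, j⟩ := p
    simp only [Function.comp, Equiv.prodComm_apply, Prod.swap_prod_mk]
    rw [hR, hQ, hea, hea, hsym]
    simp only [mem_ofPred_eq]
    by_cases h2 : j ∈ F
    · rw [if_neg fun h => h.2 h2, norm_zero, zero_pow two_ne_zero]
      exact sq_nonneg _
    · rw [if_pos h2]
      split_ifs
      · exact le_refl _
      · rw [norm_zero, zero_pow two_ne_zero]
        exact sq_nonneg _
  set κ := B.finKer F c with hκ
  have hdec : x 0 = κ + (Q (x 0) + R (x 0)) := by
    refine ext_coeff e fun p => ?_
    obtain ⟨i, j⟩ := p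
    rw [inner_add_right, inner_add_right, hQ, hR, hea, hκ, B.inner_e_finKer]
    simp only [mem_ofPred_eq]
    by_cases h1 : i ∈ F <;> by_cases h2 : j ∈ F <;> simp [h1, h2, hc]
  have hUκ : ‖U (x 0)‖ - 2 * D ≤ ‖U κ‖ := by
    have h1 : ‖U (x 0)‖ ≤ ‖U κ‖ + ‖U (Q (x 0) + R (x 0))‖ := by
      conv_lhs => rw [hdec, map_add]
      exact norm_add_le _ _
    have h2 := (hU (Q (x 0) + R (x 0))).trans (norm_add_le _ _)
    linarith
  have hs0 := hasSum_norm_sq e (x 0)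
  have hsE : HasSum (fun p => (B.lam p.1 - m) * ‖⟪e p, x 0⟫_ℂ‖ ^ 2) (⟪x 0, y 0⟫_ℂ).re := by
    have h := hasSum_re (e.hasSum_inner_mul_inner (x 0) (y 0))
    convert! h using 1
    funext p
    rw [hye, ← inner_conj_symm (x 0) (e p), mul_left_comm, mul_comm (conj _), mul_conj,
      normSq_eq_norm_sq]
    norm_cast
  have hsP := hasSum_norm_sq e (P1 (x 0))
  have hsum1 : ∑ i ∈ F, ∑ j ∈ F, ‖c i j‖ ^ 2 ≤ ‖x 0‖ ^ 2 := by
    have h := sum_le_hasSum (F ×ˢ F) (fun p _ => sq_nonneg ‖⟪e p, x 0⟫_ℂ‖) hs0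
    rw [sum_product] at h
    simpa only [hea] using h
  have hsum2 : ∑ i ∈ F, ∑ j ∈ F, (B.lam i - m) * ‖c i j‖ ^ 2 ≤ (⟪x 0, y 0⟫_ℂ).re + m * Θ ^ 2 := by
    have hle : ∀ p, (if p ∈ F ×ˢ F then (B.lam p.1 - m) * ‖⟪e p, x 0⟫_ℂ‖ ^ 2 else 0) ≤
        (B.lam p.1 - m) * ‖⟪e p, x 0⟫_ℂ‖ ^ 2 + m * ‖⟪e p, P1 (x 0)⟫_ℂ‖ ^ 2 := fun p => by
      rw [hP1]
      simp only [mem_ofPred_eq]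
      have hl := B.lam_nonneg hτ p.1
      by_cases h1 : B.lam p.1 - m ≤ 0
      · rw [if_pos h1, if_neg (fun h => by
          have := ((hmem _).1 (Finset.mem_product.1 h).1).2
          linarith), ← add_mul]
        exact mul_nonneg (by linarith) (sq_nonneg _)
      · rw [if_neg h1, norm_zero, zero_pow two_ne_zero, mul_zero, add_zero]
        split_ifs
        · exact le_rfl
        · exact mul_nonneg (by linarith) (sq_nonneg _)
    have h1 := hasSum_le hle (hasSum_sum_of_ne_finset_zero (s := F ×ˢ F) fun p hp => if_neg hp)
      (hsE.add (hsP.mul_left m))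
    rw [sum_congr rfl fun p hp => if_pos hp, sum_product] at h1
    simp only [hea] at h1
    exact h1.trans (add_le_add_right (mul_le_mul_of_nonneg_left
      (pow_le_pow_left₀ (norm_nonneg _) n1 2) hm.le) _)
  have hkT := B.sum_kT_le (c := c) hT (fun i hi => ((hmem i).1 hi).2) hsym
  have h4 : T * ∑ i ∈ F, ∑ j ∈ F, ‖c i j‖ ^ 2 ≤ T * ‖x 0‖ ^ 2 := by gcongr
  have h3 : m * Θ ^ 2 ≤ m * D ^ 2 :=
    mul_le_mul_of_nonneg_left (pow_le_pow_left₀ hΘ0 hD.le 2) hm.le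
  have hFm : ∀ i ∈ F, m < B.lam i := fun i hi => ((hmem i).1 hi).2
  refine ⟨F, c, hFm, hsym, ?_⟩
  clear_value F c Λ Θ e κ
  have h1 : c₀ * (‖U (x 0)‖ - 2 * D) ^ 2 ≤ c₀ * ‖U κ‖ ^ 2 := by
    have : 0 ≤ ‖U (x 0)‖ - 2 * D := by linarith
    gcongr
  have h2 := hVU κ
  rw [← hκ]
  linarith

end EigenBasis

/-! ## From a trial function on the plane to the lattice -/

section mulOp
variable {X : Type*} [MeasurableSpace X] {ν : Measure X} {V U : Lp ℂ 2 ν →L[ℂ] Lp ℂ 2 ν}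
  {g h : X → ℝ}

lemma re_inner_mulOp_le (hV : ∀ κ, (V κ : X → ℂ) =ᵐ[ν] fun x => (g x : ℂ) * κ x)
    (hU : ∀ κ, (U κ : X → ℂ) =ᵐ[ν] fun x => (h x : ℂ) * κ x) {c : ℝ}
    (hle : ∀ x, g x ≤ -(c * h x ^ 2)) (κ : Lp ℂ 2 ν) :
    (⟪κ, V κ⟫_ℂ).re ≤ -(c * ‖U κ‖ ^ 2) := by
  have h1 : ‖U κ‖ ^ 2 = (⟪U κ, U κ⟫_ℂ).re := by
    rw [inner_self_eq_norm_sq_to_K]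
    norm_cast
  rw [h1, L2_inner_eq, L2_inner_eq, ← reCLM_apply, ← reCLM_apply,
    ← reCLM.integral_comp_comm (L2_integrable_conj_mul κ (V κ)),
    ← reCLM.integral_comp_comm (L2_integrable_conj_mul (U κ) (U κ)), ← integral_const_mul,
    ← integral_neg]
  refine integral_mono_ae (reCLM.integrable_comp (L2_integrable_conj_mul κ (V κ)))
    ((reCLM.integrable_comp (L2_integrable_conj_mul (U κ) (U κ))).const_mul c).neg ?_
  filter_upwards [hV κ, hU κ] with x h2 h3
  simp only [h2, h3, reCLM_apply]
  have h4 : conj (κ x) * ((g x : ℂ) * κ x) = ((g x * normSq (κ x) : ℝ) : ℂ) := by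
    rw [mul_left_comm, mul_comm (conj _), mul_conj]; push_cast; ring
  have h5 : conj ((h x : ℂ) * κ x) * ((h x : ℂ) * κ x) = ((h x ^ 2 * normSq (κ x) : ℝ) : ℂ) := by
    rw [mul_comm (conj _), mul_conj, map_mul, normSq_ofReal]; push_cast; ring
  rw [h4, h5, ofReal_re, ofReal_re, ← mul_assoc, ← neg_mul]
  exact mul_le_mul_of_nonneg_right (hle x) (normSq_nonneg _)

lemma norm_mulOp_le (hU : ∀ κ, (U κ : X → ℂ) =ᵐ[ν] fun x => (h x : ℂ) * κ x)
    (hh : ∀ x, |h x| ≤ 1) (κ : Lp ℂ 2 ν) : ‖U κ‖ ≤ ‖κ‖ := by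
  refine Lp.norm_le_norm_of_ae_le ?_
  filter_upwards [hU κ] with x h1
  rw [h1, norm_mul, norm_real, norm_eq_abs]
  exact mul_le_of_le_one_left (norm_nonneg _) (hh x)

end mulOp

namespace MagLattice
variable {M : MagLattice τ}

lemma le_norm_mulOp_emb {A : Set ℂ} (hA : MeasurableSet A) {U : M.HH →L[ℂ] M.HH}
    (hU : ∀ κ, (U κ : ℂ × ℂ → ℂ) =ᵐ[M.vol.prod M.vol]
      fun p => ((A.indicator 1 (p.1 - p.2) : ℝ) : ℂ) * κ p)
    {ρ : ℝ} {z : ℂ} (hz : ∀ x, ‖x - z‖ ≤ ρ → x ∈ M.cell) {κ : ℂ × ℂ → ℂ} (hκ : LocKer ρ κ) {q : ℝ}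
    (hq : q ^ 2 ≤ ∫ p in {p : ℂ × ℂ | p.1 - p.2 ∈ A}, ‖κ p‖ ^ 2) : q ≤ ‖U (M.emb z κ)‖ := by
  refine le_of_sq_le_sq (hq.trans_eq ?_) (norm_nonneg _)
  obtain ⟨S, hS⟩ : ∃ S, S = {p : ℂ × ℂ | p.1 - p.2 ∈ A} := ⟨_, rfl⟩
  have hmem : ∀ p, p ∈ S ↔ p.1 - p.2 ∈ A := fun p => by rw [hS]; rfl
  have hm : MeasurableSet S := hS ▸ measurable_fst.sub measurable_snd hA
  rw [← hS]
  have h1 : ((‖U (M.emb z κ)‖ ^ 2 : ℝ) : ℂ) = ⟪U (M.emb z κ), U (M.emb z κ)⟫_ℂ := by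
    rw [inner_self_eq_norm_sq_to_K]
    norm_cast
  have h2 : ⟪U (M.emb z κ), U (M.emb z κ)⟫_ℂ =
      ∫ p : ℂ × ℂ, ((S.indicator (fun p => ‖shift M.b z κ p‖ ^ 2) p : ℝ) : ℂ) := by
    rw [L2_inner_eq, ← integral_eq_of_supp (M := M)]
    · refine integral_congr_ae ?_
      filter_upwards [hU (M.emb z κ), coeFn_emb (M := M) (z := z) hκ] with p h3 h4
      rw [h3, h4]
      by_cases h5 : p.1 - p.2 ∈ A
      · rw [indicator_of_mem h5, indicator_of_mem ((hmem p).2 h5)]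
        simp only [Pi.one_apply, ofReal_one, one_mul]
        rw [mul_comm, mul_conj, normSq_eq_norm_sq]
      · rw [indicator_of_notMem h5, indicator_of_notMem (fun h => h5 ((hmem p).1 h))]
        simp
    · intro p hp
      refine mem_cell_of_shift_ne_zero hκ hz (b := M.b) (z := z) fun h => hp ?_
      by_cases h5 : p ∈ S
      · rw [indicator_of_mem h5, h]; simp
      · rw [indicator_of_notMem h5, ofReal_zero]
  have h3 : ∫ p : ℂ × ℂ, S.indicator (fun p => ‖shift M.b z κ p‖ ^ 2) p =
      ∫ p, S.indicator (fun p => ‖κ p‖ ^ 2) p := by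
    rw [Measure.volume_eq_prod]
    refine Eq.trans ?_ (integral_sub_right_eq_self (fun p => S.indicator (fun p => ‖κ p‖ ^ 2) p)
      ((z, z) : ℂ × ℂ))
    refine integral_ext fun p => ?_
    have h5 : p - (z, z) ∈ S ↔ p ∈ S := by
      rw [hmem, hmem, Prod.fst_sub, Prod.snd_sub, sub_sub_sub_cancel_right]
    by_cases h4 : p ∈ S
    · simp only [indicator_of_mem h4, indicator_of_mem (h5.2 h4), norm_shift]
    · simp only [indicator_of_notMem h4, indicator_of_notMem fun h => h4 (h5.1 h)]
  rw [h2, integral_complex_ofReal, ofReal_inj, h3, integral_indicator hm] at h1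
  exact h1.symm

lemma per_le {v : ℂ → ℝ} (hτ : 0 < τ.im)
    (hdecay : ∃ C p : ℝ, 2 < p ∧ ∀ x, |v x| ≤ C * (1 + ‖x‖) ^ (-p))
    (hv : ∀ x, v x ≤ 0) (x : ℂ) : M.per v x ≤ v x := by
  obtain ⟨C, p, hp, h⟩ := hdecay
  obtain ⟨D, hD⟩ := exists_per_bound (M := M) hτ hp h
  have h1 := (hD x).1
  have h2 := h1.neg.le_tsum 0 fun m _ => by simpa using hv _
  rw [tsum_neg] at h2
  have h3 : M.w 0 = 0 := by simp [w, latPt]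
  rw [h3, add_zero] at h2
  exact neg_le_neg_iff.1 h2

end MagLattice

lemma exists_stable {E : Type*} [NormedAddCommGroup E] [InnerProductSpace ℂ E] {k a₀ : ℕ → E}
    {N : ℕ} {L : ℂ} {m₀ D r : ℝ}
    (hD : ‖k N‖ + ∑ n ∈ range N, ‖k (n + 1) - k n + L • (a₀ n - (m₀ : ℂ) • k n)‖ < D)
    (hneg : 8 * ((⟪k 0, a₀ 0 - (m₀ : ℂ) • k 0⟫_ℂ).re + m₀ * D ^ 2) < r) (a₁ a₂ : ℕ → E) :
    ∃ ε > 0, ∀ b m T : ℝ, |b| < ε → |m - m₀| < ε → |T| < ε →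
      ‖k N‖ + ∑ n ∈ range N, ‖k (n + 1) - k n +
        L • ((a₀ n + (b : ℂ) • a₁ n + ((b : ℂ) ^ 2) • a₂ n) - (m : ℂ) • k n)‖ < D ∧
      4 * (T * ‖k 0‖ ^ 2 +
        2 * (⟪k 0, (a₀ 0 + (b : ℂ) • a₁ 0 + ((b : ℂ) ^ 2) • a₂ 0) - (m : ℂ) • k 0⟫_ℂ).re +
          2 * m * D ^ 2) < r := by
  have c1 : Continuous fun t : ℝ × ℝ × ℝ => ‖k N‖ + ∑ n ∈ range N, ‖k (n + 1) - k n +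
      L • ((a₀ n + (t.1 : ℂ) • a₁ n + ((t.1 : ℂ) ^ 2) • a₂ n) - (t.2.1 : ℂ) • k n)‖ := by
    fun_prop
  have h : Continuous fun t : ℝ × ℝ × ℝ =>
      (⟪k 0, (a₀ 0 + (t.1 : ℂ) • a₁ 0 + ((t.1 : ℂ) ^ 2) • a₂ 0) - (t.2.1 : ℂ) • k 0⟫_ℂ).re :=
    reCLM.continuous.comp (continuous_const.inner (𝕜 := ℂ) (by fun_prop))
  have c2 : Continuous fun t : ℝ × ℝ × ℝ => 4 * (t.2.2 * ‖k 0‖ ^ 2 +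
      2 * (⟪k 0, (a₀ 0 + (t.1 : ℂ) • a₁ 0 + ((t.1 : ℂ) ^ 2) • a₂ 0) - (t.2.1 : ℂ) • k 0⟫_ℂ).re +
        2 * t.2.1 * D ^ 2) := by
    fun_prop
  obtain ⟨ε, hε, hball⟩ := Metric.isOpen_iff.1 ((isOpen_lt c1 (continuous_const (y := D))).inter
    (isOpen_lt c2 (continuous_const (y := r)))) (0, m₀, 0) ⟨by simpa using hD, by
      simp only [mem_ofPred_eq, ofReal_zero, zero_smul, add_zero, zero_mul, ne_eq,
        OfNat.ofNat_ne_zero, not_false_eq_true, zero_pow, zero_add]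
      linarith⟩
  refine ⟨ε, hε, fun b m T hb hm hT => hball (a := (b, m, T)) ?_⟩
  rw [Metric.mem_ball, Prod.dist_eq, Prod.dist_eq, max_lt_iff, max_lt_iff, Real.dist_eq,
    Real.dist_eq, Real.dist_eq, sub_zero, sub_zero]
  exact ⟨hb, hm, hT⟩

open MagLattice in
theorem exists_unstable_of_trial (hτ : 0 < τ.im) {μ : ℝ} {v : ℂ → ℝ} (hmeas : Measurable v)
    (hdecay : ∃ C p : ℝ, 2 < p ∧ ∀ x, |v x| ≤ C * (1 + ‖x‖) ^ (-p)) (hv : ∀ x, v x ≤ 0)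
    {A : Set ℂ} (hA : MeasurableSet A) {c₀ : ℝ} (hc₀ : 0 < c₀) (hvA : ∀ x ∈ A, v x ≤ -c₀)
    {m₀ : ℝ} (hm₀ : 0 < m₀) {ρ : ℝ} (hρ : 0 ≤ ρ) {κ : ℕ → ℂ × ℂ → ℂ} (hκ : ∀ n, LocKer ρ (κ n))
    (hd : ∀ n, ContDiff ℝ ∞ (κ n)) (hs : ∀ x y, κ 0 (x, y) = κ 0 (y, x)) {N : ℕ} {L : ℝ}
    (hL : 0 < L) {q D : ℝ} (hq : q ^ 2 ≤ ∫ p in {p : ℂ × ℂ | p.1 - p.2 ∈ A}, ‖κ 0 p‖ ^ 2)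
    (hD : ‖cls volume (κ N)‖ + ∑ n ∈ range N, ‖cls volume (κ (n + 1)) - cls volume (κ n) +
      ((L⁻¹ : ℝ) : ℂ) • (cls volume (lapx₀ (κ n)) - (m₀ : ℂ) • cls volume (κ n))‖ < D)
    (hDq : 2 * D < q)
    (hneg : 8 * ((⟪cls volume (κ 0), cls volume (lapx₀ (κ 0)) - (m₀ : ℂ) • cls volume (κ 0)⟫_ℂ).re +
      m₀ * D ^ 2) < c₀ * (q - 2 * D) ^ 2) :
    ∃ ε > 0, ∀ (M : MagLattice τ) (T : ℝ), M.b < ε → 0 < T → T < ε →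
      ∀ (γ : M.H →L[ℂ] M.H) (k : ℂ → ℂ → ℂ), M.IsNormal v μ T γ k → |chem v μ k - m₀| < ε →
        (∃ E : ℝ, E < 0 ∧ ∃ κ : M.HH, κ ≠ 0 ∧ M.LOp v μ T k κ ((E : ℂ) • κ)) ∧
        M.Unstable v μ T γ k := by
  set l : ℝ → ℕ → Lp ℂ 2 (volume : Measure (ℂ × ℂ)) := fun b n => cls volume (lapx₀ (κ n)) +
    (b : ℂ) • cls volume (angx (κ n)) +
      ((b : ℂ) ^ 2) • cls volume (fun p : ℂ × ℂ => ((‖p.1‖ ^ 2 / 4 : ℝ) : ℂ) * κ n p) with hl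
  obtain ⟨ε₁, hε₁, hball⟩ := exists_stable (k := fun n => cls volume (κ n)) (N := N) hD hneg
    (fun n => cls volume (angx (κ n)))
    (fun n => cls volume (fun p : ℂ × ℂ => ((‖p.1‖ ^ 2 / 4 : ℝ) : ℂ) * κ n p))
  obtain ⟨ε₂, hε₂, hcell⟩ := exists_cell_center hτ hρ
  refine ⟨min (min ε₁ ε₂) m₀, by positivity, fun M T hb hT hTε γ k hN hm => ?_⟩
  set m := chem v μ k with hmdef
  have hm0 : 0 < m := by
    have := (abs_lt.1 (hm.trans_le (min_le_right _ _))).1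
    linarith
  obtain ⟨z, hz⟩ := hcell M (hb.trans_le ((min_le_left _ _).trans (min_le_right _ _)))
  have hlt : ∀ {r : ℝ}, r < min (min ε₁ ε₂) m₀ → r < ε₁ := fun h =>
    h.trans_le ((min_le_left _ _).trans (min_le_left _ _))
  obtain ⟨hΘ, hG⟩ := hball M.b m T (by rw [abs_of_pos M.b_pos]; exact hlt hb) (hlt hm)
    (by rw [abs_of_pos hT]; exact hlt hTε)
  have hD0 : 0 ≤ D := le_trans (add_nonneg (norm_nonneg _)
    (sum_nonneg fun _ _ => norm_nonneg _)) hD.le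
  obtain ⟨B⟩ := nonempty_eigenBasis (M := M) hτ
  obtain ⟨V, hV, hVs⟩ := exists_vSharp (M := M) hτ hmeas hdecay
  obtain ⟨U, hU⟩ := exists_mulOp (m := M.vol.prod M.vol)
    (g := fun p : ℂ × ℂ => A.indicator 1 (p.1 - p.2))
    ((measurable_one.indicator hA).comp (measurable_fst.sub measurable_snd)) (C := 1)
    (fun p => by
      by_cases h : p.1 - p.2 ∈ A <;> simp [h])
  have hloc : ∀ n, LocKer ρ (fun p => lapx M.b (κ n) p + -(m : ℂ) * κ n p) := fun n =>
    ((hκ n).lapx (hd n) M.b).add ((hκ n).const_mul _)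
  set x : ℕ → M.HH := fun n => M.emb z (κ n) with hx
  set y : ℕ → M.HH := fun n => M.emb z (fun p => lapx M.b (κ n) p + -(m : ℂ) * κ n p) with hy
  have hcy : ∀ n, cls volume (fun p => lapx M.b (κ n) p + -(m : ℂ) * κ n p) =
      l M.b n - (m : ℂ) • cls volume (κ n) := fun n => by
    rw [cls_add ((hκ n).lapx (hd n) M.b).memLp ((hκ n).const_mul _).memLp,
      cls_const_mul (hκ n).memLp, (hκ n).cls_lapx (hd n), neg_smul, ← sub_eq_add_neg]
  have hcoef : ∀ n i j, ⟪M.tens (B.e i) (B.e j), y n⟫_ℂ =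
      ((B.lam i - m : ℝ) : ℂ) * ⟪M.tens (B.e i) (B.e j), x n⟫_ℂ := fun n i j => by
    rw [hy]
    simp only
    rw [emb_add ((hκ n).lapx (hd n) M.b) ((hκ n).const_mul _), emb_const_mul (hκ n),
      inner_add_right, inner_smul_right, B.inner_emb_lapx hτ hz (hκ n) (hd n)]
    push_cast
    ring
  have herr : ∀ n, ‖x (n + 1) - x n + ((L⁻¹ : ℝ) : ℂ) • y n‖ = ‖cls volume (κ (n + 1)) -
      cls volume (κ n) + ((L⁻¹ : ℝ) : ℂ) • (l M.b n - (m : ℂ) • cls volume (κ n))‖ := fun n => by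
    have h1 := (hκ n).const_mul (-1)
    have h2 := (hloc n).const_mul ((L⁻¹ : ℝ) : ℂ)
    have h3 : x (n + 1) - x n + ((L⁻¹ : ℝ) : ℂ) • y n = M.emb z (fun p => (κ (n + 1) p + -1 * κ n p) +
        ((L⁻¹ : ℝ) : ℂ) * (lapx M.b (κ n) p + -(m : ℂ) * κ n p)) := by
      rw [emb_add ((hκ (n + 1)).add h1) h2, emb_add (hκ (n + 1)) h1, emb_const_mul (hκ n),
        emb_const_mul (hloc n), neg_one_smul, ← sub_eq_add_neg]
    rw [h3, norm_emb hz (((hκ (n + 1)).add h1).add h2),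
      cls_add ((hκ (n + 1)).add h1).memLp h2.memLp, cls_add (hκ (n + 1)).memLp h1.memLp,
      cls_const_mul (hκ n).memLp, cls_const_mul (hloc n).memLp, hcy, neg_one_smul,
      ← sub_eq_add_neg]
  have hqU := le_norm_mulOp_emb hA hU hz (hκ 0) hq
  have hx0 : ‖x 0‖ = ‖cls volume (κ 0)‖ := norm_emb hz (hκ 0)
  have hVU : ∀ η, (⟪η, V η⟫_ℂ).re ≤ -(c₀ * ‖U η‖ ^ 2) := by
    refine re_inner_mulOp_le (g := fun p : ℂ × ℂ => M.per v (p.1 - p.2)) (fun η => hV η) hU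
      fun p => ?_
    refine (per_le hτ hdecay hv _).trans ?_
    by_cases h : p.1 - p.2 ∈ A
    · simpa [h] using hvA _ h
    · simpa [h] using hv _
  obtain ⟨F, c, hF, hc, hfin⟩ := B.exists_trial hτ hT hm0 hcoef
    (fun i j => B.inner_emb_swap hτ hz (hκ 0) hs i j) hL (N := N) (D := D) (by
      rw [sum_congr rfl fun n _ => herr n, show ‖x N‖ = _ from norm_emb hz (hκ N)]
      exact hΘ) hc₀.le hVU (norm_mulOp_le hU fun p => by
        by_cases h : p.1 - p.2 ∈ A <;> simp [h]) (hDq.trans_le hqU) (by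
      rw [hx0, hx, hy]
      simp only
      rw [inner_emb hz (hκ 0) (hloc 0), hcy]
      refine lt_of_lt_of_le hG ?_
      have : 0 ≤ q - 2 * D := by linarith
      have h2 : q - 2 * D ≤ ‖U (M.emb z (κ 0))‖ - 2 * D := by linarith
      gcongr)
  refine ⟨?_, B.unstable_of_trial hτ hT hN hV hVs hF hc hfin⟩
  refine B.exists_neg_eigenvalue_lOp hτ hT hN hV hVs (F ×ˢ F) (fun p => c p.1 p.2) ?_
  have h1 : ∑ p ∈ F ×ˢ F, c p.1 p.2 • M.tensBasis B.e B.e p = B.finKer F c := by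
    rw [sum_product, EigenBasis.finKer]
    simp only [tensBasis_apply]
  rw [h1, sum_product]
  have h2 : 0 ≤ ∑ i ∈ F, ∑ j ∈ F, kT T (B.lam i - m) (B.lam j - m) * ‖c i j‖ ^ 2 :=
    sum_nonneg fun i _ => sum_nonneg fun j _ =>
      mul_nonneg (kT_nonneg hT _ _) (sq_nonneg _)
  simp only
  linarith

/-! ## Slowly modulated translation invariant pair functions -/

open scoped SchwartzMap LineDeriv

/-- The integral of a pair function over pairs of given separation. -/
def overlap (Z : ℂ × ℂ → ℂ) (t : ℂ) : ℂ := ∫ s, Z (t + s, s)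

section overlap
variable {ρ : ℝ} {Z : ℂ × ℂ → ℂ}

lemma LocKer.overlap_eq (hZ : LocKer ρ Z) (t : ℂ) :
    overlap Z t = ∫ s in Metric.closedBall 0 ρ, Z (t + s, s) := by
  refine (setIntegral_eq_integral_of_forall_compl_eq_zero fun s hs => ?_).symm
  by_contra h
  exact hs (mem_closedBall_zero_iff.2 (hZ.supp _ h).2)

lemma LocKer.continuous_overlap (hZ : LocKer ρ Z) : Continuous (overlap Z) := by
  have h := continuous_parametric_integral_of_continuous (μ := volume)
    (f := fun t s : ℂ => Z (t + s, s)) (by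
      have := hZ.cont.comp ((continuous_fst.add continuous_snd).prodMk
        (continuous_snd (X := ℂ) (Y := ℂ)))
      exact this) (isCompact_closedBall (0 : ℂ) ρ)
  exact h.congr fun t => (hZ.overlap_eq t).symm

lemma LocKer.exists_overlap_bound (hZ : LocKer ρ Z) : ∃ C, 0 ≤ C ∧ ∀ t, ‖overlap Z t‖ ≤ C := by
  obtain ⟨C, hC⟩ := hZ.exists_bound
  refine ⟨|C| * volume.real (Metric.closedBall (0 : ℂ) ρ), by positivity, fun t => ?_⟩
  rw [hZ.overlap_eq]
  exact norm_setIntegral_le_of_norm_le_const measure_closedBall_lt_top fun s _ =>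
    (hC _).trans (le_abs_self C)

lemma LocKer.integral_mul (hZ : LocKer ρ Z) {g : ℂ → ℂ} (hg : Integrable g) {R : ℝ} (hR : 0 < R) :
    ∫ p : ℂ × ℂ, g (p.1 - p.2) * Z (R⁻¹ • p) = (R : ℂ) ^ 2 * ∫ u, g u * overlap Z (R⁻¹ • u) := by
  obtain ⟨C, hC⟩ := hZ.exists_bound
  set F : ℂ × ℂ → ℂ := fun p => g p.1 * Z (R⁻¹ • (p.1 + p.2, p.2)) with hF
  have hmeas : AEStronglyMeasurable F (volume.prod volume) := by
    refine (hg.aestronglyMeasurable.comp_fst).mul (Continuous.aestronglyMeasurable ?_)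
    exact hZ.cont.comp (by fun_prop : Continuous fun p : ℂ × ℂ => R⁻¹ • (p.1 + p.2, p.2))
  have hint : Integrable F (volume.prod volume) := by
    have h1 : Integrable ((Metric.closedBall (0 : ℂ) (R * ρ)).indicator fun _ => |C|) volume :=
      (integrable_indicator_iff Metric.isClosed_closedBall.measurableSet).2
        (integrableOn_const (measure_closedBall_lt_top.ne))
    refine (hg.norm.mul_prod h1).mono' hmeas (.of_forall fun p => ?_)
    rw [norm_mul]
    refine mul_le_mul_of_nonneg_left ?_ (norm_nonneg _)
    by_cases h : p.2 ∈ Metric.closedBall (0 : ℂ) (R * ρ)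
    · rw [indicator_of_mem h]
      exact (hC _).trans (le_abs_self C)
    · rw [indicator_of_notMem h, norm_le_zero_iff]
      by_contra h2
      have h3 : ‖R⁻¹ • p.2‖ ≤ ρ := (hZ.supp _ h2).2
      rw [norm_smul, norm_eq_abs, abs_of_pos (inv_pos.2 hR), inv_mul_le_iff₀ hR] at h3
      exact h (mem_closedBall_zero_iff.2 h3)
  have h2 := measurePreserving_sub_prod (volume : Measure ℂ) (volume : Measure ℂ)
  have h3 := integral_map h2.measurable.aemeasurable (by rw [h2.map_eq]; exact hmeas)
  rw [h2.map_eq] at h3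
  rw [Measure.volume_eq_prod]
  calc ∫ p : ℂ × ℂ, g (p.1 - p.2) * Z (R⁻¹ • p) ∂(volume.prod volume)
      = ∫ p, F p ∂(volume.prod volume) := by
        rw [h3]
        refine integral_ext fun p => ?_
        simp only [hF, sub_add_cancel, Prod.mk.eta]
    _ = ∫ u, ∫ y, F (u, y) := integral_prod _ hint
    _ = ∫ u, (R : ℂ) ^ 2 * (g u * overlap Z (R⁻¹ • u)) := by
        refine integral_ext fun u => ?_
        simp only [hF]
        rw [integral_const_mul]
        have h4 := Measure.integral_comp_inv_smul_of_nonneg (volume : Measure ℂ)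
          (fun s => Z (R⁻¹ • u + s, s)) hR.le
        rw [finrank_real_complex, real_smul (x := R ^ 2), ofReal_pow] at h4
        rw [overlap, mul_left_comm, ← h4]
        simp only [Prod.smul_mk, smul_add]
    _ = _ := integral_const_mul _ _

lemma LocKer.tendsto_integral_overlap (hZ : LocKer ρ Z) {g : ℂ → ℂ} (hg : Integrable g) :
    Tendsto (fun R : ℝ => ∫ u, g u * overlap Z (R⁻¹ • u)) atTop
      (𝓝 ((∫ u, g u) * overlap Z 0)) := by
  obtain ⟨C, hC0, hC⟩ := hZ.exists_overlap_bound
  rw [← integral_mul_const]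
  refine tendsto_integral_filter_of_dominated_convergence (fun u => ‖g u‖ * C)
    (.of_forall fun R => hg.aestronglyMeasurable.mul
      (hZ.continuous_overlap.comp (continuous_const_smul _)).aestronglyMeasurable)
    (.of_forall fun R => Eventually.of_forall fun u => ?_)
    (hg.norm.mul_const C) (.of_forall fun u => ?_)
  · rw [norm_mul]
    exact mul_le_mul_of_nonneg_left (hC _) (norm_nonneg _)
  · have h1 : Tendsto (fun R : ℝ => R⁻¹ • u) atTop (𝓝 0) := by
      simpa using (tendsto_inv_atTop_zero (𝕜 := ℝ)).smul_const u
    exact ((hZ.continuous_overlap.tendsto 0).comp h1).const_mul _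

end overlap

/-- `R⁻¹ β(x - y) Z(x / R, y / R)`. -/
def loc (R : ℝ) (β : 𝓢(ℂ, ℂ)) (Z : ℂ × ℂ → ℂ) (p : ℂ × ℂ) : ℂ :=
  ((R⁻¹ : ℝ) : ℂ) * (β (p.1 - p.2) * Z (R⁻¹ • p))

/-- `-Δ` on Schwartz functions. -/
def lapS : 𝓢(ℂ, ℂ) →ₗ[ℂ] 𝓢(ℂ, ℂ) where
  toFun β := -(∂_{(1 : ℂ)} (∂_{(1 : ℂ)} β) + ∂_{I} (∂_{I} β))
  map_add' β γ := by simp only [LineDeriv.lineDerivOp_add]; abel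
  map_smul' c β := by simp only [LineDeriv.lineDerivOp_smul, smul_neg, smul_add, RingHom.id_apply]

section loc
variable {ρ R : ℝ} {β β' : 𝓢(ℂ, ℂ)} {Z Z' : ℂ × ℂ → ℂ}

lemma LocKer.loc (hZ : LocKer ρ Z) (hR : 0 < R) (β : 𝓢(ℂ, ℂ)) : LocKer (R * ρ) (loc R β Z) := by
  refine ⟨continuous_const.mul ((β.continuous.comp (continuous_fst.sub continuous_snd)).mul
    (hZ.cont.comp (continuous_const_smul _))), fun p hp => ?_⟩
  have h := hZ.supp (R⁻¹ • p) (right_ne_zero_of_mul (right_ne_zero_of_mul hp))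
  rw [Prod.smul_fst, Prod.smul_snd, norm_smul, norm_smul, norm_eq_abs,
    abs_of_pos (inv_pos.2 hR), inv_mul_le_iff₀ hR, inv_mul_le_iff₀ hR] at h
  exact h

lemma contDiff_loc (hZ : ContDiff ℝ ∞ Z) (R : ℝ) (β : 𝓢(ℂ, ℂ)) : ContDiff ℝ ∞ (loc R β Z) :=
  contDiff_const.mul (((β.smooth ⊤).comp (contDiff_fst.sub contDiff_snd)).mul
    (hZ.comp (contDiff_id.const_smul _)))

lemma dx_loc (hZ : ContDiff ℝ ∞ Z) (R : ℝ) (β : 𝓢(ℂ, ℂ)) (v : ℂ) :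
    dx v (loc R β Z) = fun p => loc R (∂_{v} β) Z p + ((R⁻¹ : ℝ) : ℂ) * loc R β (dx v Z) p := by
  funext p
  have h1 : HasFDerivAt (fun p : ℂ × ℂ => β (p.1 - p.2))
      ((fderiv ℝ β (p.1 - p.2)).comp (ContinuousLinearMap.fst ℝ ℂ ℂ - ContinuousLinearMap.snd ℝ ℂ ℂ))
      p := (β.hasFDerivAt (p.1 - p.2)).comp p (hasFDerivAt_fst.sub hasFDerivAt_snd)
  have h2 : HasFDerivAt (fun p : ℂ × ℂ => Z (R⁻¹ • p))
      ((fderiv ℝ Z (R⁻¹ • p)).comp (R⁻¹ • ContinuousLinearMap.id ℝ (ℂ × ℂ))) p :=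
    ((hZ.differentiable (by simp)) (R⁻¹ • p)).hasFDerivAt.comp p
      (R⁻¹ • ContinuousLinearMap.id ℝ (ℂ × ℂ)).hasFDerivAt
  have h3 := (h1.mul h2).const_mul ((R⁻¹ : ℝ) : ℂ)
  have h4 : fderiv ℝ (loc R β Z) p = _ := h3.fderiv
  rw [dx, h4]
  simp [loc, dx, SchwartzMap.lineDerivOp_apply_eq_fderiv]
  ring

lemma lapx₀_loc (hZ : ContDiff ℝ ∞ Z) (R : ℝ) (β : 𝓢(ℂ, ℂ)) :
    lapx₀ (loc R β Z) = fun p => loc R (lapS β) Z p + ((R⁻¹ : ℝ) : ℂ) *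
      ((-2) * (loc R (∂_{(1 : ℂ)} β) (dx 1 Z) p + loc R (∂_{I} β) (dx I Z) p) +
        ((R⁻¹ : ℝ) : ℂ) * loc R β (lapx₀ Z) p) := by
  have hadd : ∀ (v : ℂ) (p : ℂ × ℂ), dx v (dx v (loc R β Z)) p =
      dx v (loc R (∂_{v} β) Z) p + ((R⁻¹ : ℝ) : ℂ) * dx v (loc R β (dx v Z)) p := fun v p => by
    have h1 := (contDiff_loc hZ R (∂_{v} β)).differentiable (by simp) p
    have h2 := (contDiff_loc (contDiff_dx (v := v) hZ) R β).differentiable (by simp) p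
    have h3 := h1.hasFDerivAt.add (h2.hasFDerivAt.const_mul ((R⁻¹ : ℝ) : ℂ))
    rw [dx_loc hZ]
    have h4 : fderiv ℝ (fun p => loc R (∂_{v} β) Z p + ((R⁻¹ : ℝ) : ℂ) * loc R β (dx v Z) p) p = _ :=
      h3.fderiv
    rw [dx, h4]
    rfl
  funext p
  have hl : lapS β (p.1 - p.2) = -((∂_{(1 : ℂ)} (∂_{(1 : ℂ)} β)) (p.1 - p.2) +
    (∂_{I} (∂_{I} β)) (p.1 - p.2)) := rfl
  rw [lapx₀, hadd, hadd, dx_loc hZ, dx_loc hZ, dx_loc (contDiff_dx hZ), dx_loc (contDiff_dx hZ)]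
  simp only [loc, hl, lapx₀]
  ring

lemma integrable_conj_mul (β β' : 𝓢(ℂ, ℂ)) : Integrable fun x => conj (β x) * β' x :=
  ((β.memLp 2).star).integrable_mul (β'.memLp 2)

lemma LocKer.conj_mul {Z Z' : ℂ × ℂ → ℂ} (hZ : LocKer ρ Z) (hZ' : LocKer ρ Z') :
    LocKer ρ fun p => conj (Z p) * Z' p :=
  hZ'.mul_left (continuous_conj.comp hZ.cont)

lemma LocKer.inner_cls_loc (hZ : LocKer ρ Z) (hZ' : LocKer ρ Z') (hR : 0 < R) (β β' : 𝓢(ℂ, ℂ)) :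
    ⟪cls volume (BdG.loc R β Z), cls volume (BdG.loc R β' Z')⟫_ℂ =
      ∫ u, conj (β u) * β' u * overlap (fun p => conj (Z p) * Z' p) (R⁻¹ • u) := by
  rw [inner_cls (hZ.loc hR β).memLp (hZ'.loc hR β').memLp]
  have h := (hZ.conj_mul hZ').integral_mul (integrable_conj_mul β β') hR
  have hR' : (R : ℂ) ≠ 0 := ofReal_ne_zero.2 hR.ne'
  refine mul_left_cancel₀ (pow_ne_zero 2 hR') ?_
  rw [← h, ← integral_const_mul]
  refine integral_ext fun p => ?_
  simp only [BdG.loc, map_mul, conj_ofReal]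
  have hi : (R : ℂ) * ((R⁻¹ : ℝ) : ℂ) = 1 := by rw [ofReal_inv, mul_inv_cancel₀ hR']
  linear_combination (conj (β (p.1 - p.2)) * conj (Z (R⁻¹ • p)) * β' (p.1 - p.2) * Z' (R⁻¹ • p) *
    ((R : ℂ) * ((R⁻¹ : ℝ) : ℂ) + 1)) * hi

lemma LocKer.exists_norm_cls_loc_le (hZ : LocKer ρ Z) : ∃ C, 0 ≤ C ∧ ∀ R > 0, ∀ β : 𝓢(ℂ, ℂ),
    ‖cls volume (BdG.loc R β Z)‖ ≤ C * ‖β.toLp 2‖ := by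
  obtain ⟨C, hC0, hC⟩ := (hZ.conj_mul hZ).exists_overlap_bound
  refine ⟨√C, sqrt_nonneg _, fun R hR β => ?_⟩
  refine le_of_sq_le_sq ?_ (by positivity)
  have h1 : ‖cls volume (BdG.loc R β Z)‖ ^ 2 =
      ‖⟪cls volume (BdG.loc R β Z), cls volume (BdG.loc R β Z)⟫_ℂ‖ := by
    rw [inner_self_eq_norm_sq_to_K]; simp
  have h2 : ‖β.toLp 2‖ ^ 2 = ∫ x, ‖conj (β x) * β x‖ := by
    have h3 : ((‖β.toLp 2‖ ^ 2 : ℝ) : ℂ) = ⟪β.toLp 2, β.toLp 2⟫_ℂ := by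
      rw [inner_self_eq_norm_sq_to_K]; norm_cast
    have h4 : ⟪β.toLp 2, β.toLp 2⟫_ℂ = ∫ x, ((‖conj (β x) * β x‖ : ℝ) : ℂ) := by
      rw [L2_inner_eq]
      refine integral_congr_ae ?_
      filter_upwards [β.coeFn_toLp 2] with x h
      rw [h, norm_mul, RCLike.norm_conj, mul_comm, mul_conj, normSq_eq_norm_sq, sq]
    rw [h4, integral_complex_ofReal, ofReal_inj] at h3
    exact h3
  rw [h1, hZ.inner_cls_loc hZ hR, mul_pow, sq_sqrt hC0, h2, ← integral_const_mul]
  refine norm_integral_le_of_norm_le ((integrable_conj_mul β β).norm.const_mul C)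
    (.of_forall fun u => ?_)
  rw [norm_mul, mul_comm]
  exact mul_le_mul_of_nonneg_right (hC _) (norm_nonneg _)

end loc

open scoped SchwartzMap LineDeriv

section locL
variable {ρ R : ℝ} {Z : ℂ × ℂ → ℂ}

/-- `loc` as a linear map into square integrable functions. -/
def locL (hZ : LocKer ρ Z) (hR : 0 < R) :
    𝓢(ℂ, ℂ) →ₗ[ℂ] Lp ℂ 2 (volume : Measure (ℂ × ℂ)) where
  toFun β := cls volume (loc R β Z)
  map_add' β γ := by
    rw [← cls_add (hZ.loc hR β).memLp (hZ.loc hR γ).memLp]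
    congr 1
    funext p
    simp only [loc, _root_.add_apply]
    ring
  map_smul' c β := by
    rw [RingHom.id_apply, ← cls_const_mul (hZ.loc hR β).memLp]
    congr 1
    funext p
    simp only [loc, _root_.smul_apply, smul_eq_mul]
    ring

lemma locL_apply (hZ : LocKer ρ Z) (hR : 0 < R) (β : 𝓢(ℂ, ℂ)) :
    locL hZ hR β = cls volume (loc R β Z) := rfl

/-- `-Δ - m` on Schwartz functions. -/
def hamS (m : ℝ) : 𝓢(ℂ, ℂ) →ₗ[ℂ] 𝓢(ℂ, ℂ) := lapS - (m : ℂ) • LinearMap.id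

lemma hamS_apply (m : ℝ) (β : 𝓢(ℂ, ℂ)) : hamS m β = lapS β - (m : ℂ) • β := rfl

lemma exists_norm_lapx₀_loc_sub_le (hZ : LocKer ρ Z) (hZd : ContDiff ℝ ∞ Z) (m : ℝ) (β : 𝓢(ℂ, ℂ)) :
    ∃ C, 0 ≤ C ∧ ∀ R : ℝ, 1 ≤ R → ‖cls volume (lapx₀ (loc R β Z)) - (m : ℂ) • cls volume (loc R β Z) -
      cls volume (loc R (hamS m β) Z)‖ ≤ R⁻¹ * C := by
  obtain ⟨C₁, h₁, b₁⟩ := (hZ.dx hZd 1).exists_norm_cls_loc_le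
  obtain ⟨C₂, h₂, b₂⟩ := (hZ.dx hZd I).exists_norm_cls_loc_le
  obtain ⟨C₃, h₃, b₃⟩ := (hZ.lapx₀ hZd).exists_norm_cls_loc_le
  refine ⟨2 * (C₁ * ‖(∂_{(1 : ℂ)} β).toLp 2 volume‖ + C₂ * ‖(∂_{I} β).toLp 2 volume‖) + C₃ * ‖β.toLp 2 volume‖,
    by positivity, fun R hR1 => ?_⟩
  have hR : 0 < R := one_pos.trans_le hR1
  have l0 := hZ.loc hR (lapS β)
  have l1 := (hZ.dx hZd 1).loc hR (∂_{(1 : ℂ)} β)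
  have l2 := (hZ.dx hZd I).loc hR (∂_{I} β)
  have l3 := (hZ.lapx₀ hZd).loc hR β
  have e1 : cls volume (lapx₀ (loc R β Z)) - (m : ℂ) • cls volume (loc R β Z) -
      cls volume (loc R (hamS m β) Z) = ((R⁻¹ : ℝ) : ℂ) •
      ((-2 : ℂ) • (cls volume (loc R (∂_{(1 : ℂ)} β) (dx 1 Z)) +
        cls volume (loc R (∂_{I} β) (dx I Z))) +
        ((R⁻¹ : ℝ) : ℂ) • cls volume (loc R β (lapx₀ Z))) := by
    have h := (locL hZ hR).map_sub (lapS β) ((m : ℂ) • β)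
    rw [map_smul, ← hamS_apply, locL_apply, locL_apply, locL_apply] at h
    rw [h, lapx₀_loc hZd, cls_add l0.memLp ((((l1.add l2).const_mul (-2)).add
      (l3.const_mul _)).const_mul _).memLp, cls_const_mul (((l1.add l2).const_mul (-2)).add
      (l3.const_mul _)).memLp, cls_add ((l1.add l2).const_mul (-2)).memLp (l3.const_mul _).memLp,
      cls_const_mul (l1.add l2).memLp, cls_const_mul l3.memLp, cls_add l1.memLp l2.memLp]
    abel
  have hR' : R⁻¹ ≤ 1 := inv_le_one_of_one_le₀ hR1
  have hR0 : 0 ≤ R⁻¹ := (inv_pos.2 hR).le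
  rw [e1, norm_smul, norm_real, norm_eq_abs, abs_of_nonneg hR0]
  refine mul_le_mul_of_nonneg_left ((norm_add_le _ _).trans (add_le_add ?_ ?_)) hR0
  · rw [norm_smul, norm_neg, norm_ofNat]
    exact mul_le_mul_of_nonneg_left ((norm_add_le _ _).trans
      (add_le_add (b₁ R hR _) (b₂ R hR _))) zero_le_two
  · rw [norm_smul, norm_real, norm_eq_abs, abs_of_nonneg hR0]
    exact (mul_le_of_le_one_left (norm_nonneg _) hR').trans (b₃ R hR _)

lemma LocKer.tendsto_inner_cls_loc (hZ : LocKer ρ Z) (β β' : 𝓢(ℂ, ℂ)) :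
    Tendsto (fun R : ℝ => ⟪cls volume (BdG.loc R β Z), cls volume (BdG.loc R β' Z)⟫_ℂ) atTop
      (𝓝 ((∫ u, conj (β u) * β' u) * overlap (fun p => conj (Z p) * Z p) 0)) := by
  refine ((hZ.conj_mul hZ).tendsto_integral_overlap (integrable_conj_mul β β')).congr' ?_
  filter_upwards [eventually_gt_atTop 0] with R hR
  exact (hZ.inner_cls_loc hZ hR β β').symm

lemma LocKer.tendsto_setIntegral_loc (hZ : LocKer ρ Z) {A : Set ℂ} (hA : MeasurableSet A)
    (β : 𝓢(ℂ, ℂ)) : Tendsto (fun R : ℝ => ∫ p in {p : ℂ × ℂ | p.1 - p.2 ∈ A}, ‖BdG.loc R β Z p‖ ^ 2)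
      atTop (𝓝 ((∫ u in A, ‖β u‖ ^ 2) * (overlap (fun p => conj (Z p) * Z p) 0).re)) := by
  have hg : Integrable (A.indicator fun u => conj (β u) * β u) :=
    (integrable_conj_mul β β).indicator hA
  have h1 := reCLM.continuous.continuousAt.tendsto.comp
    ((hZ.conj_mul hZ).tendsto_integral_overlap hg)
  have h2 : ∫ u, A.indicator (fun u => conj (β u) * β u) u = ((∫ u in A, ‖β u‖ ^ 2 : ℝ) : ℂ) := by
    rw [integral_indicator hA, ← integral_complex_ofReal]
    refine integral_ext fun u => ?_
    rw [mul_comm, mul_conj, normSq_eq_norm_sq]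
  rw [h2, reCLM_apply, re_ofReal_mul] at h1
  refine h1.congr' ?_
  filter_upwards [eventually_gt_atTop 0] with R hR
  have hm : MeasurableSet {p : ℂ × ℂ | p.1 - p.2 ∈ A} := measurable_fst.sub measurable_snd hA
  have h3 := (hZ.conj_mul hZ).integral_mul hg hR
  have hR' : (R : ℂ) ≠ 0 := ofReal_ne_zero.2 hR.ne'
  have h4 : ((∫ p in {p : ℂ × ℂ | p.1 - p.2 ∈ A}, ‖BdG.loc R β Z p‖ ^ 2 : ℝ) : ℂ) =
      ∫ u, A.indicator (fun u => conj (β u) * β u) u *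
        overlap (fun p => conj (Z p) * Z p) (R⁻¹ • u) := by
    refine mul_left_cancel₀ (pow_ne_zero 2 hR') ?_
    rw [← h3, ← integral_complex_ofReal, ← integral_const_mul, ← integral_indicator hm]
    refine integral_ext fun p => ?_
    by_cases h : p.1 - p.2 ∈ A
    · rw [indicator_of_mem h, indicator_of_mem (by exact h)]
      rw [ofReal_pow, ← mul_conj']
      simp only [BdG.loc, map_mul, conj_ofReal]
      have hi : (R : ℂ) * ((R⁻¹ : ℝ) : ℂ) = 1 := by rw [ofReal_inv, mul_inv_cancel₀ hR']
      linear_combination (conj (β (p.1 - p.2)) * conj (Z (R⁻¹ • p)) * β (p.1 - p.2) *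
        Z (R⁻¹ • p) * ((R : ℂ) * ((R⁻¹ : ℝ) : ℂ) + 1)) * hi
    · rw [indicator_of_notMem h, indicator_of_notMem (by exact h), zero_mul]
  simp only [Function.comp, reCLM_apply]
  rw [← h4, ofReal_re]

end locL

/-- A smooth symmetric cut-off in both particles. -/
lemma exists_cutoff : ∃ Y : ℂ × ℂ → ℂ, LocKer 2 Y ∧ ContDiff ℝ ∞ Y ∧ (∀ x y, Y (x, y) = Y (y, x)) ∧
    ∃ ν : ℝ, 0 < ν ∧ overlap (fun p => conj (Y p) * Y p) 0 = ν := by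
  let X : ContDiffBump (0 : ℂ) := ⟨1, 2, one_pos, one_lt_two⟩
  have hXd : ContDiff ℝ ∞ X := X.contDiff
  have hX : ∀ x : ℂ, X x ≠ 0 → ‖x‖ ≤ 2 := fun x hx => by
    have h : x ∈ Function.support X := hx
    rw [X.support_eq] at h
    exact (mem_ball_zero_iff.1 h).le
  have hd : ContDiff ℝ ∞ fun p : ℂ × ℂ => ((X p.1 * X p.2 : ℝ) : ℂ) :=
    ofRealCLM.contDiff.comp ((hXd.comp contDiff_fst).mul (hXd.comp contDiff_snd))
  refine ⟨fun p => ((X p.1 * X p.2 : ℝ) : ℂ), ⟨hd.continuous, fun p hp => ?_⟩, hd, fun x y => by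
    simp only [mul_comm], ∫ s, (X s * X s) ^ 2, ?_, ?_⟩
  · have h := ofReal_ne_zero.1 hp
    exact ⟨hX _ (left_ne_zero_of_mul h), hX _ (right_ne_zero_of_mul h)⟩
  · have hc : Continuous fun s : ℂ => (X s * X s) ^ 2 := (hXd.continuous.mul hXd.continuous).pow 2
    have hs : HasCompactSupport fun s : ℂ => (X s * X s) ^ 2 :=
      X.hasCompactSupport.comp_left (g := fun t : ℝ => (t * t) ^ 2) (by norm_num)
    refine hc.integral_pos_of_hasCompactSupport_nonneg_nonzero hs (fun s => by positivity) (x := 0) ?_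
    rw [X.one_of_mem_closedBall (by simp [X])]
    norm_num
  · rw [overlap, ← integral_complex_ofReal]
    refine integral_ext fun s => ?_
    simp only [zero_add, conj_ofReal]
    push_cast
    ring

theorem exists_unstable_of_schwartz (hτ : 0 < τ.im) {μ : ℝ} {v : ℂ → ℝ} (hmeas : Measurable v)
    (hdecay : ∃ C p : ℝ, 2 < p ∧ ∀ x, |v x| ≤ C * (1 + ‖x‖) ^ (-p)) (hv : ∀ x, v x ≤ 0)
    {A : Set ℂ} (hA : MeasurableSet A) {c₀ : ℝ} (hc₀ : 0 < c₀) (hvA : ∀ x ∈ A, v x ≤ -c₀)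
    {m : ℝ} (hm : 0 < m) {α : 𝓢(ℂ, ℂ)} (hα : ∀ x, α (-x) = α x) {L : ℝ} (hL : 0 < L)
    (hlim : Tendsto (fun n : ℕ => ‖(((1 - ((L⁻¹ : ℝ) : ℂ) • hamS m) ^ n) α).toLp 2 volume‖) atTop (𝓝 0))
    (hpos : 0 < ∫ u in A, ‖α u‖ ^ 2)
    (hneg : 8 * (∫ u, conj (α u) * hamS m α u).re < c₀ * ∫ u in A, ‖α u‖ ^ 2) :
    ∃ ε > 0, ∀ (M : MagLattice τ) (T : ℝ), M.b < ε → 0 < T → T < ε →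
      ∀ (γ : M.H →L[ℂ] M.H) (k : ℂ → ℂ → ℂ), M.IsNormal v μ T γ k → |chem v μ k - m| < ε →
        (∃ E : ℝ, E < 0 ∧ ∃ κ : M.HH, κ ≠ 0 ∧ M.LOp v μ T k κ ((E : ℂ) • κ)) ∧
        M.Unstable v μ T γ k := by
  obtain ⟨Y, hY, hYd, hYs, ν, hν, hYν⟩ := exists_cutoff
  set a : ℕ → 𝓢(ℂ, ℂ) := fun n => ((1 - ((L⁻¹ : ℝ) : ℂ) • hamS m) ^ n) α with ha
  have ha0 : a 0 = α := by simp [ha]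
  have hstep : ∀ n, a (n + 1) = a n - ((L⁻¹ : ℝ) : ℂ) • hamS m (a n) := fun n => by
    simp only [ha, pow_succ']
    rfl
  set Q := √((∫ u in A, ‖α u‖ ^ 2) * ν) with hQ
  set K := (∫ u, conj (α u) * hamS m α u).re * ν with hK
  have hQpos : 0 < Q := sqrt_pos.2 (by positivity)
  have hQsq : Q ^ 2 = (∫ u in A, ‖α u‖ ^ 2) * ν := sq_sqrt (by positivity)
  have hKQ : 8 * K < c₀ * Q ^ 2 := by
    rw [hQsq, hK]
    have := mul_lt_mul_of_pos_right hneg hν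
    linarith
  obtain ⟨D, hD0, hDQ, hDK⟩ : ∃ D > 0, 2 * D < Q ∧ 8 * (K + m * D ^ 2) < c₀ * (Q - 2 * D) ^ 2 := by
    have c1 : Continuous fun D : ℝ => 2 * D := by fun_prop
    have c2 : Continuous fun D : ℝ => c₀ * (Q - 2 * D) ^ 2 - 8 * (K + m * D ^ 2) := by fun_prop
    have e1 : ∀ᶠ D in 𝓝[>] (0 : ℝ), 2 * D < Q :=
      (c1.tendsto 0).mono_left nhdsWithin_le_nhds |>.eventually_lt_const (by simpa using hQpos)
    have e2 : ∀ᶠ D in 𝓝[>] (0 : ℝ), 0 < c₀ * (Q - 2 * D) ^ 2 - 8 * (K + m * D ^ 2) :=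
      (c2.tendsto 0).mono_left nhdsWithin_le_nhds |>.eventually_const_lt (by
        simpa using hKQ)
    obtain ⟨D, h1, h2, h3⟩ := (e1.and (e2.and self_mem_nhdsWithin)).exists
    exact ⟨D, h3, h1, by linarith⟩
  obtain ⟨CY, hCY0, hCY⟩ := hY.exists_norm_cls_loc_le
  obtain ⟨N, hN⟩ : ∃ N, CY * ‖(a N).toLp 2 volume‖ < D := by
    have h := hlim.const_mul CY
    rw [mul_zero] at h
    exact (h.eventually_lt_const hD0).exists
  choose C hC0 hC using fun n => exists_norm_lapx₀_loc_sub_le hY hYd m (a n)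
  have t1 : Tendsto (fun R : ℝ => CY * ‖(a N).toLp 2 volume‖ +
      ∑ n ∈ range N, L⁻¹ * (R⁻¹ * C n)) atTop (𝓝 (CY * ‖(a N).toLp 2 volume‖ + 0)) := by
    refine tendsto_const_nhds.add ?_
    have h : ∀ n ∈ range N, Tendsto (fun R : ℝ => L⁻¹ * (R⁻¹ * C n)) atTop (𝓝 0) :=
      fun n _ => by
        simpa using (tendsto_inv_atTop_zero.mul_const (C n)).const_mul L⁻¹
    simpa using tendsto_finsetSum _ h
  have t2 : Tendsto (fun R : ℝ => √(∫ p in {p : ℂ × ℂ | p.1 - p.2 ∈ A}, ‖loc R α Y p‖ ^ 2))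
      atTop (𝓝 Q) := by
    have h := hY.tendsto_setIntegral_loc hA α
    rw [hYν, ofReal_re] at h
    exact (Real.continuous_sqrt.tendsto _).comp h
  have t3 : Tendsto (fun R : ℝ => (⟪cls volume (loc R α Y), cls volume (loc R (hamS m α) Y)⟫_ℂ).re +
      CY * ‖α.toLp 2 volume‖ * (R⁻¹ * C 0)) atTop (𝓝 (K + CY * ‖α.toLp 2 volume‖ * (0 * C 0))) := by
    refine Tendsto.add ?_ ((tendsto_inv_atTop_zero.mul_const _).const_mul _)
    have h := (continuous_re.tendsto _).comp (hY.tendsto_inner_cls_loc α (hamS m α))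
    rw [hYν, mul_comm _ (ν : ℂ), re_ofReal_mul, mul_comm] at h
    exact h
  rw [zero_mul, mul_zero, add_zero] at t3
  have t4 := ((t2.sub_const (2 * D)).pow 2).const_mul c₀
  have t5 := (t3.add_const (m * D ^ 2)).const_mul 8
  rw [add_zero] at t1
  obtain ⟨R, hR1, r1, r2, r3⟩ := ((eventually_ge_atTop (1 : ℝ)).and
    ((t1.eventually_lt_const hN).and ((t2.eventually_const_lt hDQ).and
      (t5.eventually_lt t4 hDK)))).exists
  have hR : 0 < R := one_pos.trans_le hR1
  have hR0 : 0 ≤ R⁻¹ := (inv_pos.2 hR).le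
  refine exists_unstable_of_trial (κ := fun n => loc R (a n) Y) (N := N) (D := D) hτ hmeas hdecay hv
    hA hc₀ hvA hm (by positivity : 0 ≤ R * 2) (fun n => hY.loc hR (a n))
    (fun n => contDiff_loc hYd R (a n)) (fun x y => ?_) hL (sq_sqrt (by positivity)).le ?_ ?_ ?_
  · have h1 : α (x - y) = α (y - x) := by rw [← neg_sub, hα]
    simp only [loc, ha0, h1, Prod.smul_mk, hYs (R⁻¹ • x)]
  · refine lt_of_le_of_lt (add_le_add (hCY R hR _) (sum_le_sum fun n _ => ?_)) r1
    have h1 : cls volume (loc R (a (n + 1)) Y) = cls volume (loc R (a n) Y) -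
        ((L⁻¹ : ℝ) : ℂ) • cls volume (loc R (hamS m (a n)) Y) := by
      have h := (locL hY hR).map_sub (a n) (((L⁻¹ : ℝ) : ℂ) • hamS m (a n))
      rw [map_smul, ← hstep] at h
      exact h
    rw [h1, sub_sub_cancel_left, neg_add_eq_sub, ← smul_sub, norm_smul, norm_real,
      norm_eq_abs, abs_of_pos (inv_pos.2 hL)]
    exact mul_le_mul_of_nonneg_left (hC n R hR1) (inv_pos.2 hL).le
  · simpa only [ha0] using r2
  · simp only [ha0]
    refine lt_of_le_of_lt ?_ r3
    have h1 := hC 0 R hR1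
    rw [ha0] at h1
    set w := cls volume (lapx₀ (loc R α Y)) - (m : ℂ) • cls volume (loc R α Y) with hw
    have h2 : (⟪cls volume (loc R α Y), w⟫_ℂ).re =
        (⟪cls volume (loc R α Y), cls volume (loc R (hamS m α) Y)⟫_ℂ).re +
        (⟪cls volume (loc R α Y), w - cls volume (loc R (hamS m α) Y)⟫_ℂ).re := by
      rw [← add_re, ← inner_add_right, add_sub_cancel]
    have h3 : (⟪cls volume (loc R α Y), w - cls volume (loc R (hamS m α) Y)⟫_ℂ).re ≤
        CY * ‖α.toLp 2 volume‖ * (R⁻¹ * C 0) :=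
      (re_le_norm _).trans ((norm_inner_le_norm _ _).trans
        (mul_le_mul (hCY R hR α) h1 (norm_nonneg _) (by positivity)))
    linarith

/-! ## The logarithmic divergence at the Fermi surface -/

open scoped SchwartzMap FourierTransform LineDeriv

/-- The free energy-momentum relation relative to the level `m`. -/
def disp (m : ℝ) (p : ℂ) : ℝ := 4 * π ^ 2 * ‖p‖ ^ 2 - m

/-- The Fermi momentum. -/
def kF (m : ℝ) : ℝ := √m / (2 * π)

lemma kF_pos {m : ℝ} (hm : 0 < m) : 0 < kF m :=
  div_pos (sqrt_pos.2 hm) Real.two_pi_pos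

lemma contDiff_disp (m : ℝ) : ContDiff ℝ ∞ (disp m) :=
  (contDiff_const.mul (contDiff_id.norm_sq ℝ)).sub contDiff_const

lemma disp_neg (m : ℝ) (p : ℂ) : disp m (-p) = disp m p := by rw [disp, disp, norm_neg]

lemma disp_eq {m : ℝ} (hm : 0 < m) (x y : ℝ) :
    disp m ⟨x, y⟩ = 4 * π ^ 2 * (x ^ 2 - (kF m ^ 2 - y ^ 2)) := by
  have h : 4 * π ^ 2 * kF m ^ 2 = m := by
    rw [kF, div_pow, sq_sqrt hm.le]
    have := pi_pos.ne'
    field_simp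
    norm_num
  rw [disp, ← normSq_eq_norm_sq, normSq_apply]
  linear_combination h

lemma measurableSet_shell (m r : ℝ) : MeasurableSet {p : ℂ | ‖p - kF m‖ < r ∧ 0 < disp m p} :=
  (measurableSet_lt (f := fun p : ℂ => ‖p - kF m‖) (by fun_prop) measurable_const).inter
    (measurableSet_lt measurable_const (contDiff_disp m).continuous.measurable)

lemma not_integrableOn_inv_disp {m : ℝ} (hm : 0 < m) {r : ℝ} (hr : 0 < r) :
    ¬ IntegrableOn (fun p => (disp m p)⁻¹) {p : ℂ | ‖p - kF m‖ < r ∧ 0 < disp m p} := by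
  intro h
  have hk := kF_pos hm
  set k := kF m with hkdef
  have hc : Continuous (disp m) := (contDiff_disp m).continuous
  have hS := measurableSet_shell m r
  rw [← integrable_indicator_iff hS, ← volume_preserving_equiv_real_prod.symm.integrable_comp_emb
    (MeasurableEquiv.measurableEmbedding _), Measure.volume_eq_prod] at h
  obtain ⟨y, hy, hy0, hyr⟩ := (Measure.dense_of_ae h.prod_left_ae).exists_mem_open
    (isOpen_Ioo (a := 0) (b := min (r / 2) k)) ⟨min (r / 2) k / 2, by positivity,
      half_lt_self (by positivity)⟩
  have hy1 : y < r / 2 := hyr.trans_le (min_le_left _ _)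
  have hy2 : y < k := hyr.trans_le (min_le_right _ _)
  set g := √(k ^ 2 - y ^ 2) with hg
  have hg2 : g ^ 2 = k ^ 2 - y ^ 2 := sq_sqrt (by nlinarith)
  have hg0 : 0 ≤ g := sqrt_nonneg _
  have hgk : k - y ≤ g := Real.le_sqrt_of_sq_le (by nlinarith)
  have hgk' : g ≤ k := by nlinarith [sq_nonneg y]
  have hmem : ∀ x ∈ Set.Ioc g (g + r / 4), (⟨x, y⟩ : ℂ) ∈
      {p : ℂ | ‖p - k‖ < r ∧ 0 < disp m p} := fun x hx => by
    refine ⟨(norm_le_abs_re_add_abs_im _).trans_lt ?_, ?_⟩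
    · simp only [sub_re, sub_im, ofReal_re, ofReal_im, sub_zero]
      rw [abs_of_pos hy0]
      have : |x - k| < r / 2 := abs_lt.2 ⟨by linarith [hx.1], by linarith [hx.2]⟩
      linarith
    · rw [disp_eq hm, ← hg2]
      have : 0 < x ^ 2 - g ^ 2 := by nlinarith [hx.1]
      positivity
  have h2 : IntegrableOn (fun x => (x - g)⁻¹) (Set.Ioc g (g + r / 4)) := by
    refine ((hy.integrableOn (s := Set.Ioc g (g + r / 4))).const_mul
      (4 * π ^ 2 * (2 * g + r / 4))).mono' ?_ ?_
    · exact (measurable_id.sub_const g).inv.aestronglyMeasurable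
    · refine (ae_restrict_iff' measurableSet_Ioc).2 (.of_forall fun x hx => ?_)
      have h3 := hmem x hx
      have h5 : measurableEquivRealProd.symm (x, y) = (⟨x, y⟩ : ℂ) := rfl
      simp only [Function.comp, h5]
      rw [indicator_of_mem h3, disp_eq hm, ← hg2]
      have hxg : 0 < x - g := sub_pos.2 hx.1
      have hx2 := hx.2
      rw [norm_eq_abs, abs_of_pos (inv_pos.2 hxg), ← div_eq_mul_inv, inv_eq_one_div,
        div_le_div_iff₀ hxg (by have : 0 < x ^ 2 - g ^ 2 := by nlinarith
                                positivity)]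
      have h6 : 0 < π ^ 2 := by positivity
      have h7 : (x - g) * (x + g) ≤ (x - g) * (2 * g + r / 4) :=
        mul_le_mul_of_nonneg_left (by linarith) hxg.le
      nlinarith
  have h3 := (intervalIntegrable_iff_integrableOn_Ioc_of_le (by linarith)).2 h2
  rw [intervalIntegrable_sub_inv_iff] at h3
  rcases h3 with h3 | h3
  · linarith
  · exact h3 Set.left_mem_uIcc

/-- `t ↦ 1 / t` with the singularity at `0` and the negative half line smoothly cut off. -/
def invCut (n : ℕ) (t : ℝ) : ℝ := smoothTransition (n * t - 1) / t

lemma invCut_of_le {n : ℕ} {t : ℝ} (h : n * t ≤ 1) : invCut n t = 0 := by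
  rw [invCut, smoothTransition.zero_of_nonpos (by linarith), zero_div]

lemma invCut_of_ge {n : ℕ} {t : ℝ} (h : 2 ≤ n * t) : invCut n t = t⁻¹ := by
  rw [invCut, smoothTransition.one_of_one_le (by linarith), one_div]

lemma pos_of_invCut_ne_zero {n : ℕ} {t : ℝ} (h : invCut n t ≠ 0) : 1 < n * t ∧ 0 < t := by
  have h1 : 1 < n * t := lt_of_not_ge fun h' => h (invCut_of_le h')
  refine ⟨h1, lt_of_not_ge fun h2 => ?_⟩
  linarith [mul_nonpos_of_nonneg_of_nonpos (Nat.cast_nonneg (α := ℝ) n) h2]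

lemma invCut_nonneg (n : ℕ) (t : ℝ) : 0 ≤ invCut n t := by
  by_cases h : invCut n t = 0
  · exact h.ge
  · exact div_nonneg (smoothTransition.nonneg _) (pos_of_invCut_ne_zero h).2.le

lemma mul_invCut_le_one (n : ℕ) (t : ℝ) : t * invCut n t ≤ 1 := by
  by_cases h : t = 0
  · rw [h, zero_mul]; exact zero_le_one
  · rw [invCut, mul_div_cancel₀ _ h]
    exact smoothTransition.le_one _

lemma contDiff_invCut (n : ℕ) : ContDiff ℝ ∞ (invCut n) := by
  refine contDiff_iff_contDiffAt.2 fun t => ?_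
  by_cases h : t = 0
  · have h1 : ∀ᶠ s in 𝓝 t, (n : ℝ) * s < 1 := by
      refine (continuous_const.mul continuous_id).continuousAt.eventually_lt continuousAt_const ?_
      simp [h]
    exact contDiffAt_const (c := (0 : ℝ)) |>.congr_of_eventuallyEq
      (h1.mono fun s hs => invCut_of_le hs.le)
  · exact (smoothTransition.contDiff.comp
      ((contDiff_const.mul contDiff_id).sub contDiff_const)).contDiffAt.div contDiffAt_id h

lemma exists_lt_integral_invCut {m : ℝ} (hm : 0 < m) (X : ContDiffBump (kF m : ℂ)) (B : ℝ) :
    ∃ n : ℕ, B < ∫ p, X p * invCut n (disp m p) := by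
  by_contra! h
  have hc : Continuous (disp m) := (contDiff_disp m).continuous
  have hi : ∀ n : ℕ, Integrable fun p => X p * invCut n (disp m p) := fun n =>
    (X.continuous.mul ((contDiff_invCut n).continuous.comp hc)).integrable_of_hasCompactSupport
      X.hasCompactSupport.mul_right
  set S := {p : ℂ | ‖p - kF m‖ < X.rIn ∧ 0 < disp m p} with hSdef
  have hS : MeasurableSet S := measurableSet_shell m X.rIn
  refine not_integrableOn_inv_disp hm X.rIn_pos ((integrable_indicator_iff hS).1 ?_)
  set φ : ℕ → Set ℂ := fun n => {p | 2 ≤ n * disp m p} ∪ {p | disp m p ≤ 0} with hφ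
  have hφm : ∀ n, MeasurableSet (φ n) := fun n =>
    ((isClosed_le continuous_const (by fun_prop)).union
      (isClosed_le hc continuous_const)).measurableSet
  have hcov : AECover volume atTop φ := by
    refine ⟨Eventually.of_forall fun p => ?_, hφm⟩
    by_cases hp : disp m p ≤ 0
    · exact Eventually.of_forall fun n => Or.inr hp
    · push Not at hp
      filter_upwards [(tendsto_natCast_atTop_atTop.atTop_mul_const hp).eventually_ge_atTop 2] with n hn
      exact Or.inl hn
  have hle : ∀ n, ∀ p ∈ φ n, ‖S.indicator (fun p => (disp m p)⁻¹) p‖ ≤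
      X p * invCut n (disp m p) := fun n p hp => by
    by_cases hpS : p ∈ S
    · have h2 : 2 ≤ n * disp m p := hp.resolve_right (not_le.2 hpS.2)
      rw [indicator_of_mem hpS, invCut_of_ge h2, X.one_of_mem_closedBall, one_mul,
        norm_eq_abs, abs_of_pos (inv_pos.2 hpS.2)]
      rw [mem_closedBall_iff_norm]
      exact hpS.1.le
    · rw [indicator_of_notMem hpS, norm_zero]
      exact mul_nonneg X.nonneg (invCut_nonneg _ _)
  have hmeas : Measurable (S.indicator fun p => (disp m p)⁻¹) := hc.measurable.inv.indicator hS
  have hfi : ∀ n, IntegrableOn (S.indicator fun p => (disp m p)⁻¹) (φ n) := fun n =>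
    (hi n).integrableOn.mono' hmeas.aestronglyMeasurable
      ((ae_restrict_iff' (hφm n)).2 (Eventually.of_forall (hle n)))
  refine hcov.integrable_of_integral_norm_bounded B hfi (.of_forall fun n => ?_)
  refine ((setIntegral_mono_on (hfi n).norm (hi n).integrableOn (hφm n) (hle n)).trans
    (setIntegral_le_integral (hi n) (.of_forall fun p =>
      mul_nonneg X.nonneg (invCut_nonneg _ _)))).trans (h n)

/-! ## Fourier representation of the trial function -/

lemma fourier_hamS (m : ℝ) (β : 𝓢(ℂ, ℂ)) (p : ℂ) : 𝓕 (hamS m β) p = disp m p * 𝓕 β p := by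
  have h1 : ∀ v : ℂ, 𝓕 (∂_{v} (∂_{v} β)) p =
      -(4 * π ^ 2 * (inner ℝ p v) ^ 2 : ℝ) * 𝓕 β p := fun v => by
    have hg : (inner ℝ · v : ℂ → ℝ).HasTemperateGrowth := ((innerSL ℝ).flip v).hasTemperateGrowth
    have h0 : ∀ f : 𝓢(ℂ, ℂ), 𝓕 (∂_{v} f) p = (2 * π * I) * ((inner ℝ p v : ℝ) * 𝓕 f p) :=
      fun f => by
        rw [SchwartzMap.fourier_lineDerivOp_eq, _root_.smul_apply,
          SchwartzMap.smulLeftCLM_apply_apply hg, smul_eq_mul, real_smul]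
    rw [h0, h0]
    push_cast
    linear_combination (4 * (π : ℂ) ^ 2 * (inner ℝ p v : ℂ) ^ 2 * 𝓕 β p) * I_sq
  have h2 : hamS m β = -(∂_{(1 : ℂ)} (∂_{(1 : ℂ)} β) + ∂_{I} (∂_{I} β)) - (m : ℂ) • β := rfl
  have h3 : 𝓕 (hamS m β) = -(𝓕 (∂_{(1 : ℂ)} (∂_{(1 : ℂ)} β)) + 𝓕 (∂_{I} (∂_{I} β))) -
      (m : ℂ) • 𝓕 β := by
    rw [h2, ← SchwartzMap.fourierTransformCLM_apply ℂ, map_sub, map_neg, map_add, map_smul]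
    simp only [SchwartzMap.fourierTransformCLM_apply]
  have h4 : ‖p‖ ^ 2 = (inner ℝ p (1 : ℂ)) ^ 2 + (inner ℝ p I) ^ 2 := by
    rw [← normSq_eq_norm_sq, normSq_apply, Complex.inner, Complex.inner]
    simp
    ring
  rw [h3]
  simp only [_root_.sub_apply, _root_.neg_apply, _root_.add_apply, _root_.smul_apply, h1, smul_eq_mul]
  rw [disp, h4]
  push_cast
  ring

lemma fourier_pow_hamS (m L : ℝ) (n : ℕ) (β : 𝓢(ℂ, ℂ)) (p : ℂ) :
    𝓕 (((1 - ((L⁻¹ : ℝ) : ℂ) • hamS m) ^ n) β) p = ((1 - L⁻¹ * disp m p : ℝ) : ℂ) ^ n * 𝓕 β p := by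
  induction n with
  | zero => simp
  | succ n ih =>
    set γ := ((1 - ((L⁻¹ : ℝ) : ℂ) • hamS m) ^ n) β with hγ
    have h1 : ((1 - ((L⁻¹ : ℝ) : ℂ) • hamS m) ^ (n + 1)) β = γ - ((L⁻¹ : ℝ) : ℂ) • hamS m γ := by
      rw [pow_succ']
      rfl
    have h2 : 𝓕 (γ - ((L⁻¹ : ℝ) : ℂ) • hamS m γ) = 𝓕 γ - ((L⁻¹ : ℝ) : ℂ) • 𝓕 (hamS m γ) := by
      rw [← SchwartzMap.fourierTransformCLM_apply ℂ, map_sub, map_smul]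
      simp only [SchwartzMap.fourierTransformCLM_apply]
    rw [h1, h2, _root_.sub_apply, _root_.smul_apply, fourier_hamS, ih, smul_eq_mul]
    push_cast
    ring

lemma integral_conj_mul_hamS (m : ℝ) (β : 𝓢(ℂ, ℂ)) :
    ∫ u, conj (β u) * hamS m β u = ∫ p, conj (𝓕 β p) * (disp m p * 𝓕 β p) := by
  have h := SchwartzMap.integral_inner_fourier_fourier β (hamS m β)
  simp only [RCLike.inner_apply, fourier_hamS] at h
  simp only [mul_comm (conj _)]
  exact h.symm

lemma tendsto_pow_hamS {m L η : ℝ} (hL : 0 < L) (hη : 0 < η) {β : 𝓢(ℂ, ℂ)}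
    (hβ : ∀ p, 𝓕 β p ≠ 0 → η ≤ disp m p ∧ disp m p ≤ L) :
    Tendsto (fun n : ℕ => ‖(((1 - ((L⁻¹ : ℝ) : ℂ) • hamS m) ^ n) β).toLp 2 volume‖) atTop (𝓝 0) := by
  set θ := max 0 (1 - L⁻¹ * η) with hθ
  have hθ1 : θ < 1 := max_lt one_pos (by have : 0 < L⁻¹ * η := by positivity
                                         linarith)
  have hθ0 : 0 ≤ θ := le_max_left _ _
  have h : Tendsto (fun n : ℕ => θ ^ n * ‖(𝓕 β).toLp 2 volume‖) atTop (𝓝 0) := by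
    simpa using (tendsto_pow_atTop_nhds_zero_of_lt_one hθ0 hθ1).mul_const _
  refine squeeze_zero (fun n => norm_nonneg _) (fun n => ?_) h
  rw [← SchwartzMap.norm_fourier_toL2_eq]
  refine Lp.norm_le_mul_norm_of_ae_le_mul ?_
  filter_upwards [(𝓕 (((1 - ((L⁻¹ : ℝ) : ℂ) • hamS m) ^ n) β)).coeFn_toLp 2 volume,
    (𝓕 β).coeFn_toLp 2 volume] with p h1 h2
  rw [h1, h2, fourier_pow_hamS, norm_mul, norm_pow, norm_real, norm_eq_abs]
  by_cases h3 : 𝓕 β p = 0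
  · rw [h3, norm_zero, mul_zero, mul_zero]
  · obtain ⟨h4, h5⟩ := hβ p h3
    refine mul_le_mul_of_nonneg_right (pow_le_pow_left₀ (abs_nonneg _) ?_ n) (norm_nonneg _)
    have h6 : L⁻¹ * disp m p ≤ 1 := by rw [inv_mul_le_iff₀ hL]; linarith
    rw [abs_of_nonneg (by linarith)]
    refine le_trans ?_ (le_max_right _ _)
    have := mul_le_mul_of_nonneg_left h4 (inv_pos.2 hL).le
    linarith

/-! ## Existence of trial functions -/

open scoped SchwartzMap FourierTransform LineDeriv

lemma volume_cos_eq_zero {k : ℝ} (hk : 0 < k) :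
    volume {r : ℂ | Real.cos (2 * π * (k * r.re)) = 0} = 0 := by
  have h1 : {x : ℝ | Real.cos (2 * π * (k * x)) = 0}.Countable := by
    refine (Set.countable_range fun n : ℤ => (2 * n + 1) / (4 * k)).mono fun x hx => ?_
    obtain ⟨n, hn⟩ := Real.cos_eq_zero_iff.1 hx
    refine ⟨n, ?_⟩
    have := pi_pos
    simp only
    rw [div_eq_iff (by positivity)]
    refine mul_right_cancel₀ (pi_pos.ne') ?_
    linarith
  exact (Measure.quasiMeasurePreserving_fst.comp
    volume_preserving_equiv_real_prod.quasiMeasurePreserving).preimage_null (h1.measure_zero volume)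

lemma sq_integral_le {A : Set ℂ} (hAf : volume A ≠ ⊤) {g : ℂ → ℝ} (hg : IntegrableOn g A)
    (hg2 : IntegrableOn (fun x => g x ^ 2) A) :
    (∫ x in A, g x) ^ 2 ≤ volume.real A * ∫ x in A, g x ^ 2 := by
  rcases (measureReal_nonneg (μ := volume) (s := A)).eq_or_lt with h | h
  · have h0 : volume A = 0 := ((ENNReal.toReal_eq_zero_iff _).1 h.symm).resolve_right hAf
    rw [Measure.restrict_eq_zero.2 h0]
    simp
  set t := (∫ x in A, g x) / volume.real A with ht
  have h1 : 0 ≤ ∫ x in A, (g x ^ 2 - 2 * t * g x + t ^ 2) :=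
    integral_nonneg fun x => by
      have := sq_nonneg (g x - t)
      simp only [Pi.zero_apply]
      nlinarith
  have ht1 : IntegrableOn (fun x => 2 * t * g x) A := hg.const_mul (2 * t)
  have ht2 : IntegrableOn (fun x => g x ^ 2 - 2 * t * g x) A := hg2.sub ht1
  rw [integral_add ht2 (integrableOn_const hAf), integral_sub hg2 ht1, integral_const_mul,
    setIntegral_const, smul_eq_mul] at h1
  have h2 : ∫ x in A, g x = t * volume.real A := by rw [ht, div_mul_cancel₀ _ h.ne']
  rw [h2] at h1 ⊢
  nlinarith

lemma continuous_innerₗ : Continuous fun p : ℂ × ℂ => innerₗ ℂ p.1 p.2 :=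
  (continuous_inner : Continuous fun p : ℂ × ℂ => inner ℝ p.1 p.2)

section cosine
variable (A : Set ℂ) (k : ℝ)

/-- A real plane wave restricted to `A`. -/
def wave : ℂ → ℂ := A.indicator fun r => (Real.cos (2 * π * (k * r.re)) : ℂ)

/-- The real part of its Fourier transform. -/
def waveF (p : ℂ) : ℝ := (𝓕 (wave A k) p).re

variable {A} {k}

lemma norm_wave_le (r : ℂ) : ‖wave A k r‖ ≤ A.indicator 1 r := by
  by_cases h : r ∈ A
  · rw [wave, indicator_of_mem h, indicator_of_mem h, norm_real]
    exact Real.abs_cos_le_one _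
  · rw [wave, indicator_of_notMem h, indicator_of_notMem h, norm_zero]

lemma integrable_wave (hA : MeasurableSet A) (hAf : volume A ≠ ⊤) : Integrable (wave A k) := by
  have h : Integrable (A.indicator (1 : ℂ → ℝ)) :=
    (integrable_indicator_iff hA).2 (integrableOn_const hAf)
  refine h.mono' ?_ (Eventually.of_forall norm_wave_le)
  exact ((by fun_prop : Continuous fun r : ℂ => (Real.cos (2 * π * (k * r.re)) : ℂ)).measurable.indicator
    hA).aestronglyMeasurable

lemma continuous_waveF (hA : MeasurableSet A) (hAf : volume A ≠ ⊤) : Continuous (waveF A k) :=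
  continuous_re.comp (VectorFourier.fourierIntegral_continuous Real.continuous_fourierChar
    continuous_innerₗ (integrable_wave hA hAf))

lemma waveF_eq (hA : MeasurableSet A) (hAf : volume A ≠ ⊤) (p : ℂ) : waveF A k p =
    ∫ r in A, Real.cos (2 * π * inner ℝ r p) * Real.cos (2 * π * (k * r.re)) := by
  have hi := (VectorFourier.fourierIntegral_convergent_iff Real.continuous_fourierChar
    (L := innerₗ ℂ) continuous_innerₗ p).2 (integrable_wave (k := k) hA hAf)
  have hi' : Integrable fun v : ℂ => exp (((-2 * π * inner ℝ v p : ℝ) : ℂ) * I) • wave A k v := by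
    refine hi.congr (.of_forall fun v => ?_)
    simp only [Circle.smul_def, Real.fourierChar_apply, innerₗ_apply_apply, mul_neg, neg_mul]
  rw [waveF, Real.fourier_eq', ← reCLM_apply, ← reCLM.integral_comp_comm hi', ← integral_indicator hA]
  refine integral_ext fun r => ?_
  simp only [reCLM_apply, smul_eq_mul]
  by_cases h : r ∈ A
  · rw [wave, indicator_of_mem h, indicator_of_mem h, mul_comm, re_ofReal_mul,
      exp_ofReal_mul_I_re, neg_mul, neg_mul, Real.cos_neg, mul_comm]
  · rw [wave, indicator_of_notMem h, indicator_of_notMem h, mul_zero, zero_re]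

lemma waveF_neg (hA : MeasurableSet A) (hAf : volume A ≠ ⊤) (p : ℂ) :
    waveF A k (-p) = waveF A k p := by
  rw [waveF_eq hA hAf, waveF_eq hA hAf]
  simp only [inner_neg_right, mul_neg, Real.cos_neg]

lemma waveF_pos (hA : MeasurableSet A) (hAf : volume A ≠ ⊤) (hA0 : volume A ≠ 0) (hk : 0 < k) :
    0 < waveF A k k := by
  rw [waveF_eq hA hAf]
  have h1 : ∀ r : ℂ, inner ℝ r (k : ℂ) = k * r.re := fun r => by
    rw [Complex.inner, re_ofReal_mul, conj_re]
  simp only [h1]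
  have hi : IntegrableOn (fun r : ℂ => Real.cos (2 * π * (k * r.re)) *
      Real.cos (2 * π * (k * r.re))) A := by
    refine (integrableOn_const (C := (1 : ℝ)) hAf).mono' (by fun_prop) (.of_forall fun r => ?_)
    rw [norm_eq_abs, abs_mul_self, ← sq]
    exact Real.cos_sq_le_one _
  rw [setIntegral_pos_iff_support_of_nonneg_ae (.of_forall fun r => mul_self_nonneg _) hi]
  refine pos_iff_ne_zero.2 fun h => hA0 ?_
  refine measure_mono_null (fun r hr => ?_) (measure_union_null h (volume_cos_eq_zero hk))
  by_cases h2 : Real.cos (2 * π * (k * r.re)) = 0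
  · exact Or.inr h2
  · exact Or.inl ⟨mul_self_ne_zero.2 h2, hr⟩

lemma integral_wave_mul (hA : MeasurableSet A) (hAf : volume A ≠ ⊤) {ψ : ℂ → ℂ} (hψ : Integrable ψ) :
    ∫ r, wave A k r * 𝓕 ψ r = ∫ p, 𝓕 (wave A k) p * ψ p := by
  have h := VectorFourier.integral_fourierIntegral_smul_eq_flip (L := innerₗ ℂ)
    Real.continuous_fourierChar continuous_innerₗ (integrable_wave (k := k) hA hAf) hψ
  rw [flip_innerₗ] at h
  exact h.symm

end cosine

theorem exists_trial_schwartz {m : ℝ} (hm : 0 < m) {A : Set ℂ} (hA : MeasurableSet A)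
    (hAf : volume A ≠ ⊤) (hA0 : volume A ≠ 0) {c₀ : ℝ} (hc₀ : 0 < c₀) :
    ∃ (α : 𝓢(ℂ, ℂ)) (L : ℝ), (∀ x, α (-x) = α x) ∧ 0 < L ∧
      Tendsto (fun n : ℕ => ‖(((1 - ((L⁻¹ : ℝ) : ℂ) • hamS m) ^ n) α).toLp 2 volume‖) atTop (𝓝 0) ∧
      0 < ∫ u in A, ‖α u‖ ^ 2 ∧
      8 * (∫ u, conj (α u) * hamS m α u).re < c₀ * ∫ u in A, ‖α u‖ ^ 2 := by
  have hk := kF_pos hm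
  set k := kF m with hkdef
  set W := waveF A k with hW
  have hW0 : 0 < W k := waveF_pos hA hAf hA0 hk
  have hA1 : 0 < volume.real A := ENNReal.toReal_pos hA0 hAf
  obtain ⟨r, hr, hWr⟩ := Metric.continuousAt_iff.1 (continuous_waveF (k := k) hA hAf).continuousAt
    (W k / 2) (half_pos hW0)
  let X : ContDiffBump (k : ℂ) := ⟨r / 2, r, half_pos hr, half_lt_self hr⟩
  have hX : ∀ p, X p ≠ 0 → ‖p - k‖ < r := fun p hp => by
    have h : p ∈ Function.support X := hp
    rw [X.support_eq] at h
    exact mem_ball_iff_norm.1 h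
  obtain ⟨n, hn⟩ := exists_lt_integral_invCut hm X (32 * volume.real A / (c₀ * W k ^ 2))
  set J := ∫ p, X p * invCut n (disp m p) with hJ
  have hJ0 : 0 < J := lt_of_le_of_lt (by positivity) hn
  set ψ : ℂ → ℝ := fun p => (X p + X (-p)) * invCut n (disp m p) with hψ
  have hXd : ContDiff ℝ ∞ X := X.contDiff
  have hψd : ContDiff ℝ ∞ ψ := (hXd.add (hXd.comp contDiff_neg)).mul
    ((contDiff_invCut n).comp (contDiff_disp m))
  have hXs : HasCompactSupport fun p => X (-p) := X.hasCompactSupport.comp_homeomorph (Homeomorph.neg ℂ)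
  have hψs : HasCompactSupport ψ := (X.hasCompactSupport.add hXs).mul_right
  have hψ0 : ∀ p, 0 ≤ ψ p := fun p => mul_nonneg (add_nonneg X.nonneg X.nonneg) (invCut_nonneg _ _)
  have hψe : ∀ p, ψ (-p) = ψ p := fun p => by
    simp only [hψ, disp_neg, neg_neg, add_comm]
  have hψsupp : ∀ p, ψ p ≠ 0 → (‖p - k‖ < r ∨ ‖-p - k‖ < r) ∧ 1 < n * disp m p ∧ 0 < disp m p :=
    fun p hp => by
      refine ⟨?_, pos_of_invCut_ne_zero (right_ne_zero_of_mul hp)⟩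
      by_cases h : X p = 0
      · exact Or.inr (hX _ fun h' => left_ne_zero_of_mul hp (by rw [h, h', add_zero]))
      · exact Or.inl (hX _ h)
  have hψi : Integrable ψ := hψd.continuous.integrable_of_hasCompactSupport hψs
  have hψJ : ∫ p, ψ p = 2 * J := by
    have h1 : Integrable fun p => X p * invCut n (disp m p) :=
      (X.continuous.mul ((contDiff_invCut n).continuous.comp
        (contDiff_disp m).continuous)).integrable_of_hasCompactSupport X.hasCompactSupport.mul_right
    have h2 : ∀ p, ψ p = X p * invCut n (disp m p) + X (-p) * invCut n (disp m (-p)) := fun p => by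
      rw [disp_neg, ← add_mul]
    simp only [h2]
    rw [integral_add h1 h1.comp_neg,
      integral_neg_eq_self (fun p => X p * invCut n (disp m p)) volume, ← hJ]
    ring
  have hcd : ContDiff ℝ ∞ fun p => (ψ p : ℂ) := ofRealCLM.contDiff.comp hψd
  have hcs : HasCompactSupport fun p => (ψ p : ℂ) := hψs.comp_left ofReal_zero
  set Ψ : 𝓢(ℂ, ℂ) := hcs.toSchwartzMap hcd with hΨ
  have hΨa : ∀ p, Ψ p = ψ p := fun p => rfl
  set α : 𝓢(ℂ, ℂ) := 𝓕⁻ Ψ with hα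
  have hFα : 𝓕 α = Ψ := FourierTransform.fourier_fourierInv_eq Ψ
  have hαe : ∀ x, α x = 𝓕 (fun p => (ψ p : ℂ)) x := fun x => by
    rw [hα, SchwartzMap.fourierInv_coe, Real.fourierInv_eq_fourier_comp_neg]
    simp only [hΨa, hψe]
  have heven : ∀ x, α (-x) = α x := fun x => by
    rw [hαe, ← Real.fourierInv_eq_fourier_neg, hα, SchwartzMap.fourierInv_coe]
    rfl
  have hα2 : Integrable fun u => ‖α u‖ ^ 2 := by
    refine (integrable_conj_mul α α).norm.congr (.of_forall fun u => ?_)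
    simp only [norm_mul, RCLike.norm_conj, sq]
  have hWψ : ∀ p, W k / 2 * ψ p ≤ W p * ψ p := fun p => by
    by_cases h : ψ p = 0
    · rw [h, mul_zero, mul_zero]
    refine mul_le_mul_of_nonneg_right ?_ (hψ0 p)
    rcases (hψsupp p h).1 with h1 | h1
    · have := hWr (x := p) (by rwa [dist_eq_norm])
      rw [Real.dist_eq] at this
      linarith [(abs_lt.1 this).1]
    · have := hWr (x := -p) (by rwa [dist_eq_norm])
      rw [Real.dist_eq, waveF_neg hA hAf] at this
      linarith [(abs_lt.1 this).1]
  have hWi : Integrable fun p => W p * ψ p :=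
    ((continuous_waveF hA hAf).mul hψd.continuous).integrable_of_hasCompactSupport hψs.mul_left
  have hlow : W k * J ≤ ∫ u in A, ‖α u‖ := by
    have h1 : W k * J ≤ ∫ p, W p * ψ p := by
      have := integral_mono (hψi.const_mul (W k / 2)) hWi hWψ
      rw [integral_const_mul, hψJ] at this
      linarith
    have hFi : Integrable fun p => 𝓕 (wave A k) p * (ψ p : ℂ) := by
      have hc : Continuous (𝓕 (wave A k)) := VectorFourier.fourierIntegral_continuous
        Real.continuous_fourierChar continuous_innerₗ (integrable_wave hA hAf)
      exact (hc.mul hcd.continuous).integrable_of_hasCompactSupport hcs.mul_left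
    have h2 : ∫ p, W p * ψ p = (∫ p, 𝓕 (wave A k) p * (ψ p : ℂ)).re := by
      rw [← reCLM_apply, ← reCLM.integral_comp_comm hFi]
      refine integral_ext fun p => ?_
      simp only [reCLM_apply]
      rw [mul_comm (𝓕 (wave A k) p), re_ofReal_mul, mul_comm]
      rfl
    rw [h2, ← integral_wave_mul hA hAf
      (hcd.continuous.integrable_of_hasCompactSupport hcs)] at h1
    refine h1.trans ((re_le_norm _).trans ?_)
    rw [← integral_indicator hA]
    refine norm_integral_le_of_norm_le (α.integrable.norm.indicator hA)
      (.of_forall fun u => ?_)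
    rw [← hαe, norm_mul]
    refine (mul_le_mul_of_nonneg_right (norm_wave_le u) (norm_nonneg _)).trans_eq ?_
    by_cases h : u ∈ A <;> simp [h]
  have hkin : (∫ u, conj (α u) * hamS m α u).re ≤ 4 * J := by
    have h1 : ∫ u, conj (α u) * hamS m α u = ((∫ p, disp m p * ψ p ^ 2 : ℝ) : ℂ) := by
      rw [integral_conj_mul_hamS, hFα, ← integral_complex_ofReal]
      refine integral_ext fun p => ?_
      simp only [hΨa, conj_ofReal]
      push_cast
      ring
    have h2 : ∀ p, disp m p * ψ p ^ 2 ≤ 2 * ψ p := fun p => by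
      have h3 : disp m p * ψ p ^ 2 =
          (X p + X (-p)) * (disp m p * invCut n (disp m p)) * ψ p := by
        simp only [hψ]; ring
      rw [h3]
      refine mul_le_mul_of_nonneg_right ?_ (hψ0 p)
      refine (mul_le_of_le_one_right (add_nonneg X.nonneg X.nonneg) (mul_invCut_le_one _ _)).trans ?_
      linarith [X.le_one (x := p), X.le_one (x := -p)]
    have h3 : Integrable fun p => disp m p * ψ p ^ 2 := by
      simp only [sq]
      exact ((contDiff_disp m).continuous.mul (hψd.continuous.mul hψd.continuous)
        ).integrable_of_hasCompactSupport hψs.mul_left.mul_left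
    rw [h1, ofReal_re]
    refine (integral_mono h3 (hψi.const_mul 2) h2).trans_eq ?_
    rw [integral_const_mul, hψJ]
    ring
  have hcs2 := sq_integral_le hAf α.integrable.norm.integrableOn hα2.integrableOn
  have hsq : (W k * J) ^ 2 ≤ (∫ u in A, ‖α u‖) ^ 2 := pow_le_pow_left₀ (by positivity) hlow 2
  have hmain : (W k * J) ^ 2 / volume.real A ≤ ∫ u in A, ‖α u‖ ^ 2 := by
    rw [div_le_iff₀ hA1]
    linarith
  refine ⟨α, 4 * π ^ 2 * (k + r) ^ 2, heven, by positivity, ?_,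
    lt_of_lt_of_le (by positivity) hmain, ?_⟩
  · refine tendsto_pow_hamS (η := 1 / (n + 1)) (by positivity) (by positivity) fun p hp => ?_
    rw [hFα, hΨa, ofReal_ne_zero] at hp
    obtain ⟨h1, h2, h3⟩ := hψsupp p hp
    constructor
    · rw [div_le_iff₀ (by positivity)]
      linarith
    · have h4 : ‖p‖ ≤ k + r := by
        have hkn : ‖(k : ℂ)‖ = k := by rw [norm_real, norm_eq_abs, abs_of_pos hk]
        rcases h1 with h1 | h1
        · linarith [norm_le_norm_add_norm_sub' p (k : ℂ)]
        · linarith [norm_le_norm_add_norm_sub' (-p) (k : ℂ), norm_neg p]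
      have h5 : 4 * π ^ 2 * ‖p‖ ^ 2 ≤ 4 * π ^ 2 * (k + r) ^ 2 := by gcongr
      rw [disp]
      linarith
  · have h1 : 32 * J < c₀ * ((W k * J) ^ 2 / volume.real A) := by
      rw [div_lt_iff₀ (by positivity)] at hn
      rw [← mul_div_assoc, lt_div_iff₀ hA1]
      nlinarith
    have h2 := mul_le_mul_of_nonneg_left hmain hc₀.le
    linarith

end BdG

end

theorem mainTheorem6 (μ : ℝ) (hμ : 0 < μ) (v : ℂ → ℝ) (hmeas : Measurable v)
    (heven : ∀ x, v (-x) = v x)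
    (hdecay : ∃ C p : ℝ, 2 < p ∧ ∀ x, |v x| ≤ C * (1 + ‖x‖) ^ (-p))
    (hnonpos : ∀ x, v x ≤ 0) (hne : ¬ v =ᵐ[MeasureTheory.volume] 0)
    (τ : ℂ) (hτ : 0 < τ.im) :
    ∃ ε₀ : ℝ, 0 < ε₀ ∧ ∀ (M : BdG.MagLattice τ) (T : ℝ), M.b < ε₀ → 0 < T → T < ε₀ →
      ∀ (γ : M.H →L[ℂ] M.H) (k : ℂ → ℂ → ℂ), M.IsNormal v μ T γ k →
        (∃ E : ℝ, E < 0 ∧ ∃ κ : M.HH, κ ≠ 0 ∧ M.LOp v μ T k κ ((E : ℂ) • κ)) ∧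
        M.Unstable v μ T γ k := by
  obtain ⟨n, hn⟩ : ∃ n : ℕ, volume ({x | v x ≤ -(1 / ((n : ℝ) + 1))} ∩ Metric.closedBall 0 n) ≠ 0 := by
    by_contra! h
    refine hne (measure_mono_null (fun x hx => ?_) (measure_iUnion_null h))
    have hx' : v x < 0 := (hnonpos x).lt_of_ne hx
    obtain ⟨i, hi⟩ := exists_nat_one_div_lt (neg_pos.2 hx')
    obtain ⟨j, hj⟩ := exists_nat_ge ‖x‖
    refine Set.mem_iUnion.2 ⟨max i j, ?_, ?_⟩
    · have h1 : 1 / (((max i j : ℕ) : ℝ) + 1) ≤ 1 / ((i : ℝ) + 1) :=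
        one_div_le_one_div_of_le (by positivity) (by gcongr; exact le_max_left i j)
      exact (by linarith : v x ≤ -(1 / (((max i j : ℕ) : ℝ) + 1)))
    · rw [mem_closedBall_zero_iff]
      exact hj.trans (by exact_mod_cast le_max_right i j)
  set c₀ : ℝ := 1 / ((n : ℝ) + 1)
  have hc₀ : 0 < c₀ := by positivity
  set A : Set ℂ := {x | v x ≤ -c₀} ∩ Metric.closedBall 0 n
  have hA : MeasurableSet A :=
    (measurableSet_le hmeas measurable_const).inter Metric.isClosed_closedBall.measurableSet
  have hAf : volume A ≠ ⊤ :=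
    ((measure_mono Set.inter_subset_right).trans_lt measure_closedBall_lt_top).ne
  obtain ⟨C, hC⟩ := BdG.exists_chem_bounds hμ hnonpos
  obtain ⟨ε, hε, h⟩ : ∃ ε > 0, ∀ (M : BdG.MagLattice τ) (T : ℝ), M.b < ε → 0 < T → T < ε →
      ∀ (γ : M.H →L[ℂ] M.H) (k : ℂ → ℂ → ℂ), M.IsNormal v μ T γ k →
        BdG.chem v μ k ∈ Set.Icc μ C →
        (∃ E : ℝ, E < 0 ∧ ∃ κ : M.HH, κ ≠ 0 ∧ M.LOp v μ T k κ ((E : ℂ) • κ)) ∧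
        M.Unstable v μ T γ k := by
    refine isCompact_Icc.induction_on (p := fun s => ∃ ε > 0, ∀ (M : BdG.MagLattice τ) (T : ℝ),
      M.b < ε → 0 < T → T < ε → ∀ (γ : M.H →L[ℂ] M.H) (k : ℂ → ℂ → ℂ), M.IsNormal v μ T γ k →
        BdG.chem v μ k ∈ s →
        (∃ E : ℝ, E < 0 ∧ ∃ κ : M.HH, κ ≠ 0 ∧ M.LOp v μ T k κ ((E : ℂ) • κ)) ∧
        M.Unstable v μ T γ k) ?_ ?_ ?_ ?_
    · exact ⟨1, one_pos, fun _ _ _ _ _ _ _ _ hs => hs.elim⟩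
    · rintro s t hst ⟨ε, hε, h⟩
      exact ⟨ε, hε, fun M T h1 h2 h3 γ k h4 h5 => h M T h1 h2 h3 γ k h4 (hst h5)⟩
    · rintro s t ⟨ε, hε, h⟩ ⟨ε', hε', h'⟩
      refine ⟨min ε ε', lt_min hε hε', fun M T h1 h2 h3 γ k h4 h5 => h5.elim (fun h6 => ?_) fun h6 => ?_⟩
      · exact h M T (h1.trans_le (min_le_left _ _)) h2 (h3.trans_le (min_le_left _ _)) γ k h4 h6
      · exact h' M T (h1.trans_le (min_le_right _ _)) h2 (h3.trans_le (min_le_right _ _)) γ k h4 h6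
    · intro m hm
      have hm0 := hμ.trans_le hm.1
      obtain ⟨α, L, hα, hL, hlim, hpos, hneg⟩ := BdG.exists_trial_schwartz hm0 hA hAf hn hc₀
      obtain ⟨ε, hε, h⟩ := BdG.exists_unstable_of_schwartz hτ hmeas hdecay hnonpos hA hc₀
        (fun x hx => hx.1) hm0 hα hL hlim hpos hneg
      refine ⟨Metric.ball m ε, mem_nhdsWithin_of_mem_nhds (Metric.ball_mem_nhds m hε), ε, hε,
        fun M T h1 h2 h3 γ k h4 h5 => h M T h1 h2 h3 γ k h4 ?_⟩
      rwa [Metric.mem_ball, Real.dist_eq] at h5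
  refine ⟨min ε (μ / 2), lt_min hε (half_pos hμ), fun M T h1 h2 h3 γ k h4 =>
    h M T (h1.trans_le (min_le_left _ _)) h2 (h3.trans_le (min_le_left _ _)) γ k h4 ?_⟩
  exact hC hτ M T (h1.trans_le (min_le_right _ _)) h2 (h3.trans_le (min_le_right _ _)) γ k h4
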